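/- Let $\mathbb T^3=(\mathbb R/2\pi\mathbb Z)^3$, let $\gamma>0$, let $g\in L^2(\mathbb T^3)$ be real-valued, and let $f\in C^1(\mathbb R)$ satisfy, with some positive constants $C,\kappa,K$ and for all $u\in\mathbb R$, $$f(u)u\ge -C+\kappa|u|^2,\qquad f'(u)\ge -K,\qquad |f'(u)|\le C(1+|u|^4).$$ Consider the problem (without the extra damping term, i.e. $\alpha=0$) $$\partial_t^2u+\gamma(-\Delta_x)^{1/2}\partial_tu-\Delta_xu+f(u)=g,\qquad u|_{t=0}=u_0,\quad \partial_tu|_{t=0}=u_1,$$ on $\mathbb T^3$, in the energy space $\mathcal E=H^1(\mathbb T^3)\times L^2(\mathbb T^3)$. A weak energy solution with initial data $\xi_0=(u_0,u_1)\in\mathcal E$ is a weakly continuous function $\xi_u=(u,\partial_tu):[0,\infty)\to\mathcal E$ with $\xi_u(0)=\xi_0$ such that, for every $T>0$, $\xi_u\in L^\infty(0,T;\mathcal E)$, $\partial_tu\in L^2(0,T;H^{1/2}(\mathbb T^3))$, and the equation holds in the sense of distributions, i.e. against all test functions $\phi\in C_0^\infty((0,T)\times\mathbb T^3)$. Assume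 in addition that $g$ is not (a.e. equal to) a constant, and that for every $a\in\mathbb R$ the set $(f')^{-1}(a)$ is nowhere dense in $\mathbb R$. Then the problem generates a solution semigroup $S(t):\mathcal E\to\mathcal E$, $t\ge0$: for every $\xi_0\in\mathcal E$ there is exactly one weak energy solution $\xi_u$ with $\xi_u(0)=\xi_0$, and $S(t)\xi_0:=\xi_u(t)$ satisfies $S(0)=\mathrm{Id}$ and $S(t+s)=S(t)S(s)$. Moreover, the energy functional $$E(u,v)=\tfrac12\|v\|_{L^2}^2+\tfrac12\|\nabla u\|_{L^2}^2+\int_{\mathbb T^3}F(u)\,dx-\int_{\mathbb T^3}g\,u\,dx,\qquad F(u)=\int_0^uf(s)\,ds,$$ is a global Lyapunov function for $S(t)$ in $\mathcal E$: it is continuous on $\mathcal E$; for every $\xi_0\in\mathcal E$ the function $t\mapsto E(S(t)\xi_0)$ is non-increasing on $[0,\infty)$; and if $E(S(T)\xi_0)=E(\xi_0)$ for some $\xi_0\in\mathcal E$ and some $T>0$, then $\xi_0$ is an equilibrium, i.e. $S(t)\xi_0=\xi_0$ for all $t\ge0$. -/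

import Mathlib

open MeasureTheory Set Filter Topology
open scoped Real ENNReal ContDiff

noncomputable section

namespace DampedWave

instance factTwoPiPos : Fact (0 < 2 * π) := ⟨Real.two_pi_pos⟩

/-- The torus `𝕋³ = (ℝ / 2πℤ)³`, with Lebesgue measure of total mass `(2π)³`. -/
abbrev Torus3 : Type := Fin 3 → AddCircle (2 * π)

/-- The quotient map `ℝ³ → 𝕋³`. -/
def proj (y : Fin 3 → ℝ) : Torus3 := fun i => (y i : AddCircle (2 * π))

/-- Real `L²(𝕋³)`. -/
abbrev L2 : Type := Lp ℝ 2 (volume : Measure Torus3)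

/-- `C^∞` functions on the torus: the `2π`-periodic lift to `ℝ³` is `C^∞`. -/
def SmoothTorus (φ : Torus3 → ℝ) : Prop :=
  ContDiff ℝ ∞ (fun y : Fin 3 → ℝ => φ (proj y))

/-- The classical partial derivative `∂_{x_i} φ` on the torus. -/
def partialX (i : Fin 3) (φ : Torus3 → ℝ) (x : Torus3) : ℝ :=
  deriv (fun s : ℝ => φ (x + Pi.single i (s : AddCircle (2 * π)))) 0

/-- `w = ∂_{x_i} u` in the sense of distributions on the torus. -/
def IsWeakPartial (i : Fin 3) (u w : L2) : Prop :=
  ∀ φ : Torus3 → ℝ, SmoothTorus φ →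
    ∫ x, u x * partialX i φ x = -∫ x, w x * φ x

theorem isOpenQuotientMap_proj : IsOpenQuotientMap proj :=
  IsOpenQuotientMap.piMap (fun _ : Fin 3 => QuotientAddGroup.isOpenQuotientMap_mk)

theorem SmoothTorus.continuous {φ : Torus3 → ℝ} (h : SmoothTorus φ) : Continuous φ :=
  isOpenQuotientMap_proj.isQuotientMap.continuous_iff.2 (ContDiff.continuous h)

theorem SmoothTorus.continuous_partialX {φ : Torus3 → ℝ} (h : SmoothTorus φ) (i : Fin 3) :
    Continuous (partialX i φ) := by
  refine isOpenQuotientMap_proj.isQuotientMap.continuous_iff.2 ?_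
  have key : partialX i φ ∘ proj = fun y =>
      fderiv ℝ (fun y : Fin 3 → ℝ => φ (proj y)) y (Pi.single i 1) := by
    funext y
    have e : (fun s : ℝ => φ (proj y + Pi.single i (s : AddCircle (2 * π)))) =
        fun s : ℝ => (fun y : Fin 3 → ℝ => φ (proj y)) (y + s • Pi.single i 1) := by
      funext s
      congr 1
      funext j
      by_cases hj : j = i
      · subst hj; simp [proj]
      · simp [proj, hj]
    have hd : DifferentiableAt ℝ (fun y : Fin 3 → ℝ => φ (proj y)) y :=
      (ContDiff.differentiable h (by simp)) y
    simp only [Function.comp, partialX]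
    rw [e]
    exact hd.lineDeriv_eq_fderiv
  rw [key]
  exact (ContDiff.continuous_fderiv h (by simp)).clm_apply continuous_const

theorem integrable_mul_of_continuous (u : L2) {ψ : Torus3 → ℝ} (hψ : Continuous ψ) :
    Integrable (fun x => u x * ψ x) := by
  have hu : MemLp (u : Torus3 → ℝ) 2 volume := Lp.memLp u
  obtain ⟨C, hC⟩ := (isCompact_univ (X := Torus3)).exists_bound_of_continuousOn hψ.continuousOn
  exact (hu.integrable (by norm_num)).mul_bdd (c := C) hψ.aestronglyMeasurable
    (Eventually.of_forall fun x => hC x (mem_univ x))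

/-- `H¹(𝕋³)`: pairs `(u, ∇u)` with `u ∈ L²(𝕋³)` and weak gradient `∇u ∈ L²(𝕋³)³`.
The weak gradient is unique, so this is the graph of `∇`; the topology inherited from
`L² × (L²)³` is the usual topology of `H¹`. -/
def H1 : Submodule ℝ (L2 × (Fin 3 → L2)) where
  carrier := {p | ∀ i, IsWeakPartial i p.1 (p.2 i)}
  zero_mem' := by
    intro i φ hφ
    simp
  add_mem' := by
    intro p q hp hq i φ hφ
    have e1 : ∫ x, (p + q).1 x * partialX i φ x =
        ∫ x, (p.1 x * partialX i φ x + q.1 x * partialX i φ x) := by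
      refine integral_congr_ae ?_
      filter_upwards [Lp.coeFn_add p.1 q.1] with x hx
      simp only [Prod.fst_add, hx, Pi.add_apply, add_mul]
    have e2 : ∫ x, (p + q).2 i x * φ x = ∫ x, (p.2 i x * φ x + q.2 i x * φ x) := by
      refine integral_congr_ae ?_
      filter_upwards [Lp.coeFn_add (p.2 i) (q.2 i)] with x hx
      simp only [Prod.snd_add, Pi.add_apply, hx, add_mul]
    rw [e1, e2, integral_add (integrable_mul_of_continuous _ (hφ.continuous_partialX i))
      (integrable_mul_of_continuous _ (hφ.continuous_partialX i)),
      integral_add (integrable_mul_of_continuous _ hφ.continuous)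
      (integrable_mul_of_continuous _ hφ.continuous), hp i φ hφ, hq i φ hφ]
    ring
  smul_mem' := by
    intro c p hp i φ hφ
    have e1 : ∫ x, (c • p).1 x * partialX i φ x = ∫ x, c * (p.1 x * partialX i φ x) := by
      refine integral_congr_ae ?_
      filter_upwards [Lp.coeFn_smul c p.1] with x hx
      simp only [Prod.smul_fst, hx, Pi.smul_apply, smul_eq_mul, mul_assoc]
    have e2 : ∫ x, (c • p).2 i x * φ x = ∫ x, c * (p.2 i x * φ x) := by
      refine integral_congr_ae ?_
      filter_upwards [Lp.coeFn_smul c (p.2 i)] with x hx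
      simp only [Prod.smul_snd, Pi.smul_apply, hx, smul_eq_mul, mul_assoc]
    rw [e1, e2, integral_const_mul, integral_const_mul, hp i φ hφ]
    ring

/-- The energy space `𝓔 = H¹(𝕋³) × L²(𝕋³)`. -/
abbrev EnergySpace : Type := H1 × L2

namespace EnergySpace

/-- The first component `u ∈ H¹(𝕋³)` of `ξ = (u, v)`, as a function in `L²(𝕋³)`. -/
def pos (ξ : EnergySpace) : L2 := (ξ.1 : L2 × (Fin 3 → L2)).1

/-- The weak gradient `∇u` of the first component of `ξ = (u, v)`. -/
def grad (ξ : EnergySpace) : Fin 3 → L2 := (ξ.1 : L2 × (Fin 3 → L2)).2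

/-- The second component `v ∈ L²(𝕋³)` of `ξ = (u, v)`. -/
def vel (ξ : EnergySpace) : L2 := ξ.2

end EnergySpace

/-- The eigenfunction `e^{ik·x}` of `-Δ` on the torus, with eigenvalue `|k|²`. -/
def expMode (k : Fin 3 → ℤ) (x : Torus3) : ℂ := ∏ i, fourier (k i) (x i)

/-- `|k|²` for `k ∈ ℤ³`. -/
def sqNorm (k : Fin 3 → ℤ) : ℝ := ∑ i, (k i : ℝ) ^ 2

/-- The Fourier coefficient `φ_k = (2π)⁻³ ∫ φ(x) e^{-ik·x} dx`. -/
def fourierCoef (φ : Torus3 → ℝ) (k : Fin 3 → ℤ) : ℂ :=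
  ((2 * π : ℝ) : ℂ)⁻¹ ^ 3 * ∫ x, (φ x : ℂ) * expMode (-k) x

/-- `(-Δ)^θ φ = ∑_k |k|^{2θ} φ_k e^{ik·x}`, for smooth real `φ` (the sum is then real). -/
def fracLaplacian (θ : ℝ) (φ : Torus3 → ℝ) (x : Torus3) : ℝ :=
  (∑' k : Fin 3 → ℤ, ((sqNorm k ^ θ : ℝ) : ℂ) * fourierCoef φ k * expMode k x).re

/-- `‖v‖²_{H^s_Δ} = (2π)³ ∑_k (1 + |k|²)^s |v_k|²`, with value `∞` when `v ∉ H^s_Δ` (`s ≥ 0`). -/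
def hsNormSq (s : ℝ) (v : L2) : ℝ≥0∞ :=
  ENNReal.ofReal ((2 * π) ^ 3) *
    ∑' k : Fin 3 → ℤ, ENNReal.ofReal ((1 + sqNorm k) ^ s * ‖fourierCoef v k‖ ^ 2)

/-- Test functions of class `C₀^∞((0,T) × 𝕋³)`, as functions of `t` and `x`. -/
structure IsTestFunction (T : ℝ) (φ : ℝ → Torus3 → ℝ) : Prop where
  smooth : ContDiff ℝ ∞ (fun p : ℝ × (Fin 3 → ℝ) => φ p.1 (proj p.2))
  support : ∃ a b : ℝ, 0 < a ∧ b < T ∧ ∀ t, t ∉ Icc a b → ∀ x, φ t x = 0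

/-- The standing assumptions on the nonlinearity: `f ∈ C¹(ℝ)`, `f(u)u ≥ -C + κ|u|²`,
`f'(u) ≥ -K` and `|f'(u)| ≤ C(1 + |u|⁴)` with positive constants `C`, `κ`, `K`. -/
structure IsAdmissible (f : ℝ → ℝ) : Prop where
  contDiff : ContDiff ℝ 1 f
  bounds : ∃ C κ K : ℝ, 0 < C ∧ 0 < κ ∧ 0 < K ∧
    (∀ u, -C + κ * |u| ^ 2 ≤ f u * u) ∧
    (∀ u, -K ≤ deriv f u) ∧
    (∀ u, |deriv f u| ≤ C * (1 + |u| ^ 4))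

/-- `ξ = (u, ∂ₜu)`, considered for `t ≥ 0`, is a weak energy solution of
`∂ₜ²u + γ(-Δ)^{1/2}∂ₜu + α∂ₜu - Δu + f(u) = g` on the torus, with initial data `ξ₀`.
The function `ξ` is the weakly continuous representative, for which the initial data have a
meaning. -/
structure IsWeakEnergySolution (α γ : ℝ) (f : ℝ → ℝ) (g : L2) (ξ : ℝ → EnergySpace)
    (ξ₀ : EnergySpace) : Prop where
  /-- `ξ ∈ C_w([0,∞), 𝓔)`. -/
  weaklyContinuous : ∀ l : EnergySpace →L[ℝ] ℝ, ContinuousOn (fun t => l (ξ t)) (Ici 0)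
  /-- `ξ ∈ L^∞(0,T; 𝓔)` for every `T`. -/
  bounded : ∀ T : ℝ, 0 < T → ∃ R : ℝ, ∀ t ∈ Icc 0 T, ‖ξ t‖ ≤ R
  /-- The second component of `ξ` is the distributional time derivative of the first. -/
  timeDeriv : ∀ T : ℝ, 0 < T → ∀ φ : ℝ → Torus3 → ℝ, IsTestFunction T φ →
    ∫ t in (0 : ℝ)..T, ∫ x, (ξ t).pos x * deriv (fun s => φ s x) t =
      -∫ t in (0 : ℝ)..T, ∫ x, (ξ t).vel x * φ t x
  /-- `∂ₜu ∈ L²(0,T; H^{1/2}_Δ)` for every `T`. -/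
  velocity : ∀ T : ℝ, 0 < T → ∫⁻ t in Ioo 0 T, hsNormSq (1 / 2) (ξ t).vel < ⊤
  initial : ξ 0 = ξ₀
  /-- The equation, in the sense of distributions. -/
  equation : ∀ T : ℝ, 0 < T → ∀ φ : ℝ → Torus3 → ℝ, IsTestFunction T φ →
    -(∫ t in (0 : ℝ)..T, ∫ x, (ξ t).vel x * deriv (fun s => φ s x) t)
      + (∫ t in (0 : ℝ)..T, ∑ i, ∫ x, (ξ t).grad i x * partialX i (φ t) x)
      + α * (∫ t in (0 : ℝ)..T, ∫ x, (ξ t).vel x * φ t x)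
      + γ * (∫ t in (0 : ℝ)..T, ∫ x, (ξ t).vel x * fracLaplacian (1 / 2) (φ t) x)
      + (∫ t in (0 : ℝ)..T, ∫ x, f ((ξ t).pos x) * φ t x)
      = ∫ t in (0 : ℝ)..T, ∫ x, g x * φ t x

/-- The energy
`E(u,v) = ½‖v‖² + ½‖∇u‖² + (F(u),1) - (g,u)`, where `F(u) = ∫₀ᵘ f(s) ds`. -/
def energy (f : ℝ → ℝ) (g : L2) (ξ : EnergySpace) : ℝ :=
  1 / 2 * ‖ξ.vel‖ ^ 2 + 1 / 2 * ∑ i, ‖ξ.grad i‖ ^ 2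
    + (∫ x, ∫ s in (0 : ℝ)..(ξ.pos x), f s) - ∫ x, g x * ξ.pos x

/-- `S(t)`, `t ≥ 0`, is the solution semigroup in the energy space: `t ↦ S(t)ξ₀` is the one and
only weak energy solution with initial data `ξ₀`, for every `ξ₀ ∈ 𝓔`.
(The values `S t` for `t < 0` are irrelevant.) -/
structure IsSolutionSemigroup (α γ : ℝ) (f : ℝ → ℝ) (g : L2)
    (S : ℝ → EnergySpace → EnergySpace) : Prop where
  isSolution : ∀ ξ₀, IsWeakEnergySolution α γ f g (fun t => S t ξ₀) ξ₀
  unique : ∀ ξ₀ ξ, IsWeakEnergySolution α γ f g ξ ξ₀ → ∀ t, 0 ≤ t → ξ t = S t ξ₀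
  zero : ∀ ξ₀, S 0 ξ₀ = ξ₀
  add : ∀ s t, 0 ≤ s → 0 ≤ t → ∀ ξ₀, S (t + s) ξ₀ = S t (S s ξ₀)

/-- `ξ₀` is an equilibrium (fixed point) of the semigroup `S(t)`, `t ≥ 0`. -/
def IsEquilibrium {X : Type*} (S : ℝ → X → X) (ξ₀ : X) : Prop :=
  ∀ t, 0 ≤ t → S t ξ₀ = ξ₀

/-- `Φ` is a global Lyapunov function for the semigroup `S(t)`, `t ≥ 0`, on the phase space `X`:
it is continuous, it does not increase along trajectories, and `Φ(S(T)ξ₀) = Φ(ξ₀)` for some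
`T > 0` happens only for equilibria `ξ₀`. -/
structure IsGlobalLyapunov {X : Type*} [TopologicalSpace X] (S : ℝ → X → X) (Φ : X → ℝ) :
    Prop where
  continuous : Continuous Φ
  nonincreasing : ∀ ξ₀, AntitoneOn (fun t => Φ (S t ξ₀)) (Ici 0)
  strict : ∀ ξ₀ T, 0 < T → Φ (S T ξ₀) = Φ ξ₀ → IsEquilibrium S ξ₀

end DampedWave

end

open MeasureTheory Set Filter Topology
open scoped Real ENNReal ContDiff

noncomputable section

namespace DampedWave

/-! ### Exponential modes -/

/-! In the orthonormal basis `hart k` of real eigenfunctions of the Laplacian, a weak energy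
solution is the same thing as a trajectory whose coefficients solve a countable system of ordinary
differential equations. This is `ModeSolution`; the two directions are
`IsWeakEnergySolution.modeSolution` and `ModeSolution.isWeakEnergySolution`.

The obstacle is the quintic growth. For `u` in H¹ the function `f(u)` is only in L^{6/5}, whereas
the velocity is at best in H^{1/2} ⊂ L³, so at energy regularity the pairing of `f(u)` with the
velocity has no meaning, and neither uniqueness nor the energy identity follows directly. The
fractional damping supplies the missing half derivative. Testing the equation with (-Δ)^{1/2}u
leaves terms controlled by the energy norm and by the L²H^{1/2} norm of the velocity, and f' ≥ -K
bounds the nonlinear term from below; hence u ∈ L²(0,T;H^{3/2}), which is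
`ModeSolution.lintegral_hs_three_lt_top`. To make the test legitimate, |k| is replaced by the
bounded symbols `mult J`, positive combinations of second differences, for which the lower bound is
a pointwise inequality.

The interpolated embedding ‖u‖₈⁸ ≲ ‖u‖⁶ in H¹ times ‖u‖² in H^{3/2} then gives the trilinear
estimate `Growth.abs_sum_sub_mul_le`. Its weight is integrable in time, which yields uniqueness by
Gronwall (`ModeSolution.eqOn`) and the energy identity by passing to the limit in Fourier
truncations (`ModeSolution.tendsto_dissipation`). Existence (`exists_modeSolution`) comes from
Galerkin systems with a truncated, globally Lipschitz nonlinearity whose energy bounds do not depend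
on the truncation.

For strictness, the dissipation γ ∑ |k| ∫ v_k² sees every mode except the mean. If the energy is the
same at times 0 and T, then u moves only by spatial constants and the nonzero modes of f(u(t)) do
not change. If the mean moved at some time, difference quotients would make f'(u(t)) constant in
space (`Growth.exists_deriv_eq_const`), so u(t) would take values in a level set of f', which is
nowhere dense. An H¹ function cannot jump across a gap, so u(t) would be constant
(`ae_eq_const_of_mem_isNowhereDense`), and the equation would force g to be constant. Hence the
velocity vanishes on [0,T], and uniqueness continues the constant trajectory to all times. -/

theorem expMode_add_index (k l : Fin 3 → ℤ) (x : Torus3) :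
    expMode (k + l) x = expMode k x * expMode l x := by
  simp only [expMode, Pi.add_apply, fourier_add, Finset.prod_mul_distrib]

theorem expMode_zero (x : Torus3) : expMode 0 x = 1 := by
  simp [expMode]

theorem expMode_neg (k : Fin 3 → ℤ) (x : Torus3) :
    expMode (-k) x = (starRingEnd ℂ) (expMode k x) := by
  simp only [expMode, Pi.neg_apply, fourier_neg, map_prod]

theorem expMode_add (k : Fin 3 → ℤ) (x y : Torus3) :
    expMode k (x + y) = expMode k x * expMode k y := by
  simp only [expMode, Pi.add_apply, ← Finset.prod_mul_distrib]
  refine Finset.prod_congr rfl fun i _ => ?_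
  simp only [fourier_apply, smul_add, AddCircle.toCircle_add, Circle.coe_mul]

theorem norm_expMode (k : Fin 3 → ℤ) (x : Torus3) : ‖expMode k x‖ = 1 := by
  rw [expMode, norm_prod]
  exact Finset.prod_eq_one fun i _ => Circle.norm_coe _

theorem continuous_expMode (k : Fin 3 → ℤ) : Continuous (expMode k) := by
  unfold expMode
  fun_prop

theorem expMode_single (k : Fin 3 → ℤ) (i : Fin 3) (s : ℝ) :
    expMode k (Pi.single i (s : AddCircle (2 * π))) = Complex.exp ((k i * s : ℝ) * Complex.I) := by
  rw [expMode, Finset.prod_eq_single i]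
  · rw [Pi.single_eq_same, fourier_coe_apply]
    congr 1
    have : (π : ℂ) ≠ 0 := by exact_mod_cast Real.pi_ne_zero
    push_cast
    field_simp
  · intro j _ hj
    rw [Pi.single_eq_of_ne hj, fourier_eval_zero]
  · simp

theorem expMode_single_re (k : Fin 3 → ℤ) (i : Fin 3) (s : ℝ) :
    (expMode k (Pi.single i (s : AddCircle (2 * π)))).re = Real.cos (k i * s) := by
  rw [expMode_single, Complex.exp_ofReal_mul_I_re]

theorem expMode_single_im (k : Fin 3 → ℤ) (i : Fin 3) (s : ℝ) :
    (expMode k (Pi.single i (s : AddCircle (2 * π)))).im = Real.sin (k i * s) := by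
  rw [expMode_single, Complex.exp_ofReal_mul_I_im]

theorem expMode_proj (k : Fin 3 → ℤ) (y : Fin 3 → ℝ) :
    expMode k (proj y) = Complex.exp ((∑ i, k i * y i : ℝ) * Complex.I) := by
  have : (π : ℂ) ≠ 0 := by exact_mod_cast Real.pi_ne_zero
  rw [expMode, Complex.ofReal_sum, Finset.sum_mul, Complex.exp_sum]
  refine Finset.prod_congr rfl fun i _ => ?_
  rw [proj, fourier_coe_apply]
  congr 1
  push_cast
  field_simp

theorem volume_real_torus : (volume : Measure Torus3).real univ = (2 * π) ^ 3 := by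
  rw [Measure.real, volume_pi, Measure.pi_univ]
  simp [AddCircle.measure_univ, Real.pi_pos.le]

/-- For `k ≠ 0`, translating by `π / k i` in a coordinate with `k i ≠ 0` multiplies the mode by
`-1`, while the Haar integral is unchanged. -/
theorem integral_expMode (k : Fin 3 → ℤ) :
    ∫ x, expMode k x = if k = 0 then (((2 * π) ^ 3 : ℝ) : ℂ) else 0 := by
  split_ifs with h
  · subst h
    simp_rw [expMode_zero]
    rw [integral_const, volume_real_torus]
    simp
  · obtain ⟨i, hi⟩ := Function.ne_iff.mp h
    have hki : (k i : ℝ) ≠ 0 := by exact_mod_cast hi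
    set y : Torus3 := Pi.single i (((π / k i : ℝ)) : AddCircle (2 * π))
    have hy : expMode k y = -1 := by
      rw [expMode_single, mul_div_cancel₀ _ hki, Complex.exp_pi_mul_I]
    have h1 : ∫ x, expMode k (x + y) = ∫ x, expMode k x := integral_add_right_eq_self _ y
    simp_rw [expMode_add, hy, mul_neg, mul_one, integral_neg] at h1
    linear_combination (-1 / 2 : ℂ) * h1

theorem integrable_of_continuous {E : Type*} [NormedAddCommGroup E] {h : Torus3 → E}
    (hh : Continuous h) : Integrable h :=
  hh.integrable_of_hasCompactSupport (HasCompactSupport.of_compactSpace h)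

/-! ### The Hartley basis -/

/-- The real eigenfunction `(2π)^{-3/2} (cos k·x + sin k·x)` of `-Δ`, normalised in `L²`. -/
def hart (k : Fin 3 → ℤ) (x : Torus3) : ℝ :=
  (Real.sqrt ((2 * π) ^ 3))⁻¹ * ((expMode k x).re + (expMode k x).im)

theorem sqrt_pos_aux : 0 < Real.sqrt ((2 * π) ^ 3) := Real.sqrt_pos.2 (by positivity)

theorem sqrt_inv_mul_self :
    (Real.sqrt ((2 * π) ^ 3))⁻¹ * (Real.sqrt ((2 * π) ^ 3))⁻¹ = ((2 * π) ^ 3)⁻¹ := by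
  rw [← mul_inv, Real.mul_self_sqrt (by positivity)]

theorem continuous_hart (k : Fin 3 → ℤ) : Continuous (hart k) := by
  unfold hart
  have := continuous_expMode k
  fun_prop

theorem hart_add (k : Fin 3 → ℤ) (x y : Torus3) :
    hart k (x + y) = (expMode k y).re * hart k x + (expMode k y).im * hart (-k) x := by
  simp only [hart, expMode_add, expMode_neg, Complex.mul_re, Complex.mul_im, Complex.conj_re,
    Complex.conj_im]
  ring

theorem abs_hart_le (k : Fin 3 → ℤ) (x : Torus3) : |hart k x| ≤ 1 := by
  have h1 := Complex.abs_re_le_norm (expMode k x)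
  have h2 := Complex.abs_im_le_norm (expMode k x)
  rw [norm_expMode] at h1 h2
  have h3 : 2 ≤ Real.sqrt ((2 * π) ^ 3) := by
    refine Real.le_sqrt_of_sq_le ?_
    have := Real.pi_gt_three
    nlinarith [sq_nonneg (2 * π - 6), pow_le_pow_left₀ (by norm_num) (by linarith : (6 : ℝ) ≤ 2 * π) 3]
  rw [hart, abs_mul, abs_of_nonneg (inv_nonneg.2 sqrt_pos_aux.le), inv_mul_le_iff₀ sqrt_pos_aux,
    mul_one]
  calc _ ≤ |(expMode k x).re| + |(expMode k x).im| := abs_add_le _ _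
    _ ≤ 2 := by linarith
    _ ≤ _ := h3

/-- Product-to-sum formula for cos + sin. Its integral gives orthonormality, and its right side lies
in the span of the basis again, so the span is an algebra and Stone–Weierstrass applies. -/
theorem hart_mul_hart (k l : Fin 3 → ℤ) (x : Torus3) :
    hart k x * hart l x =
      ((2 * π) ^ 3)⁻¹ * ((expMode (k - l) x).re + (expMode (k + l) x).im) := by
  rw [hart, hart, sub_eq_add_neg, expMode_add_index, expMode_add_index, expMode_neg,
    ← sqrt_inv_mul_self]
  simp only [Complex.mul_re, Complex.mul_im, Complex.conj_re, Complex.conj_im]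
  ring

theorem integral_hart_mul_hart (k l : Fin 3 → ℤ) :
    ∫ x, hart k x * hart l x = if k = l then 1 else 0 := by
  have hre : ∀ m, ∫ x, (expMode m x).re = (∫ x, expMode m x).re := fun m =>
    integral_re (𝕜 := ℂ) (integrable_of_continuous (continuous_expMode m))
  have him : ∀ m, ∫ x, (expMode m x).im = (∫ x, expMode m x).im := fun m =>
    integral_im (𝕜 := ℂ) (integrable_of_continuous (continuous_expMode m))
  have c1 := continuous_expMode (k - l)
  have c2 := continuous_expMode (k + l)
  simp_rw [hart_mul_hart]
  rw [integral_const_mul, integral_add (integrable_of_continuous (by fun_prop))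
    (integrable_of_continuous (by fun_prop)), hre, him, integral_expMode, integral_expMode]
  have h0 : (if k + l = 0 then (((2 * π) ^ 3 : ℝ) : ℂ) else 0).im = 0 := by
    split_ifs
    · exact Complex.ofReal_im _
    · rfl
  rw [h0, add_zero]
  by_cases h : k = l
  · rw [if_pos h, if_pos (sub_eq_zero.2 h), Complex.ofReal_re, inv_mul_cancel₀ (by positivity)]
  · rw [if_neg h, if_neg (sub_ne_zero.2 h)]
    simp

/-- `hart k` as a continuous map. -/
def hartC (k : Fin 3 → ℤ) : C(Torus3, ℝ) := ⟨hart k, continuous_hart k⟩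

theorem re_expMode_eq (k : Fin 3 → ℤ) (x : Torus3) :
    (expMode k x).re = Real.sqrt ((2 * π) ^ 3) / 2 * (hart k x + hart (-k) x) := by
  have := sqrt_pos_aux.ne'
  simp only [hart, expMode_neg, Complex.conj_re, Complex.conj_im]
  field_simp
  ring

theorem im_expMode_eq (k : Fin 3 → ℤ) (x : Torus3) :
    (expMode k x).im = Real.sqrt ((2 * π) ^ 3) / 2 * (hart k x - hart (-k) x) := by
  have := sqrt_pos_aux.ne'
  simp only [hart, expMode_neg, Complex.conj_re, Complex.conj_im]
  field_simp
  ring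

theorem hartC_mem (k : Fin 3 → ℤ) : hartC k ∈ Submodule.span ℝ (range hartC) :=
  Submodule.subset_span ⟨k, rfl⟩

theorem reMode_mem (k : Fin 3 → ℤ) :
    (⟨fun x => (expMode k x).re, Complex.continuous_re.comp (continuous_expMode k)⟩ : C(Torus3, ℝ))
      ∈ Submodule.span ℝ (range hartC) := by
  convert Submodule.smul_mem _ (Real.sqrt ((2 * π) ^ 3) / 2)
    (Submodule.add_mem _ (hartC_mem k) (hartC_mem (-k))) using 1
  ext x
  exact re_expMode_eq k x

theorem imMode_mem (k : Fin 3 → ℤ) :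
    (⟨fun x => (expMode k x).im, Complex.continuous_im.comp (continuous_expMode k)⟩ : C(Torus3, ℝ))
      ∈ Submodule.span ℝ (range hartC) := by
  convert Submodule.smul_mem _ (Real.sqrt ((2 * π) ^ 3) / 2)
    (Submodule.sub_mem _ (hartC_mem k) (hartC_mem (-k))) using 1
  ext x
  exact im_expMode_eq k x

/-- The algebra of real trigonometric polynomials. -/
def trigAlgebra : Subalgebra ℝ C(Torus3, ℝ) :=
  (Submodule.span ℝ (range hartC)).toSubalgebra
    (by
      convert reMode_mem 0 using 1
      ext x
      simp [expMode_zero])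
    (by
      intro a b ha hb
      induction ha using Submodule.span_induction with
      | mem a ha =>
        obtain ⟨k, rfl⟩ := ha
        induction hb using Submodule.span_induction with
        | mem b hb =>
          obtain ⟨l, rfl⟩ := hb
          convert Submodule.smul_mem _ (((2 * π) ^ 3)⁻¹ : ℝ)
            (Submodule.add_mem _ (reMode_mem (k - l)) (imMode_mem (k + l))) using 1
          ext x
          exact hart_mul_hart k l x
        | zero => simp
        | add b c _ _ hb hc => rw [mul_add]; exact Submodule.add_mem _ hb hc
        | smul r b _ hb => rw [mul_smul_comm]; exact Submodule.smul_mem _ _ hb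
      | zero => simp
      | add a c _ _ ha hc => rw [add_mul]; exact Submodule.add_mem _ ha hc
      | smul r a _ ha => rw [smul_mul_assoc]; exact Submodule.smul_mem _ _ ha)

theorem expMode_single_one (i : Fin 3) (x : Torus3) :
    expMode (Pi.single i 1) x = fourier 1 (x i) := by
  rw [expMode, Finset.prod_eq_single i]
  · rw [Pi.single_eq_same]
  · intro j _ hj
    rw [Pi.single_eq_of_ne hj, fourier_zero]
  · simp

theorem trigAlgebra_separatesPoints : trigAlgebra.SeparatesPoints := by
  intro x y hxy
  obtain ⟨i, hi⟩ := Function.ne_iff.mp hxy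
  have h : expMode (Pi.single i 1) x ≠ expMode (Pi.single i 1) y := by
    rw [expMode_single_one, expMode_single_one, fourier_one, fourier_one]
    exact fun h => hi (AddCircle.injective_toCircle Real.two_pi_pos.ne' (Circle.ext h))
  by_cases hre : (expMode (Pi.single i 1) x).re = (expMode (Pi.single i 1) y).re
  · exact ⟨_, ⟨_, imMode_mem (Pi.single i 1), rfl⟩, fun him => h (Complex.ext hre him)⟩
  · exact ⟨_, ⟨_, reMode_mem (Pi.single i 1), rfl⟩, hre⟩

theorem span_hartC_closure : (Submodule.span ℝ (range hartC)).topologicalClosure = ⊤ := by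
  have := ContinuousMap.subalgebra_topologicalClosure_eq_top_of_separatesPoints _
    trigAlgebra_separatesPoints
  exact congr_arg Subalgebra.toSubmodule this

/-- `hart k` as an element of `L²`. -/
def hartLp (k : Fin 3 → ℤ) : L2 := ContinuousMap.toLp (E := ℝ) 2 volume ℝ (hartC k)

theorem coeFn_hartLp (k : Fin 3 → ℤ) : hartLp k =ᵐ[volume] hart k :=
  ContinuousMap.coeFn_toLp volume (hartC k)

theorem span_hartLp_closure : (Submodule.span ℝ (range hartLp)).topologicalClosure = ⊤ := by
  have := (ContinuousMap.toLp_denseRange ℝ (volume : Measure Torus3) ℝ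
    (by simp : (2 : ℝ≥0∞) ≠ ⊤)).topologicalClosure_map_submodule span_hartC_closure
  rw [Submodule.map_span, ← range_comp] at this
  exact this

/-- The `k`-th coefficient of a function in the Hartley basis. -/
def coef (u : Torus3 → ℝ) (k : Fin 3 → ℤ) : ℝ := ∫ x, u x * hart k x

theorem inner_hartLp (k : Fin 3 → ℤ) (u : L2) : inner ℝ (hartLp k) u = coef u k := by
  rw [L2.inner_def, coef]
  refine integral_congr_ae ?_
  filter_upwards [coeFn_hartLp k] with x hx
  simp [hx]

theorem orthonormal_hartLp : Orthonormal ℝ hartLp := by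
  rw [orthonormal_iff_ite]
  intro k l
  rw [inner_hartLp, coef, ← integral_hart_mul_hart]
  refine integral_congr_ae ?_
  filter_upwards [coeFn_hartLp l] with x hx
  rw [hx, mul_comm]

/-- The Hartley basis of real `L²(𝕋³)`. -/
def hartBasis : HilbertBasis (Fin 3 → ℤ) ℝ L2 :=
  HilbertBasis.mk orthonormal_hartLp span_hartLp_closure.ge

theorem hartBasis_apply (k : Fin 3 → ℤ) : hartBasis k = hartLp k := by
  rw [hartBasis, HilbertBasis.coe_mk]

theorem hartBasis_repr (u : L2) (k : Fin 3 → ℤ) : hartBasis.repr u k = coef u k := by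
  rw [HilbertBasis.repr_apply_apply, hartBasis_apply, inner_hartLp]

theorem hasSum_coef_mul (u w : L2) :
    HasSum (fun k => coef u k * coef w k) (∫ x, u x * w x) := by
  have h := hartBasis.hasSum_inner_mul_inner u w
  have e : (inner ℝ u w : ℝ) = ∫ x, u x * w x := by
    rw [L2.inner_def]
    refine integral_congr_ae (Eventually.of_forall fun x => ?_)
    simp [mul_comm]
  rw [e] at h
  refine h.congr_fun fun k => ?_
  rw [hartBasis_apply, inner_hartLp, real_inner_comm, inner_hartLp]

theorem hasSum_coef_sq (u : L2) : HasSum (fun k => coef u k ^ 2) (‖u‖ ^ 2) := by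
  have h := hasSum_coef_mul u u
  have e : ∫ x, u x * u x = ‖u‖ ^ 2 := by
    rw [← real_inner_self_eq_norm_sq, L2.inner_def]
    refine integral_congr_ae (Eventually.of_forall fun x => ?_)
    simp [sq]
  rw [e] at h
  simpa only [sq] using h

theorem ext_coef {u w : L2} (h : ∀ k, coef u k = coef w k) : u = w := by
  apply hartBasis.repr.injective
  ext k
  rw [hartBasis_repr, hartBasis_repr, h]

theorem integrable_coe (u : L2) : Integrable u := (Lp.memLp u).integrable (by norm_num)

theorem integrable_mul_hart {h : Torus3 → ℝ} (hh : Integrable h) (k : Fin 3 → ℤ) :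
    Integrable (fun x => h x * hart k x) :=
  hh.mul_bdd (c := 1) (continuous_hart k).aestronglyMeasurable
    (Eventually.of_forall fun x => abs_hart_le k x)

theorem coef_sub {u w : Torus3 → ℝ} (hu : Integrable u) (hw : Integrable w) (k : Fin 3 → ℤ) :
    coef (fun x => u x - w x) k = coef u k - coef w k := by
  simp only [coef, sub_mul]
  exact integral_sub (integrable_mul_hart hu k) (integrable_mul_hart hw k)

theorem coef_const_mul (c : ℝ) (u : Torus3 → ℝ) (k : Fin 3 → ℤ) :
    coef (fun x => c * u x) k = c * coef u k := by
  simp only [coef, mul_assoc]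
  exact integral_const_mul _ _

theorem coef_congr {u w : Torus3 → ℝ} (h : u =ᵐ[volume] w) (k : Fin 3 → ℤ) :
    coef u k = coef w k :=
  integral_congr_ae (h.mono fun x hx => by simp only [hx])

theorem coef_hart (k l : Fin 3 → ℤ) : coef (hart k) l = if k = l then 1 else 0 :=
  integral_hart_mul_hart k l

theorem coef_hartLp (k l : Fin 3 → ℤ) : coef (hartLp k) l = if k = l then 1 else 0 := by
  rw [coef_congr (coeFn_hartLp k), coef_hart]

theorem coef_Lp_add (u w : L2) (k : Fin 3 → ℤ) : coef (u + w : L2) k = coef u k + coef w k := by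
  rw [← inner_hartLp, inner_add_right, inner_hartLp, inner_hartLp]

theorem coef_Lp_sub (u w : L2) (k : Fin 3 → ℤ) : coef (u - w : L2) k = coef u k - coef w k := by
  rw [← inner_hartLp, inner_sub_right, inner_hartLp, inner_hartLp]

theorem coef_Lp_smul (c : ℝ) (u : L2) (k : Fin 3 → ℤ) : coef (c • u : L2) k = c * coef u k := by
  rw [← inner_hartLp, inner_smul_right, inner_hartLp]

theorem coef_Lp_zero (k : Fin 3 → ℤ) : coef (0 : L2) k = 0 := by
  rw [← inner_hartLp, inner_zero_right]

/-- The square-summable sequences are exactly the coefficients of `L²` functions. -/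
theorem exists_coef_eq {a : (Fin 3 → ℤ) → ℝ} (ha : Summable fun k => a k ^ 2) :
    ∃ u : L2, ∀ k, coef u k = a k := by
  have hm : Memℓp a 2 := by
    refine memℓp_gen ?_
    simpa using ha
  refine ⟨hartBasis.repr.symm ⟨a, hm⟩, fun k => ?_⟩
  rw [← hartBasis_repr, LinearIsometryEquiv.apply_symm_apply]

/-! ### `L¹` uniqueness -/

/-- Integration against an L¹ function is continuous in the sup norm and vanishes on a uniformly
dense span. -/
theorem integral_mul_continuous_eq_zero {h : Torus3 → ℝ} (hh : Integrable h)
    (h0 : ∀ k, coef h k = 0) (ψ : C(Torus3, ℝ)) : ∫ x, h x * ψ x = 0 := by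
  have hint : ∀ φ : C(Torus3, ℝ), Integrable (fun x => h x * φ x) := fun φ =>
    hh.mul_bdd (c := ‖φ‖) φ.continuous.aestronglyMeasurable
      (Eventually.of_forall fun x => φ.norm_coe_le_norm x)
  let l : C(Torus3, ℝ) →L[ℝ] ℝ := LinearMap.mkContinuous
    { toFun := fun φ => ∫ x, h x * φ x
      map_add' := fun φ ψ => by
        simp only [ContinuousMap.add_apply, mul_add]
        exact integral_add (hint φ) (hint ψ)
      map_smul' := fun c φ => by
        simp only [ContinuousMap.smul_apply, smul_eq_mul, RingHom.id_apply, mul_left_comm _ c]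
        exact integral_const_mul _ _ } (∫ x, ‖h x‖) (fun φ => by
          refine (norm_integral_le_integral_norm _).trans ?_
          rw [← integral_mul_const]
          refine integral_mono (hint φ).norm (hh.norm.mul_const _) fun x => ?_
          simp only [norm_mul]
          exact mul_le_mul_of_nonneg_left (φ.norm_coe_le_norm x) (norm_nonneg _))
  have hl : (⊤ : Submodule ℝ C(Torus3, ℝ)) ≤ LinearMap.ker l.toLinearMap := by
    rw [← span_hartC_closure]
    refine Submodule.topologicalClosure_minimal _ (Submodule.span_le.2 ?_) l.isClosed_ker
    rintro _ ⟨k, rfl⟩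
    exact h0 k
  exact hl (Submodule.mem_top : ψ ∈ ⊤)

/-- The positive and negative parts are densities of two finite measures which agree on continuous
functions, hence coincide. The L¹ form is needed for `f'(u)`, which grows like |u|⁴ and need not be
square integrable. -/
theorem ae_eq_zero_of_coef_eq_zero {h : Torus3 → ℝ} (hh : Integrable h)
    (h0 : ∀ k, coef h k = 0) : h =ᵐ[volume] 0 := by
  have key := integral_mul_continuous_eq_zero hh h0
  set p : Torus3 → ℝ := fun x => max (h x) 0
  set q : Torus3 → ℝ := fun x => max (-h x) 0
  have hp : Integrable p := hh.pos_part
  have hq : Integrable q := hh.neg_part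
  have hμ : volume.withDensity (fun x => ENNReal.ofReal (p x)) =
      volume.withDensity (fun x => ENNReal.ofReal (q x)) := by
    have i1 := isFiniteMeasure_withDensity_ofReal hp.2
    have i2 := isFiniteMeasure_withDensity_ofReal hq.2
    refine ext_of_forall_integral_eq_of_IsFiniteMeasure fun φ => ?_
    rw [integral_withDensity_eq_integral_toReal_smul₀ hp.1.aemeasurable.ennreal_ofReal (by simp),
      integral_withDensity_eq_integral_toReal_smul₀ hq.1.aemeasurable.ennreal_ofReal (by simp)]
    have hb : ∀ r : Torus3 → ℝ, Integrable r → Integrable (fun x => r x * φ x) := fun r hr =>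
      hr.mul_bdd (c := ‖φ‖) φ.continuous.aestronglyMeasurable
        (Eventually.of_forall fun x => φ.norm_coe_le_norm x)
    have e := key φ.toContinuousMap
    have e2 : ∀ x, h x * φ.toContinuousMap x = p x * φ x - q x * φ x := fun x => by
      simp only [BoundedContinuousFunction.coe_toContinuousMap, p, q]
      rcases le_total (h x) 0 with hx | hx
      · rw [max_eq_right hx, max_eq_left (by linarith)]; ring
      · rw [max_eq_left hx, max_eq_right (by linarith)]; ring
    simp_rw [e2] at e
    rw [integral_sub (hb p hp) (hb q hq), sub_eq_zero] at e
    calc _ = ∫ x, p x * φ x := integral_congr_ae (Eventually.of_forall fun x => by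
          simp only [smul_eq_mul]; rw [ENNReal.toReal_ofReal (le_max_right _ _)])
      _ = ∫ x, q x * φ x := e
      _ = _ := integral_congr_ae (Eventually.of_forall fun x => by
          simp only [smul_eq_mul]; rw [ENNReal.toReal_ofReal (le_max_right _ _)])
  have := (withDensity_eq_iff hp.1.aemeasurable.ennreal_ofReal hq.1.aemeasurable.ennreal_ofReal
    (by
      have := isFiniteMeasure_withDensity_ofReal hp.2
      have h2 := measure_ne_top (volume.withDensity (fun x => ENNReal.ofReal (p x))) univ
      rwa [withDensity_apply _ MeasurableSet.univ, Measure.restrict_univ] at h2)).1 hμ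
  filter_upwards [this] with x hx
  have h3 : p x = q x := by
    have := congrArg ENNReal.toReal hx
    rwa [ENNReal.toReal_ofReal (le_max_right _ _), ENNReal.toReal_ofReal (le_max_right _ _)] at this
  simp only [p, q] at h3
  show h x = 0
  rcases le_total (h x) 0 with hx | hx
  · rw [max_eq_right hx, max_eq_left (by linarith)] at h3; linarith
  · rw [max_eq_left hx, max_eq_right (by linarith)] at h3; linarith

/-! ### Calculus on the torus -/

/-- `x ↦ s eᵢ` on the torus. -/
def shift (i : Fin 3) (s : ℝ) : Torus3 := Pi.single i (s : AddCircle (2 * π))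

theorem shift_add (i : Fin 3) (s t : ℝ) : shift i (s + t) = shift i s + shift i t := by
  rw [shift, AddCircle.coe_add, Pi.single_add]; rfl

theorem shift_zero (i : Fin 3) : shift i 0 = 0 := by simp [shift]

theorem shift_neg (i : Fin 3) (s : ℝ) : shift i (-s) = -shift i s := by
  rw [eq_neg_iff_add_eq_zero, ← shift_add, neg_add_cancel, shift_zero]

theorem hart_shift (k : Fin 3 → ℤ) (x : Torus3) (i : Fin 3) (s : ℝ) :
    hart k (x + shift i s) = Real.cos (k i * s) * hart k x + Real.sin (k i * s) * hart (-k) x := by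
  rw [hart_add, shift, expMode_single_re, expMode_single_im]

theorem proj_surjective : Function.Surjective proj := isOpenQuotientMap_proj.surjective

theorem proj_add_single (y : Fin 3 → ℝ) (i : Fin 3) (s : ℝ) :
    proj (y + s • Pi.single i 1) = proj y + shift i s := by
  funext j
  by_cases hj : j = i
  · subst hj; simp [proj, shift]
  · simp [proj, shift, hj]

theorem smoothTorus_hart (k : Fin 3 → ℤ) : SmoothTorus (hart k) := by
  unfold SmoothTorus hart
  simp_rw [expMode_proj, Complex.exp_ofReal_mul_I_re, Complex.exp_ofReal_mul_I_im]
  fun_prop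

theorem partialX_hart (k : Fin 3 → ℤ) (i : Fin 3) (x : Torus3) :
    partialX i (hart k) x = k i * hart (-k) x := by
  have e : (fun s : ℝ => hart k (x + Pi.single i (s : AddCircle (2 * π)))) =
      fun s => Real.cos (k i * s) * hart k x + Real.sin (k i * s) * hart (-k) x := by
    funext s
    exact hart_shift k x i s
  rw [partialX, e]
  have h0 : HasDerivAt (fun s : ℝ => (k i : ℝ) * s) (k i) 0 := by
    simpa using (hasDerivAt_id (0 : ℝ)).const_mul (k i : ℝ)
  have h := (h0.cos.mul_const (hart k x)).add (h0.sin.mul_const (hart (-k) x))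
  rw [show (fun s => Real.cos (k i * s) * hart k x + Real.sin (k i * s) * hart (-k) x) =
    (fun s => Real.cos (k i * s) * hart k x) + (fun s => Real.sin (k i * s) * hart (-k) x) from rfl,
    h.deriv]
  simp

theorem SmoothTorus.partialX_proj {φ : Torus3 → ℝ} (h : SmoothTorus φ) (i : Fin 3)
    (y : Fin 3 → ℝ) : partialX i φ (proj y) =
      fderiv ℝ (fun y : Fin 3 → ℝ => φ (proj y)) y (Pi.single i 1) := by
  have hd : DifferentiableAt ℝ (fun y : Fin 3 → ℝ => φ (proj y)) y :=
    (ContDiff.differentiable h (by simp)) y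
  rw [partialX, ← hd.lineDeriv_eq_fderiv, lineDeriv]
  congr 1
  funext s
  rw [proj_add_single]; rfl

theorem SmoothTorus.hasDerivAt_shift {φ : Torus3 → ℝ} (h : SmoothTorus φ) (i : Fin 3)
    (x : Torus3) (s : ℝ) :
    HasDerivAt (fun s => φ (x + shift i s)) (partialX i φ (x + shift i s)) s := by
  obtain ⟨y, rfl⟩ := proj_surjective x
  rw [← proj_add_single, h.partialX_proj]
  have hd : DifferentiableAt ℝ (fun y : Fin 3 → ℝ => φ (proj y)) (y + s • Pi.single i 1) :=
    (ContDiff.differentiable h (by simp)) _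
  have h1 : HasDerivAt (fun s : ℝ => y + s • (Pi.single i 1 : Fin 3 → ℝ)) (Pi.single i 1) s := by
    simpa using ((hasDerivAt_id s).smul_const (Pi.single i 1 : Fin 3 → ℝ)).const_add y
  have h2 := hd.hasFDerivAt.comp_hasDerivAt s h1
  refine h2.congr_of_eventuallyEq (Eventually.of_forall fun r => ?_)
  simp only [Function.comp, proj_add_single]

theorem exists_bound_of_continuous {h : Torus3 → ℝ} (hh : Continuous h) :
    ∃ C, ∀ x, |h x| ≤ C := by
  obtain ⟨C, hC⟩ := (isCompact_univ (X := Torus3)).exists_bound_of_continuousOn hh.continuousOn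
  exact ⟨C, fun x => hC x (mem_univ x)⟩

/-- By translation invariance the integral of `φ(x + s eᵢ)` does not depend on `s`; its derivative
at `s = 0` is the integral in question. -/
theorem integral_partialX {φ : Torus3 → ℝ} (h : SmoothTorus φ) (i : Fin 3) :
    ∫ x, partialX i φ x = 0 := by
  obtain ⟨C, hC⟩ := exists_bound_of_continuous (h.continuous_partialX i)
  have key := hasDerivAt_integral_of_dominated_loc_of_deriv_le (μ := (volume : Measure Torus3))
    (F := fun s x => φ (x + shift i s)) (F' := fun s x => partialX i φ (x + shift i s))
    (x₀ := 0) (s := univ) (bound := fun _ => C) univ_mem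
    (Eventually.of_forall fun s =>
      (h.continuous.comp (continuous_add_const (shift i s))).aestronglyMeasurable)
    (integrable_of_continuous (h.continuous.comp (continuous_add_const _)))
    ((h.continuous_partialX i).comp (continuous_add_const _)).aestronglyMeasurable
    (Eventually.of_forall fun x s _ => hC _) (integrable_const _)
    (Eventually.of_forall fun x s _ => h.hasDerivAt_shift i x s)
  have h2 := key.2
  simp_rw [integral_add_right_eq_self (μ := (volume : Measure Torus3)) φ] at h2
  have h3 := h2.unique (hasDerivAt_const (0 : ℝ) (∫ x, φ x))
  simpa [shift_zero] using h3

theorem integral_mul_partialX {φ ψ : Torus3 → ℝ} (hφ : SmoothTorus φ) (hψ : SmoothTorus ψ)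
    (i : Fin 3) : ∫ x, partialX i φ x * ψ x = -∫ x, φ x * partialX i ψ x := by
  have hm : SmoothTorus (fun x => φ x * ψ x) := ContDiff.mul hφ hψ
  have h := integral_partialX hm i
  have e : ∀ x, partialX i (fun x => φ x * ψ x) x =
      partialX i φ x * ψ x + φ x * partialX i ψ x := fun x => by
    have h1 := (hφ.hasDerivAt_shift i x 0).mul (hψ.hasDerivAt_shift i x 0)
    have h2 := (hm.hasDerivAt_shift i x 0).unique h1
    simpa [shift_zero] using h2
  simp_rw [e] at h
  have c1 := hφ.continuous
  have c2 := hψ.continuous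
  have c3 := hφ.continuous_partialX i
  have c4 := hψ.continuous_partialX i
  rw [integral_add (integrable_of_continuous (by fun_prop)) (integrable_of_continuous (by fun_prop))] at h
  linarith

theorem coef_partialX {φ : Torus3 → ℝ} (hφ : SmoothTorus φ) (i : Fin 3) (k : Fin 3 → ℤ) :
    coef (partialX i φ) k = -(k i * coef φ (-k)) := by
  rw [coef, integral_mul_partialX hφ (smoothTorus_hart k), coef, ← integral_const_mul]
  simp_rw [partialX_hart]
  congr 1
  refine integral_congr_ae (Eventually.of_forall fun x => ?_)
  ring

/-- A continuous function as an element of `L²`. -/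
def toL2 {h : Torus3 → ℝ} (hh : Continuous h) : L2 :=
  ContinuousMap.toLp (E := ℝ) 2 volume ℝ ⟨h, hh⟩

theorem coeFn_toL2 {h : Torus3 → ℝ} (hh : Continuous h) : toL2 hh =ᵐ[volume] h :=
  ContinuousMap.coeFn_toLp volume (⟨h, hh⟩ : C(Torus3, ℝ))

theorem coef_toL2 {h : Torus3 → ℝ} (hh : Continuous h) (k : Fin 3 → ℤ) :
    coef (toL2 hh) k = coef h k := coef_congr (coeFn_toL2 hh) k

theorem hasSum_coef_mul_continuous (u : L2) {h : Torus3 → ℝ} (hh : Continuous h) :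
    HasSum (fun k => coef u k * coef h k) (∫ x, u x * h x) := by
  have := hasSum_coef_mul u (toL2 hh)
  simp_rw [coef_toL2 hh] at this
  convert this using 1
  refine integral_congr_ae ?_
  filter_upwards [coeFn_toL2 hh] with x hx
  rw [hx]

/-- Differentiation exchanges the basis functions of `k` and `-k`, which is where the index `-k`
comes from. Testing with basis functions gives one direction, Parseval the other. -/
theorem isWeakPartial_iff {i : Fin 3} {u w : L2} :
    IsWeakPartial i u w ↔ ∀ k, coef w k = -(k i * coef u (-k)) := by
  constructor
  · intro h k
    have := h (hart k) (smoothTorus_hart k)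
    simp_rw [partialX_hart] at this
    have e : ∫ x, u x * (k i * hart (-k) x) = k i * coef u (-k) := by
      rw [coef, ← integral_const_mul]
      refine integral_congr_ae (Eventually.of_forall fun x => ?_)
      ring
    rw [e] at this
    rw [this, neg_neg]; rfl
  · intro h φ hφ
    have h1 := hasSum_coef_mul_continuous u (hφ.continuous_partialX i)
    have h2 := (hasSum_coef_mul_continuous w hφ.continuous).neg
    rw [← (Equiv.neg (Fin 3 → ℤ)).hasSum_iff] at h2
    refine h1.unique (h2.congr_fun fun k => ?_)
    simp only [Function.comp, Equiv.neg_apply, coef_partialX hφ, h, neg_neg, Pi.neg_apply]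
    push_cast
    ring

/-! ### Sobolev weights -/

/-- The weight `1 + max |kᵢ|`. -/
def nu (k : Fin 3 → ℤ) : ℝ := 1 + ‖k‖

theorem one_le_nu (k : Fin 3 → ℤ) : 1 ≤ nu k := by
  have := norm_nonneg k
  unfold nu; linarith

theorem nu_pos (k : Fin 3 → ℤ) : 0 < nu k := one_pos.trans_le (one_le_nu k)

theorem nu_neg (k : Fin 3 → ℤ) : nu (-k) = nu k := by rw [nu, norm_neg, nu]

theorem abs_apply_le_norm (k : Fin 3 → ℤ) (i : Fin 3) : |(k i : ℝ)| ≤ ‖k‖ := by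
  have := norm_le_pi_norm k i
  rwa [Int.norm_eq_abs] at this

theorem abs_apply_le_nu (k : Fin 3 → ℤ) (i : Fin 3) : |(k i : ℝ)| ≤ nu k := by
  have := abs_apply_le_norm k i
  unfold nu; linarith

theorem sqNorm_nonneg (k : Fin 3 → ℤ) : 0 ≤ sqNorm k := Finset.sum_nonneg fun _ _ => sq_nonneg _

theorem exists_norm_eq (k : Fin 3 → ℤ) : ∃ i, ‖k‖ = |(k i : ℝ)| := by
  obtain ⟨i, -, hi⟩ := Finset.exists_max_image Finset.univ (fun i => |(k i : ℝ)|)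
    Finset.univ_nonempty
  refine ⟨i, le_antisymm ?_ (abs_apply_le_norm k i)⟩
  refine (pi_norm_le_iff_of_nonneg (abs_nonneg _)).2 fun j => ?_
  rw [Int.norm_eq_abs]
  exact hi j (Finset.mem_univ j)

theorem norm_sq_le_sqNorm (k : Fin 3 → ℤ) : ‖k‖ ^ 2 ≤ sqNorm k := by
  obtain ⟨i, hi⟩ := exists_norm_eq k
  rw [hi, sq_abs]
  exact Finset.single_le_sum (f := fun i => (k i : ℝ) ^ 2) (fun j _ => sq_nonneg _)
    (Finset.mem_univ i)

theorem sqNorm_le (k : Fin 3 → ℤ) : sqNorm k ≤ 3 * ‖k‖ ^ 2 := by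
  calc sqNorm k ≤ ∑ _i : Fin 3, ‖k‖ ^ 2 := Finset.sum_le_sum fun i _ => by
        rw [← sq_abs]
        exact pow_le_pow_left₀ (abs_nonneg _) (abs_apply_le_norm k i) 2
    _ = _ := by simp

/-- `|k|`, the symbol of `(-Δ)^{1/2}`. -/
def absK (k : Fin 3 → ℤ) : ℝ := Real.sqrt (sqNorm k)

theorem absK_nonneg (k : Fin 3 → ℤ) : 0 ≤ absK k := Real.sqrt_nonneg _

theorem absK_sq (k : Fin 3 → ℤ) : absK k ^ 2 = sqNorm k := Real.sq_sqrt (sqNorm_nonneg k)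

theorem norm_le_absK (k : Fin 3 → ℤ) : ‖k‖ ≤ absK k :=
  Real.le_sqrt_of_sq_le (norm_sq_le_sqNorm k)

theorem absK_le (k : Fin 3 → ℤ) : absK k ≤ 2 * ‖k‖ := by
  refine Real.sqrt_le_iff.2 ⟨by positivity, ?_⟩
  have := sqNorm_le k
  nlinarith [sq_nonneg ‖k‖]

theorem absK_le_nu (k : Fin 3 → ℤ) : absK k ≤ 2 * nu k := by
  have := absK_le k
  unfold nu; linarith

theorem sqNorm_neg (k : Fin 3 → ℤ) : sqNorm (-k) = sqNorm k := by simp [sqNorm]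

theorem absK_neg (k : Fin 3 → ℤ) : absK (-k) = absK k := by rw [absK, sqNorm_neg, absK]

theorem sqNorm_zero : sqNorm 0 = 0 := by simp [sqNorm]

theorem one_le_norm_of_ne_zero {k : Fin 3 → ℤ} (hk : k ≠ 0) : 1 ≤ ‖k‖ := by
  obtain ⟨i, hi⟩ := Function.ne_iff.mp hk
  refine le_trans ?_ (abs_apply_le_norm k i)
  exact_mod_cast Int.one_le_abs hi

/-- The square of the `H^{n/2}` norm of a function with coefficients `a`. -/
def hs (n : ℕ) (a : (Fin 3 → ℤ) → ℝ) : ℝ≥0∞ := ∑' k, ENNReal.ofReal (nu k ^ n * a k ^ 2)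

theorem hs_mono {m n : ℕ} (h : m ≤ n) (a : (Fin 3 → ℤ) → ℝ) : hs m a ≤ hs n a :=
  ENNReal.tsum_le_tsum fun k => ENNReal.ofReal_le_ofReal
    (mul_le_mul_of_nonneg_right (pow_le_pow_right₀ (one_le_nu k) h) (sq_nonneg _))

theorem hs_le_of_abs_le {n : ℕ} {a b : (Fin 3 → ℤ) → ℝ} (h : ∀ k, |a k| ≤ |b k|) :
    hs n a ≤ hs n b :=
  ENNReal.tsum_le_tsum fun k => ENNReal.ofReal_le_ofReal
    (mul_le_mul_of_nonneg_left (sq_le_sq.2 (h k)) (pow_nonneg (nu_pos k).le _))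

theorem hs_term_nonneg (n : ℕ) (a : (Fin 3 → ℤ) → ℝ) (k : Fin 3 → ℤ) : 0 ≤ nu k ^ n * a k ^ 2 :=
  mul_nonneg (pow_nonneg (nu_pos k).le _) (sq_nonneg _)

theorem summable_of_hs_lt_top {n : ℕ} {a : (Fin 3 → ℤ) → ℝ} (h : hs n a < ⊤) :
    Summable fun k => nu k ^ n * a k ^ 2 := by
  have := ENNReal.summable_toReal h.ne
  refine this.congr fun k => ?_
  rw [ENNReal.toReal_ofReal (hs_term_nonneg n a k)]

theorem hs_eq_ofReal {n : ℕ} {a : (Fin 3 → ℤ) → ℝ} (h : Summable fun k => nu k ^ n * a k ^ 2) :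
    hs n a = ENNReal.ofReal (∑' k, nu k ^ n * a k ^ 2) :=
  (ENNReal.ofReal_tsum_of_nonneg (hs_term_nonneg n a) h).symm

theorem hs_le_ofReal_iff {n : ℕ} {a : (Fin 3 → ℤ) → ℝ} {R : ℝ} (hR : 0 ≤ R) :
    hs n a ≤ ENNReal.ofReal R ↔ ∀ s : Finset (Fin 3 → ℤ), ∑ k ∈ s, nu k ^ n * a k ^ 2 ≤ R := by
  rw [hs, ENNReal.tsum_eq_iSup_sum, iSup_le_iff]
  refine forall_congr' fun s => ?_
  rw [← ENNReal.ofReal_sum_of_nonneg fun k _ => hs_term_nonneg n a k,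
    ENNReal.ofReal_le_ofReal_iff hR]

theorem hs_zero_coef (u : L2) : hs 0 (coef u) = ENNReal.ofReal (‖u‖ ^ 2) := by
  have h := hasSum_coef_sq u
  have e : (fun k => nu k ^ 0 * coef u k ^ 2) = fun k => coef u k ^ 2 := by simp
  rw [hs_eq_ofReal (by rw [e]; exact h.summable), e, h.tsum_eq]

theorem hs_add_le (n : ℕ) (a b : (Fin 3 → ℤ) → ℝ) :
    hs n (fun k => a k + b k) ≤ 2 * hs n a + 2 * hs n b := by
  rw [hs, hs, hs, ← ENNReal.tsum_mul_left, ← ENNReal.tsum_mul_left, ← ENNReal.tsum_add]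
  refine ENNReal.tsum_le_tsum fun k => ?_
  have e2 : (2 : ℝ≥0∞) = ENNReal.ofReal 2 := by simp
  rw [e2, ← ENNReal.ofReal_mul (by norm_num), ← ENNReal.ofReal_mul (by norm_num),
    ← ENNReal.ofReal_add (mul_nonneg (by norm_num) (hs_term_nonneg _ _ _))
      (mul_nonneg (by norm_num) (hs_term_nonneg _ _ _))]
  refine ENNReal.ofReal_le_ofReal ?_
  have := pow_pos (nu_pos k) n
  nlinarith [mul_nonneg this.le (sq_nonneg (a k - b k))]

theorem hs_const_mul (n : ℕ) (c : ℝ) (a : (Fin 3 → ℤ) → ℝ) :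
    hs n (fun k => c * a k) = ENNReal.ofReal (c ^ 2) * hs n a := by
  rw [hs, hs, ← ENNReal.tsum_mul_left]
  refine tsum_congr fun k => ?_
  rw [← ENNReal.ofReal_mul (sq_nonneg c)]
  congr 1; ring

theorem hs_sub_le (n : ℕ) (a b : (Fin 3 → ℤ) → ℝ) :
    hs n (fun k => a k - b k) ≤ 2 * hs n a + 2 * hs n b := by
  have := hs_add_le n a (fun k => (-1) * b k)
  rw [hs_const_mul] at this
  simpa [sub_eq_add_neg] using this

/-! ### The energy space in terms of coefficients -/

theorem coef_grad (ξ : EnergySpace) (i : Fin 3) (k : Fin 3 → ℤ) :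
    coef (ξ.grad i) k = -(k i * coef ξ.pos (-k)) :=
  isWeakPartial_iff.1 (ξ.1.2 i) k

theorem hs_grad (ξ : EnergySpace) (i : Fin 3) :
    ENNReal.ofReal (‖ξ.grad i‖ ^ 2) = ∑' k, ENNReal.ofReal ((k i : ℝ) ^ 2 * coef ξ.pos k ^ 2) := by
  rw [← hs_zero_coef, hs, ← (Equiv.neg (Fin 3 → ℤ)).tsum_eq]
  refine tsum_congr fun k => ?_
  simp only [Equiv.neg_apply, coef_grad, neg_neg, pow_zero, one_mul, Pi.neg_apply]
  congr 1
  push_cast; ring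

theorem hasSum_grad (ξ : EnergySpace) :
    HasSum (fun k => sqNorm k * coef ξ.pos k ^ 2) (∑ i, ‖ξ.grad i‖ ^ 2) := by
  simp_rw [sqNorm, Finset.sum_mul]
  refine hasSum_sum fun i _ => ?_
  have := hasSum_coef_sq (ξ.grad i)
  rw [← (Equiv.neg (Fin 3 → ℤ)).hasSum_iff] at this
  refine this.congr_fun fun k => ?_
  simp only [Function.comp, Equiv.neg_apply, coef_grad, neg_neg, Pi.neg_apply]
  push_cast; ring

theorem norm_pos_le (ξ : EnergySpace) : ‖ξ.pos‖ ≤ ‖ξ‖ :=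
  (norm_fst_le (ξ.1 : L2 × (Fin 3 → L2))).trans (norm_fst_le ξ)

theorem norm_grad_le (ξ : EnergySpace) (i : Fin 3) : ‖ξ.grad i‖ ≤ ‖ξ‖ :=
  (norm_le_pi_norm _ i).trans ((norm_snd_le (ξ.1 : L2 × (Fin 3 → L2))).trans (norm_fst_le ξ))

theorem norm_vel_le (ξ : EnergySpace) : ‖ξ.vel‖ ≤ ‖ξ‖ := norm_snd_le ξ

/-- The constant is `2 + 2 * 3`: the norm on the product is a maximum, so each of the three gradient
components contributes separately. -/
theorem hs_two_pos_le (ξ : EnergySpace) : hs 2 (coef ξ.pos) ≤ ENNReal.ofReal (8 * ‖ξ‖ ^ 2) := by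
  have h0 := hasSum_coef_sq ξ.pos
  have h1 := hasSum_grad ξ
  have h2 := (h0.mul_left 2).add (h1.mul_left 2)
  have hle : ∀ k, nu k ^ 2 * coef ξ.pos k ^ 2 ≤
      2 * coef ξ.pos k ^ 2 + 2 * (sqNorm k * coef ξ.pos k ^ 2) := fun k => by
    have := norm_sq_le_sqNorm k
    have h3 : nu k ^ 2 ≤ 2 + 2 * sqNorm k := by unfold nu; nlinarith [sq_nonneg (1 - ‖k‖)]
    nlinarith [sq_nonneg (coef ξ.pos k)]
  have hs := Summable.of_nonneg_of_le (hs_term_nonneg 2 _) hle h2.summable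
  rw [hs_eq_ofReal hs]
  refine ENNReal.ofReal_le_ofReal ((hs.tsum_le_tsum hle h2.summable).trans ?_)
  rw [h2.tsum_eq]
  have a0 := pow_le_pow_left₀ (norm_nonneg _) (norm_pos_le ξ) 2
  have a1 : ∑ i, ‖ξ.grad i‖ ^ 2 ≤ ∑ _i : Fin 3, ‖ξ‖ ^ 2 := Finset.sum_le_sum fun i _ =>
    pow_le_pow_left₀ (norm_nonneg _) (norm_grad_le ξ i) 2
  simp at a1
  linarith

theorem hs_zero_vel_le (ξ : EnergySpace) : hs 0 (coef ξ.vel) ≤ ENNReal.ofReal (‖ξ‖ ^ 2) := by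
  rw [hs_zero_coef]
  exact ENNReal.ofReal_le_ofReal (pow_le_pow_left₀ (norm_nonneg _) (norm_vel_le ξ) 2)

theorem norm_le_of_hs {ξ : EnergySpace} {R : ℝ} (hR : 0 ≤ R)
    (h1 : hs 2 (coef ξ.pos) ≤ ENNReal.ofReal (R ^ 2))
    (h2 : hs 0 (coef ξ.vel) ≤ ENNReal.ofReal (R ^ 2)) : ‖ξ‖ ≤ R := by
  have aux : ∀ u : L2, ENNReal.ofReal (‖u‖ ^ 2) ≤ ENNReal.ofReal (R ^ 2) → ‖u‖ ≤ R := fun u h =>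
    (pow_le_pow_iff_left₀ (norm_nonneg _) hR two_ne_zero).1
      ((ENNReal.ofReal_le_ofReal_iff (by positivity)).1 h)
  refine norm_prod_le_iff.2 ⟨norm_prod_le_iff.2 ⟨?_, ?_⟩, ?_⟩
  · refine aux ξ.pos ?_
    rw [← hs_zero_coef]
    exact (hs_mono (by norm_num) _).trans h1
  · refine (pi_norm_le_iff_of_nonneg hR).2 fun i => aux (ξ.grad i) ?_
    rw [hs_grad]
    refine le_trans (ENNReal.tsum_le_tsum fun k => ENNReal.ofReal_le_ofReal ?_) h1
    refine mul_le_mul_of_nonneg_right ?_ (sq_nonneg _)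
    rw [← sq_abs]
    exact pow_le_pow_left₀ (abs_nonneg _) (abs_apply_le_nu k i) 2
  · refine aux ξ.vel ?_
    rwa [← hs_zero_coef]

theorem ext_energySpace {ξ η : EnergySpace} (h1 : ∀ k, coef ξ.pos k = coef η.pos k)
    (h2 : ∀ k, coef ξ.vel k = coef η.vel k) : ξ = η := by
  refine Prod.ext (Subtype.ext (Prod.ext (ext_coef h1) (funext fun i => ext_coef fun k => ?_)))
    (ext_coef h2)
  rw [show (ξ.1 : L2 × (Fin 3 → L2)).2 i = ξ.grad i from rfl,
    show (η.1 : L2 × (Fin 3 → L2)).2 i = η.grad i from rfl, coef_grad, coef_grad, h1]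

theorem exists_energySpace {a b : (Fin 3 → ℤ) → ℝ} (ha : hs 2 a < ⊤) (hb : hs 0 b < ⊤) :
    ∃ ξ : EnergySpace, (∀ k, coef ξ.pos k = a k) ∧ ∀ k, coef ξ.vel k = b k := by
  have sa := summable_of_hs_lt_top ha
  obtain ⟨u, hu⟩ := exists_coef_eq (a := a) (by
    simpa using summable_of_hs_lt_top ((hs_mono (by norm_num : 0 ≤ 2) a).trans_lt ha))
  obtain ⟨v, hv⟩ := exists_coef_eq (a := b) (by simpa using summable_of_hs_lt_top hb)
  have hw : ∀ i : Fin 3, ∃ w : L2, ∀ k, coef w k = -(k i * a (-k)) := fun i => by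
    refine exists_coef_eq ?_
    rw [← (Equiv.neg (Fin 3 → ℤ)).summable_iff]
    refine Summable.of_nonneg_of_le (fun k => sq_nonneg _) (fun k => ?_) sa
    simp only [Function.comp, Equiv.neg_apply, neg_neg, Pi.neg_apply, neg_sq, mul_pow]
    push_cast
    rw [neg_sq]
    refine mul_le_mul_of_nonneg_right ?_ (sq_nonneg _)
    rw [← sq_abs]
    exact pow_le_pow_left₀ (abs_nonneg _) (abs_apply_le_nu k i) 2
  choose w hw using hw
  refine ⟨(⟨(u, w), fun i => isWeakPartial_iff.2 fun k => ?_⟩, v), hu, hv⟩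
  simp only [hw, hu]

/-! ### Lattice boxes -/

/-- The integer vectors with `max |kᵢ| ≤ N`. -/
def box (N : ℕ) : Finset (Fin 3 → ℤ) := Finset.Icc (fun _ => -(N : ℤ)) (fun _ => (N : ℤ))

theorem mem_box {N : ℕ} {k : Fin 3 → ℤ} : k ∈ box N ↔ ‖k‖ ≤ N := by
  rw [box, Finset.mem_Icc, pi_norm_le_iff_of_nonneg (Nat.cast_nonneg N), Pi.le_def, Pi.le_def,
    ← forall_and]
  refine forall_congr' fun i => ?_
  rw [← abs_le, Int.norm_eq_abs]
  exact_mod_cast Iff.rfl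

theorem card_box (N : ℕ) : (box N).card = (2 * N + 1) ^ 3 := by
  rw [box, Pi.card_Icc]
  simp only [Int.card_Icc, Finset.prod_const, Finset.card_univ, Fintype.card_fin]
  congr 1
  omega

theorem box_mono {M N : ℕ} (h : M ≤ N) : box M ⊆ box N := fun k hk => by
  rw [mem_box] at hk ⊢
  exact hk.trans (by exact_mod_cast h)

theorem nu_of_mem_sdiff {N : ℕ} {k : Fin 3 → ℤ} (hk : k ∈ box (N + 1) \ box N) :
    nu k = N + 2 := by
  rw [Finset.mem_sdiff, mem_box, mem_box, not_le] at hk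
  obtain ⟨i, hi⟩ := exists_norm_eq k
  have h1 : ‖k‖ = N + 1 := by
    rw [hi] at hk ⊢
    have h2 : |k i| ≤ N + 1 := by exact_mod_cast hk.1
    have h3 : (N : ℤ) < |k i| := by exact_mod_cast hk.2
    exact_mod_cast le_antisymm h2 h3
  rw [nu, h1]; ring

/-- The shell between consecutive boxes contains `(2N+3)³ - (2N+1)³` points, and `nu` equals `N + 2`
on all of it. -/
theorem sum_box_succ (g : ℝ → ℝ) (N : ℕ) :
    ∑ k ∈ box (N + 1), g (nu k) =
      ∑ k ∈ box N, g (nu k) + (24 * N ^ 2 + 48 * N + 26) * g (N + 2) := by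
  rw [← Finset.sum_sdiff (box_mono N.le_succ), add_comm]
  congr 1
  rw [Finset.sum_congr rfl fun k hk => by rw [nu_of_mem_sdiff hk], Finset.sum_const,
    Finset.card_sdiff_of_subset (box_mono N.le_succ), card_box, card_box, nsmul_eq_mul,
    Nat.cast_sub (Nat.pow_le_pow_left (by omega) 3)]
  push_cast
  ring

theorem box_zero : box 0 = {0} := by
  ext k
  rw [mem_box]
  simp

theorem nu_zero : nu 0 = 1 := by simp [nu]

theorem sum_box_inv_sq (N : ℕ) : ∑ k ∈ box N, (nu k ^ 2)⁻¹ ≤ 26 * (N + 1) := by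
  induction N with
  | zero => simp [box_zero, nu_zero]
  | succ N ih =>
    rw [sum_box_succ (fun x => (x ^ 2)⁻¹)]
    have h : (24 * (N : ℝ) ^ 2 + 48 * N + 26) * (((N : ℝ) + 2) ^ 2)⁻¹ ≤ 26 := by
      rw [← div_eq_mul_inv, div_le_iff₀ (by positivity)]
      have : (0 : ℝ) ≤ N := Nat.cast_nonneg N
      nlinarith
    push_cast
    linarith

theorem sum_box_inv (N : ℕ) : ∑ k ∈ box N, (nu k ^ 1)⁻¹ ≤ 26 * (N + 1) ^ 2 := by
  induction N with
  | zero => simp [box_zero, nu_zero]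
  | succ N ih =>
    rw [sum_box_succ (fun x => (x ^ 1)⁻¹)]
    have : (0 : ℝ) ≤ N := Nat.cast_nonneg N
    have h : (24 * (N : ℝ) ^ 2 + 48 * N + 26) * (((N : ℝ) + 2) ^ 1)⁻¹ ≤ 26 * (N + 2) := by
      rw [← div_eq_mul_inv, div_le_iff₀ (by positivity)]
      nlinarith
    push_cast
    nlinarith

/-- The subtracted term makes the induction close: each shell contributes at most `26 /
((N+1)(N+2))`, which telescopes. -/
theorem sum_box_inv_four (N : ℕ) : ∑ k ∈ box N, (nu k ^ 4)⁻¹ ≤ 52 - 26 / (N + 1) := by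
  induction N with
  | zero => norm_num [box_zero, nu_zero]
  | succ N ih =>
    rw [sum_box_succ (fun x => (x ^ 4)⁻¹)]
    have : (0 : ℝ) ≤ N := Nat.cast_nonneg N
    have h : (24 * (N : ℝ) ^ 2 + 48 * N + 26) * (((N : ℝ) + 2) ^ 4)⁻¹ ≤
        26 / (N + 1) - 26 / (N + 1 + 1) := by
      rw [← div_eq_mul_inv, div_sub_div _ _ (by positivity) (by positivity),
        div_le_div_iff₀ (by positivity) (by positivity)]
      have e : 26 * ((N : ℝ) + 1 + 1) - (N + 1) * 26 = 26 := by ring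
      rw [e]
      have h1 : 24 * (N : ℝ) ^ 2 + 48 * N + 26 ≤ 26 * (N + 2) ^ 2 := by nlinarith
      have h2 : ((N : ℝ) + 1) * (N + 1 + 1) ≤ (N + 2) ^ 2 := by nlinarith
      calc _ ≤ 26 * ((N : ℝ) + 2) ^ 2 * ((N + 2) ^ 2) := mul_le_mul h1 h2 (by positivity) (by positivity)
        _ = _ := by ring
    push_cast
    linarith

theorem exists_subset_box (s : Finset (Fin 3 → ℤ)) : ∃ N, s ⊆ box N := by
  obtain ⟨N, hN⟩ := exists_nat_ge (∑ k ∈ s, ‖k‖)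
  exact ⟨N, fun k hk => mem_box.2
    ((Finset.single_le_sum (f := fun k => ‖k‖) (fun _ _ => norm_nonneg _) hk).trans hN)⟩

theorem summable_nu_inv_four : Summable fun k : Fin 3 → ℤ => (nu k ^ 4)⁻¹ := by
  refine summable_of_sum_le (c := 52) (fun k => inv_nonneg.2 (pow_nonneg (nu_pos k).le _))
    fun s => ?_
  obtain ⟨N, hN⟩ := exists_subset_box s
  refine (Finset.sum_le_sum_of_subset_of_nonneg hN fun k _ _ =>
    inv_nonneg.2 (pow_nonneg (nu_pos k).le _)).trans ((sum_box_inv_four N).trans ?_)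
  have : (0 : ℝ) ≤ 26 / (N + 1) := by positivity
  linarith

theorem tendsto_box : Tendsto box atTop atTop :=
  tendsto_atTop_finset_of_monotone (fun _ _ h => box_mono h) fun k => by
    obtain ⟨N, hN⟩ := exists_subset_box {k}
    exact ⟨N, hN (Finset.mem_singleton_self k)⟩

/-! ### Trigonometric polynomials -/

/-- The trigonometric polynomial with coefficients `a` on `s`. -/
def trig (s : Finset (Fin 3 → ℤ)) (a : (Fin 3 → ℤ) → ℝ) (x : Torus3) : ℝ := ∑ k ∈ s, a k * hart k x

theorem continuous_trig (s : Finset (Fin 3 → ℤ)) (a : (Fin 3 → ℤ) → ℝ) : Continuous (trig s a) :=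
  continuous_finsetSum _ fun k _ => continuous_const.mul (continuous_hart k)

theorem coef_finset_sum {ι : Type*} (s : Finset ι) (h : ι → Torus3 → ℝ)
    (hh : ∀ i ∈ s, Integrable (h i)) (k : Fin 3 → ℤ) :
    coef (fun x => ∑ i ∈ s, h i x) k = ∑ i ∈ s, coef (h i) k := by
  simp only [coef, Finset.sum_mul]
  exact integral_finsetSum _ fun i hi => integrable_mul_hart (hh i hi) k

theorem coef_trig (s : Finset (Fin 3 → ℤ)) (a : (Fin 3 → ℤ) → ℝ) (k : Fin 3 → ℤ) :
    coef (trig s a) k = if k ∈ s then a k else 0 := by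
  unfold trig
  rw [coef_finset_sum s (fun l x => a l * hart l x)
    fun l _ => (integrable_of_continuous (continuous_hart l)).const_mul _]
  simp only [coef_const_mul, coef_hart, mul_ite, mul_one, mul_zero, Finset.sum_ite_eq']

/-- A trigonometric polynomial as an element of `L²`. -/
def trigL (s : Finset (Fin 3 → ℤ)) (a : (Fin 3 → ℤ) → ℝ) : L2 := toL2 (continuous_trig s a)

theorem coeFn_trigL (s : Finset (Fin 3 → ℤ)) (a : (Fin 3 → ℤ) → ℝ) :
    trigL s a =ᵐ[volume] trig s a := coeFn_toL2 _

theorem coef_trigL (s : Finset (Fin 3 → ℤ)) (a : (Fin 3 → ℤ) → ℝ) (k : Fin 3 → ℤ) :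
    coef (trigL s a) k = if k ∈ s then a k else 0 := by rw [trigL, coef_toL2, coef_trig]

theorem abs_trig_le (s : Finset (Fin 3 → ℤ)) (a : (Fin 3 → ℤ) → ℝ) (x : Torus3) :
    |trig s a x| ≤ ∑ k ∈ s, |a k| :=
  (Finset.abs_sum_le_sum_abs _ _).trans (Finset.sum_le_sum fun k _ => by
    rw [abs_mul]
    exact mul_le_of_le_one_right (abs_nonneg _) (abs_hart_le k x))

/-- Weighted Cauchy–Schwarz: `W²` bounds the sum of inverse weights over the frequencies in use.
This is the Bernstein-type bound for low frequencies. -/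
theorem abs_trig_le_of_hs {n : ℕ} {a : (Fin 3 → ℤ) → ℝ} {R W : ℝ} (hR : 0 ≤ R) (hW : 0 ≤ W)
    (ha : hs n a ≤ ENNReal.ofReal (R ^ 2)) (s : Finset (Fin 3 → ℤ))
    (hw : ∑ k ∈ s, (nu k ^ n)⁻¹ ≤ W ^ 2) (x : Torus3) : |trig s a x| ≤ R * W := by
  refine (abs_trig_le s a x).trans ?_
  have h1 := (hs_le_ofReal_iff (by positivity)).1 ha s
  have h2 := Finset.sum_mul_sq_le_sq_mul_sq s (fun k => Real.sqrt (nu k ^ n) * |a k|)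
    (fun k => (Real.sqrt (nu k ^ n))⁻¹)
  have e1 : ∀ k ∈ s, Real.sqrt (nu k ^ n) * |a k| * (Real.sqrt (nu k ^ n))⁻¹ = |a k| := by
    intro k _
    have : Real.sqrt (nu k ^ n) ≠ 0 := (Real.sqrt_pos.2 (pow_pos (nu_pos k) n)).ne'
    field_simp
  have e2 : ∀ k ∈ s, (Real.sqrt (nu k ^ n) * |a k|) ^ 2 = nu k ^ n * a k ^ 2 := by
    intro k _
    rw [mul_pow, Real.sq_sqrt (pow_pos (nu_pos k) n).le, sq_abs]
  have e3 : ∀ k ∈ s, ((Real.sqrt (nu k ^ n))⁻¹) ^ 2 = (nu k ^ n)⁻¹ := by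
    intro k _
    rw [inv_pow, Real.sq_sqrt (pow_pos (nu_pos k) n).le]
  rw [Finset.sum_congr rfl e1, Finset.sum_congr rfl e2, Finset.sum_congr rfl e3] at h2
  refine abs_le_of_sq_le_sq' ?_ (by positivity) |>.2
  rw [mul_pow]
  exact h2.trans (mul_le_mul h1 hw (Finset.sum_nonneg fun k _ =>
    inv_nonneg.2 (pow_nonneg (nu_pos k).le _)) (by positivity))

/-! ### Sobolev embeddings by frequency truncation -/

/-- Where |u| exceeds `c`, the frequencies outside `s` must contribute more than `c / 2`; Chebyshev
bounds the measure by their L² norm. -/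
theorem measure_abs_gt_le (u : L2) (s : Finset (Fin 3 → ℤ)) {c : ℝ} (hc : 0 < c)
    (hsm : ∀ x, |trig s (coef u) x| ≤ c / 2) :
    volume {x | c < |u x|} ≤
      ENNReal.ofReal (4 / c ^ 2) * ∑' k, if k ∈ s then 0 else ENNReal.ofReal (coef u k ^ 2) := by
  set r : L2 := u - trigL s (coef u) with hr
  have hcr : ∀ k, coef r k = if k ∈ s then 0 else coef u k := fun k => by
    rw [hr, coef_Lp_sub, coef_trigL]
    split_ifs <;> simp
  have h1 : volume {x | c < |u x|} ≤ volume {x | ENNReal.ofReal (c ^ 2 / 4) ≤ ENNReal.ofReal (r x ^ 2)} := by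
    refine measure_mono_ae ?_
    filter_upwards [Lp.coeFn_sub u (trigL s (coef u)), coeFn_trigL s (coef u)] with x hx1 hx2 hx
    have hx' : c < |u x| := hx
    show ENNReal.ofReal (c ^ 2 / 4) ≤ ENNReal.ofReal (r x ^ 2)
    refine ENNReal.ofReal_le_ofReal ?_
    have e : r x = u x - trig s (coef u) x := by rw [hr, hx1, Pi.sub_apply, hx2]
    have h3 : c / 2 ≤ |r x| := by
      have := abs_sub_abs_le_abs_sub (u x) (trig s (coef u) x)
      rw [e]
      linarith [hsm x]
    rw [← sq_abs (r x)]
    nlinarith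
  have h2 := meas_ge_le_lintegral_div (μ := (volume : Measure Torus3))
    (f := fun x => ENNReal.ofReal (r x ^ 2)) (ε := ENNReal.ofReal (c ^ 2 / 4))
    ((Lp.aestronglyMeasurable r).aemeasurable.pow_const 2).ennreal_ofReal
    (by simp; positivity) ENNReal.ofReal_ne_top
  refine h1.trans (h2.trans ?_)
  have e1 : ∫⁻ x, ENNReal.ofReal (r x ^ 2) = hs 0 (coef r) := by
    rw [hs_zero_coef, ← ofReal_integral_eq_lintegral_ofReal]
    · congr 1
      rw [← real_inner_self_eq_norm_sq, L2.inner_def]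
      refine integral_congr_ae (Eventually.of_forall fun x => ?_)
      simp [sq]
    · exact (Lp.memLp r).integrable_sq
    · exact Eventually.of_forall fun x => sq_nonneg _
  rw [e1, ENNReal.div_eq_inv_mul, ← ENNReal.ofReal_inv_of_pos (by positivity), inv_div]
  refine mul_le_mul_right (ENNReal.tsum_le_tsum fun k => ?_) _
  rw [hcr]
  split_ifs <;> simp

/-- Layer-cake proof of Sobolev embeddings. At each height the function is cut at the frequency
where its low part is still at most half the height, so only the L² mass of the high part counts.
After exchanging sum and integral, mode `k` is met only for heights below `2 M w(nu k)`, which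
produces the weight `w(nu k)^(p-2)`. -/
theorem lintegral_pow_le (u : L2) {p : ℕ} (hp : 3 ≤ p) {w : ℝ → ℝ} (hw : Monotone w)
    (hw0 : ∀ x, 0 ≤ w x) (hwt : Tendsto w atTop atTop) {M : ℝ} (hM : 0 < M)
    (h : ∀ N x, |trig (box N) (coef u) x| ≤ M * w (N + 1)) :
    ∫⁻ x, ENNReal.ofReal (|u x| ^ p) ≤ ENNReal.ofReal (p * 4 * (2 * M) ^ (p - 2)) *
      ∑' k, ENNReal.ofReal (w (nu k) ^ (p - 2) * coef u k ^ 2) := by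
  have hdist : ∀ c : ℝ, 0 < c → volume {x | c < |u x|} ≤ ENNReal.ofReal (4 / c ^ 2) *
      ∑' k, if c < 2 * M * w (nu k) then ENNReal.ofReal (coef u k ^ 2) else 0 := by
    intro c hc
    obtain ⟨s, hs1, hs2⟩ : ∃ s : Finset (Fin 3 → ℤ), (∀ x, |trig s (coef u) x| ≤ c / 2) ∧
        ∀ k, k ∉ s → c < 2 * M * w (nu k) := by
      -- The cut-off is the box just below the least such `N`: minimality bounds the low part by `c
      -- / 2`, and every frequency left out has `nu k ≥ N + 1`.
      have hex : ∃ N : ℕ, c < 2 * M * w (N + 1) := by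
        have h1 : Tendsto (fun N : ℕ => 2 * M * w ((N : ℝ) + 1)) atTop atTop :=
          (hwt.comp (tendsto_atTop_add_const_right _ 1 tendsto_natCast_atTop_atTop)).const_mul_atTop
            (by positivity)
        exact (h1.eventually_gt_atTop c).exists
      classical
      set N := Nat.find hex with hN
      have hN1 : c < 2 * M * w (N + 1) := Nat.find_spec hex
      rcases Nat.eq_zero_or_pos N with h0 | hpos
      · refine ⟨∅, fun x => by simp [trig]; positivity, fun k _ => hN1.trans_le ?_⟩
        refine mul_le_mul_of_nonneg_left (hw ?_) (by positivity)
        rw [h0]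
        simpa using one_le_nu k
      · obtain ⟨m, hm⟩ := Nat.exists_eq_succ_of_ne_zero hpos.ne'
        refine ⟨box m, fun x => (h m x).trans ?_, fun k hk => hN1.trans_le ?_⟩
        · have := Nat.find_min hex (show m < N by omega)
          rw [not_lt] at this
          linarith
        · refine mul_le_mul_of_nonneg_left (hw ?_) (by positivity)
          rw [mem_box, not_le] at hk
          obtain ⟨i, hi⟩ := exists_norm_eq k
          have h3 : (m : ℤ) < |k i| := by rw [hi] at hk; exact_mod_cast hk
          have h4 : ((m : ℝ) + 1) ≤ |(k i : ℝ)| := by exact_mod_cast h3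
          rw [nu, hi, hm]
          push_cast
          linarith
    refine (measure_abs_gt_le u s hc hs1).trans
      (mul_le_mul_right (ENNReal.tsum_le_tsum fun k => ?_) _)
    by_cases hk : k ∈ s
    · simp [hk]
    · rw [if_neg hk, if_pos (hs2 k hk)]
  have hp0 : (0 : ℝ) < p := by exact_mod_cast (by omega : 0 < p)
  have hlc := lintegral_rpow_eq_lintegral_meas_lt_mul (volume : Measure Torus3)
    (f := fun x => |u x|) (Eventually.of_forall fun x => abs_nonneg _)
    (Lp.aestronglyMeasurable u).aemeasurable.abs hp0
  simp only [Real.rpow_natCast] at hlc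
  rw [hlc, mul_assoc (p : ℝ), ENNReal.ofReal_mul hp0.le, mul_assoc]
  refine mul_le_mul_right ?_ _
  have hbd : ∀ t ∈ Ioi (0 : ℝ), volume {x | t < |u x|} * ENNReal.ofReal (t ^ ((p : ℝ) - 1)) ≤
      ∑' k, (Ioo 0 (2 * M * w (nu k))).indicator (fun _ =>
        ENNReal.ofReal (4 * (2 * M * w (nu k)) ^ (p - 3) * coef u k ^ 2)) t := by
    intro t ht
    have ht0 : 0 < t := ht
    refine (mul_le_mul_left (hdist t ht) _).trans ?_
    rw [mul_comm (ENNReal.ofReal (4 / t ^ 2)), mul_assoc, ← ENNReal.ofReal_mul (by positivity),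
      ← ENNReal.tsum_mul_right]
    refine ENNReal.tsum_le_tsum fun k => ?_
    by_cases hk : t < 2 * M * w (nu k)
    · rw [if_pos hk, indicator_of_mem (show t ∈ Ioo 0 (2 * M * w (nu k)) from ⟨ht0, hk⟩), ← ENNReal.ofReal_mul (sq_nonneg _)]
      refine ENNReal.ofReal_le_ofReal ?_
      have e : 4 / t ^ 2 * t ^ ((p : ℝ) - 1) = 4 * t ^ (p - 3) := by
        have : (p : ℝ) - 1 = ((p - 3 : ℕ) : ℝ) + 2 := by
          rw [Nat.cast_sub hp]; push_cast; ring
        rw [this, Real.rpow_add ht0, Real.rpow_natCast]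
        norm_cast
        field_simp
      rw [e, mul_comm]
      refine mul_le_mul_of_nonneg_right ?_ (sq_nonneg _)
      exact mul_le_mul_of_nonneg_left (pow_le_pow_left₀ ht0.le hk.le _) (by norm_num)
    · rw [if_neg hk, zero_mul]
      exact zero_le
  refine (setLIntegral_mono' measurableSet_Ioi hbd).trans ?_
  rw [lintegral_tsum fun k => (measurable_const.indicator measurableSet_Ioo).aemeasurable,
    ← ENNReal.tsum_mul_left]
  refine ENNReal.tsum_le_tsum fun k => ?_
  refine (lintegral_mono' Measure.restrict_le_self le_rfl).trans ?_
  have hk0 : 0 ≤ 2 * M * w (nu k) := mul_nonneg (by positivity) (hw0 _)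
  rw [lintegral_indicator measurableSet_Ioo, setLIntegral_const, Real.volume_Ioo, sub_zero,
    ← ENNReal.ofReal_mul (mul_nonneg (mul_nonneg (by norm_num) (pow_nonneg hk0 _)) (sq_nonneg _)),
    ← ENNReal.ofReal_mul (by positivity)]
  refine ENNReal.ofReal_le_ofReal (le_of_eq ?_)
  have e : p - 2 = p - 3 + 1 := by omega
  rw [e, mul_pow, mul_pow, pow_succ, pow_succ (w _), pow_succ (2 * M)]
  ring

theorem eq_zero_of_hs_le_zero {n : ℕ} {u : L2} (h : hs n (coef u) ≤ ENNReal.ofReal 0) : u = 0 := by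
  refine ext_coef fun k => ?_
  have h1 := (hs_le_ofReal_iff le_rfl).1 h {k}
  rw [Finset.sum_singleton] at h1
  rw [coef_Lp_zero]
  by_contra hne
  have : 0 < nu k ^ n * coef u k ^ 2 := mul_pos (pow_pos (nu_pos k) n) (by positivity)
  linarith

/-- A common constant for the Sobolev embeddings below. -/
def sobC : ℝ := 10 ^ 8

theorem lintegral_abs_pow_eq_zero {u : L2} (hu : u = 0) {p : ℕ} (hp : p ≠ 0) :
    ∫⁻ x, ENNReal.ofReal (|u x| ^ p) = 0 := by
  subst hu
  rw [lintegral_congr_ae (g := fun _ => 0)]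
  · simp
  · filter_upwards [Lp.coeFn_zero ℝ 2 (volume : Measure Torus3)] with x hx
    rw [hx]; simp [hp]

theorem abs_trig_box_le_of_hs_two {u : L2} {R : ℝ} (hR : 0 ≤ R)
    (hu : hs 2 (coef u) ≤ ENNReal.ofReal (R ^ 2)) (N : ℕ) (x : Torus3) :
    |trig (box N) (coef u) x| ≤ 6 * R * Real.sqrt (N + 1) := by
  have := abs_trig_le_of_hs (W := 6 * Real.sqrt (N + 1)) hR (by positivity) hu (box N) (by
    rw [mul_pow, Real.sq_sqrt (by positivity)]
    refine (sum_box_inv_sq N).trans ?_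
    have : (0 : ℝ) ≤ N := Nat.cast_nonneg N
    linarith) x
  linarith

/-- With `w` the square root and `p = 6` the weight is exactly `nu²`: the critical embedding H¹ ⊂
L⁶. -/
theorem lintegral_pow_six_le {u : L2} {R : ℝ} (hR : 0 ≤ R)
    (hu : hs 2 (coef u) ≤ ENNReal.ofReal (R ^ 2)) :
    ∫⁻ x, ENNReal.ofReal (|u x| ^ 6) ≤ ENNReal.ofReal (sobC * R ^ 6) := by
  rcases hR.eq_or_lt with rfl | hR
  · rw [lintegral_abs_pow_eq_zero (eq_zero_of_hs_le_zero (by simpa using hu)) (by norm_num)]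
    exact zero_le
  have h := lintegral_pow_le u (p := 6) (by norm_num) Real.sqrt_monotone Real.sqrt_nonneg
    Real.tendsto_sqrt_atTop (by positivity : 0 < 6 * R) (abs_trig_box_le_of_hs_two hR.le hu)
  have e : ∀ k, Real.sqrt (nu k) ^ (6 - 2) = nu k ^ 2 := fun k => by
    rw [show 6 - 2 = 2 * 2 by norm_num, pow_mul, Real.sq_sqrt (nu_pos k).le]
  simp_rw [e] at h
  refine h.trans ((mul_le_mul_right hu _).trans ?_)
  rw [← ENNReal.ofReal_mul (by positivity)]
  refine ENNReal.ofReal_le_ofReal ?_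
  have := pow_pos hR 6
  norm_num [sobC]
  nlinarith

/-- The cut-off still uses only the H¹ norm, while `p = 8` turns the weight into `nu³`. Thus the
H^{3/2} norm enters only squared, hence integrably in time. -/
theorem lintegral_pow_eight_le {u : L2} {R : ℝ} (hR : 0 ≤ R)
    (hu : hs 2 (coef u) ≤ ENNReal.ofReal (R ^ 2)) :
    ∫⁻ x, ENNReal.ofReal (|u x| ^ 8) ≤ ENNReal.ofReal (sobC * R ^ 6) * hs 3 (coef u) := by
  rcases hR.eq_or_lt with rfl | hR
  · rw [lintegral_abs_pow_eq_zero (eq_zero_of_hs_le_zero (by simpa using hu)) (by norm_num)]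
    exact zero_le
  have h := lintegral_pow_le u (p := 8) (by norm_num) Real.sqrt_monotone Real.sqrt_nonneg
    Real.tendsto_sqrt_atTop (by positivity : 0 < 6 * R) (abs_trig_box_le_of_hs_two hR.le hu)
  have e : ∀ k, Real.sqrt (nu k) ^ (8 - 2) = nu k ^ 3 := fun k => by
    rw [show 8 - 2 = 2 * 3 by norm_num, pow_mul, Real.sq_sqrt (nu_pos k).le]
  simp_rw [e] at h
  -- Here the constant is `8 * 4 * 12 ^ 6 = 95551488`, the largest of the three embeddings, and it
  -- dictates the value of `sobC`.
  refine h.trans (mul_le_mul_left (ENNReal.ofReal_le_ofReal ?_) _)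
  have := pow_pos hR 6
  norm_num [sobC]
  nlinarith

/-- The embedding H^{1/2} ⊂ L³: `w` is linear, and the maximum with 0 only makes it nonnegative on
all of ℝ. -/
theorem lintegral_pow_three_le {u : L2} {B : ℝ} (hB : 0 ≤ B)
    (hu : hs 1 (coef u) ≤ ENNReal.ofReal (B ^ 2)) :
    ∫⁻ x, ENNReal.ofReal (|u x| ^ 3) ≤ ENNReal.ofReal (sobC * B ^ 3) := by
  rcases hB.eq_or_lt with rfl | hB
  · rw [lintegral_abs_pow_eq_zero (eq_zero_of_hs_le_zero (by simpa using hu)) (by norm_num)]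
    exact zero_le
  have h := lintegral_pow_le u (p := 3) (by norm_num) (w := fun x => max x 0)
    (monotone_id.max monotone_const) (fun x => le_max_right _ _)
    (tendsto_atTop_mono (fun x => le_max_left x 0) tendsto_id)
    (by positivity : 0 < 6 * B) (fun N x => by
      have := abs_trig_le_of_hs (W := 6 * ((N : ℝ) + 1)) hB.le (by positivity) hu (box N) (by
        rw [mul_pow]
        refine (sum_box_inv N).trans ?_
        have : (0 : ℝ) ≤ ((N : ℝ) + 1) ^ 2 := by positivity
        linarith) x
      rw [max_eq_left (by positivity)]
      linarith)
  have e : ∀ k, max (nu k) 0 ^ (3 - 2) = nu k ^ 1 := fun k => by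
    rw [max_eq_left (nu_pos k).le]
  simp_rw [e] at h
  refine h.trans ((mul_le_mul_right hu _).trans ?_)
  rw [← ENNReal.ofReal_mul (by positivity)]
  refine ENNReal.ofReal_le_ofReal ?_
  have := pow_pos hB 3
  norm_num [sobC]
  nlinarith

/-! ### Multilinear estimates -/

theorem lintegral_mul_rpow_le {α : Type*} [MeasurableSpace α] {μ : Measure α} {F G H : α → ℝ}
    (hF : AEMeasurable F μ) (hG : AEMeasurable G μ) (hH : AEMeasurable H μ)
    (hF0 : ∀ x, 0 ≤ F x) (hG0 : ∀ x, 0 ≤ G x) (hH0 : ∀ x, 0 ≤ H x)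
    {p q r : ℝ} (hp : 0 ≤ p) (hq : 0 ≤ q) (hr : 0 ≤ r) (hpqr : p + q + r = 1) {a b c : ℝ}
    (ha : 0 ≤ a) (hb : 0 ≤ b) (hc : 0 ≤ c)
    (h1 : ∫⁻ x, ENNReal.ofReal (F x) ∂μ ≤ ENNReal.ofReal a)
    (h2 : ∫⁻ x, ENNReal.ofReal (G x) ∂μ ≤ ENNReal.ofReal b)
    (h3 : ∫⁻ x, ENNReal.ofReal (H x) ∂μ ≤ ENNReal.ofReal c) :
    ∫⁻ x, ENNReal.ofReal (F x ^ p * G x ^ q * H x ^ r) ∂μ ≤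
      ENNReal.ofReal (a ^ p * b ^ q * c ^ r) := by
  have key := ENNReal.lintegral_prod_norm_pow_le (μ := μ) (Finset.univ : Finset (Fin 3))
    (f := ![fun x => ENNReal.ofReal (F x), fun x => ENNReal.ofReal (G x),
      fun x => ENNReal.ofReal (H x)]) (p := ![p, q, r]) (by
        intro i _
        fin_cases i
        · exact hF.ennreal_ofReal
        · exact hG.ennreal_ofReal
        · exact hH.ennreal_ofReal) (by simpa [Fin.sum_univ_three] using hpqr) (by
        intro i _
        fin_cases i
        · exact hp
        · exact hq
        · exact hr)
  simp only [Fin.prod_univ_three, Matrix.cons_val_zero, Matrix.cons_val_one, Matrix.cons_val] at key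
  calc _ = ∫⁻ x, ENNReal.ofReal (F x) ^ p * ENNReal.ofReal (G x) ^ q * ENNReal.ofReal (H x) ^ r ∂μ := by
        refine lintegral_congr fun x => ?_
        rw [ENNReal.ofReal_rpow_of_nonneg (hF0 x) hp, ENNReal.ofReal_rpow_of_nonneg (hG0 x) hq,
          ENNReal.ofReal_rpow_of_nonneg (hH0 x) hr,
          ← ENNReal.ofReal_mul (Real.rpow_nonneg (hF0 x) _),
          ← ENNReal.ofReal_mul (mul_nonneg (Real.rpow_nonneg (hF0 x) _)
            (Real.rpow_nonneg (hG0 x) _))]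
    _ ≤ _ := key
    _ ≤ ENNReal.ofReal a ^ p * ENNReal.ofReal b ^ q * ENNReal.ofReal c ^ r := by gcongr
    _ = _ := by
        rw [ENNReal.ofReal_rpow_of_nonneg ha hp, ENNReal.ofReal_rpow_of_nonneg hb hq,
          ENNReal.ofReal_rpow_of_nonneg hc hr, ← ENNReal.ofReal_mul (Real.rpow_nonneg ha _),
          ← ENNReal.ofReal_mul (mul_nonneg (Real.rpow_nonneg ha _) (Real.rpow_nonneg hb _))]

theorem pow_rpow_div {x : ℝ} (hx : 0 ≤ x) (n m : ℕ) (r : ℝ) (h : n * r = m) :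
    (x ^ n) ^ r = x ^ m := by
  rw [← Real.rpow_natCast, ← Real.rpow_mul hx, h, Real.rpow_natCast]

theorem aemeasurable_abs_pow (u : L2) (n : ℕ) : AEMeasurable (fun x => |u x| ^ n) :=
  (Lp.aestronglyMeasurable u).aemeasurable.abs.pow_const n

theorem sobC_pos : 0 < sobC := by norm_num [sobC]

/-- Hölder with |u|⁴ in L², `a` in L⁶ and `b` in L³. Square integrability of |u|⁴ is the place where
H^{3/2} regularity is spent, linearly in `Q`. -/
theorem lintegral_four_one_one_le {u a b : L2} {R Q A B : ℝ} (hR : 0 ≤ R) (hQ : 0 ≤ Q) (hA : 0 ≤ A)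
    (hB : 0 ≤ B) (hu : hs 2 (coef u) ≤ ENNReal.ofReal (R ^ 2))
    (hu3 : hs 3 (coef u) ≤ ENNReal.ofReal (Q ^ 2)) (ha : hs 2 (coef a) ≤ ENNReal.ofReal (A ^ 2))
    (hb : hs 1 (coef b) ≤ ENNReal.ofReal (B ^ 2)) :
    ∫⁻ x, ENNReal.ofReal (|u x| ^ 4 * |a x| * |b x|) ≤ ENNReal.ofReal (sobC * (R ^ 3 * Q * A * B)) := by
  have h8 : ∫⁻ x, ENNReal.ofReal (|u x| ^ 8) ≤ ENNReal.ofReal (sobC * (R ^ 3 * Q) ^ 2) := by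
    refine (lintegral_pow_eight_le hR hu).trans ((mul_le_mul_right hu3 _).trans ?_)
    rw [← ENNReal.ofReal_mul (mul_nonneg sobC_pos.le (by positivity))]
    exact ENNReal.ofReal_le_ofReal (le_of_eq (by ring))
  have key := lintegral_mul_rpow_le (μ := (volume : Measure Torus3)) (aemeasurable_abs_pow u 8)
    (aemeasurable_abs_pow a 6) (aemeasurable_abs_pow b 3) (fun x => by positivity)
    (fun x => by positivity) (fun x => by positivity) (p := 1 / 2) (q := 1 / 6) (r := 1 / 3)
    (by norm_num) (by norm_num) (by norm_num) (by norm_num)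
    (mul_nonneg sobC_pos.le (by positivity)) (mul_nonneg sobC_pos.le (by positivity))
    (mul_nonneg sobC_pos.le (by positivity)) h8 (lintegral_pow_six_le hA ha)
    (lintegral_pow_three_le hB hb)
  refine (le_of_eq (lintegral_congr fun x => ?_)).trans (key.trans (le_of_eq (congrArg _ ?_)))
  · rw [pow_rpow_div (abs_nonneg _) 8 4 _ (by norm_num),
      pow_rpow_div (abs_nonneg _) 6 1 _ (by norm_num),
      pow_rpow_div (abs_nonneg _) 3 1 _ (by norm_num), pow_one, pow_one]
  · rw [Real.mul_rpow sobC_pos.le (by positivity), Real.mul_rpow sobC_pos.le (by positivity),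
      Real.mul_rpow sobC_pos.le (by positivity), pow_rpow_div (by positivity) 2 1 _ (by norm_num),
      pow_rpow_div (by positivity) 6 1 _ (by norm_num),
      pow_rpow_div (by positivity) 3 1 _ (by norm_num)]
    have : sobC = sobC ^ (1 / 2 : ℝ) * sobC ^ (1 / 6 : ℝ) * sobC ^ (1 / 3 : ℝ) := by
      rw [← Real.rpow_add sobC_pos, ← Real.rpow_add sobC_pos]; norm_num
    conv_rhs => rw [this]
    ring

/-- Hölder with exponents 2/3 and 1/3; the third factor of the general inequality is a dummy with
exponent 0. -/
theorem lintegral_four_one_le {u b : L2} {R B : ℝ} (hR : 0 ≤ R)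
    (hB : 0 ≤ B) (hu : hs 2 (coef u) ≤ ENNReal.ofReal (R ^ 2))
    (hb : hs 1 (coef b) ≤ ENNReal.ofReal (B ^ 2)) :
    ∫⁻ x, ENNReal.ofReal (|u x| ^ 4 * |b x|) ≤ ENNReal.ofReal (sobC * (R ^ 4 * B)) := by
  have key := lintegral_mul_rpow_le (μ := (volume : Measure Torus3)) (aemeasurable_abs_pow u 6)
    (aemeasurable_abs_pow b 3) (aemeasurable_abs_pow b 3) (fun x => by positivity)
    (fun x => by positivity) (fun x => by positivity) (p := 2 / 3) (q := 1 / 3) (r := 0)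
    (by norm_num) (by norm_num) (by norm_num) (by norm_num)
    (mul_nonneg sobC_pos.le (by positivity)) (mul_nonneg sobC_pos.le (by positivity))
    (mul_nonneg sobC_pos.le (by positivity)) (lintegral_pow_six_le hR hu)
    (lintegral_pow_three_le hB hb) (lintegral_pow_three_le hB hb)
  refine (le_of_eq (lintegral_congr fun x => ?_)).trans (key.trans (le_of_eq (congrArg _ ?_)))
  · rw [pow_rpow_div (abs_nonneg _) 6 4 _ (by norm_num),
      pow_rpow_div (abs_nonneg _) 3 1 _ (by norm_num), Real.rpow_zero, pow_one, mul_one]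
  · rw [Real.mul_rpow sobC_pos.le (by positivity), Real.mul_rpow sobC_pos.le (by positivity),
      Real.rpow_zero, pow_rpow_div (by positivity) 6 4 _ (by norm_num),
      pow_rpow_div (by positivity) 3 1 _ (by norm_num)]
    have : sobC = sobC ^ (2 / 3 : ℝ) * sobC ^ (1 / 3 : ℝ) := by
      rw [← Real.rpow_add sobC_pos]; norm_num
    conv_rhs => rw [this]
    ring

theorem lintegral_five_one_le {u a : L2} {R A : ℝ} (hR : 0 ≤ R)
    (hA : 0 ≤ A) (hu : hs 2 (coef u) ≤ ENNReal.ofReal (R ^ 2))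
    (ha : hs 2 (coef a) ≤ ENNReal.ofReal (A ^ 2)) :
    ∫⁻ x, ENNReal.ofReal (|u x| ^ 5 * |a x|) ≤ ENNReal.ofReal (sobC * (R ^ 5 * A)) := by
  have key := lintegral_mul_rpow_le (μ := (volume : Measure Torus3)) (aemeasurable_abs_pow u 6)
    (aemeasurable_abs_pow a 6) (aemeasurable_abs_pow a 6) (fun x => by positivity)
    (fun x => by positivity) (fun x => by positivity) (p := 5 / 6) (q := 1 / 6) (r := 0)
    (by norm_num) (by norm_num) (by norm_num) (by norm_num)
    (mul_nonneg sobC_pos.le (by positivity)) (mul_nonneg sobC_pos.le (by positivity))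
    (mul_nonneg sobC_pos.le (by positivity)) (lintegral_pow_six_le hR hu)
    (lintegral_pow_six_le hA ha) (lintegral_pow_six_le hA ha)
  refine (le_of_eq (lintegral_congr fun x => ?_)).trans (key.trans (le_of_eq (congrArg _ ?_)))
  · rw [pow_rpow_div (abs_nonneg _) 6 5 _ (by norm_num),
      pow_rpow_div (abs_nonneg _) 6 1 _ (by norm_num), Real.rpow_zero, pow_one, mul_one]
  · rw [Real.mul_rpow sobC_pos.le (by positivity), Real.mul_rpow sobC_pos.le (by positivity),
      Real.rpow_zero, pow_rpow_div (by positivity) 6 5 _ (by norm_num),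
      pow_rpow_div (by positivity) 6 1 _ (by norm_num)]
    have : sobC = sobC ^ (5 / 6 : ℝ) * sobC ^ (1 / 6 : ℝ) := by
      rw [← Real.rpow_add sobC_pos]; norm_num
    conv_rhs => rw [this]
    ring

theorem integral_le_of_lintegral_le {h : Torus3 → ℝ} {c : ℝ} (hm : AEStronglyMeasurable h)
    (h0 : ∀ x, 0 ≤ h x) (hc : 0 ≤ c) (hl : ∫⁻ x, ENNReal.ofReal (h x) ≤ ENNReal.ofReal c) :
    Integrable h ∧ ∫ x, h x ≤ c := by
  have hi : Integrable h := ⟨hm, by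
    rw [hasFiniteIntegral_iff_ofReal (Eventually.of_forall h0)]
    exact hl.trans_lt ENNReal.ofReal_lt_top⟩
  refine ⟨hi, ?_⟩
  rw [← ofReal_integral_eq_lintegral_ofReal hi (Eventually.of_forall h0)] at hl
  exact (ENNReal.ofReal_le_ofReal_iff hc).1 hl

/-! ### Nonlinearities of quintic growth -/

/-- Continuous functions of at most quintic growth, with the corresponding local Lipschitz bound. -/
structure Growth (f : ℝ → ℝ) (C : ℝ) : Prop where
  pos : 0 < C
  cont : Continuous f
  bound : ∀ u, |f u| ≤ C * (1 + |u| ^ 5)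
  lip : ∀ u v, |f u - f v| ≤ C * (1 + |u| ^ 4 + |v| ^ 4) * |u - v|

theorem abs_le_max_abs_of_mem_uIcc {a b x : ℝ} (hx : x ∈ uIcc a b) : |x| ≤ max |a| |b| := by
  rcases le_total a b with h | h
  · rw [uIcc_of_le h] at hx
    exact abs_le_max_abs_abs hx.1 hx.2
  · rw [uIcc_of_ge h] at hx
    rw [max_comm]
    exact abs_le_max_abs_abs hx.1 hx.2

theorem pow_le_add_of_mem_uIcc {a b x : ℝ} (hx : x ∈ uIcc a b) (n : ℕ) :
    |x| ^ n ≤ |a| ^ n + |b| ^ n := by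
  have h1 := pow_le_pow_left₀ (abs_nonneg x) (abs_le_max_abs_of_mem_uIcc hx) n
  have ha := pow_nonneg (abs_nonneg a) n
  have hb := pow_nonneg (abs_nonneg b) n
  rcases le_total |a| |b| with h | h
  · rw [max_eq_right h] at h1; linarith
  · rw [max_eq_left h] at h1; linarith

theorem IsAdmissible.exists_growth {f : ℝ → ℝ} (hf : IsAdmissible f) : ∃ C, Growth f C := by
  obtain ⟨C, κ, K, hC, hκ, hK, h1, h2, h3⟩ := hf.bounds
  have hd : Differentiable ℝ f := hf.contDiff.differentiable (by norm_num)
  have hlip : ∀ u v, |f u - f v| ≤ C * (1 + |u| ^ 4 + |v| ^ 4) * |u - v| := by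
    intro u v
    have := (convex_uIcc v u).norm_image_sub_le_of_norm_deriv_le (f := f)
      (C := C * (1 + |u| ^ 4 + |v| ^ 4)) (x := v) (y := u)
      (fun x _ => hd x) (fun x hx => by
        rw [Real.norm_eq_abs]
        refine (h3 x).trans (mul_le_mul_of_nonneg_left ?_ hC.le)
        have := pow_le_add_of_mem_uIcc hx 4
        linarith) left_mem_uIcc right_mem_uIcc
    simpa [Real.norm_eq_abs] using this
  refine ⟨C * 2 + |f 0|, by positivity, hf.contDiff.continuous, fun u => ?_, fun u v => ?_⟩
  · have h := hlip u 0
    have h4 := abs_sub_abs_le_abs_sub (f u) (f 0)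
    simp only [abs_zero, sub_zero] at h
    have h5 : |u| ≤ 1 + |u| ^ 5 := by
      rcases le_total |u| 1 with h | h
      · have : 0 ≤ |u| ^ 5 := by positivity
        linarith
      · have := le_self_pow₀ h (by norm_num : 5 ≠ 0)
        linarith
    have e : C * (1 + |u| ^ 4 + 0 ^ 4) * |u| = C * (|u| + |u| ^ 5) := by ring
    have h6 : 0 ≤ |f 0| * |u| ^ 5 := by positivity
    have h7 := mul_le_mul_of_nonneg_left h5 hC.le
    have h8 : 0 ≤ |u| ^ 5 := by positivity
    nlinarith
  · refine (hlip u v).trans (mul_le_mul_of_nonneg_right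
      (mul_le_mul_of_nonneg_right ?_ (by positivity)) (abs_nonneg _))
    have := abs_nonneg (f 0)
    linarith

theorem IsAdmissible.exists_monotone {f : ℝ → ℝ} (hf : IsAdmissible f) :
    ∃ K, 0 < K ∧ ∀ u v, -K * (u - v) ^ 2 ≤ (f u - f v) * (u - v) := by
  obtain ⟨C, κ, K, hC, hκ, hK, h1, h2, h3⟩ := hf.bounds
  have hd : Differentiable ℝ f := hf.contDiff.differentiable (by norm_num)
  refine ⟨K, hK, fun u v => ?_⟩
  have hm : Monotone (fun x => f x + K * x) := by
    refine monotone_of_deriv_nonneg (hd.add (differentiable_id.const_mul K)) fun x => ?_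
    have : HasDerivAt (fun x => f x + K * x) (deriv f x + K * 1) x :=
      (hd x).hasDerivAt.add ((hasDerivAt_id x).const_mul K)
    rw [this.deriv]
    linarith [h2 x]
  rcases le_total u v with h | h
  · have := hm h
    simp only at this
    nlinarith
  · have := hm h
    simp only at this
    nlinarith

/-- The linear lower bound which encodes dissipativity of the nonlinearity. -/
theorem IsAdmissible.exists_coercive {f : ℝ → ℝ} (hf : IsAdmissible f) :
    ∃ κ D, 0 < κ ∧ 0 ≤ D ∧ (∀ u, 0 ≤ u → κ * u - D ≤ f u) ∧ ∀ u, u ≤ 0 → f u ≤ κ * u + D := by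
  obtain ⟨C, κ, K, hC, hκ, hK, h1, h2, h3⟩ := hf.bounds
  -- For |u| ≥ 1 the bound comes from dividing `f(u) u ≥ κ u² - C` by `u`; near 0, where this is
  -- useless, compactness supplies `B`.
  obtain ⟨B, hB⟩ := (isCompact_Icc (a := (-1 : ℝ)) (b := 1)).exists_bound_of_continuousOn
    hf.contDiff.continuous.continuousOn
  have hB0 : 0 ≤ B := (norm_nonneg _).trans (hB 0 (by norm_num))
  refine ⟨κ, C + κ + B, hκ, by positivity, fun u hu => ?_, fun u hu => ?_⟩
  · rcases le_total u 1 with h | h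
    · have := (abs_le.1 (hB u ⟨by linarith, h⟩)).1
      nlinarith
    · have := h1 u
      rw [sq_abs] at this
      have h5 : (κ * u - C) * u ≤ f u * u := by nlinarith
      have := le_of_mul_le_mul_right h5 (by linarith)
      linarith
  · rcases le_total (-1) u with h | h
    · have := (abs_le.1 (hB u ⟨h, by linarith⟩)).2
      nlinarith
    · have := h1 u
      rw [sq_abs] at this
      have h5 : (κ * u + C) * u ≤ f u * u := by nlinarith
      have h6 : f u * (-u) ≤ (κ * u + C) * (-u) := by linarith
      have := le_of_mul_le_mul_right h6 (by linarith)
      linarith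

/-! ### Integral bounds for weights of quartic and quintic growth -/

theorem lintegral_sq (u : L2) : ∫⁻ x, ENNReal.ofReal (|u x| ^ 2) = hs 0 (coef u) := by
  rw [hs_zero_coef, ← ofReal_integral_eq_lintegral_ofReal]
  · congr 1
    rw [← real_inner_self_eq_norm_sq, L2.inner_def]
    refine integral_congr_ae (Eventually.of_forall fun x => ?_)
    simp [sq]
  · simpa only [sq_abs] using (Lp.memLp u).integrable_sq
  · exact Eventually.of_forall fun x => sq_nonneg _

theorem lintegral_one_one_le {a b : L2} {A B : ℝ} (hA : 0 ≤ A) (hB : 0 ≤ B)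
    (ha : hs 0 (coef a) ≤ ENNReal.ofReal (A ^ 2)) (hb : hs 0 (coef b) ≤ ENNReal.ofReal (B ^ 2)) :
    ∫⁻ x, ENNReal.ofReal (|a x| * |b x|) ≤ ENNReal.ofReal (A * B) := by
  have key := lintegral_mul_rpow_le (μ := (volume : Measure Torus3)) (aemeasurable_abs_pow a 2)
    (aemeasurable_abs_pow b 2) (aemeasurable_abs_pow b 2) (fun x => by positivity)
    (fun x => by positivity) (fun x => by positivity) (p := 1 / 2) (q := 1 / 2) (r := 0)
    (by norm_num) (by norm_num) (by norm_num) (by norm_num)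
    (by positivity) (by positivity) (by positivity) ((lintegral_sq a).trans_le ha)
    ((lintegral_sq b).trans_le hb) ((lintegral_sq b).trans_le hb)
  refine (le_of_eq (lintegral_congr fun x => ?_)).trans (key.trans (le_of_eq (congrArg _ ?_)))
  · rw [pow_rpow_div (abs_nonneg _) 2 1 _ (by norm_num),
      pow_rpow_div (abs_nonneg _) 2 1 _ (by norm_num), Real.rpow_zero, pow_one, pow_one, mul_one]
  · rw [pow_rpow_div hA 2 1 _ (by norm_num), pow_rpow_div hB 2 1 _ (by norm_num), Real.rpow_zero]
    ring

theorem volume_torus_le : (2 * π) ^ 3 ≤ sobC := by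
  have := Real.pi_lt_four
  calc (2 * π) ^ 3 ≤ 8 ^ 3 := by
        have := Real.pi_pos
        gcongr; linarith
    _ ≤ sobC := by norm_num [sobC]

theorem lintegral_one_torus : ∫⁻ _x : Torus3, ENNReal.ofReal 1 = ENNReal.ofReal ((2 * π) ^ 3) := by
  rw [ENNReal.ofReal_one, lintegral_one, ← volume_real_torus, ofReal_measureReal]

theorem lintegral_one_le {b : L2} {B : ℝ} (hB : 0 ≤ B) (hb : hs 0 (coef b) ≤ ENNReal.ofReal (B ^ 2)) :
    ∫⁻ x, ENNReal.ofReal |b x| ≤ ENNReal.ofReal (sobC * B) := by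
  have key := lintegral_mul_rpow_le (μ := (volume : Measure Torus3)) (F := fun _ => 1)
    aemeasurable_const
    (aemeasurable_abs_pow b 2) (aemeasurable_abs_pow b 2) (fun x => zero_le_one)
    (fun x => by positivity) (fun x => by positivity) (p := 1 / 2) (q := 1 / 2) (r := 0)
    (by norm_num) (by norm_num) (by norm_num) (by norm_num)
    (by positivity) (by positivity) (by positivity) lintegral_one_torus.le
    ((lintegral_sq b).trans_le hb) ((lintegral_sq b).trans_le hb)
  refine (le_of_eq (lintegral_congr fun x => ?_)).trans (key.trans (ENNReal.ofReal_le_ofReal ?_))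
  · rw [pow_rpow_div (abs_nonneg _) 2 1 _ (by norm_num), Real.rpow_zero, pow_one, mul_one,
      Real.one_rpow, one_mul]
  · rw [pow_rpow_div hB 2 1 _ (by norm_num), Real.rpow_zero, mul_one, pow_one]
    refine mul_le_mul_of_nonneg_right ?_ hB
    refine (Real.rpow_le_self_of_one_le ?_ (by norm_num)).trans volume_torus_le
    have := Real.pi_gt_three
    exact one_le_pow₀ (by linarith)

theorem aesm_abs_pow (u : L2) (n : ℕ) : AEStronglyMeasurable (fun x => |u x| ^ n) :=
  (aemeasurable_abs_pow u n).aestronglyMeasurable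

theorem aesm_abs (u : L2) : AEStronglyMeasurable (fun x => |u x|) := by
  simpa using aesm_abs_pow u 1

theorem growth_five {u v a : L2} {R A : ℝ} (hR : 0 ≤ R) (hA : 0 ≤ A)
    (hu : hs 2 (coef u) ≤ ENNReal.ofReal (R ^ 2)) (hv : hs 2 (coef v) ≤ ENNReal.ofReal (R ^ 2))
    (ha : hs 2 (coef a) ≤ ENNReal.ofReal (A ^ 2)) :
    Integrable (fun x => (1 + |u x| ^ 5 + |v x| ^ 5) * |a x|) ∧
      ∫ x, (1 + |u x| ^ 5 + |v x| ^ 5) * |a x| ≤ sobC * (1 + 2 * R ^ 5) * A := by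
  have s0 := sobC_pos
  have h1 := integral_le_of_lintegral_le (aesm_abs a) (fun x => abs_nonneg _) (by positivity)
    (lintegral_one_le hA ((hs_mono (by norm_num) _).trans ha))
  have h2 := integral_le_of_lintegral_le (h := fun x => |u x| ^ 5 * |a x|)
    ((aesm_abs_pow u 5).mul (aesm_abs a))
    (fun x => by positivity) (by positivity) (lintegral_five_one_le hR hA hu ha)
  have h3 := integral_le_of_lintegral_le (h := fun x => |v x| ^ 5 * |a x|)
    ((aesm_abs_pow v 5).mul (aesm_abs a))
    (fun x => by positivity) (by positivity) (lintegral_five_one_le hR hA hv ha)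
  have e : (fun x => (1 + |u x| ^ 5 + |v x| ^ 5) * |a x|) =
      (fun x => |a x|) + (fun x => |u x| ^ 5 * |a x|) + (fun x => |v x| ^ 5 * |a x|) := by
    ext x
    simp only [Pi.add_apply]
    ring
  rw [e]
  refine ⟨(h1.1.add h2.1).add h3.1, ?_⟩
  rw [integral_add' (h1.1.add h2.1) h3.1, integral_add' h1.1 h2.1]
  linarith [h1.2, h2.2, h3.2]

/-- Only the H^{1/2} norm of `b` enters. With `b = u - v` this gives continuity of the nonlinearity
in a topology for which bounded sets of H¹ are relatively compact. -/
theorem growth_four {u v b : L2} {R B : ℝ} (hR : 0 ≤ R) (hB : 0 ≤ B)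
    (hu : hs 2 (coef u) ≤ ENNReal.ofReal (R ^ 2)) (hv : hs 2 (coef v) ≤ ENNReal.ofReal (R ^ 2))
    (hb : hs 1 (coef b) ≤ ENNReal.ofReal (B ^ 2)) :
    Integrable (fun x => (1 + |u x| ^ 4 + |v x| ^ 4) * |b x|) ∧
      ∫ x, (1 + |u x| ^ 4 + |v x| ^ 4) * |b x| ≤ sobC * (1 + 2 * R ^ 4) * B := by
  have s0 := sobC_pos
  have h1 := integral_le_of_lintegral_le (aesm_abs b) (fun x => abs_nonneg _) (by positivity)
    (lintegral_one_le hB ((hs_mono (by norm_num) _).trans hb))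
  have h2 := integral_le_of_lintegral_le (h := fun x => |u x| ^ 4 * |b x|)
    ((aesm_abs_pow u 4).mul (aesm_abs b))
    (fun x => by positivity) (by positivity) (lintegral_four_one_le hR hB hu hb)
  have h3 := integral_le_of_lintegral_le (h := fun x => |v x| ^ 4 * |b x|)
    ((aesm_abs_pow v 4).mul (aesm_abs b))
    (fun x => by positivity) (by positivity) (lintegral_four_one_le hR hB hv hb)
  have e : (fun x => (1 + |u x| ^ 4 + |v x| ^ 4) * |b x|) =
      (fun x => |b x|) + (fun x => |u x| ^ 4 * |b x|) + (fun x => |v x| ^ 4 * |b x|) := by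
    ext x
    simp only [Pi.add_apply]
    ring
  rw [e]
  refine ⟨(h1.1.add h2.1).add h3.1, ?_⟩
  rw [integral_add' (h1.1.add h2.1) h3.1, integral_add' h1.1 h2.1]
  linarith [h1.2, h2.2, h3.2]

theorem growth_four_mul {u v a b : L2} {R Q A B : ℝ} (hR : 0 ≤ R) (hQ : 0 ≤ Q) (hA : 0 ≤ A)
    (hB : 0 ≤ B)
    (hu : hs 2 (coef u) ≤ ENNReal.ofReal (R ^ 2)) (hv : hs 2 (coef v) ≤ ENNReal.ofReal (R ^ 2))
    (hu3 : hs 3 (coef u) ≤ ENNReal.ofReal (Q ^ 2)) (hv3 : hs 3 (coef v) ≤ ENNReal.ofReal (Q ^ 2))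
    (ha : hs 2 (coef a) ≤ ENNReal.ofReal (A ^ 2)) (hb : hs 1 (coef b) ≤ ENNReal.ofReal (B ^ 2)) :
    Integrable (fun x => (1 + |u x| ^ 4 + |v x| ^ 4) * |a x| * |b x|) ∧
      ∫ x, (1 + |u x| ^ 4 + |v x| ^ 4) * |a x| * |b x| ≤
        sobC * (1 + 2 * R ^ 3 * Q) * A * B := by
  have s0 := sobC_pos
  have s1 : 1 ≤ sobC := by norm_num [sobC]
  have h1 := integral_le_of_lintegral_le (h := fun x => |a x| * |b x|)
    ((aesm_abs a).mul (aesm_abs b)) (fun x => by positivity)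
    (by positivity) (lintegral_one_one_le hA hB ((hs_mono (by norm_num) _).trans ha)
      ((hs_mono (by norm_num) _).trans hb))
  have h2 := integral_le_of_lintegral_le (h := fun x => |u x| ^ 4 * |a x| * |b x|)
    (((aesm_abs_pow u 4).mul (aesm_abs a)).mul (aesm_abs b))
    (fun x => by positivity) (by positivity) (lintegral_four_one_one_le hR hQ hA hB hu hu3 ha hb)
  have h3 := integral_le_of_lintegral_le (h := fun x => |v x| ^ 4 * |a x| * |b x|)
    (((aesm_abs_pow v 4).mul (aesm_abs a)).mul (aesm_abs b))
    (fun x => by positivity) (by positivity) (lintegral_four_one_one_le hR hQ hA hB hv hv3 ha hb)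
  have e : (fun x => (1 + |u x| ^ 4 + |v x| ^ 4) * |a x| * |b x|) =
      (fun x => |a x| * |b x|) + (fun x => |u x| ^ 4 * |a x| * |b x|) +
        (fun x => |v x| ^ 4 * |a x| * |b x|) := by
    ext x
    simp only [Pi.add_apply]
    ring
  rw [e]
  refine ⟨(h1.1.add h2.1).add h3.1, ?_⟩
  rw [integral_add' (h1.1.add h2.1) h3.1, integral_add' h1.1 h2.1]
  have : A * B ≤ sobC * (A * B) := le_mul_of_one_le_left (by positivity) s1
  linarith [h1.2, h2.2, h3.2]

theorem exists_sq_bound {n : ℕ} {a : (Fin 3 → ℤ) → ℝ} (h : hs n a < ⊤) :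
    ∃ R, 0 ≤ R ∧ hs n a ≤ ENNReal.ofReal (R ^ 2) :=
  ⟨Real.sqrt (hs n a).toReal, Real.sqrt_nonneg _, by
    rw [Real.sq_sqrt ENNReal.toReal_nonneg, ENNReal.ofReal_toReal h.ne]⟩

theorem hs_zero_le : hs 2 (coef (0 : L2)) ≤ ENNReal.ofReal (0 ^ 2) := by
  rw [hs]
  simp_rw [coef_Lp_zero]
  simp

/-! ### The nonlinearity tested against H¹ functions and basis functions -/

section

variable {f : ℝ → ℝ} {C : ℝ}

theorem Growth.aesm (hf : Growth f C) (u : L2) : AEStronglyMeasurable (fun x => f (u x)) :=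
  hf.cont.comp_aestronglyMeasurable (Lp.aestronglyMeasurable u)

theorem Growth.mul_le (hf : Growth f C) {u w : L2} {R A : ℝ} (hR : 0 ≤ R) (hA : 0 ≤ A)
    (hu : hs 2 (coef u) ≤ ENNReal.ofReal (R ^ 2)) (hw : hs 2 (coef w) ≤ ENNReal.ofReal (A ^ 2)) :
    Integrable (fun x => f (u x) * w x) ∧
      |∫ x, f (u x) * w x| ≤ C * (sobC * (1 + 2 * R ^ 5) * A) := by
  obtain ⟨h1, h2⟩ := growth_five hR hA hu hu hw
  have hC := hf.pos
  have hb : ∀ x, ‖f (u x) * w x‖ ≤ C * ((1 + |u x| ^ 5 + |u x| ^ 5) * |w x|) := fun x => by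
    rw [norm_mul, Real.norm_eq_abs, Real.norm_eq_abs, ← mul_assoc]
    refine mul_le_mul_of_nonneg_right ((hf.bound _).trans ?_) (abs_nonneg _)
    have : 0 ≤ |u x| ^ 5 := by positivity
    nlinarith
  refine ⟨(h1.const_mul C).mono' ((hf.aesm u).mul (Lp.aestronglyMeasurable w))
    (Eventually.of_forall hb), ?_⟩
  refine (norm_integral_le_of_norm_le (h1.const_mul C) (Eventually.of_forall hb)).trans ?_
  rw [integral_const_mul]
  exact mul_le_mul_of_nonneg_left h2 hC.le

theorem hs_coef_hart (n : ℕ) (k : Fin 3 → ℤ) : hs n (coef (hartLp k)) = ENNReal.ofReal (nu k ^ n) := by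
  rw [hs, tsum_eq_single k]
  · simp [coef_hartLp]
  · intro l hl
    simp [coef_hartLp, Ne.symm hl]

theorem one_eq_hart (x : Torus3) : 1 = Real.sqrt ((2 * π) ^ 3) * hart 0 x := by
  have := sqrt_pos_aux.ne'
  simp [hart, expMode_zero, this]

/-- Pairing with the constant mode `hart 0`, which belongs to H¹. -/
theorem Growth.integrable (hf : Growth f C) {u : L2} (hu : hs 2 (coef u) < ⊤) :
    Integrable (fun x => f (u x)) := by
  obtain ⟨R, hR, hu⟩ := exists_sq_bound hu
  obtain ⟨A, hA, hw⟩ := exists_sq_bound (n := 2) (a := coef (hartLp 0))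
    (by rw [hs_coef_hart]; exact ENNReal.ofReal_lt_top)
  refine (((hf.mul_le hR hA hu hw).1).const_mul (Real.sqrt ((2 * π) ^ 3))).congr ?_
  filter_upwards [coeFn_hartLp 0] with x hx
  rw [hx]
  linear_combination (-f (u x)) * one_eq_hart x

/-- Basis functions are bounded by 1, so the local Lipschitz bound only needs the difference in
H^{1/2}. -/
theorem Growth.coef_sub_le (hf : Growth f C) {u w : L2} {R B : ℝ} (hR : 0 ≤ R) (hB : 0 ≤ B)
    (hu : hs 2 (coef u) ≤ ENNReal.ofReal (R ^ 2)) (hw : hs 2 (coef w) ≤ ENNReal.ofReal (R ^ 2))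
    (hd : hs 1 (fun k => coef u k - coef w k) ≤ ENNReal.ofReal (B ^ 2)) (k : Fin 3 → ℤ) :
    |coef (fun x => f (u x)) k - coef (fun x => f (w x)) k| ≤
      C * (sobC * (1 + 2 * R ^ 4) * B) := by
  have e : (fun k => coef u k - coef w k) = coef (u - w : L2) := by
    ext k; rw [coef_Lp_sub]
  rw [e] at hd
  obtain ⟨h1, h2⟩ := growth_four hR hB hu hw hd
  rw [← coef_sub (hf.integrable (hu.trans_lt ENNReal.ofReal_lt_top))
    (hf.integrable (hw.trans_lt ENNReal.ofReal_lt_top)), coef, ← Real.norm_eq_abs]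
  refine (norm_integral_le_of_norm_le (h1.const_mul C) ?_).trans ?_
  · filter_upwards [Lp.coeFn_sub u w] with x hx
    rw [norm_mul, Real.norm_eq_abs, Real.norm_eq_abs, hx, Pi.sub_apply, ← mul_assoc]
    exact (mul_le_of_le_one_right (abs_nonneg _) (abs_hart_le k x)).trans (hf.lip _ _)
  · rw [integral_const_mul]
    exact mul_le_mul_of_nonneg_left h2 hf.pos.le

end

/-! ### Compactness and limits in the nonlinear term -/

theorem hs_sub_le_ofReal {n : ℕ} {a b : (Fin 3 → ℤ) → ℝ} {R : ℝ}
    (ha : hs n a ≤ ENNReal.ofReal (R ^ 2)) (hb : hs n b ≤ ENNReal.ofReal (R ^ 2)) :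
    hs n (fun k => a k - b k) ≤ ENNReal.ofReal ((2 * R) ^ 2) := by
  refine (hs_sub_le n a b).trans ?_
  have e : ENNReal.ofReal ((2 * R) ^ 2) = 2 * ENNReal.ofReal (R ^ 2) + 2 * ENNReal.ofReal (R ^ 2) := by
    rw [← two_mul, ← mul_assoc, show (2 * 2 : ℝ≥0∞) = ENNReal.ofReal 4 by norm_num,
      ← ENNReal.ofReal_mul (by norm_num)]
    congr 1; ring
  rw [e]
  gcongr

/-- Compactness of the embedding `H¹ ⊂ H^{1/2}`, in terms of coefficients. -/
theorem eventually_hs_one_sub_le {ι : Type*} {l : Filter ι} {a : ι → (Fin 3 → ℤ) → ℝ}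
    {b : (Fin 3 → ℤ) → ℝ} {R : ℝ} (ha : ∀ᶠ i in l, hs 2 (a i) ≤ ENNReal.ofReal (R ^ 2))
    (hb : hs 2 b ≤ ENNReal.ofReal (R ^ 2)) (h : ∀ k, Tendsto (fun i => a i k) l (𝓝 (b k)))
    {ε : ℝ} (hε : 0 < ε) : ∀ᶠ i in l, hs 1 (fun k => a i k - b k) ≤ ENNReal.ofReal ε := by
  -- Frequencies outside `box N` gain a factor `1 / N` in passing from H¹ to H^{1/2}, which makes
  -- them at most `ε / 2`; the finitely many others converge termwise.
  obtain ⟨N, hN⟩ := exists_nat_gt ((2 * R) ^ 2 / (ε / 2))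
  have hN0 : (0 : ℝ) < N := lt_of_le_of_lt (by positivity) hN
  have h1 : Tendsto (fun i => ∑ k ∈ box N, nu k ^ 1 * (a i k - b k) ^ 2) l (𝓝 0) := by
    have : Tendsto (fun i => ∑ k ∈ box N, nu k ^ 1 * (a i k - b k) ^ 2) l
        (𝓝 (∑ k ∈ box N, nu k ^ 1 * (b k - b k) ^ 2)) :=
      tendsto_finsetSum _ fun k _ => (((h k).sub_const _).pow 2).const_mul _
    simpa using this
  filter_upwards [ha, h1.eventually_lt_const (half_pos hε)] with i hi h2
  have h3 := (hs_le_ofReal_iff (by positivity)).1 (hs_sub_le_ofReal hi hb)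
  refine (hs_le_ofReal_iff hε.le).2 fun s => ?_
  classical
  calc ∑ k ∈ s, nu k ^ 1 * (a i k - b k) ^ 2
      ≤ ∑ k ∈ box N ∪ s \ box N, nu k ^ 1 * (a i k - b k) ^ 2 :=
        Finset.sum_le_sum_of_subset_of_nonneg (by intro k hk; by_cases h : k ∈ box N <;> simp [h, hk])
          fun k _ _ => hs_term_nonneg 1 (fun k => a i k - b k) k
    _ = ∑ k ∈ box N, nu k ^ 1 * (a i k - b k) ^ 2 + ∑ k ∈ s \ box N, nu k ^ 1 * (a i k - b k) ^ 2 :=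
        Finset.sum_union Finset.disjoint_sdiff
    _ ≤ ε / 2 + ∑ k ∈ s \ box N, (N : ℝ)⁻¹ * (nu k ^ 2 * (a i k - b k) ^ 2) := by
        refine add_le_add h2.le (Finset.sum_le_sum fun k hk => ?_)
        rw [Finset.mem_sdiff, mem_box, not_le] at hk
        rw [← mul_assoc]
        refine mul_le_mul_of_nonneg_right ?_ (sq_nonneg _)
        have : (N : ℝ) ≤ nu k := by unfold nu; linarith [hk.2]
        rw [pow_one, le_inv_mul_iff₀ hN0, sq]
        exact mul_le_mul_of_nonneg_right this (nu_pos k).le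
    _ ≤ ε / 2 + (N : ℝ)⁻¹ * (2 * R) ^ 2 := by
        rw [← Finset.mul_sum]
        gcongr
        exact h3 _
    _ ≤ ε := by
        rw [div_lt_iff₀ (by positivity)] at hN
        have : (N : ℝ)⁻¹ * (2 * R) ^ 2 ≤ ε / 2 := by
          rw [inv_mul_le_iff₀ hN0]; linarith
        linarith

theorem hs_le_of_tendsto {ι : Type*} {l : Filter ι} [l.NeBot] {n : ℕ} {a : ι → (Fin 3 → ℤ) → ℝ}
    {b : (Fin 3 → ℤ) → ℝ} {R : ℝ} (hR : 0 ≤ R) (ha : ∀ᶠ i in l, hs n (a i) ≤ ENNReal.ofReal R)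
    (h : ∀ k, Tendsto (fun i => a i k) l (𝓝 (b k))) : hs n b ≤ ENNReal.ofReal R := by
  refine (hs_le_ofReal_iff hR).2 fun s => ?_
  refine le_of_tendsto (tendsto_finsetSum s fun k _ => ((h k).pow 2).const_mul (nu k ^ n)) ?_
  filter_upwards [ha] with i hi
  exact (hs_le_ofReal_iff hR).1 hi s

section

variable {f : ℝ → ℝ} {C : ℝ}

/-- Weak continuity of the nonlinearity: an H¹ bound upgrades convergence of coefficients to
convergence in H^{1/2}, which `Growth.coef_sub_le` can use. -/
theorem Growth.tendsto_coef (hf : Growth f C) {ι : Type*} {l : Filter ι} {u : ι → L2} {w : L2}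
    {R : ℝ} (hR : 0 ≤ R) (hu : ∀ᶠ i in l, hs 2 (coef (u i)) ≤ ENNReal.ofReal (R ^ 2))
    (hw : hs 2 (coef w) ≤ ENNReal.ofReal (R ^ 2))
    (h : ∀ k, Tendsto (fun i => coef (u i) k) l (𝓝 (coef w k))) (k : Fin 3 → ℤ) :
    Tendsto (fun i => coef (fun x => f (u i x)) k) l (𝓝 (coef (fun x => f (w x)) k)) := by
  rw [Metric.tendsto_nhds]
  intro ε hε
  have hP : 0 < C * (sobC * (1 + 2 * R ^ 4)) :=
    mul_pos hf.pos (mul_pos sobC_pos (by positivity))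
  set B := ε / 2 / (C * (sobC * (1 + 2 * R ^ 4))) with hB
  have hB0 : 0 < B := by positivity
  filter_upwards [hu, eventually_hs_one_sub_le hu hw h (pow_pos hB0 2)] with i h1 h2
  rw [Real.dist_eq]
  refine (hf.coef_sub_le hR hB0.le h1 hw h2 k).trans_lt ?_
  have : C * (sobC * (1 + 2 * R ^ 4) * B) = ε / 2 := by
    have := hf.pos.ne'
    have := sobC_pos.ne'
    rw [hB]; field_simp
  rw [this]; linarith

theorem hs_trigL_le (n : ℕ) (s : Finset (Fin 3 → ℤ)) (a : (Fin 3 → ℤ) → ℝ) :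
    hs n (coef (trigL s a)) ≤ hs n a :=
  hs_le_of_abs_le fun k => by
    rw [coef_trigL]
    split_ifs
    · exact le_rfl
    · simp

theorem tendsto_hs_tail {n : ℕ} {a : (Fin 3 → ℤ) → ℝ} (h : hs n a < ⊤) :
    Tendsto (fun N => hs n (fun k => a k - coef (trigL (box N) a) k)) atTop (𝓝 0) := by
  have h1 := (ENNReal.tendsto_tsum_compl_atTop_zero h.ne).comp tendsto_box
  refine h1.congr fun N => ?_
  simp only [Function.comp]
  refine (tsum_subtype {k | k ∉ box N} (fun k => ENNReal.ofReal (nu k ^ n * a k ^ 2))).trans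
    (tsum_congr fun k => ?_)
  simp only [coef_trigL]
  by_cases hk : k ∈ box N
  · rw [if_pos hk, indicator_of_notMem (by simpa using hk)]; simp
  · rw [if_neg hk, indicator_of_mem (by exact hk), sub_zero]

theorem integral_mul_trigL {h : Torus3 → ℝ} (hh : Integrable h) (s : Finset (Fin 3 → ℤ))
    (a : (Fin 3 → ℤ) → ℝ) : ∫ x, h x * trigL s a x = ∑ k ∈ s, coef h k * a k := by
  calc _ = ∫ x, ∑ k ∈ s, a k * (h x * hart k x) := by
        refine integral_congr_ae ?_
        filter_upwards [coeFn_trigL s a] with x hx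
        rw [hx, trig, Finset.mul_sum]
        exact Finset.sum_congr rfl fun k _ => by ring
    _ = _ := by
        rw [integral_finsetSum _ fun k _ => (integrable_mul_hart hh k).const_mul _]
        refine Finset.sum_congr rfl fun k _ => ?_
        rw [integral_const_mul, mul_comm]; rfl

/-- Parseval in L² does not apply, because `f(u)` need not be square integrable. It is replaced by
the continuity of `w ↦ ∫ f(u) w` on H¹ and the H¹ convergence of box truncations of `w`. -/
theorem Growth.tendsto_sum_coef_mul (hf : Growth f C) {u w : L2} (hu : hs 2 (coef u) < ⊤)
    (hw : hs 2 (coef w) < ⊤) :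
    Tendsto (fun N => ∑ k ∈ box N, coef (fun x => f (u x)) k * coef w k) atTop
      (𝓝 (∫ x, f (u x) * w x)) := by
  have hfi := hf.integrable hu
  obtain ⟨R, hR, hu⟩ := exists_sq_bound hu
  simp_rw [← integral_mul_trigL hfi]
  rw [Metric.tendsto_nhds]
  intro ε hε
  have hP : 0 < C * (sobC * (1 + 2 * R ^ 5)) :=
    mul_pos hf.pos (mul_pos sobC_pos (by positivity))
  set A := ε / 2 / (C * (sobC * (1 + 2 * R ^ 5))) with hA
  have hA0 : 0 < A := by positivity
  filter_upwards [(tendsto_hs_tail hw).eventually_le_const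
    (ENNReal.ofReal_pos.2 (pow_pos hA0 2))] with N hN
  obtain ⟨W, hW, hw'⟩ := exists_sq_bound hw
  have h1 := (hf.mul_le hR hW hu hw').1
  have h2 := (hf.mul_le hR hW hu ((hs_trigL_le 2 (box N) (coef w)).trans hw')).1
  have e : (fun k => coef w k - coef (trigL (box N) (coef w)) k) =
      coef (w - trigL (box N) (coef w) : L2) := by
    ext k; rw [coef_Lp_sub]
  rw [e] at hN
  have h3 := (hf.mul_le hR hA0.le hu hN).2
  rw [dist_comm, Real.dist_eq, ← integral_sub h1 h2]
  have e2 : ∫ x, (f (u x) * w x - f (u x) * trigL (box N) (coef w) x) =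
      ∫ x, f (u x) * (w - trigL (box N) (coef w) : L2) x := by
    refine integral_congr_ae ?_
    filter_upwards [Lp.coeFn_sub w (trigL (box N) (coef w))] with x hx
    rw [hx, Pi.sub_apply]; ring
  rw [e2]
  refine h3.trans_lt ?_
  have : C * (sobC * (1 + 2 * R ^ 5) * A) = ε / 2 := by
    have := hf.pos.ne'
    have := sobC_pos.ne'
    rw [hA]; field_simp
  rw [this]; linarith

theorem Growth.abs_sum_coef_mul_le (hf : Growth f C) {u w : L2} {R A : ℝ} (hR : 0 ≤ R) (hA : 0 ≤ A)
    (hu : hs 2 (coef u) ≤ ENNReal.ofReal (R ^ 2)) (hw : hs 2 (coef w) ≤ ENNReal.ofReal (A ^ 2))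
    (s : Finset (Fin 3 → ℤ)) :
    |∑ k ∈ s, coef (fun x => f (u x)) k * coef w k| ≤ C * (sobC * (1 + 2 * R ^ 5) * A) := by
  rw [← integral_mul_trigL (hf.integrable (hu.trans_lt ENNReal.ofReal_lt_top))]
  exact (hf.mul_le hR hA hu ((hs_trigL_le 2 s (coef w)).trans hw)).2

/-! ### The potential energy -/

theorem Growth.abs_primitive_sub_le (hf : Growth f C) (u v : ℝ) :
    |(∫ s in (0 : ℝ)..u, f s) - ∫ s in (0 : ℝ)..v, f s| ≤
      C * ((1 + |u| ^ 5 + |v| ^ 5) * |u - v|) := by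
  rw [intervalIntegral.integral_interval_sub_left (hf.cont.intervalIntegrable _ _)
    (hf.cont.intervalIntegrable _ _), ← mul_assoc, ← Real.norm_eq_abs]
  refine intervalIntegral.norm_integral_le_of_norm_le_const fun x hx => ?_
  refine (hf.bound x).trans (mul_le_mul_of_nonneg_left ?_ hf.pos.le)
  have := pow_le_add_of_mem_uIcc (uIoc_subset_uIcc hx) 5
  linarith

theorem continuous_primitive (hf : Continuous f) : Continuous fun u => ∫ s in (0 : ℝ)..u, f s :=
  intervalIntegral.continuous_primitive (fun _ _ => hf.intervalIntegrable _ _) 0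

theorem Growth.integrable_primitive (hf : Growth f C) {u : L2} (hu : hs 2 (coef u) < ⊤) :
    Integrable (fun x => ∫ s in (0 : ℝ)..(u x), f s) := by
  obtain ⟨R, hR, hu⟩ := exists_sq_bound hu
  refine ((growth_five hR hR hu hu hu).1.const_mul C).mono'
    ((continuous_primitive hf.cont).comp_aestronglyMeasurable (Lp.aestronglyMeasurable u))
    (Eventually.of_forall fun x => ?_)
  have := hf.abs_primitive_sub_le (u x) 0
  simp only [intervalIntegral.integral_same, sub_zero, abs_zero] at this
  refine this.trans (mul_le_mul_of_nonneg_left (mul_le_mul_of_nonneg_right ?_ (abs_nonneg _)) hf.pos.le)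
  have : 0 ≤ |u x| ^ 5 := by positivity
  simp

theorem Growth.abs_integral_primitive_sub_le (hf : Growth f C) {u v : L2} {R A : ℝ} (hR : 0 ≤ R)
    (hA : 0 ≤ A) (hu : hs 2 (coef u) ≤ ENNReal.ofReal (R ^ 2))
    (hv : hs 2 (coef v) ≤ ENNReal.ofReal (R ^ 2))
    (hd : hs 2 (fun k => coef u k - coef v k) ≤ ENNReal.ofReal (A ^ 2)) :
    |(∫ x, ∫ s in (0 : ℝ)..(u x), f s) - ∫ x, ∫ s in (0 : ℝ)..(v x), f s| ≤
      C * (sobC * (1 + 2 * R ^ 5) * A) := by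
  have e : (fun k => coef u k - coef v k) = coef (u - v : L2) := by
    ext k; rw [coef_Lp_sub]
  rw [e] at hd
  obtain ⟨h1, h2⟩ := growth_five hR hA hu hv hd
  rw [← integral_sub (hf.integrable_primitive (hu.trans_lt ENNReal.ofReal_lt_top))
    (hf.integrable_primitive (hv.trans_lt ENNReal.ofReal_lt_top)), ← Real.norm_eq_abs]
  refine (norm_integral_le_of_norm_le (h1.const_mul C) ?_).trans ?_
  · filter_upwards [Lp.coeFn_sub u v] with x hx
    rw [hx]
    exact hf.abs_primitive_sub_le _ _
  · rw [integral_const_mul]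
    exact mul_le_mul_of_nonneg_left h2 hf.pos.le

theorem integral_mul_eq_inner (g u : L2) : ∫ x, g x * u x = inner ℝ g u := by
  rw [L2.inner_def]
  refine integral_congr_ae (Eventually.of_forall fun x => ?_)
  simp [mul_comm]

theorem continuous_pos : Continuous EnergySpace.pos :=
  continuous_fst.comp (continuous_subtype_val.comp continuous_fst)

theorem continuous_grad (i : Fin 3) : Continuous fun ξ : EnergySpace => ξ.grad i :=
  (continuous_apply i).comp (continuous_snd.comp (continuous_subtype_val.comp continuous_fst))

theorem continuous_vel : Continuous EnergySpace.vel := continuous_snd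

theorem pos_sub (ξ η : EnergySpace) : (ξ - η).pos = ξ.pos - η.pos := rfl

theorem Growth.continuous_energy (hf : Growth f C) (g : L2) : Continuous (energy f g) := by
  have h1 : Continuous fun ξ : EnergySpace => ∫ x, ∫ s in (0 : ℝ)..(ξ.pos x), f s := by
    rw [continuous_iff_continuousAt]
    intro η
    rw [ContinuousAt, tendsto_iff_dist_tendsto_zero]
    -- The factor 3 is chosen for `8 ≤ 3²`, the constant in `hs_two_pos_le`.
    set R := 3 * (‖η‖ + 1) with hR
    have hb : ∀ ξ : EnergySpace, ‖ξ‖ ≤ ‖η‖ + 1 → hs 2 (coef ξ.pos) ≤ ENNReal.ofReal (R ^ 2) :=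
      fun ξ hξ => (hs_two_pos_le ξ).trans (ENNReal.ofReal_le_ofReal (by
        rw [hR]
        have := pow_le_pow_left₀ (norm_nonneg _) hξ 2
        have := norm_nonneg η
        nlinarith))
    have hlim : Tendsto (fun ξ : EnergySpace => C * (sobC * (1 + 2 * R ^ 5) * (3 * ‖ξ - η‖)))
        (𝓝 η) (𝓝 0) := by
      have : Continuous fun ξ : EnergySpace => C * (sobC * (1 + 2 * R ^ 5) * (3 * ‖ξ - η‖)) := by
        fun_prop
      simpa using this.tendsto η
    have hev : ∀ᶠ ξ in 𝓝 η, ‖ξ‖ ≤ ‖η‖ + 1 :=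
      continuous_norm.continuousAt.eventually_le_const (by simp)
    refine squeeze_zero' (Eventually.of_forall fun _ => dist_nonneg) ?_ hlim
    filter_upwards [hev] with ξ hξ
    rw [Real.dist_eq]
    refine hf.abs_integral_primitive_sub_le (by positivity) (by positivity) (hb ξ hξ)
      (hb η (by linarith)) ?_
    have e : (fun k => coef ξ.pos k - coef η.pos k) = coef (ξ - η).pos := by
      ext k; rw [pos_sub, coef_Lp_sub]
    rw [e]
    refine (hs_two_pos_le _).trans (ENNReal.ofReal_le_ofReal ?_)
    nlinarith [sq_nonneg ‖ξ - η‖]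
  unfold energy
  simp_rw [integral_mul_eq_inner]
  have c1 := continuous_pos
  have c2 := continuous_vel
  have c3 := continuous_grad
  refine (((c2.norm.pow 2).const_mul _).add ((continuous_finsetSum _ fun i _ =>
    (c3 i).norm.pow 2).const_mul _)).add h1 |>.sub ?_
  exact continuous_const.inner c1

end

/-! ### Solutions in terms of their coefficients -/

/-- The equation for each coefficient, for a trajectory which is extended to negative times. -/
structure ModeSolution (γ : ℝ) (f : ℝ → ℝ) (g : L2) (ξ : ℝ → EnergySpace) : Prop where
  cont_pos : ∀ k, Continuous fun t => coef (ξ t).pos k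
  cont_vel : ∀ k, Continuous fun t => coef (ξ t).vel k
  bounded : ∀ T, ∃ R, 0 ≤ R ∧ ∀ t ≤ T, ‖ξ t‖ ≤ R
  dissip : ∀ T, ∫⁻ t in Ioo 0 T, hs 1 (coef (ξ t).vel) < ⊤
  hasDerivAt_pos : ∀ k t, 0 < t → HasDerivAt (fun t => coef (ξ t).pos k) (coef (ξ t).vel k) t
  hasDerivAt_vel : ∀ k t, 0 < t → HasDerivAt (fun t => coef (ξ t).vel k)
    (coef g k - γ * absK k * coef (ξ t).vel k - sqNorm k * coef (ξ t).pos k -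
      coef (fun x => f ((ξ t).pos x)) k) t

section

variable {γ : ℝ} {f : ℝ → ℝ} {g : L2} {ξ : ℝ → EnergySpace} {C : ℝ}

theorem ModeSolution.exists_bound (h : ModeSolution γ f g ξ) (T : ℝ) :
    ∃ R, 0 < R ∧ ∀ t ≤ T, hs 2 (coef (ξ t).pos) ≤ ENNReal.ofReal (R ^ 2) ∧
      hs 0 (coef (ξ t).vel) ≤ ENNReal.ofReal (R ^ 2) := by
  obtain ⟨R, hR, hb⟩ := h.bounded T
  refine ⟨3 * R + 1, by positivity, fun t ht => ⟨(hs_two_pos_le _).trans ?_,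
    (hs_zero_vel_le _).trans ?_⟩⟩ <;>
  · refine ENNReal.ofReal_le_ofReal ?_
    have := pow_le_pow_left₀ (norm_nonneg _) (hb t ht) 2
    nlinarith

theorem Growth.continuous_coef (hf : Growth f C) {u : ℝ → L2} (hu : ∀ k, Continuous fun t => coef (u t) k)
    (hb : ∀ T, ∃ R, 0 < R ∧ ∀ t ≤ T, hs 2 (coef (u t)) ≤ ENNReal.ofReal (R ^ 2)) (k : Fin 3 → ℤ) :
    Continuous fun t => coef (fun x => f (u t x)) k := by
  rw [continuous_iff_continuousAt]
  intro t
  obtain ⟨R, hR, hb⟩ := hb (t + 1)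
  refine hf.tendsto_coef hR.le ?_ (hb t (by linarith)) (fun k => (hu k).tendsto t) k
  filter_upwards [eventually_le_nhds (by linarith : t < t + 1)] with s hs
  exact hb s hs

theorem ModeSolution.continuous_coef (h : ModeSolution γ f g ξ) (hf : Growth f C)
    (k : Fin 3 → ℤ) : Continuous fun t => coef (fun x => f ((ξ t).pos x)) k :=
  hf.continuous_coef h.cont_pos (fun T => by
    obtain ⟨R, hR, hb⟩ := h.exists_bound T
    exact ⟨R, hR, fun t ht => (hb t ht).1⟩) k

theorem hs_lt_top_pos (ξ : EnergySpace) : hs 2 (coef ξ.pos) < ⊤ :=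
  (hs_two_pos_le ξ).trans_lt ENNReal.ofReal_lt_top

end

theorem measurable_hs {a : ℝ → (Fin 3 → ℤ) → ℝ} (ha : ∀ k, Continuous fun t => a t k) (n : ℕ) :
    Measurable fun t => hs n (a t) :=
  Measurable.tsum fun k =>
    (((ha k).pow 2).const_mul (nu k ^ n)).measurable.ennreal_ofReal

/-! ### Translations -/

/-- The translate `u(· + y)` of a function in `L²`. -/
def translate (y : Torus3) (u : L2) : L2 :=
  Lp.compMeasurePreserving (fun x => x + y) (measurePreserving_add_right volume y) u

theorem coeFn_translate (y : Torus3) (u : L2) : translate y u =ᵐ[volume] fun x => u (x + y) :=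
  Lp.coeFn_compMeasurePreserving u _

/-- A translation rotates the pair of coefficients of `k` and `-k` by the angle `k i * s`. -/
theorem coef_translate (i : Fin 3) (s : ℝ) (u : L2) (k : Fin 3 → ℤ) :
    coef (translate (shift i s) u) k =
      Real.cos (k i * s) * coef u k - Real.sin (k i * s) * coef u (-k) := by
  rw [coef_congr (coeFn_translate _ _), coef,
    ← integral_sub_right_eq_self (fun x => u (x + shift i s) * hart k x) (shift i s)]
  have e : ∀ x, u (x - shift i s + shift i s) * hart k (x - shift i s) =
      Real.cos (k i * s) * (u x * hart k x) - Real.sin (k i * s) * (u x * hart (-k) x) := fun x => by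
    rw [sub_add_cancel, sub_eq_add_neg x, ← shift_neg, hart_shift, mul_neg, Real.cos_neg,
      Real.sin_neg]
    ring
  simp_rw [e]
  rw [integral_sub ((integrable_mul_hart (integrable_coe u) k).const_mul _)
    ((integrable_mul_hart (integrable_coe u) (-k)).const_mul _), integral_const_mul,
    integral_const_mul]
  rfl

theorem hs_comp_neg (n : ℕ) (a : (Fin 3 → ℤ) → ℝ) : hs n (fun k => a (-k)) = hs n a := by
  rw [hs, hs, ← (Equiv.neg (Fin 3 → ℤ)).tsum_eq]
  simp [nu_neg]

theorem hs_translate_lt_top {n : ℕ} {u : L2} (hu : hs n (coef u) < ⊤) (i : Fin 3) (s : ℝ) :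
    hs n (coef (translate (shift i s) u)) < ⊤ := by
  have e : coef (translate (shift i s) u) = fun k => Real.cos (k i * s) * coef u k -
      Real.sin (k i * s) * coef u (-k) := funext fun k => coef_translate i s u k
  rw [e]
  refine (hs_sub_le n _ _).trans_lt (ENNReal.add_lt_top.2
    ⟨ENNReal.mul_lt_top (by simp) (lt_of_le_of_lt (hs_le_of_abs_le fun k => ?_) hu),
      ENNReal.mul_lt_top (by simp) (lt_of_le_of_lt (hs_le_of_abs_le (b := fun k => coef u (-k))
        fun k => ?_) ((hs_comp_neg n _).trans_lt hu))⟩)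
  · rw [abs_mul]; exact mul_le_of_le_one_left (abs_nonneg _) (Real.abs_cos_le_one _)
  · rw [abs_mul]; exact mul_le_of_le_one_left (abs_nonneg _) (Real.abs_sin_le_one _)

/-- The second difference `2u - u(· + y) - u(· - y)`. -/
def secondDiff (i : Fin 3) (s : ℝ) (u : L2) : L2 :=
  (u - translate (shift i s) u) + (u - translate (shift i (-s)) u)

theorem coef_secondDiff (i : Fin 3) (s : ℝ) (u : L2) (k : Fin 3 → ℤ) :
    coef (secondDiff i s u) k = (2 - 2 * Real.cos (k i * s)) * coef u k := by
  rw [secondDiff, coef_Lp_add, coef_Lp_sub, coef_Lp_sub, coef_translate, coef_translate, mul_neg,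
    Real.cos_neg, Real.sin_neg]
  ring

theorem growth_id : Growth (fun x => x) 1 := by
  refine ⟨one_pos, continuous_id, fun u => ?_, fun u v => ?_⟩
  · rw [one_mul]
    rcases le_total |u| 1 with h | h
    · have : 0 ≤ |u| ^ 5 := by positivity
      linarith
    · have := le_self_pow₀ h (by norm_num : 5 ≠ 0)
      linarith
  · rw [one_mul]
    refine le_mul_of_one_le_left (abs_nonneg _) ?_
    have h1 : 0 ≤ |u| ^ 4 := by positivity
    have h2 : 0 ≤ |v| ^ 4 := by positivity
    linarith

theorem Growth.integrable_mul {f : ℝ → ℝ} {C : ℝ} (hf : Growth f C) {u w : L2}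
    (hu : hs 2 (coef u) < ⊤) (hw : hs 2 (coef w) < ⊤) : Integrable (fun x => f (u x) * w x) := by
  obtain ⟨R, hR, hu⟩ := exists_sq_bound hu
  obtain ⟨A, hA, hw⟩ := exists_sq_bound hw
  exact (hf.mul_le hR hA hu hw).1

/-- Discrete integration by parts: translation invariance moves the backward difference to the point
`x + y`, where it combines with the forward one. -/
theorem Growth.integral_mul_secondDiff {f : ℝ → ℝ} {C : ℝ} (hf : Growth f C) {u : L2}
    (hu : hs 2 (coef u) < ⊤) (i : Fin 3) (s : ℝ) :
    Integrable (fun x => (f (u (x + shift i s)) - f (u x)) * (u (x + shift i s) - u x)) ∧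
    ∫ x, f (u x) * secondDiff i s u x =
      ∫ x, (f (u (x + shift i s)) - f (u x)) * (u (x + shift i s) - u x) := by
  set y := shift i s with hy
  have i0 := hf.integrable_mul hu hu
  have i1 : Integrable (fun x => f (u x) * u (x + y)) := by
    refine (hf.integrable_mul hu (hs_translate_lt_top hu i s)).congr ?_
    filter_upwards [coeFn_translate y u] with x hx
    rw [hx]
  have i2 : Integrable (fun x => f (u x) * u (x - y)) := by
    refine (hf.integrable_mul hu (hs_translate_lt_top hu i (-s))).congr ?_
    filter_upwards [coeFn_translate (shift i (-s)) u] with x hx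
    rw [hx, shift_neg, sub_eq_add_neg]
  have a1 : Integrable (fun x => f (u x) * (u x - u (x + y))) := by
    simp_rw [mul_sub]; exact i0.sub i1
  have a2 : Integrable (fun x => f (u x) * (u x - u (x - y))) := by
    simp_rw [mul_sub]; exact i0.sub i2
  have e2 := integral_add_right_eq_self (μ := (volume : Measure Torus3))
    (fun x => f (u x) * (u x - u (x - y))) y
  have a3 := a2.comp_add_right y
  simp only [add_sub_cancel_right] at e2 a3
  have e3 : ∀ x, (f (u (x + y)) - f (u x)) * (u (x + y) - u x) =
      f (u x) * (u x - u (x + y)) + f (u (x + y)) * (u (x + y) - u x) := fun x => by ring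
  simp_rw [e3]
  refine ⟨a1.add a3, ?_⟩
  rw [integral_add a1 a3, e2, ← integral_add a1 a2]
  refine integral_congr_ae ?_
  filter_upwards [coeFn_translate y u, coeFn_translate (shift i (-s)) u,
    Lp.coeFn_add (u - translate (shift i s) u) (u - translate (shift i (-s)) u),
    Lp.coeFn_sub u (translate (shift i s) u),
    Lp.coeFn_sub u (translate (shift i (-s)) u)] with x h1 h2 h3 h4 h5
  rw [secondDiff, h3, Pi.add_apply, h4, h5, Pi.sub_apply, Pi.sub_apply, ← hy, h1, h2, shift_neg,
    ← hy, ← sub_eq_add_neg]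
  ring

/-- After the integration by parts the one-sided monotonicity of `f` applies pointwise. The same
identity with `f` replaced by the identity map computes the lower bound in terms of coefficients. -/
theorem Growth.integral_mul_secondDiff_ge {f : ℝ → ℝ} {C K : ℝ} (hf : Growth f C)
    (hK : ∀ u v, -K * (u - v) ^ 2 ≤ (f u - f v) * (u - v)) {u : L2} (hu : hs 2 (coef u) < ⊤)
    (i : Fin 3) (s : ℝ) :
    -K * ∑' k, (2 - 2 * Real.cos (k i * s)) * coef u k ^ 2 ≤ ∫ x, f (u x) * secondDiff i s u x := by
  obtain ⟨h1, h2⟩ := hf.integral_mul_secondDiff hu i s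
  obtain ⟨h3, h4⟩ := growth_id.integral_mul_secondDiff hu i s
  have e : ∑' k, (2 - 2 * Real.cos (k i * s)) * coef u k ^ 2 = ∫ x, u x * secondDiff i s u x := by
    rw [← (hasSum_coef_mul u (secondDiff i s u)).tsum_eq]
    refine tsum_congr fun k => ?_
    rw [coef_secondDiff]; ring
  rw [e, h4, h2, ← integral_const_mul]
  refine integral_mono (h3.const_mul _) h1 fun x => ?_
  have := hK (u (x + shift i s)) (u x)
  simp only
  linarith

/-! ### A dyadic approximation of the symbol `|k|` -/

/-- Symbol of a positive combination of second differences; it approximates `|k|`. -/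
def mult (J : ℕ) (k : Fin 3 → ℤ) : ℝ :=
  ∑ i, ∑ j ∈ Finset.range J, (2 : ℝ) ^ j * (2 - 2 * Real.cos (k i * (1 / 2) ^ j))

theorem diff_symbol_nonneg (x : ℝ) : 0 ≤ 2 - 2 * Real.cos x := by
  linarith [Real.cos_le_one x]

theorem diff_symbol_le_four (x : ℝ) : 2 - 2 * Real.cos x ≤ 4 := by
  linarith [Real.neg_one_le_cos x]

theorem diff_symbol_le_sq (x : ℝ) : 2 - 2 * Real.cos x ≤ x ^ 2 := by
  linarith [Real.one_sub_sq_div_two_le_cos (x := x)]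

theorem mult_nonneg (J : ℕ) (k : Fin 3 → ℤ) : 0 ≤ mult J k :=
  Finset.sum_nonneg fun i _ => Finset.sum_nonneg fun j _ =>
    mul_nonneg (by positivity) (diff_symbol_nonneg _)

/-- A dyadic form of the representation of |q| as a multiple of ∫ (1 - cos(qs)) s⁻² ds. Scales with
`2^j` up to about |q| are bounded trivially and sum to a multiple of |q|; finer scales are bounded
by the quadratic estimate of cosine and form a convergent geometric series. -/
theorem dyadic_sum_le (q : ℤ) (J : ℕ) :
    ∑ j ∈ Finset.range J, (2 : ℝ) ^ j * (2 - 2 * Real.cos (q * (1 / 2) ^ j)) ≤ 10 * |(q : ℝ)| := by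
  rcases eq_or_ne q 0 with rfl | hq
  · simp
  set n := q.natAbs with hn
  have hn0 : n ≠ 0 := Int.natAbs_ne_zero.2 hq
  have hqn : |(q : ℝ)| = n := by rw [hn, Nat.cast_natAbs]; push_cast; rfl
  have hq2 : (q : ℝ) ^ 2 = (n : ℝ) ^ 2 := by rw [← sq_abs, hqn]
  -- The crossover scale, with `n ≤ 2^J0 ≤ 2n`. The two ranges contribute at most `8n` and `2n`.
  set J0 := Nat.log 2 n + 1 with hJ0
  have l1 : (2 : ℝ) ^ J0 ≤ 2 * n := by
    have := Nat.pow_log_le_self 2 hn0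
    rw [hJ0, pow_succ]
    have h : ((2 : ℝ) ^ Nat.log 2 n) ≤ n := by exact_mod_cast this
    linarith
  have l2 : (n : ℝ) ≤ 2 ^ J0 := by
    exact_mod_cast (Nat.lt_pow_succ_log_self one_lt_two n).le
  have b1 : ∀ J, ∑ j ∈ Finset.range J, (2 : ℝ) ^ j * (2 - 2 * Real.cos (q * (1 / 2) ^ j)) ≤
      4 * 2 ^ J := fun J => by
    induction J with
    | zero => simp
    | succ J ih =>
      rw [Finset.sum_range_succ, pow_succ]
      have := mul_le_mul_of_nonneg_left (diff_symbol_le_four (q * (1 / 2) ^ J))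
        (by positivity : (0 : ℝ) ≤ 2 ^ J)
      linarith
  have b2 : ∀ J, J0 ≤ J →
      ∑ j ∈ Finset.range J, (2 : ℝ) ^ j * (2 - 2 * Real.cos (q * (1 / 2) ^ j)) ≤
        4 * 2 ^ J0 + (n : ℝ) ^ 2 * (2 * (1 / 2) ^ J0 - 2 * (1 / 2) ^ J) := fun J hJ => by
    induction J, hJ using Nat.le_induction with
    | base => simpa using b1 J0
    | succ J _ ih =>
      rw [Finset.sum_range_succ]
      have h1 := mul_le_mul_of_nonneg_left (diff_symbol_le_sq (q * (1 / 2) ^ J))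
        (by positivity : (0 : ℝ) ≤ 2 ^ J)
      have e : (2 : ℝ) ^ J * (q * (1 / 2) ^ J) ^ 2 = n ^ 2 * (1 / 2) ^ J := by
        rw [mul_pow, hq2]
        have : (2 : ℝ) ^ J * (1 / 2) ^ J = 1 := by rw [← mul_pow]; norm_num
        linear_combination (n : ℝ) ^ 2 * (1 / 2) ^ J * this
      rw [e] at h1
      rw [pow_succ (1 / 2 : ℝ) J]
      linarith
  rw [hqn]
  have hn1 : (0 : ℝ) < n := by exact_mod_cast Nat.pos_of_ne_zero hn0
  rcases le_total J J0 with h | h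
  · refine (b1 J).trans ?_
    have : (2 : ℝ) ^ J ≤ 2 ^ J0 := pow_le_pow_right₀ (by norm_num) h
    linarith
  · refine (b2 J h).trans ?_
    have h3 : (n : ℝ) * (1 / 2) ^ J0 ≤ 1 := by
      rw [one_div, inv_pow, mul_inv_le_iff₀ (by positivity), one_mul]; exact l2
    have h4 : 0 ≤ (n : ℝ) ^ 2 * (2 * (1 / 2) ^ J) := by positivity
    nlinarith

theorem mult_le (J : ℕ) (k : Fin 3 → ℤ) : mult J k ≤ 30 * nu k := by
  calc mult J k ≤ ∑ _i : Fin 3, 10 * nu k := Finset.sum_le_sum fun i _ =>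
        (dyadic_sum_le (k i) J).trans (by linarith [abs_apply_le_nu k i])
    _ = _ := by simp; ring

/-- A single term suffices: at the scale `2^j ≤ |k i| < 2^(j+1)` of the largest component the
argument of the cosine has modulus in [1, 2), so the symbol is at least 2/3. -/
theorem norm_le_mult {J : ℕ} {k : Fin 3 → ℤ} (hJ : ‖k‖ < J) : ‖k‖ ≤ 3 * mult J k := by
  obtain ⟨i, hi⟩ := exists_norm_eq k
  rcases eq_or_ne (k i) 0 with h0 | h0
  · rw [hi, h0]; simpa using mult_nonneg J k
  set n := (k i).natAbs with hn
  have hn0 : n ≠ 0 := Int.natAbs_ne_zero.2 h0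
  have hqn : |(k i : ℝ)| = n := by rw [hn, Nat.cast_natAbs]; push_cast; rfl
  rw [hi, hqn] at hJ ⊢
  set j := Nat.log 2 n with hj
  have hjJ : j < J := by
    have h1 : n < J := by exact_mod_cast hJ
    exact (Nat.log_le_self 2 n).trans_lt h1
  have l1 : (2 : ℝ) ^ j ≤ n := by exact_mod_cast Nat.pow_log_le_self 2 hn0
  have l2 : (n : ℝ) < 2 ^ j * 2 := by
    rw [← pow_succ]; exact_mod_cast Nat.lt_pow_succ_log_self one_lt_two n
  have h1 : (2 : ℝ) ^ j * (2 - 2 * Real.cos (k i * (1 / 2) ^ j)) ≤ mult J k :=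
    (Finset.single_le_sum (f := fun j => (2 : ℝ) ^ j * (2 - 2 * Real.cos (k i * (1 / 2) ^ j)))
      (fun j _ => mul_nonneg (by positivity) (diff_symbol_nonneg _))
      (Finset.mem_range.2 hjJ)).trans
    (Finset.single_le_sum (f := fun i => ∑ j ∈ Finset.range J,
      (2 : ℝ) ^ j * (2 - 2 * Real.cos (k i * (1 / 2) ^ j)))
      (fun i _ => Finset.sum_nonneg fun j _ => mul_nonneg (by positivity) (diff_symbol_nonneg _))
      (Finset.mem_univ i))
  have h2 : Real.cos (k i * (1 / 2) ^ j) ≤ 2 / 3 := by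
    rw [← Real.cos_abs, abs_mul, hqn, abs_of_pos (by positivity : (0 : ℝ) < (1 / 2) ^ j)]
    refine (Real.cos_le_cos_of_nonneg_of_le_pi zero_le_one ?_ ?_).trans (Real.cos_one_le.trans (by norm_num))
    · rw [one_div, inv_pow, ← div_eq_mul_inv, div_le_iff₀ (by positivity)]
      have := Real.pi_gt_three
      have h5 : (0 : ℝ) < 2 ^ j := by positivity
      nlinarith
    · rw [one_div, inv_pow, ← div_eq_mul_inv, le_div_iff₀ (by positivity)]
      linarith
  have h3 : (2 : ℝ) ^ j * (2 / 3) ≤ mult J k :=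
    le_trans (mul_le_mul_of_nonneg_left (by linarith) (by positivity)) h1
  linarith

/-- For fixed `J` the multiplier is bounded, so it preserves H¹ and its product with `f(u)` is
integrable. The bound depends on `J` and serves only qualitatively. -/
theorem mult_le_const (J : ℕ) (k : Fin 3 → ℤ) : mult J k ≤ 12 * ∑ j ∈ Finset.range J, (2 : ℝ) ^ j := by
  calc mult J k ≤ ∑ _i : Fin 3, ∑ j ∈ Finset.range J, (2 : ℝ) ^ j * 4 :=
        Finset.sum_le_sum fun i _ => Finset.sum_le_sum fun j _ =>
          mul_le_mul_of_nonneg_left (diff_symbol_le_four _) (by positivity)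
    _ = _ := by rw [← Finset.sum_mul]; simp; ring

/-- The lower bound does not depend on `J`: each second difference costs `-K` times its own symbol,
and the symbols add up to `mult J k ≤ 30 nu k ≤ 30 nu k ^ 2`. -/
theorem Growth.exists_mult {f : ℝ → ℝ} {C K : ℝ} (hf : Growth f C) (hK0 : 0 ≤ K)
    (hK : ∀ u v, -K * (u - v) ^ 2 ≤ (f u - f v) * (u - v)) (J : ℕ) {u : L2} {R : ℝ}
    (hu : hs 2 (coef u) ≤ ENNReal.ofReal (R ^ 2)) :
    ∃ W : L2, (∀ k, coef W k = mult J k * coef u k) ∧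
      hs 2 (coef W) ≤ ENNReal.ofReal ((12 * (∑ j ∈ Finset.range J, (2 : ℝ) ^ j) * R) ^ 2) ∧
      -(30 * K * R ^ 2) ≤ ∫ x, f (u x) * W x := by
  have hut : hs 2 (coef u) < ⊤ := hu.trans_lt ENNReal.ofReal_lt_top
  set c := 12 * ∑ j ∈ Finset.range J, (2 : ℝ) ^ j with hc
  have hc0 : 0 ≤ c := by positivity
  have hW2 : hs 2 (fun k => mult J k * coef u k) ≤ ENNReal.ofReal ((c * R) ^ 2) := by
    rw [mul_pow, ENNReal.ofReal_mul (sq_nonneg c)]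
    refine le_trans (hs_le_of_abs_le (b := fun k => c * coef u k) fun k => ?_)
      ((hs_const_mul 2 c _).trans_le (mul_le_mul_right hu _))
    rw [abs_mul, abs_mul, abs_of_nonneg (mult_nonneg J k), abs_of_nonneg hc0]
    exact mul_le_mul_of_nonneg_right (mult_le_const J k) (abs_nonneg _)
  have hW2t := hW2.trans_lt ENNReal.ofReal_lt_top
  obtain ⟨W, hW⟩ := exists_coef_eq (a := fun k => mult J k * coef u k) (by
    simpa using summable_of_hs_lt_top ((hs_mono (by norm_num : 0 ≤ 2) _).trans_lt hW2t))
  have eW : coef W = fun k => mult J k * coef u k := funext hW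
  refine ⟨W, hW, by rw [eW]; exact hW2, ?_⟩
  have t1 := hf.tendsto_sum_coef_mul hut (w := W) (by rw [eW]; exact hW2t)
  have hsd : ∀ (i : Fin 3) (s : ℝ), hs 2 (coef (secondDiff i s u)) < ⊤ := fun i s => by
    have e : coef (secondDiff i s u) = fun k => (2 - 2 * Real.cos (k i * s)) * coef u k :=
      funext fun k => coef_secondDiff i s u k
    rw [e]
    refine lt_of_le_of_lt (hs_le_of_abs_le (b := fun k => 4 * coef u k) fun k => ?_)
      ((hs_const_mul 2 4 _).trans_lt (ENNReal.mul_lt_top ENNReal.ofReal_lt_top hut))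
    rw [abs_mul, abs_mul, abs_of_nonneg (diff_symbol_nonneg _), abs_of_nonneg (by norm_num : (0 : ℝ) ≤ 4)]
    exact mul_le_mul_of_nonneg_right (diff_symbol_le_four _) (abs_nonneg _)
  -- The pairing with `W` is identified with the combination of pairings with second differences
  -- because both are limits of the same box sums.
  have t2 : Tendsto (fun N => ∑ k ∈ box N, coef (fun x => f (u x)) k * coef W k) atTop
      (𝓝 (∑ i : Fin 3, ∑ j ∈ Finset.range J,
        (2 : ℝ) ^ j * ∫ x, f (u x) * secondDiff i ((1 / 2) ^ j) u x)) := by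
    refine (tendsto_finsetSum _ fun i _ => tendsto_finsetSum _ fun j _ =>
      (hf.tendsto_sum_coef_mul hut (hsd i ((1 / 2) ^ j))).const_mul ((2 : ℝ) ^ j)).congr fun N => ?_
    simp_rw [hW, mult, Finset.mul_sum, Finset.sum_mul, Finset.mul_sum]
    rw [Finset.sum_comm]
    simp_rw [coef_secondDiff]
    conv_rhs => rw [Finset.sum_comm]
    rw [Finset.sum_comm]
    refine Finset.sum_congr rfl fun i _ => ?_
    rw [Finset.sum_comm]
    refine Finset.sum_congr rfl fun k _ => Finset.sum_congr rfl fun j _ => ?_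
    ring
  rw [tendsto_nhds_unique t1 t2]
  have hsum : ∀ (i : Fin 3) (s : ℝ), Summable fun k : Fin 3 → ℤ =>
      (2 - 2 * Real.cos (k i * s)) * coef u k ^ 2 := fun i s =>
    Summable.of_nonneg_of_le (fun k => mul_nonneg (diff_symbol_nonneg _) (sq_nonneg _))
      (fun k => mul_le_mul_of_nonneg_right (diff_symbol_le_four _) (sq_nonneg _))
      ((hasSum_coef_sq u).summable.mul_left 4)
  have h1 : -K * ∑ i : Fin 3, ∑ j ∈ Finset.range J, (2 : ℝ) ^ j *
      ∑' k : Fin 3 → ℤ, (2 - 2 * Real.cos (k i * (1 / 2) ^ j)) * coef u k ^ 2 ≤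
      ∑ i : Fin 3, ∑ j ∈ Finset.range J,
        (2 : ℝ) ^ j * ∫ x, f (u x) * secondDiff i ((1 / 2) ^ j) u x := by
    rw [Finset.mul_sum]
    refine Finset.sum_le_sum fun i _ => ?_
    rw [Finset.mul_sum]
    refine Finset.sum_le_sum fun j _ => ?_
    rw [mul_left_comm]
    exact mul_le_mul_of_nonneg_left (hf.integral_mul_secondDiff_ge hK hut i _) (by positivity)
  refine le_trans ?_ h1
  have h2 : HasSum (fun k => mult J k * coef u k ^ 2) (∑ i : Fin 3, ∑ j ∈ Finset.range J, (2 : ℝ) ^ j *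
      ∑' k : Fin 3 → ℤ, (2 - 2 * Real.cos (k i * (1 / 2) ^ j)) * coef u k ^ 2) := by
    simp_rw [mult, Finset.sum_mul]
    refine hasSum_sum fun i _ => hasSum_sum fun j _ => ?_
    refine ((hsum i ((1 / 2) ^ j)).hasSum.mul_left ((2 : ℝ) ^ j)).congr_fun fun k => ?_
    ring
  have h3 : ∑ i : Fin 3, ∑ j ∈ Finset.range J, (2 : ℝ) ^ j *
      ∑' k : Fin 3 → ℤ, (2 - 2 * Real.cos (k i * (1 / 2) ^ j)) * coef u k ^ 2 ≤ 30 * R ^ 2 := by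
    refine hasSum_le_of_sum_le h2 fun s => ?_
    have h4 := (hs_le_ofReal_iff (by positivity)).1 hu s
    calc _ ≤ ∑ k ∈ s, 30 * (nu k ^ 2 * coef u k ^ 2) := Finset.sum_le_sum fun k _ => by
          have a1 := mult_le J k
          have a2 := one_le_nu k
          rw [← mul_assoc]
          exact mul_le_mul_of_nonneg_right (by nlinarith) (sq_nonneg _)
      _ ≤ _ := by rw [← Finset.mul_sum]; linarith
  have := mul_le_mul_of_nonneg_left h3 hK0
  linarith

/-! ### Additional regularity of energy solutions -/

theorem lintegral_hs {a : ℝ → (Fin 3 → ℤ) → ℝ} (ha : ∀ k, Continuous fun t => a t k) (n : ℕ) {T : ℝ}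
    (hT : 0 ≤ T) : ∫⁻ t in Ioo 0 T, hs n (a t) =
      ∑' k, ENNReal.ofReal (∫ t in (0 : ℝ)..T, nu k ^ n * a t k ^ 2) := by
  have hc : ∀ k, Continuous fun t => nu k ^ n * a t k ^ 2 := fun k =>
    ((ha k).pow 2).const_mul (nu k ^ n)
  unfold hs
  rw [lintegral_tsum fun k => (hc k).measurable.ennreal_ofReal.aemeasurable]
  refine tsum_congr fun k => ?_
  rw [intervalIntegral.integral_of_le hT, integral_Ioc_eq_integral_Ioo,
    ofReal_integral_eq_lintegral_ofReal]
  · exact ((hc k).integrableOn_Icc (a := 0) (b := T)).mono_set Ioo_subset_Icc_self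
  · exact Eventually.of_forall fun t => hs_term_nonneg n (a t) k

theorem lintegral_hs_le_iff {a : ℝ → (Fin 3 → ℤ) → ℝ} (ha : ∀ k, Continuous fun t => a t k) (n : ℕ)
    {T D : ℝ} (hT : 0 ≤ T) (hD : 0 ≤ D) : ∫⁻ t in Ioo 0 T, hs n (a t) ≤ ENNReal.ofReal D ↔
      ∀ s : Finset (Fin 3 → ℤ), ∑ k ∈ s, ∫ t in (0 : ℝ)..T, nu k ^ n * a t k ^ 2 ≤ D := by
  have h0 : ∀ k, 0 ≤ ∫ t in (0 : ℝ)..T, nu k ^ n * a t k ^ 2 := fun k =>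
    intervalIntegral.integral_nonneg hT fun t _ => hs_term_nonneg n (a t) k
  rw [lintegral_hs ha n hT, ENNReal.tsum_eq_iSup_sum, iSup_le_iff]
  refine forall_congr' fun s => ?_
  rw [← ENNReal.ofReal_sum_of_nonneg fun k _ => h0 k, ENNReal.ofReal_le_ofReal_iff hD]

section

variable {γ : ℝ} {f : ℝ → ℝ} {g : L2} {ξ : ℝ → EnergySpace} {C : ℝ}

/-- The equation multiplied by the coefficient of `u` itself. The damping term `γ |k| v p` is an
exact derivative and moves to the endpoints. -/
theorem ModeSolution.mode_identity (h : ModeSolution γ f g ξ) (hf : Growth f C) {T : ℝ} (hT : 0 ≤ T)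
    (k : Fin 3 → ℤ) :
    sqNorm k * ∫ t in (0 : ℝ)..T, coef (ξ t).pos k ^ 2 =
      (coef (ξ 0).vel k * coef (ξ 0).pos k + γ / 2 * absK k * coef (ξ 0).pos k ^ 2) -
      (coef (ξ T).vel k * coef (ξ T).pos k + γ / 2 * absK k * coef (ξ T).pos k ^ 2) +
      (∫ t in (0 : ℝ)..T, coef (ξ t).vel k ^ 2) -
      (∫ t in (0 : ℝ)..T, coef (fun x => f ((ξ t).pos x)) k * coef (ξ t).pos k) +
      ∫ t in (0 : ℝ)..T, coef g k * coef (ξ t).pos k := by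
  have cp := h.cont_pos k
  have cv := h.cont_vel k
  have cF := h.continuous_coef hf k
  have key := intervalIntegral.integral_eq_sub_of_hasDerivAt_of_le hT
    (f := fun t => coef (ξ t).vel k * coef (ξ t).pos k + γ / 2 * absK k * coef (ξ t).pos k ^ 2)
    (f' := fun t => coef (ξ t).vel k ^ 2 - sqNorm k * coef (ξ t).pos k ^ 2 -
      coef (fun x => f ((ξ t).pos x)) k * coef (ξ t).pos k + coef g k * coef (ξ t).pos k)
    (by fun_prop) (fun t ht => by
      have h1 := h.hasDerivAt_pos k t ht.1
      have h2 := h.hasDerivAt_vel k t ht.1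
      convert! (h2.mul h1).add ((h1.pow 2).const_mul (γ / 2 * absK k)) using 1
      simp only [Nat.cast_ofNat, Nat.add_one_sub_one, pow_one]
      ring)
    (Continuous.intervalIntegrable (by fun_prop) _ _)
  have i1 : IntervalIntegrable (fun t => coef (ξ t).vel k ^ 2) volume 0 T :=
    Continuous.intervalIntegrable (by fun_prop) _ _
  have i2 : IntervalIntegrable (fun t => sqNorm k * coef (ξ t).pos k ^ 2) volume 0 T :=
    Continuous.intervalIntegrable (by fun_prop) _ _
  have i3 : IntervalIntegrable (fun t => coef (fun x => f ((ξ t).pos x)) k * coef (ξ t).pos k)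
      volume 0 T := Continuous.intervalIntegrable (by fun_prop) _ _
  have i4 : IntervalIntegrable (fun t => coef g k * coef (ξ t).pos k) volume 0 T :=
    Continuous.intervalIntegrable (by fun_prop) _ _
  rw [intervalIntegral.integral_add ((i1.sub i2).sub i3) i4,
    intervalIntegral.integral_sub (i1.sub i2) i3, intervalIntegral.integral_sub i1 i2,
    intervalIntegral.integral_const_mul] at key
  linarith

theorem integral_le_const_mul {F : ℝ → ℝ} (hF : Continuous F) {T c : ℝ} (hT : 0 ≤ T)
    (h : ∀ t ∈ Icc 0 T, F t ≤ c) : ∫ t in (0 : ℝ)..T, F t ≤ T * c := by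
  have := intervalIntegral.integral_mono_on hT (hF.intervalIntegrable 0 T)
    (intervalIntegrable_const (c := c) (μ := volume)) (fun t ht => h t ht)
  simpa using this

/-- The mode identities are summed with weights `mult J`, a test of the equation with an
approximation of (-Δ)^{1/2}u. Since `mult J k ≤ 30 nu k`, the endpoint terms are bounded by the
energy norm and the velocity term by its L²H^{1/2} norm; the nonlinear term has a sign up to `30 K
R²`. The result is uniform in `J` and `N`. -/
theorem ModeSolution.exists_mult_bound (h : ModeSolution γ f g ξ) (hf : Growth f C) {K : ℝ}
    (hγ : 0 < γ) (hK0 : 0 ≤ K) (hK : ∀ u v, -K * (u - v) ^ 2 ≤ (f u - f v) * (u - v)) {T : ℝ}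
    (hT : 0 < T) : ∃ B, 0 ≤ B ∧ ∀ J N, ∑ k ∈ box N, mult J k *
      (sqNorm k * ∫ t in (0 : ℝ)..T, coef (ξ t).pos k ^ 2) ≤ B := by
  obtain ⟨R, hR, hb⟩ := h.exists_bound T
  have hp : ∀ t ≤ T, ∀ s : Finset (Fin 3 → ℤ), ∑ k ∈ s, nu k ^ 2 * coef (ξ t).pos k ^ 2 ≤ R ^ 2 :=
    fun t ht => (hs_le_ofReal_iff (by positivity)).1 (hb t ht).1
  have hv : ∀ t ≤ T, ∀ s : Finset (Fin 3 → ℤ), ∑ k ∈ s, nu k ^ 0 * coef (ξ t).vel k ^ 2 ≤ R ^ 2 :=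
    fun t ht => (hs_le_ofReal_iff (by positivity)).1 (hb t ht).2
  set D := (∫⁻ t in Ioo 0 T, hs 1 (coef (ξ t).vel)).toReal with hD
  have hDv := (lintegral_hs_le_iff h.cont_vel 1 hT.le (D := D) ENNReal.toReal_nonneg).1
    (by rw [hD, ENNReal.ofReal_toReal (h.dissip T).ne])
  have hD0 : 0 ≤ D := ENNReal.toReal_nonneg
  set B := 60 * (1 + γ) * R ^ 2 + 30 * D + T * (15 * (‖g‖ ^ 2 + R ^ 2)) + T * (30 * K * R ^ 2) with hB
  refine ⟨B, by positivity, fun J N0 => ?_⟩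
  have hend : ∀ t ≤ T, ∀ s : Finset (Fin 3 → ℤ), |∑ k ∈ s, mult J k *
      (coef (ξ t).vel k * coef (ξ t).pos k + γ / 2 * absK k * coef (ξ t).pos k ^ 2)| ≤
      30 * (1 + γ) * R ^ 2 := by
    intro t ht s
    refine (Finset.abs_sum_le_sum_abs _ _).trans ?_
    have hterm : ∀ k ∈ s, |mult J k *
        (coef (ξ t).vel k * coef (ξ t).pos k + γ / 2 * absK k * coef (ξ t).pos k ^ 2)| ≤
        15 * (nu k ^ 0 * coef (ξ t).vel k ^ 2) + (15 + 30 * γ) * (nu k ^ 2 * coef (ξ t).pos k ^ 2) := by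
      intro k _
      set v := coef (ξ t).vel k
      set p := coef (ξ t).pos k
      rw [abs_mul, abs_of_nonneg (mult_nonneg J k)]
      have a0 := nu_pos k
      have a1 : |v * p + γ / 2 * absK k * p ^ 2| ≤ |v| * |p| + γ * nu k * |p| ^ 2 := by
        refine (abs_add_le _ _).trans ?_
        rw [abs_mul, abs_of_nonneg (by have := absK_nonneg k; positivity : 0 ≤ γ / 2 * absK k * p ^ 2),
          sq_abs]
        have := absK_le_nu k
        have h2 : γ / 2 * absK k ≤ γ * nu k := by nlinarith
        have := mul_le_mul_of_nonneg_right h2 (sq_nonneg p)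
        linarith
      calc mult J k * |v * p + γ / 2 * absK k * p ^ 2| ≤
            30 * nu k * (|v| * |p| + γ * nu k * |p| ^ 2) :=
            mul_le_mul (mult_le J k) a1 (abs_nonneg _) (by positivity)
        _ ≤ _ := by
            rw [← sq_abs v, ← sq_abs p]
            nlinarith [sq_nonneg (|v| - nu k * |p|)]
    refine (Finset.sum_le_sum hterm).trans ?_
    rw [Finset.sum_add_distrib, ← Finset.mul_sum, ← Finset.mul_sum]
    have := hp t ht s
    have := hv t ht s
    nlinarith
  choose W hW1 hW2 hW3 using fun t : Iic T => hf.exists_mult hK0 hK J (hb t t.2).1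
  have hlim : Tendsto (fun N => ∫ t in (0 : ℝ)..T, ∑ k ∈ box N,
      mult J k * (coef (fun x => f ((ξ t).pos x)) k * coef (ξ t).pos k)) atTop
      (𝓝 (∫ t in (0 : ℝ)..T, if ht : t ≤ T then ∫ x, f ((ξ t).pos x) * W ⟨t, ht⟩ x else 0)) := by
    have hcW : 0 ≤ 12 * (∑ j ∈ Finset.range J, (2 : ℝ) ^ j) * R := by positivity
    have e : ∀ N, ∀ t (ht : t ≤ T), ∑ k ∈ box N, mult J k *
        (coef (fun x => f ((ξ t).pos x)) k * coef (ξ t).pos k) =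
        ∑ k ∈ box N, coef (fun x => f ((ξ t).pos x)) k * coef (W ⟨t, ht⟩) k := fun N t ht =>
      Finset.sum_congr rfl fun k _ => by rw [hW1]; ring
    refine intervalIntegral.tendsto_integral_filter_of_dominated_convergence
      (fun _ => C * (sobC * (1 + 2 * R ^ 5) * (12 * (∑ j ∈ Finset.range J, (2 : ℝ) ^ j) * R)))
      (Eventually.of_forall fun N => Continuous.aestronglyMeasurable
        (continuous_finsetSum _ fun k _ => continuous_const.mul
          ((h.continuous_coef hf k).mul (h.cont_pos k))))
      (Eventually.of_forall fun N => Eventually.of_forall fun t ht => ?_)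
      intervalIntegrable_const (Eventually.of_forall fun t ht => ?_)
    · rw [uIoc_of_le hT.le] at ht
      rw [e N t ht.2]
      exact hf.abs_sum_coef_mul_le hR.le hcW (hb t ht.2).1 (hW2 ⟨t, ht.2⟩) _
    · rw [uIoc_of_le hT.le] at ht
      rw [dif_pos ht.2]
      refine (hf.tendsto_sum_coef_mul (hs_lt_top_pos _)
        ((hW2 ⟨t, ht.2⟩).trans_lt ENNReal.ofReal_lt_top)).congr fun N => (e N t ht.2).symm
  have hlow : -(T * (30 * K * R ^ 2)) ≤
      ∫ t in (0 : ℝ)..T, if ht : t ≤ T then ∫ x, f ((ξ t).pos x) * W ⟨t, ht⟩ x else 0 := by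
    -- Measurability in time of the limit is not needed: if the function is not integrable, its
    -- integral is 0 by convention and the bound is trivial.
    by_cases hi : IntervalIntegrable (fun t => if ht : t ≤ T then
        ∫ x, f ((ξ t).pos x) * W ⟨t, ht⟩ x else 0) volume 0 T
    · have := intervalIntegral.integral_mono_on hT.le
        (intervalIntegrable_const (c := -(30 * K * R ^ 2))) hi (fun t ht => by
          rw [dif_pos ht.2]
          exact hW3 ⟨t, ht.2⟩)
      simp only [intervalIntegral.integral_const, smul_eq_mul, sub_zero] at this
      linarith
    · rw [intervalIntegral.integral_undef hi]
      have : 0 ≤ T * (30 * K * R ^ 2) := by positivity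
      linarith
  -- The left side keeps the modes of `box N0` while the right side uses a larger box, so that `N`
  -- can tend to infinity, where the sign of the nonlinear term becomes available.
  have hN : ∀ N, N0 ≤ N → ∑ k ∈ box N0, mult J k *
      (sqNorm k * ∫ t in (0 : ℝ)..T, coef (ξ t).pos k ^ 2) ≤
      60 * (1 + γ) * R ^ 2 + 30 * D + T * (15 * (‖g‖ ^ 2 + R ^ 2)) - ∫ t in (0 : ℝ)..T, ∑ k ∈ box N,
      mult J k * (coef (fun x => f ((ξ t).pos x)) k * coef (ξ t).pos k) := by
    intro N hN
    refine (Finset.sum_le_sum_of_subset_of_nonneg (box_mono hN) fun k _ _ =>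
      mul_nonneg (mult_nonneg J k) (mul_nonneg (sqNorm_nonneg k)
        (intervalIntegral.integral_nonneg hT.le fun t _ => sq_nonneg _))).trans ?_
    have hid : ∀ k, mult J k * (sqNorm k * ∫ t in (0 : ℝ)..T, coef (ξ t).pos k ^ 2) =
        mult J k * (coef (ξ 0).vel k * coef (ξ 0).pos k + γ / 2 * absK k * coef (ξ 0).pos k ^ 2) -
        mult J k * (coef (ξ T).vel k * coef (ξ T).pos k + γ / 2 * absK k * coef (ξ T).pos k ^ 2) +
        mult J k * (∫ t in (0 : ℝ)..T, coef (ξ t).vel k ^ 2) -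
        mult J k * (∫ t in (0 : ℝ)..T, coef (fun x => f ((ξ t).pos x)) k * coef (ξ t).pos k) +
        mult J k * (coef g k * ∫ t in (0 : ℝ)..T, coef (ξ t).pos k) := fun k => by
      rw [h.mode_identity hf hT.le, intervalIntegral.integral_const_mul]
      ring
    simp_rw [hid]
    have hcF : ∀ k, IntervalIntegrable (fun t => mult J k *
        (coef (fun x => f ((ξ t).pos x)) k * coef (ξ t).pos k)) volume 0 T := fun k =>
      (continuous_const.mul ((h.continuous_coef hf k).mul (h.cont_pos k))).intervalIntegrable _ _
    rw [intervalIntegral.integral_finsetSum fun k _ => hcF k]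
    simp_rw [intervalIntegral.integral_const_mul]
    rw [Finset.sum_add_distrib, Finset.sum_sub_distrib, Finset.sum_add_distrib,
      Finset.sum_sub_distrib]
    have e0 := (abs_le.1 (hend 0 hT.le (box N))).2
    have eT := (abs_le.1 (hend T le_rfl (box N))).1
    have ev : ∑ k ∈ box N, mult J k * ∫ t in (0 : ℝ)..T, coef (ξ t).vel k ^ 2 ≤ 30 * D := by
      refine le_trans (Finset.sum_le_sum fun k _ => ?_)
        ((Finset.mul_sum (box N) _ (30 : ℝ)).symm.le.trans
          (mul_le_mul_of_nonneg_left (hDv (box N)) (by norm_num)))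
      rw [intervalIntegral.integral_const_mul, pow_one, ← mul_assoc]
      exact mul_le_mul_of_nonneg_right (mult_le J k)
        (intervalIntegral.integral_nonneg hT.le fun t _ => sq_nonneg _)
    have eg : ∑ k ∈ box N, mult J k * (coef g k * ∫ t in (0 : ℝ)..T, coef (ξ t).pos k) ≤
        T * (15 * (‖g‖ ^ 2 + R ^ 2)) := by
      have e1 : ∑ k ∈ box N, mult J k * (coef g k * ∫ t in (0 : ℝ)..T, coef (ξ t).pos k) =
          ∫ t in (0 : ℝ)..T, ∑ k ∈ box N, mult J k * (coef g k * coef (ξ t).pos k) := by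
        rw [intervalIntegral.integral_finsetSum
          (f := fun k t => mult J k * (coef g k * coef (ξ t).pos k)) fun k _ => (continuous_const.mul
          (continuous_const.mul (h.cont_pos k))).intervalIntegrable _ _]
        simp_rw [intervalIntegral.integral_const_mul]
      rw [e1]
      refine integral_le_const_mul (continuous_finsetSum _ fun k _ => continuous_const.mul
          (continuous_const.mul (h.cont_pos k))) hT.le fun t ht => ?_
      have hterm : ∀ k ∈ box N, mult J k * (coef g k * coef (ξ t).pos k) ≤
          15 * (coef g k ^ 2) + 15 * (nu k ^ 2 * coef (ξ t).pos k ^ 2) := by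
        intro k _
        set p := coef (ξ t).pos k
        have a0 := nu_pos k
        calc mult J k * (coef g k * p) ≤ mult J k * (|coef g k| * |p|) := by
              rw [← abs_mul]
              exact mul_le_mul_of_nonneg_left (le_abs_self _) (mult_nonneg J k)
          _ ≤ 30 * nu k * (|coef g k| * |p|) :=
              mul_le_mul_of_nonneg_right (mult_le J k) (by positivity)
          _ ≤ _ := by
              rw [← sq_abs (coef g k), ← sq_abs p]
              nlinarith [sq_nonneg (|coef g k| - nu k * |p|)]
      refine (Finset.sum_le_sum hterm).trans ?_
      rw [Finset.sum_add_distrib, ← Finset.mul_sum, ← Finset.mul_sum]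
      have := hp t ht.2 (box N)
      have := sum_le_hasSum (box N) (fun k _ => sq_nonneg _) (hasSum_coef_sq g)
      linarith
    linarith
  have := ge_of_tendsto (tendsto_const_nhds.sub hlim)
    (eventually_atTop.2 ⟨N0, fun N h => hN N h⟩)
  linarith

/-- The half derivative gained over the energy space: on `box N` the symbol `mult (N + 1)` dominates
`‖k‖ / 3`, so the weighted bound controls the H^{3/2} norm. -/
theorem ModeSolution.lintegral_hs_three_lt_top (h : ModeSolution γ f g ξ) (hf : Growth f C) {K : ℝ}
    (hγ : 0 < γ) (hK0 : 0 ≤ K) (hK : ∀ u v, -K * (u - v) ^ 2 ≤ (f u - f v) * (u - v)) (T : ℝ) :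
    ∫⁻ t in Ioo 0 T, hs 3 (coef (ξ t).pos) < ⊤ := by
  rcases le_or_gt T 0 with hT | hT
  · rw [Ioo_eq_empty (not_lt.2 hT)]; simp
  obtain ⟨B, hB0, hB⟩ := h.exists_mult_bound hf hγ hK0 hK hT
  obtain ⟨R, hR, hb⟩ := h.exists_bound T
  refine lt_of_le_of_lt ((lintegral_hs_le_iff h.cont_pos 3 hT.le
    (D := 4 * (T * R ^ 2) + 12 * B) (by positivity)).2 fun s => ?_) ENNReal.ofReal_lt_top
  obtain ⟨N, hN⟩ := exists_subset_box s
  have h0 : ∀ k, 0 ≤ ∫ t in (0 : ℝ)..T, coef (ξ t).pos k ^ 2 := fun k =>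
    intervalIntegral.integral_nonneg hT.le fun t _ => sq_nonneg _
  have hterm : ∀ k ∈ box N, ∫ t in (0 : ℝ)..T, nu k ^ 3 * coef (ξ t).pos k ^ 2 ≤
      4 * (∫ t in (0 : ℝ)..T, coef (ξ t).pos k ^ 2) + 12 * (mult (N + 1) k *
      (sqNorm k * ∫ t in (0 : ℝ)..T, coef (ξ t).pos k ^ 2)) := by
    intro k hk
    rw [intervalIntegral.integral_const_mul]
    have h1 : ‖k‖ ≤ 3 * mult (N + 1) k := norm_le_mult (by
      push_cast; linarith [mem_box.1 hk])
    have h2 := norm_sq_le_sqNorm k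
    -- From `(1 + x)³ ≤ 4 (1 + x³)` and `x³ ≤ 3 mult * sqNorm` with `x = ‖k‖`.
    have h3 : nu k ^ 3 ≤ 4 + 12 * (mult (N + 1) k * sqNorm k) := by
      have hn := norm_nonneg k
      have h4 : ‖k‖ * ‖k‖ ^ 2 ≤ 3 * mult (N + 1) k * sqNorm k :=
        mul_le_mul h1 h2 (by positivity) (by linarith)
      unfold nu
      nlinarith [mul_nonneg (by linarith : 0 ≤ 1 + ‖k‖) (sq_nonneg (1 - ‖k‖))]
    nlinarith [h0 k]
  calc _ ≤ ∑ k ∈ box N, ∫ t in (0 : ℝ)..T, nu k ^ 3 * coef (ξ t).pos k ^ 2 :=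
        Finset.sum_le_sum_of_subset_of_nonneg hN fun k _ _ =>
          intervalIntegral.integral_nonneg hT.le fun t _ => hs_term_nonneg 3 (coef (ξ t).pos) k
    _ ≤ _ := (Finset.sum_le_sum hterm)
    _ ≤ _ := by
        rw [Finset.sum_add_distrib, ← Finset.mul_sum, ← Finset.mul_sum]
        have h5 : ∑ k ∈ box N, ∫ t in (0 : ℝ)..T, coef (ξ t).pos k ^ 2 ≤ T * R ^ 2 := by
          rw [← intervalIntegral.integral_finsetSum (f := fun k t => coef (ξ t).pos k ^ 2) fun k _ =>
            ((h.cont_pos k).pow 2).intervalIntegrable _ _]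
          refine integral_le_const_mul (continuous_finsetSum _ fun k _ => (h.cont_pos k).pow 2)
            hT.le fun t ht => ?_
          have := (hs_le_ofReal_iff (by positivity)).1
            ((hs_mono (by norm_num : 0 ≤ 2) _).trans (hb t ht.2).1) (box N)
          simpa using this
        linarith [hB (N + 1) N]

end

/-! ### A Gronwall inequality with an integrable weight -/

/-- By absolute continuity of the integral there is a step length over which `b` has mass at most
1/2. On each successive step the supremum `S` of `G` is finite and satisfies `S ≤ S / 2`. No
measurability of `G` is used. -/
theorem eq_zero_of_le_lintegral_mul {G b : ℝ → ℝ≥0∞} {T : ℝ} {M : ℝ≥0∞} (hM : M ≠ ⊤)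
    (hG : ∀ t ∈ Icc 0 T, G t ≤ M) (hb : ∫⁻ t in Ioo 0 T, b t ≠ ⊤)
    (h : ∀ t ∈ Icc 0 T, G t ≤ ∫⁻ s in Ioo 0 t, b s * G s) : ∀ t ∈ Icc 0 T, G t = 0 := by
  obtain ⟨δ, hδ, hδb⟩ := exists_pos_setLIntegral_lt_of_measure_lt hb (ε := 1 / 2) (by simp)
  obtain ⟨d, hd0, hd⟩ : ∃ d : ℝ, 0 < d ∧ ENNReal.ofReal d < δ := by
    obtain ⟨d, h1, h2⟩ := ENNReal.lt_iff_exists_nnreal_btwn.1 hδ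
    refine ⟨d, by exact_mod_cast h1, by simpa using h2⟩
  have step : ∀ n : ℕ, ∀ t ∈ Icc 0 T, t ≤ n * d → G t = 0 := by
    intro n
    induction n with
    | zero =>
      intro t ht hn
      have : t = 0 := le_antisymm (by simpa using hn) ht.1
      simpa [this] using h t ht
    | succ n ih =>
      set I := Icc 0 T ∩ Iic ((n + 1 : ℕ) * d) with hI
      set S := ⨆ t ∈ I, G t with hS
      have hSM : S ≤ M := iSup₂_le fun t ht => hG t ht.1
      have hle : ∀ t ∈ I, G t ≤ S := fun t ht => le_iSup₂ (f := fun t (_ : t ∈ I) => G t) t ht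
      have hhalf : S ≤ 1 / 2 * S := by
        refine iSup₂_le fun t ht => (h t ht.1).trans ?_
        have hst : ∀ s ∈ Ioo 0 t, b s * G s ≤ (Ioo (n * d) t).indicator (fun s => S * b s) s := by
          intro s hs
          by_cases hsn : s ≤ n * d
          · rw [ih s ⟨hs.1.le, hs.2.le.trans ht.1.2⟩ hsn]; simp
          · rw [indicator_of_mem (show s ∈ Ioo (n * d) t from ⟨not_le.1 hsn, hs.2⟩), mul_comm]
            exact mul_le_mul_left (hle s ⟨⟨hs.1.le, hs.2.le.trans ht.1.2⟩, hs.2.le.trans ht.2⟩) _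
        refine (setLIntegral_mono' measurableSet_Ioo hst).trans ?_
        have hsub : Ioo (n * d) t ⊆ Ioo 0 T := fun s hs =>
          ⟨lt_of_le_of_lt (by positivity) hs.1, hs.2.trans_le ht.1.2⟩
        calc ∫⁻ s in Ioo 0 t, (Ioo (n * d) t).indicator (fun s => S * b s) s
            ≤ ∫⁻ s, (Ioo (n * d) t).indicator (fun s => S * b s) s := setLIntegral_le_lintegral _ _
          _ = S * ∫⁻ s in Ioo (n * d) t, b s := by
              rw [lintegral_indicator measurableSet_Ioo,
                lintegral_const_mul' _ _ (hSM.trans_lt hM.lt_top).ne]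
          _ ≤ S * (1 / 2) := by
              refine mul_le_mul_right ?_ S
              have h1 := hδb (Ioo (n * d) t) (by
                refine lt_of_le_of_lt (Measure.restrict_apply_le _ _) ?_
                rw [Real.volume_Ioo]
                refine lt_of_le_of_lt (ENNReal.ofReal_le_ofReal ?_) hd
                have := ht.2
                rw [mem_Iic] at this
                push_cast at this
                linarith)
              rw [Measure.restrict_restrict measurableSet_Ioo, inter_eq_left.2 hsub] at h1
              exact h1.le
          _ = 1 / 2 * S := mul_comm _ _
      have hS0 : S = 0 := by
        by_contra h0
        have : 1 / 2 * S < S := by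
          rw [one_div, mul_comm, ← div_eq_mul_inv]
          exact ENNReal.half_lt_self h0 (hSM.trans_lt hM.lt_top).ne
        exact absurd hhalf (not_le.2 this)
      intro t ht hn
      exact le_antisymm ((hle t ⟨ht, hn⟩).trans_eq hS0) zero_le
  intro t ht
  obtain ⟨n, hn⟩ := exists_nat_ge (t / d)
  exact step n t ht ((div_le_iff₀ hd0).1 hn)

theorem ofReal_integral_le_lintegral {F : ℝ → ℝ} (hF : Continuous F) {t : ℝ} (ht : 0 ≤ t) :
    ENNReal.ofReal (∫ s in (0 : ℝ)..t, F s) ≤ ∫⁻ s in Ioo 0 t, ENNReal.ofReal (F s) := by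
  rw [intervalIntegral.integral_of_le ht, integral_Ioc_eq_integral_Ioo]
  have hi : IntegrableOn F (Ioo 0 t) := (hF.integrableOn_Icc).mono_set Ioo_subset_Icc_self
  rw [← ofReal_integral_eq_lintegral_ofReal (f := fun s => max (F s) 0) hi.pos_part
    (Eventually.of_forall fun s => le_max_right _ _) |>.trans (lintegral_congr fun s => by
      rcases le_total (F s) 0 with h | h
      · rw [max_eq_right h, ENNReal.ofReal_zero, ENNReal.ofReal_of_nonpos h]
      · rw [max_eq_left h])]
  exact ENNReal.ofReal_le_ofReal (integral_mono hi hi.pos_part fun s => le_max_left _ _)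

/-! ### Uniqueness -/


/-- The trilinear estimate in terms of coefficients. -/
theorem Growth.abs_sum_sub_mul_le {f : ℝ → ℝ} {C : ℝ} (hf : Growth f C) {u w : L2}
    {R Q A B : ℝ} (hR : 0 ≤ R) (hQ : 0 ≤ Q) (hA : 0 ≤ A) (hB : 0 ≤ B)
    (hu : hs 2 (coef u) ≤ ENNReal.ofReal (R ^ 2)) (hw : hs 2 (coef w) ≤ ENNReal.ofReal (R ^ 2))
    (hu3 : hs 3 (coef u) ≤ ENNReal.ofReal (Q ^ 2)) (hw3 : hs 3 (coef w) ≤ ENNReal.ofReal (Q ^ 2))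
    (hd : hs 2 (fun k => coef u k - coef w k) ≤ ENNReal.ofReal (A ^ 2))
    (s : Finset (Fin 3 → ℤ)) (b : (Fin 3 → ℤ) → ℝ) (hb : hs 1 (coef (trigL s b)) ≤ ENNReal.ofReal (B ^ 2)) :
    |∑ k ∈ s, (coef (fun x => f (u x)) k - coef (fun x => f (w x)) k) * b k| ≤
      C * (sobC * (1 + 2 * R ^ 3 * Q) * A * B) := by
  have hiu := hf.integrable (hu.trans_lt ENNReal.ofReal_lt_top)
  have hiw := hf.integrable (hw.trans_lt ENNReal.ofReal_lt_top)
  have e : (fun k => coef u k - coef w k) = coef (u - w : L2) := by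
    ext k; rw [coef_Lp_sub]
  rw [e] at hd
  obtain ⟨h1, h2⟩ := growth_four_mul hR hQ hA hB hu hw hu3 hw3 hd hb
  simp_rw [← coef_sub hiu hiw]
  rw [← integral_mul_trigL (h := fun x => f (u x) - f (w x)) (hiu.sub hiw), ← Real.norm_eq_abs]
  refine (norm_integral_le_of_norm_le (h1.const_mul C) ?_).trans ?_
  · filter_upwards [Lp.coeFn_sub u w] with x hx
    rw [norm_mul, Real.norm_eq_abs, Real.norm_eq_abs, hx, Pi.sub_apply, ← mul_assoc, ← mul_assoc]
    exact mul_le_mul_of_nonneg_right (hf.lip _ _) (abs_nonneg _)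
  · rw [integral_const_mul]
    exact mul_le_mul_of_nonneg_left h2 hf.pos.le

theorem hs_trigL_eq (n : ℕ) (s : Finset (Fin 3 → ℤ)) (a : (Fin 3 → ℤ) → ℝ) :
    hs n (coef (trigL s a)) = ENNReal.ofReal (∑ k ∈ s, nu k ^ n * a k ^ 2) := by
  rw [hs, tsum_eq_sum (s := s), ENNReal.ofReal_sum_of_nonneg fun k _ => hs_term_nonneg n a k]
  · refine Finset.sum_congr rfl fun k hk => ?_
    rw [coef_trigL, if_pos hk]
  · intro k hk
    rw [coef_trigL, if_neg hk]; simp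

theorem exists_sq_eq {n : ℕ} {a : (Fin 3 → ℤ) → ℝ} (h : hs n a ≠ ⊤) :
    ∃ A, 0 ≤ A ∧ hs n a = ENNReal.ofReal (A ^ 2) :=
  ⟨Real.sqrt (hs n a).toReal, Real.sqrt_nonneg _, by
    rw [Real.sq_sqrt ENNReal.toReal_nonneg, ENNReal.ofReal_toReal h]⟩

/-- Young's inequality with the damping coefficient in front of `B²`, followed by `(1 + y)² ≤ 2 +
2y²` with `y = 2R³Q`. Only `Q²`, which is integrable in time, survives. -/
theorem weighted_young {γ c R Q A B : ℝ} (hγ : 0 < γ) : (c * (1 + 2 * R ^ 3 * Q) * A) * B ≤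
    γ * B ^ 2 + c ^ 2 / (4 * γ) * (2 + 8 * R ^ 6 * Q ^ 2) * A ^ 2 := by
  have y2 : (c * (1 + 2 * R ^ 3 * Q) * A) * B ≤
      γ * B ^ 2 + (c * (1 + 2 * R ^ 3 * Q) * A) ^ 2 / (4 * γ) := by
    set X := c * (1 + 2 * R ^ 3 * Q) * A
    have : γ * B ^ 2 + X ^ 2 / (4 * γ) - X * B = (2 * γ * B - X) ^ 2 / (4 * γ) := by
      field_simp; ring
    have : 0 ≤ (2 * γ * B - X) ^ 2 / (4 * γ) := by positivity
    linarith
  have y3 : (1 + 2 * R ^ 3 * Q) ^ 2 ≤ 2 + 8 * R ^ 6 * Q ^ 2 := by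
    nlinarith [sq_nonneg (1 - 2 * R ^ 3 * Q)]
  have y4 : (c * (1 + 2 * R ^ 3 * Q) * A) ^ 2 / (4 * γ) ≤
      c ^ 2 / (4 * γ) * (2 + 8 * R ^ 6 * Q ^ 2) * A ^ 2 := by
    have : (c * (1 + 2 * R ^ 3 * Q) * A) ^ 2 / (4 * γ) =
      c ^ 2 / (4 * γ) * (1 + 2 * R ^ 3 * Q) ^ 2 * A ^ 2 := by ring
    rw [this]
    gcongr
  linarith

/-- Collects the remaining terms into a weight `L (1 + Q²)` times the energy of the difference; the
difference of the two sides is a sum of nonnegative products. -/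
theorem weight_le {γ m R Q A A' : ℝ} (hγ : 0 ≤ γ) (hm : 0 ≤ m) :
    (1 + γ) * (A ^ 2 + A' ^ 2) + m * (2 + 8 * R ^ 6 * Q ^ 2) * A ^ 2 ≤
      (1 + γ + m * (2 + 8 * R ^ 6)) * (1 + Q ^ 2) * (A ^ 2 + A' ^ 2) := by
  have e : (1 + γ + m * (2 + 8 * R ^ 6)) * (1 + Q ^ 2) * (A ^ 2 + A' ^ 2) -
      ((1 + γ) * (A ^ 2 + A' ^ 2) + m * (2 + 8 * R ^ 6 * Q ^ 2) * A ^ 2) =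
      (1 + γ) * Q ^ 2 * (A ^ 2 + A' ^ 2) + m * (2 + 8 * R ^ 6) * (1 + Q ^ 2) * A' ^ 2 +
      m * (8 * R ^ 6 + 2 * Q ^ 2) * A ^ 2 := by ring
  have : 0 ≤ (1 + γ) * Q ^ 2 * (A ^ 2 + A' ^ 2) + m * (2 + 8 * R ^ 6) * (1 + Q ^ 2) * A' ^ 2 +
      m * (8 * R ^ 6 + 2 * Q ^ 2) * A ^ 2 := by positivity
  linarith

section

variable {γ : ℝ} {f : ℝ → ℝ} {g : L2} {ξ η : ℝ → EnergySpace} {C : ℝ}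

-- Energy estimate for the difference of two solutions. The nonlinear difference is paired with the
-- velocity difference by the trilinear estimate; the H^{1/2} norm of the latter is absorbed by the
-- damping, and what remains is a Gronwall inequality whose weight involves the integrable squared
-- H^{3/2} norms.
set_option maxHeartbeats 1000000 in
theorem ModeSolution.eqOn (h : ModeSolution γ f g ξ) (h' : ModeSolution γ f g η) (hf : Growth f C)
    {K : ℝ} (hγ : 0 < γ) (hK0 : 0 ≤ K) (hK : ∀ u v, -K * (u - v) ^ 2 ≤ (f u - f v) * (u - v))
    (h0 : ξ 0 = η 0) {T : ℝ} (hT : 0 ≤ T) : ξ T = η T := by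
  set p := fun t k => coef (ξ t).pos k - coef (η t).pos k with hp
  set q := fun t k => coef (ξ t).vel k - coef (η t).vel k with hq
  set d := fun t k => coef (fun x => f ((ξ t).pos x)) k - coef (fun x => f ((η t).pos x)) k with hd
  have cp : ∀ k, Continuous fun t => p t k := fun k => (h.cont_pos k).sub (h'.cont_pos k)
  have cq : ∀ k, Continuous fun t => q t k := fun k => (h.cont_vel k).sub (h'.cont_vel k)
  have cd : ∀ k, Continuous fun t => d t k := fun k =>
    (h.continuous_coef hf k).sub (h'.continuous_coef hf k)
  obtain ⟨R1, hR1, hb1⟩ := h.exists_bound T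
  obtain ⟨R2, hR2, hb2⟩ := h'.exists_bound T
  set R := max R1 R2
  have hR0 : 0 < R := hR1.trans_le (le_max_left _ _)
  have hb : ∀ t ≤ T, (hs 2 (coef (ξ t).pos) ≤ ENNReal.ofReal (R ^ 2) ∧
      hs 0 (coef (ξ t).vel) ≤ ENNReal.ofReal (R ^ 2)) ∧ hs 2 (coef (η t).pos) ≤ ENNReal.ofReal (R ^ 2) ∧
      hs 0 (coef (η t).vel) ≤ ENNReal.ofReal (R ^ 2) := by
    intro t ht
    have e1 : ENNReal.ofReal (R1 ^ 2) ≤ ENNReal.ofReal (R ^ 2) :=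
      ENNReal.ofReal_le_ofReal (pow_le_pow_left₀ hR1.le (le_max_left _ _) 2)
    have e2 : ENNReal.ofReal (R2 ^ 2) ≤ ENNReal.ofReal (R ^ 2) :=
      ENNReal.ofReal_le_ofReal (pow_le_pow_left₀ hR2.le (le_max_right _ _) 2)
    exact ⟨⟨(hb1 t ht).1.trans e1, (hb1 t ht).2.trans e1⟩, (hb2 t ht).1.trans e2,
      (hb2 t ht).2.trans e2⟩
  set c := C * sobC with hc
  have hc0 : 0 < c := mul_pos hf.pos sobC_pos
  set L := 1 + γ + c ^ 2 / (4 * γ) * (2 + 8 * R ^ 6) with hL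
  have hL0 : 0 < L := by positivity
  set G := fun t => hs 2 (p t) + hs 0 (q t) with hG
  set b := fun t => ENNReal.ofReal (8 * L) * (1 + (hs 3 (coef (ξ t).pos) + hs 3 (coef (η t).pos)))
    with hbdef
  have m1 := measurable_hs h.cont_pos 3
  have m2 := measurable_hs h'.cont_pos 3
  have hbint : ∫⁻ t in Ioo 0 T, b t ≠ ⊤ := by
    rw [hbdef, lintegral_const_mul' _ _ ENNReal.ofReal_ne_top,
      lintegral_add_left measurable_const, lintegral_add_left m1]
    refine ENNReal.mul_ne_top ENNReal.ofReal_ne_top (ENNReal.add_ne_top.2 ⟨by simp,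
      ENNReal.add_ne_top.2 ⟨(h.lintegral_hs_three_lt_top hf hγ hK0 hK T).ne,
      (h'.lintegral_hs_three_lt_top hf hγ hK0 hK T).ne⟩⟩)
  have hGM : ∀ t ∈ Icc 0 T, G t ≤ ENNReal.ofReal ((2 * R) ^ 2) + ENNReal.ofReal ((2 * R) ^ 2) := by
    intro t ht
    obtain ⟨⟨b1, b2⟩, b3, b4⟩ := hb t ht.2
    exact add_le_add (hs_sub_le_ofReal b1 b3) (hs_sub_le_ofReal b2 b4)
  -- The estimate is made for finitely many modes, where the energy is differentiable, with a right
  -- side that does not depend on `N`. The `+ 1` beside `sqNorm k` keeps the mean under control.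
  have key : ∀ N : ℕ, ∀ t ∈ Icc 0 T, ENNReal.ofReal (∑ k ∈ box N,
      (1 / 2 * q t k ^ 2 + (sqNorm k + 1) / 2 * p t k ^ 2)) ≤
      ∫⁻ s in Ioo 0 t, ENNReal.ofReal L *
        (1 + (hs 3 (coef (ξ s).pos) + hs 3 (coef (η s).pos))) * G s := by
    intro N t ht
    set F := fun t => ∑ k ∈ box N, (-(γ * absK k * q t k ^ 2) + p t k * q t k - d t k * q t k) with hF
    have cF : Continuous F := continuous_finsetSum _ fun k _ => by
      have := cp k; have := cq k; have := cd k
      fun_prop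
    have hFTC := intervalIntegral.integral_eq_sub_of_hasDerivAt_of_le ht.1
      (f := fun t => ∑ k ∈ box N, (1 / 2 * q t k ^ 2 + (sqNorm k + 1) / 2 * p t k ^ 2)) (f' := F)
      (continuous_finsetSum _ fun k _ => by
        have := cp k; have := cq k
        fun_prop).continuousOn (fun s hs => by
          refine HasDerivAt.fun_sum fun k _ => ?_
          have h1 := (h.hasDerivAt_pos k s hs.1).sub (h'.hasDerivAt_pos k s hs.1)
          have h2 := (h.hasDerivAt_vel k s hs.1).sub (h'.hasDerivAt_vel k s hs.1)
          have h3 := ((h2.pow 2).const_mul (1 / 2)).add ((h1.pow 2).const_mul ((sqNorm k + 1) / 2))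
          refine h3.congr_deriv ?_
          simp only [hp, hq, hd, Pi.sub_apply, Nat.cast_ofNat, Nat.add_one_sub_one, pow_one]
          ring) (cF.intervalIntegrable _ _)
    have z : ∑ k ∈ box N, (1 / 2 * q 0 k ^ 2 + (sqNorm k + 1) / 2 * p 0 k ^ 2) = 0 :=
      Finset.sum_eq_zero fun k _ => by simp [hp, hq, h0]
    rw [z, sub_zero] at hFTC
    rw [← hFTC]
    refine (ofReal_integral_le_lintegral cF ht.1).trans (lintegral_mono_ae ?_)
    have hsub : Ioo 0 t ⊆ Ioo 0 T := Ioo_subset_Ioo_right ht.2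
    have f1 := ae_restrict_of_ae_restrict_of_subset hsub
      (ae_lt_top m1 (h.lintegral_hs_three_lt_top hf hγ hK0 hK T).ne)
    have f2 := ae_restrict_of_ae_restrict_of_subset hsub
      (ae_lt_top m2 (h'.lintegral_hs_three_lt_top hf hγ hK0 hK T).ne)
    filter_upwards [f1, f2, ae_restrict_mem measurableSet_Ioo] with s s1 s2 hs'
    have hsT : s ≤ T := hs'.2.le.trans ht.2
    obtain ⟨⟨b1, b2⟩, b3, b4⟩ := hb s hsT
    obtain ⟨A, hA, eA⟩ := exists_sq_eq (((hs_sub_le_ofReal b1 b3).trans_lt ENNReal.ofReal_lt_top).ne)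
    obtain ⟨A', hA', eA'⟩ := exists_sq_eq (((hs_sub_le_ofReal b2 b4).trans_lt ENNReal.ofReal_lt_top).ne)
    obtain ⟨Q1, hQ1, eQ1⟩ := exists_sq_eq s1.ne
    obtain ⟨Q2, hQ2, eQ2⟩ := exists_sq_eq s2.ne
    set Q := Real.sqrt (Q1 ^ 2 + Q2 ^ 2) with hQ
    have hQ0 : 0 ≤ Q := Real.sqrt_nonneg _
    have hQsq : Q ^ 2 = Q1 ^ 2 + Q2 ^ 2 := Real.sq_sqrt (by positivity)
    set B := Real.sqrt (∑ k ∈ box N, nu k ^ 1 * q s k ^ 2) with hB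
    have hB0 : 0 ≤ B := Real.sqrt_nonneg _
    have hBsq : B ^ 2 = ∑ k ∈ box N, nu k ^ 1 * q s k ^ 2 :=
      Real.sq_sqrt (Finset.sum_nonneg fun k _ => hs_term_nonneg 1 (q s) k)
    have tri := hf.abs_sum_sub_mul_le hR0.le hQ0 hA hB0 b1 b3
      (eQ1.le.trans (ENNReal.ofReal_le_ofReal (by nlinarith)))
      (eQ2.le.trans (ENNReal.ofReal_le_ofReal (by nlinarith))) eA.le (box N) (q s)
      (by rw [hs_trigL_eq, hBsq])
    have p2 := (hs_le_ofReal_iff (sq_nonneg A)).1 ((hs_mono (by norm_num : 0 ≤ 2) (p s)).trans eA.le) (box N)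
    have q2 : ∑ k ∈ box N, nu k ^ 0 * q s k ^ 2 ≤ A' ^ 2 :=
      (hs_le_ofReal_iff (sq_nonneg A')).1 eA'.le (box N)
    -- The damping provides only the homogeneous part `|k|`; the low-frequency rest is paid for by
    -- the L² norm of the velocity difference.
    have hBle : B ^ 2 ≤ ∑ k ∈ box N, nu k ^ 0 * q s k ^ 2 + ∑ k ∈ box N, absK k * q s k ^ 2 := by
      rw [hBsq, ← Finset.sum_add_distrib]
      refine Finset.sum_le_sum fun k _ => ?_
      rw [pow_one, pow_zero, ← add_mul]
      refine mul_le_mul_of_nonneg_right ?_ (sq_nonneg _)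
      unfold nu; linarith [norm_le_absK k]
    have hFle : F s ≤ L * (1 + Q ^ 2) * (A ^ 2 + A' ^ 2) := by
      have e1 : F s = -(γ * ∑ k ∈ box N, absK k * q s k ^ 2) + ∑ k ∈ box N, p s k * q s k -
          ∑ k ∈ box N, d s k * q s k := by
        rw [hF]
        simp only
        rw [Finset.sum_sub_distrib, Finset.sum_add_distrib, Finset.sum_neg_distrib, Finset.mul_sum]
        simp_rw [mul_assoc]
      have e2 : ∑ k ∈ box N, p s k * q s k ≤ 1 / 2 * ∑ k ∈ box N, nu k ^ 0 * p s k ^ 2 +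
          1 / 2 * ∑ k ∈ box N, nu k ^ 0 * q s k ^ 2 := by
        rw [Finset.mul_sum, Finset.mul_sum, ← Finset.sum_add_distrib]
        refine Finset.sum_le_sum fun k _ => ?_
        nlinarith [sq_nonneg (p s k - q s k)]
      have e3 : -(C * (sobC * (1 + 2 * R ^ 3 * Q) * A * B)) ≤ ∑ k ∈ box N, d s k * q s k :=
        (abs_le.1 tri).1
      have e4 : C * (sobC * (1 + 2 * R ^ 3 * Q) * A * B) ≤
          γ * B ^ 2 + c ^ 2 / (4 * γ) * (2 + 8 * R ^ 6 * Q ^ 2) * A ^ 2 := by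
        rw [show C * (sobC * (1 + 2 * R ^ 3 * Q) * A * B) = (c * (1 + 2 * R ^ 3 * Q) * A) * B by
          rw [hc]; ring]
        exact weighted_young hγ
      have e5 : L * (1 + Q ^ 2) * (A ^ 2 + A' ^ 2) ≥ (1 + γ) * (A ^ 2 + A' ^ 2) +
          c ^ 2 / (4 * γ) * (2 + 8 * R ^ 6 * Q ^ 2) * A ^ 2 := by
        rw [hL]
        exact weight_le hγ.le (by positivity)
      rw [e1]
      have e6 := mul_le_mul_of_nonneg_left hBle hγ.le
      have e7 := mul_le_mul_of_nonneg_left q2 hγ.le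
      linarith [e2, e3, e4, e5, e6, e7, p2, q2, sq_nonneg A, sq_nonneg A', mul_nonneg hγ.le (sq_nonneg A)]
    refine (ENNReal.ofReal_le_ofReal hFle).trans (le_of_eq ?_)
    rw [ENNReal.ofReal_mul (by positivity), ENNReal.ofReal_mul hL0.le,
      ENNReal.ofReal_add zero_le_one (sq_nonneg _), ENNReal.ofReal_one, hQsq,
      ENNReal.ofReal_add (sq_nonneg _) (sq_nonneg _), ENNReal.ofReal_add (sq_nonneg _) (sq_nonneg _),
      ← eQ1, ← eQ2]
    congr 1
    exact congrArg₂ (· + ·) eA.symm eA'.symm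
  have hGle : ∀ t ∈ Icc 0 T, G t ≤ ∫⁻ s in Ioo 0 t, b s * G s := by
    intro t ht
    set X := ∫⁻ s in Ioo 0 t, ENNReal.ofReal L *
        (1 + (hs 3 (coef (ξ s).pos) + hs 3 (coef (η s).pos))) * G s with hX
    -- The weight `8 L` is `4 L + 4 L`: the H¹ part and the L² part of `G` are each at most four
    -- times the modal energy.
    have e : ∫⁻ s in Ioo 0 t, b s * G s = 4 * X + 4 * X := by
      rw [← add_mul, show (4 + 4 : ℝ≥0∞) = 8 by norm_num, hX, ← lintegral_const_mul' _ _ (by simp)]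
      refine lintegral_congr fun s => ?_
      rw [hbdef]
      simp only
      rw [ENNReal.ofReal_mul (by norm_num), ENNReal.ofReal_ofNat]
      ring
    rw [e]
    have fin : ∀ n (a : (Fin 3 → ℤ) → ℝ), (∀ k, nu k ^ n * a k ^ 2 ≤
        4 * (1 / 2 * q t k ^ 2 + (sqNorm k + 1) / 2 * p t k ^ 2)) → hs n a ≤ 4 * X := by
      intro n a ha
      rw [hs, ENNReal.tsum_eq_iSup_sum]
      refine iSup_le fun s => ?_
      obtain ⟨N, hN⟩ := exists_subset_box s
      rw [← ENNReal.ofReal_sum_of_nonneg fun k _ => hs_term_nonneg n a k]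
      refine le_trans (ENNReal.ofReal_le_ofReal ((Finset.sum_le_sum_of_subset_of_nonneg hN
        fun k _ _ => hs_term_nonneg n a k).trans (Finset.sum_le_sum fun k _ => ha k))) ?_
      rw [← Finset.mul_sum, ENNReal.ofReal_mul (by norm_num), ENNReal.ofReal_ofNat]
      exact mul_le_mul_right (key N t ht) _
    refine add_le_add (fin 2 (p t) fun k => ?_) (fin 0 (q t) fun k => ?_)
    · have h1 := norm_sq_le_sqNorm k
      have h2 : nu k ^ 2 ≤ 2 * (sqNorm k + 1) := by
        unfold nu; nlinarith [sq_nonneg (1 - ‖k‖)]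
      nlinarith [mul_le_mul_of_nonneg_right h2 (sq_nonneg (p t k)), sq_nonneg (q t k)]
    · have := sqNorm_nonneg k
      nlinarith [mul_nonneg this (sq_nonneg (p t k)), sq_nonneg (q t k), sq_nonneg (p t k)]
  have hfin := eq_zero_of_le_lintegral_mul (by simp) hGM hbint hGle T ⟨hT, le_rfl⟩
  have hz : ∀ n (a : (Fin 3 → ℤ) → ℝ), hs n a = 0 → ∀ k, a k = 0 := by
    intro n a ha k
    have := ENNReal.tsum_eq_zero.1 ha k
    rw [ENNReal.ofReal_eq_zero] at this
    have h1 := pow_pos (nu_pos k) n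
    have h2 : a k ^ 2 ≤ 0 := by
      by_contra h3
      exact absurd this (not_le.2 (mul_pos h1 (not_le.1 h3)))
    exact pow_eq_zero_iff two_ne_zero |>.1 (le_antisymm h2 (sq_nonneg _))
  rw [hG] at hfin
  simp only [add_eq_zero] at hfin
  exact ext_energySpace (fun k => sub_eq_zero.1 (hz 2 _ hfin.1 k))
    fun k => sub_eq_zero.1 (hz 0 _ hfin.2 k)

end

/-! ### Integrals over the torus depending on a parameter -/

theorem continuous_integral_torus {h : ℝ → Torus3 → ℝ} (hh : Continuous (Function.uncurry h)) :
    Continuous fun t => ∫ x, h t x := by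
  simpa using continuous_parametric_integral_of_continuous (μ := (volume : Measure Torus3)) hh
    isCompact_univ

theorem hasDerivAt_integral_torus {h h' : ℝ → Torus3 → ℝ} (hh : Continuous (Function.uncurry h))
    (hh' : Continuous (Function.uncurry h')) {t ε : ℝ} (hε : 0 < ε)
    (hd : ∀ s ∈ Metric.ball t ε, ∀ x, HasDerivAt (fun s => h s x) (h' s x) s) :
    HasDerivAt (fun s => ∫ x, h s x) (∫ x, h' t x) t := by
  obtain ⟨M, hM⟩ := ((isCompact_closedBall t ε).prod
    (isCompact_univ (X := Torus3))).exists_bound_of_continuousOn hh'.continuousOn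
  have hc : ∀ s, Continuous (h s) := fun s => hh.comp (Continuous.prodMk_right s)
  have hc' : ∀ s, Continuous (h' s) := fun s => hh'.comp (Continuous.prodMk_right s)
  exact (hasDerivAt_integral_of_dominated_loc_of_deriv_le (bound := fun _ => M)
    (Metric.ball_mem_nhds t hε) (Eventually.of_forall fun s => (hc s).aestronglyMeasurable)
    (integrable_of_continuous (hc t)) (hc' t).aestronglyMeasurable
    (Eventually.of_forall fun x s hs => hM (s, x) ⟨Metric.ball_subset_closedBall hs, mem_univ _⟩)
    (integrable_const M) (Eventually.of_forall fun x s hs => hd s hs x)).2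

/-! ### The energy of finitely many modes -/

theorem integral_mul_trig {h : Torus3 → ℝ} (hh : Integrable h) (s : Finset (Fin 3 → ℤ))
    (a : (Fin 3 → ℤ) → ℝ) : ∫ x, h x * trig s a x = ∑ k ∈ s, coef h k * a k := by
  rw [← integral_mul_trigL hh s a]
  refine integral_congr_ae ?_
  filter_upwards [coeFn_trigL s a] with x hx
  rw [hx]

theorem continuous_uncurry_trig {s : Finset (Fin 3 → ℤ)} {a : ℝ → (Fin 3 → ℤ) → ℝ}
    (ha : ∀ k ∈ s, Continuous fun t => a t k) :
    Continuous fun q : ℝ × Torus3 => trig s (a q.1) q.2 :=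
  continuous_finsetSum _ fun k hk =>
    ((ha k hk).comp continuous_fst).mul ((continuous_hart k).comp continuous_snd)

/-- The energy of the trigonometric polynomials with coefficients `a`, `b`. -/
def modalEnergy (f : ℝ → ℝ) (s : Finset (Fin 3 → ℤ)) (c a b : (Fin 3 → ℤ) → ℝ) : ℝ :=
  ∑ k ∈ s, (1 / 2 * b k ^ 2 + 1 / 2 * sqNorm k * a k ^ 2 - c k * a k) +
    ∫ x, ∫ r in (0 : ℝ)..(trig s a x), f r

section

variable {f : ℝ → ℝ} {s : Finset (Fin 3 → ℤ)} {a b : ℝ → (Fin 3 → ℤ) → ℝ}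

theorem continuous_coef_comp_trig (hf : Continuous f) (ha : ∀ k ∈ s, Continuous fun t => a t k)
    (k : Fin 3 → ℤ) : Continuous fun t => coef (fun x => f (trig s (a t) x)) k :=
  continuous_integral_torus (h := fun t x => f (trig s (a t) x) * hart k x)
    ((hf.comp (continuous_uncurry_trig ha)).mul ((continuous_hart k).comp continuous_snd))

theorem continuous_modalEnergy (hf : Continuous f) (ha : ∀ k ∈ s, Continuous fun t => a t k)
    (hb : ∀ k ∈ s, Continuous fun t => b t k) (c : (Fin 3 → ℤ) → ℝ) :
    Continuous fun t => modalEnergy f s c (a t) (b t) := by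
  refine (continuous_finsetSum _ fun k hk => ?_).add
    (continuous_integral_torus ((continuous_primitive hf).comp (continuous_uncurry_trig ha)))
  have := ha k hk
  have := hb k hk
  fun_prop

theorem hasDerivAt_modalEnergy (hf : Continuous f) (ca : ∀ k ∈ s, Continuous fun t => a t k)
    (cb : ∀ k ∈ s, Continuous fun t => b t k) (c : (Fin 3 → ℤ) → ℝ) {G : (Fin 3 → ℤ) → ℝ} {t : ℝ}
    (ht : 0 < t) (ha : ∀ k ∈ s, ∀ t, 0 < t → HasDerivAt (fun t => a t k) (b t k) t)
    (hb : ∀ k ∈ s, HasDerivAt (fun t => b t k) (G k) t) :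
    HasDerivAt (fun t => modalEnergy f s c (a t) (b t))
      (∑ k ∈ s, b t k * (G k + sqNorm k * a t k - c k + coef (fun x => f (trig s (a t) x)) k)) t := by
  have h1 : HasDerivAt (fun t => ∑ k ∈ s, (1 / 2 * b t k ^ 2 + 1 / 2 * sqNorm k * a t k ^ 2 - c k * a t k))
      (∑ k ∈ s, b t k * (G k + sqNorm k * a t k - c k)) t := by
    refine HasDerivAt.fun_sum fun k hk => ?_
    refine (((((hb k hk).pow 2).const_mul (1 / 2)).add
      (((ha k hk t ht).pow 2).const_mul (1 / 2 * sqNorm k))).sub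
      ((ha k hk t ht).const_mul (c k))).congr_deriv ?_
    simp only [Nat.cast_ofNat, Nat.add_one_sub_one, pow_one]
    ring
  have h2 := hasDerivAt_integral_torus (h := fun t x => ∫ r in (0 : ℝ)..(trig s (a t) x), f r)
    (h' := fun t x => f (trig s (a t) x) * trig s (b t) x) (t := t) (ε := t)
    ((continuous_primitive hf).comp (continuous_uncurry_trig ca))
    ((hf.comp (continuous_uncurry_trig ca)).mul (continuous_uncurry_trig cb)) ht
    (fun r hr x => by
      have hr0 : 0 < r := by
        rw [Metric.mem_ball, Real.dist_eq, abs_lt] at hr; linarith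
      have h3 : HasDerivAt (fun t => trig s (a t) x) (trig s (b r) x) r :=
        HasDerivAt.fun_sum fun k hk => (ha k hk r hr0).mul_const _
      exact (intervalIntegral.integral_hasDerivAt_right (hf.intervalIntegrable _ _)
        hf.aestronglyMeasurable.stronglyMeasurableAtFilter hf.continuousAt).comp r h3)
  rw [integral_mul_trig (h := fun x => f (trig s (a t) x))
    (integrable_of_continuous (hf.comp (continuous_trig s _)))] at h2
  refine (h1.add h2).congr_deriv ?_
  rw [← Finset.sum_add_distrib]
  exact Finset.sum_congr rfl fun k _ => by ring

end

/-! ### The energy identity in the limit of all modes -/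

section

variable {γ : ℝ} {f : ℝ → ℝ} {g : L2} {ξ : ℝ → EnergySpace} {C : ℝ}

theorem Growth.tendsto_modalEnergy (hf : Growth f C) (g : L2) (ξ : EnergySpace) :
    Tendsto (fun N => modalEnergy f (box N) (coef g) (coef ξ.pos) (coef ξ.vel)) atTop
      (𝓝 (energy f g ξ)) := by
  have h1 := ((hasSum_coef_sq ξ.vel).comp tendsto_box).const_mul (1 / 2)
  have h2 := ((hasSum_grad ξ).comp tendsto_box).const_mul (1 / 2)
  have h3 := (hasSum_coef_mul g ξ.pos).comp tendsto_box
  have h4 : Tendsto (fun N => ∫ x, ∫ r in (0 : ℝ)..(trig (box N) (coef ξ.pos) x), f r) atTop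
      (𝓝 (∫ x, ∫ r in (0 : ℝ)..(ξ.pos x), f r)) := by
    obtain ⟨R, hR, hu⟩ := exists_sq_bound (hs_lt_top_pos ξ)
    rw [tendsto_iff_dist_tendsto_zero, Metric.tendsto_nhds]
    intro ε hε
    have hP : 0 < C * (sobC * (1 + 2 * R ^ 5)) :=
      mul_pos hf.pos (mul_pos sobC_pos (by positivity))
    set A := ε / 2 / (C * (sobC * (1 + 2 * R ^ 5))) with hA
    have hA0 : 0 < A := by positivity
    filter_upwards [(tendsto_hs_tail (hs_lt_top_pos ξ)).eventually_le_const
      (ENNReal.ofReal_pos.2 (pow_pos hA0 2))] with N hN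
    have h5 := hf.abs_integral_primitive_sub_le hR hA0.le hu
      ((hs_trigL_le 2 (box N) (coef ξ.pos)).trans hu) hN
    have e : ∫ x, ∫ r in (0 : ℝ)..(trigL (box N) (coef ξ.pos) x), f r =
        ∫ x, ∫ r in (0 : ℝ)..(trig (box N) (coef ξ.pos) x), f r := by
      refine integral_congr_ae ?_
      filter_upwards [coeFn_trigL (box N) (coef ξ.pos)] with x hx
      rw [hx]
    rw [e] at h5
    rw [dist_zero_right, Real.norm_eq_abs, abs_of_nonneg dist_nonneg, dist_comm, Real.dist_eq]
    refine h5.trans_lt ?_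
    have : C * (sobC * (1 + 2 * R ^ 5) * A) = ε / 2 := by
      have := hf.pos.ne'
      have := sobC_pos.ne'
      rw [hA]; field_simp
    rw [this]; linarith
  refine (((h1.add h2).add h4).sub h3 |>.congr fun N => ?_).trans (le_of_eq ?_)
  · simp only [Function.comp, modalEnergy, Finset.sum_sub_distrib, Finset.sum_add_distrib,
      Finset.mul_sum, mul_assoc]
    ring
  · rfl

/-- The energy identity. For the truncation to `box N` it holds up to the commutator `ρ N`, the
pairing of `f(P_N u) - f(u)` with the velocity. At almost every time the trilinear estimate bounds
`ρ N` by a multiple of the H¹ norm of the tail of `u`, which tends to 0, and H^{3/2} regularity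
gives an integrable majorant. -/
theorem ModeSolution.tendsto_dissipation (h : ModeSolution γ f g ξ) (hf : Growth f C)
    {K : ℝ} (hγ : 0 < γ) (hK0 : 0 ≤ K) (hK : ∀ u v, -K * (u - v) ^ 2 ≤ (f u - f v) * (u - v))
    {T : ℝ} (hT : 0 ≤ T) :
    Tendsto (fun N => γ * ∑ k ∈ box N, absK k * ∫ t in (0 : ℝ)..T, coef (ξ t).vel k ^ 2) atTop
      (𝓝 (energy f g (ξ 0) - energy f g (ξ T))) := by
  set E := fun N t => modalEnergy f (box N) (coef g) (coef (ξ t).pos) (coef (ξ t).vel) with hE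
  set ρ := fun N t => ∑ k ∈ box N, (coef (fun x => f (trigL (box N) (coef (ξ t).pos) x)) k -
    coef (fun x => f ((ξ t).pos x)) k) * coef (ξ t).vel k with hρ
  have etrig : ∀ N t k, coef (fun x => f (trigL (box N) (coef (ξ t).pos) x)) k =
      coef (fun x => f (trig (box N) (coef (ξ t).pos) x)) k := fun N t k => by
    refine coef_congr ?_ k
    filter_upwards [coeFn_trigL (box N) (coef (ξ t).pos)] with x hx
    rw [hx]
  have ccoef : ∀ N k, Continuous fun t => coef (fun x => f (trigL (box N) (coef (ξ t).pos) x)) k :=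
    fun N k => by
      simp_rw [etrig]
      exact continuous_coef_comp_trig hf.cont (fun k _ => h.cont_pos k) k
  have cρ : ∀ N, Continuous (ρ N) := fun N => continuous_finsetSum _ fun k _ =>
    ((ccoef N k).sub (h.continuous_coef hf k)).mul (h.cont_vel k)
  have cv : ∀ k, Continuous fun t => coef (ξ t).vel k ^ 2 := fun k => (h.cont_vel k).pow 2
  have hid : ∀ N, γ * ∑ k ∈ box N, absK k * ∫ t in (0 : ℝ)..T, coef (ξ t).vel k ^ 2 =
      E N 0 - E N T + ∫ t in (0 : ℝ)..T, ρ N t := by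
    intro N
    have hFTC := intervalIntegral.integral_eq_sub_of_hasDerivAt_of_le hT
      (f := E N) (f' := fun t => -(γ * ∑ k ∈ box N, absK k * coef (ξ t).vel k ^ 2) + ρ N t)
      (continuous_modalEnergy hf.cont (fun k _ => h.cont_pos k) (fun k _ => h.cont_vel k)
        _).continuousOn (fun t ht => by
          refine (hasDerivAt_modalEnergy hf.cont (fun k _ => h.cont_pos k) (fun k _ => h.cont_vel k)
            (coef g) ht.1 (fun k _ t ht => h.hasDerivAt_pos k t ht)
            (fun k _ => h.hasDerivAt_vel k t ht.1)).congr_deriv ?_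
          rw [hρ, Finset.mul_sum, ← Finset.sum_neg_distrib, ← Finset.sum_add_distrib]
          refine Finset.sum_congr rfl fun k _ => ?_
          rw [etrig]
          ring) (Continuous.intervalIntegrable
            ((continuous_const.mul (continuous_finsetSum _ fun k _ => (cv k).const_mul _)).neg.add (cρ N)) _ _)
    have cD : Continuous fun t => -(γ * ∑ k ∈ box N, absK k * coef (ξ t).vel k ^ 2) :=
      (continuous_const.mul (continuous_finsetSum _ fun k _ => (cv k).const_mul _)).neg
    rw [intervalIntegral.integral_add (cD.intervalIntegrable _ _)
        ((cρ N).intervalIntegrable _ _), intervalIntegral.integral_neg,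
        intervalIntegral.integral_const_mul, intervalIntegral.integral_finsetSum
          (f := fun k t => absK k * coef (ξ t).vel k ^ 2)
          (fun k _ => ((cv k).const_mul _).intervalIntegrable _ _)] at hFTC
    simp_rw [intervalIntegral.integral_const_mul] at hFTC
    linarith
  have hlim : Tendsto (fun N => ∫ t in (0 : ℝ)..T, ρ N t) atTop (𝓝 0) := by
    obtain ⟨R, hR, hb⟩ := h.exists_bound T
    have m3 := measurable_hs h.cont_pos 3
    have m1 := measurable_hs h.cont_vel 1
    have f3 := (h.lintegral_hs_three_lt_top hf hγ hK0 hK T).ne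
    have f1 := (h.dissip T).ne
    set c := C * sobC with hc
    have hc0 : 0 < c := mul_pos hf.pos sobC_pos
    set Q := fun t => Real.sqrt (hs 3 (coef (ξ t).pos)).toReal with hQ
    set B := fun t => Real.sqrt (hs 1 (coef (ξ t).vel)).toReal with hB
    have hQ2 : ∀ t, Q t ^ 2 = (hs 3 (coef (ξ t).pos)).toReal := fun t =>
      Real.sq_sqrt ENNReal.toReal_nonneg
    have hB2 : ∀ t, B t ^ 2 = (hs 1 (coef (ξ t).vel)).toReal := fun t =>
      Real.sq_sqrt ENNReal.toReal_nonneg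
    have hQ0 : ∀ t, 0 ≤ Q t := fun t => Real.sqrt_nonneg _
    have hB0 : ∀ t, 0 ≤ B t := fun t => Real.sqrt_nonneg _
    have est : ∀ t ≤ T, hs 3 (coef (ξ t).pos) < ⊤ → hs 1 (coef (ξ t).vel) < ⊤ → ∀ N A, 0 ≤ A →
        hs 2 (fun k => coef (ξ t).pos k - coef (trigL (box N) (coef (ξ t).pos)) k) ≤
          ENNReal.ofReal (A ^ 2) →
        |ρ N t| ≤ C * (sobC * (1 + 2 * R ^ 3 * Q t) * A * B t) := by
      intro t ht h3 h1 N A hA hd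
      have e3 : hs 3 (coef (ξ t).pos) ≤ ENNReal.ofReal (Q t ^ 2) := by
        rw [hQ2, ENNReal.ofReal_toReal h3.ne]
      have := hf.abs_sum_sub_mul_le hR.le (hQ0 t) hA (hB0 t) (hb t ht).1
        ((hs_trigL_le 2 (box N) _).trans (hb t ht).1) e3 ((hs_trigL_le 3 (box N) _).trans e3) hd
        (box N) (coef (ξ t).vel) ((hs_trigL_le 1 (box N) _).trans
          (by rw [hB2, ENNReal.ofReal_toReal h1.ne]))
      rw [← abs_neg, hρ, ← Finset.sum_neg_distrib]
      simpa only [← neg_mul, neg_sub] using this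
    have ae3 := ae_lt_top m3 f3
    have ae1 := ae_lt_top m1 f1
    have hDCT := tendsto_integral_of_dominated_convergence (μ := volume.restrict (Ioo 0 T))
      (F := ρ) (f := fun _ => 0)
      -- The majorant comes from the trilinear bound with the tail replaced by `R`, the product `(1
      -- + 2R³Q) B` being split into squares.
      (fun t => c * R * (2 + 4 * R ^ 6 * (hs 3 (coef (ξ t).pos)).toReal +
        (hs 1 (coef (ξ t).vel)).toReal)) (fun N => (cρ N).aestronglyMeasurable)
      (((integrable_const _).add ((integrable_toReal_of_lintegral_ne_top m3.aemeasurable f3).const_mul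
        (4 * R ^ 6))).add (integrable_toReal_of_lintegral_ne_top m1.aemeasurable f1) |>.const_mul _)
      (fun N => by
        filter_upwards [ae3, ae1, ae_restrict_mem measurableSet_Ioo] with t t3 t1 ht
        have htail : hs 2 (fun k => coef (ξ t).pos k - coef (trigL (box N) (coef (ξ t).pos)) k) ≤
            hs 2 (coef (ξ t).pos) := hs_le_of_abs_le fun k => by
          rw [coef_trigL]
          split_ifs <;> simp
        refine (est t ht.2.le t3 t1 N R hR.le (htail.trans (hb t ht.2.le).1)).trans ?_
        rw [← hQ2, ← hB2]
        have e : C * (sobC * (1 + 2 * R ^ 3 * Q t) * R * B t) =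
          c * R * ((1 + 2 * R ^ 3 * Q t) * B t) := by rw [hc]; ring
        rw [e]
        refine mul_le_mul_of_nonneg_left ?_ (by positivity)
        nlinarith [sq_nonneg (1 + 2 * R ^ 3 * Q t - B t), sq_nonneg (1 - 2 * R ^ 3 * Q t), sq_nonneg (B t)])
      (by
        filter_upwards [ae3, ae1, ae_restrict_mem measurableSet_Ioo] with t t3 t1 ht
        rw [tendsto_zero_iff_abs_tendsto_zero]
        have htop := hs_lt_top_pos (ξ t)
        have l1 := tendsto_hs_tail htop
        have l2 : Tendsto (fun N => Real.sqrt (hs 2 (fun k => coef (ξ t).pos k -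
            coef (trigL (box N) (coef (ξ t).pos)) k)).toReal) atTop (𝓝 0) := by
          have := (Real.continuous_sqrt.tendsto _).comp
            ((ENNReal.tendsto_toReal ENNReal.zero_ne_top).comp l1)
          simpa [Function.comp_def] using this
        have l3 : Tendsto (fun N => C * (sobC * (1 + 2 * R ^ 3 * Q t) * Real.sqrt (hs 2 (fun k =>
            coef (ξ t).pos k - coef (trigL (box N) (coef (ξ t).pos)) k)).toReal * B t)) atTop (𝓝 0) := by
          have := ((l2.const_mul (sobC * (1 + 2 * R ^ 3 * Q t))).mul_const (B t)).const_mul C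
          simpa using this
        refine squeeze_zero (fun _ => abs_nonneg _) (fun N => est t ht.2.le t3 t1 N _
          (Real.sqrt_nonneg _) ?_) l3
        rw [Real.sq_sqrt ENNReal.toReal_nonneg, ENNReal.ofReal_toReal]
        refine (lt_of_le_of_lt (hs_le_of_abs_le fun k => ?_) htop).ne
        rw [coef_trigL]
        split_ifs <;> simp)
    simp only [integral_zero] at hDCT
    refine hDCT.congr fun N => ?_
    rw [intervalIntegral.integral_of_le hT, integral_Ioc_eq_integral_Ioo]
  have := ((hf.tendsto_modalEnergy g (ξ 0)).sub (hf.tendsto_modalEnergy g (ξ T))).add hlim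
  rw [add_zero] at this
  exact this.congr fun N => (hid N).symm

/-- All terms of the dissipation are nonnegative. For `k = 0` the left side vanishes and the energy
is seen not to increase; for `k ≠ 0` equality of energies kills the velocity mode. -/
theorem ModeSolution.dissipation_le (h : ModeSolution γ f g ξ) (hf : Growth f C)
    {K : ℝ} (hγ : 0 < γ) (hK0 : 0 ≤ K) (hK : ∀ u v, -K * (u - v) ^ 2 ≤ (f u - f v) * (u - v))
    {T : ℝ} (hT : 0 ≤ T) (k : Fin 3 → ℤ) :
    γ * absK k * ∫ t in (0 : ℝ)..T, coef (ξ t).vel k ^ 2 ≤ energy f g (ξ 0) - energy f g (ξ T) := by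
  obtain ⟨N, hN⟩ := exists_subset_box {k}
  refine ge_of_tendsto (h.tendsto_dissipation hf hγ hK0 hK hT) (eventually_atTop.2 ⟨N, fun M hM => ?_⟩)
  rw [mul_assoc]
  refine mul_le_mul_of_nonneg_left ?_ hγ.le
  exact Finset.single_le_sum (f := fun k => absK k * ∫ t in (0 : ℝ)..T, coef (ξ t).vel k ^ 2)
    (fun l _ => mul_nonneg (absK_nonneg l) (intervalIntegral.integral_nonneg hT fun t _ => sq_nonneg _))
    (box_mono hM (hN (Finset.mem_singleton_self k)))

end

/-! ### Complex Fourier coefficients -/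

theorem fourierCoef_eq {φ : Torus3 → ℝ} (hφ : Integrable φ) (l : Fin 3 → ℤ) :
    fourierCoef φ l = (((2 * Real.sqrt ((2 * π) ^ 3))⁻¹ : ℝ) : ℂ) *
      (((coef φ l + coef φ (-l) : ℝ) : ℂ) - ((coef φ l - coef φ (-l) : ℝ) : ℂ) * Complex.I) := by
  set S := Real.sqrt ((2 * π) ^ 3) with hS
  have hS0 : S ≠ 0 := sqrt_pos_aux.ne'
  have hSS : S * S = (2 * π) ^ 3 := Real.mul_self_sqrt (by positivity)
  have i1 := integrable_mul_hart hφ l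
  have i2 := integrable_mul_hart hφ (-l)
  have e1 : ∫ x, φ x * (expMode l x).re = S / 2 * (coef φ l + coef φ (-l)) := by
    rw [coef, coef, ← integral_add i1 i2, ← integral_const_mul]
    refine integral_congr_ae (Eventually.of_forall fun x => ?_)
    simp only [re_expMode_eq, ← hS]
    ring
  have e2 : ∫ x, φ x * (expMode l x).im = S / 2 * (coef φ l - coef φ (-l)) := by
    rw [coef, coef, ← integral_sub i1 i2, ← integral_const_mul]
    refine integral_congr_ae (Eventually.of_forall fun x => ?_)
    simp only [im_expMode_eq, ← hS]
    ring
  have j1 : Integrable (fun x => φ x * (expMode l x).re) :=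
    ((i1.add i2).const_mul (S / 2)).congr (Eventually.of_forall fun x => by
      simp only [re_expMode_eq, ← hS, Pi.add_apply]; ring)
  have j2 : Integrable (fun x => φ x * (expMode l x).im) :=
    ((i1.sub i2).const_mul (S / 2)).congr (Eventually.of_forall fun x => by
      simp only [im_expMode_eq, ← hS, Pi.sub_apply]; ring)
  have e3 : ∫ x, (φ x : ℂ) * expMode (-l) x =
      ((∫ x, φ x * (expMode l x).re : ℝ) : ℂ) - ((∫ x, φ x * (expMode l x).im : ℝ) : ℂ) * Complex.I := by
    rw [← integral_complex_ofReal, ← integral_complex_ofReal, ← integral_mul_const,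
      ← integral_sub j1.ofReal (j2.ofReal.mul_const _)]
    refine integral_congr_ae (Eventually.of_forall fun x => ?_)
    simp only [expMode_neg]
    apply Complex.ext <;> simp
  have e4 : (((2 * π : ℝ) : ℂ)⁻¹) ^ 3 = (((S * S)⁻¹ : ℝ) : ℂ) := by
    rw [hSS]; push_cast; rw [inv_pow]
  rw [fourierCoef, e3, e1, e2, e4]
  have : (2 * S)⁻¹ = (S * S)⁻¹ * (S / 2) := by field_simp
  rw [this]
  push_cast
  ring

/-- The moduli at `k` and `-k` agree for real functions, so the complex coefficient sees only the
mean of the two real squares. Weights even in `k` lose nothing by this. -/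
theorem norm_fourierCoef_sq {φ : Torus3 → ℝ} (hφ : Integrable φ) (l : Fin 3 → ℤ) :
    (2 * π) ^ 3 * ‖fourierCoef φ l‖ ^ 2 = (coef φ l ^ 2 + coef φ (-l) ^ 2) / 2 := by
  set S := Real.sqrt ((2 * π) ^ 3) with hS
  have hS0 : S ≠ 0 := sqrt_pos_aux.ne'
  have hSS : (2 * π) ^ 3 = S * S := (Real.mul_self_sqrt (by positivity)).symm
  rw [fourierCoef_eq hφ, norm_mul, mul_pow ‖_‖ ‖_‖, Complex.sq_norm, Complex.sq_norm,
    Complex.normSq_ofReal, Complex.normSq_apply, ← hS, hSS]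
  simp only [Complex.sub_re, Complex.ofReal_re, Complex.mul_re, Complex.I_re, mul_zero,
    Complex.ofReal_im, Complex.I_im, mul_one, sub_self, sub_zero, Complex.sub_im, Complex.mul_im,
    add_zero, zero_sub]
  field_simp
  ring

theorem fourierCoef_mul_expMode_re {φ : Torus3 → ℝ} (hφ : Integrable φ) (l : Fin 3 → ℤ) (x : Torus3) :
    (fourierCoef φ l * expMode l x).re =
      1 / 2 * (coef φ l * hart l x + coef φ (-l) * hart (-l) x) := by
  set S := Real.sqrt ((2 * π) ^ 3) with hS
  have hS0 : S ≠ 0 := sqrt_pos_aux.ne'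
  rw [fourierCoef_eq hφ, Complex.mul_re, re_expMode_eq, im_expMode_eq, ← hS, Complex.re_ofReal_mul,
    Complex.im_ofReal_mul]
  simp only [Complex.sub_re, Complex.ofReal_re, Complex.mul_re, Complex.I_re, mul_zero,
    Complex.ofReal_im, Complex.I_im, mul_one, sub_self, sub_zero, Complex.sub_im, Complex.mul_im,
    add_zero, zero_sub]
  field_simp
  ring

/-- The averaging over `±k` is undone by reindexing the sum, because the weight is even. -/
theorem hsNormSq_eq (s : ℝ) (v : L2) :
    hsNormSq s v = ∑' k, ENNReal.ofReal ((1 + sqNorm k) ^ s * coef v k ^ 2) := by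
  set F := fun k => ENNReal.ofReal ((1 + sqNorm k) ^ s * (coef v k ^ 2 / 2)) with hF
  have h0 : ∀ k, 0 ≤ (1 + sqNorm k) ^ s := fun k =>
    Real.rpow_nonneg (by linarith [sqNorm_nonneg k]) s
  have e : hsNormSq s v = ∑' k, (F k + F (-k)) := by
    rw [hsNormSq, ← ENNReal.tsum_mul_left]
    refine tsum_congr fun k => ?_
    have h1 := norm_fourierCoef_sq (integrable_coe v) k
    simp only [hF]
    rw [← ENNReal.ofReal_mul (by positivity), sqNorm_neg,
      ← ENNReal.ofReal_add (mul_nonneg (h0 k) (by positivity)) (mul_nonneg (h0 k) (by positivity))]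
    congr 1
    linear_combination (1 + sqNorm k) ^ s * h1
  rw [e, ENNReal.tsum_add, show (∑' k, F (-k)) = ∑' k, F k from (Equiv.neg (Fin 3 → ℤ)).tsum_eq F,
    ← ENNReal.tsum_add]
  refine tsum_congr fun k => ?_
  simp only [hF]
  rw [← ENNReal.ofReal_add (mul_nonneg (h0 k) (by positivity)) (mul_nonneg (h0 k) (by positivity))]
  congr 1
  ring

theorem rpow_half_eq (x : ℝ) : x ^ (1 / 2 : ℝ) = Real.sqrt x := (Real.sqrt_eq_rpow x).symm

theorem hsNormSq_half_le (v : L2) : hsNormSq (1 / 2) v ≤ 2 * hs 1 (coef v) := by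
  rw [hsNormSq_eq, hs, ← ENNReal.tsum_mul_left]
  refine ENNReal.tsum_le_tsum fun k => ?_
  rw [show (2 : ℝ≥0∞) * ENNReal.ofReal (nu k ^ 1 * coef v k ^ 2) =
    ENNReal.ofReal (2 * (nu k ^ 1 * coef v k ^ 2)) by
      rw [ENNReal.ofReal_mul (by norm_num : (0 : ℝ) ≤ 2), ENNReal.ofReal_ofNat],
    rpow_half_eq, pow_one, ← mul_assoc]
  refine ENNReal.ofReal_le_ofReal (mul_le_mul_of_nonneg_right ?_ (sq_nonneg _))
  refine Real.sqrt_le_iff.2 ⟨by linarith [nu_pos k], ?_⟩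
  have := sqNorm_le k
  have := norm_nonneg k
  unfold nu
  nlinarith

theorem hs_one_le_hsNormSq (v : L2) : hs 1 (coef v) ≤ 2 * hsNormSq (1 / 2) v := by
  rw [hsNormSq_eq, hs, ← ENNReal.tsum_mul_left]
  refine ENNReal.tsum_le_tsum fun k => ?_
  rw [rpow_half_eq, show (2 : ℝ≥0∞) * ENNReal.ofReal (Real.sqrt (1 + sqNorm k) * coef v k ^ 2) =
    ENNReal.ofReal (2 * (Real.sqrt (1 + sqNorm k) * coef v k ^ 2)) by
      rw [ENNReal.ofReal_mul (by norm_num : (0 : ℝ) ≤ 2), ENNReal.ofReal_ofNat], pow_one, ← mul_assoc]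
  refine ENNReal.ofReal_le_ofReal (mul_le_mul_of_nonneg_right ?_ (sq_nonneg _))
  have : nu k / 2 ≤ Real.sqrt (1 + sqNorm k) := by
    refine Real.le_sqrt_of_sq_le ?_
    have := norm_sq_le_sqNorm k
    unfold nu
    nlinarith [sq_nonneg (1 - ‖k‖)]
  linarith

theorem fracLaplacian_half_eq {φ : Torus3 → ℝ} (hφ : Integrable φ)
    (hs : Summable fun k => absK k * |coef φ k|) (x : Torus3) :
    fracLaplacian (1 / 2) φ x = ∑' k, absK k * coef φ k * hart k x := by
  have hF : Summable fun k => absK k * coef φ k * hart k x := by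
    refine Summable.of_norm_bounded hs fun k => ?_
    rw [norm_mul, norm_mul, Real.norm_eq_abs, Real.norm_eq_abs, Real.norm_eq_abs,
      abs_of_nonneg (absK_nonneg k)]
    exact mul_le_of_le_one_right (mul_nonneg (absK_nonneg k) (abs_nonneg _)) (abs_hart_le k x)
  have hs' : Summable fun k => absK k * |coef φ (-k)| := by
    have := (Equiv.neg (Fin 3 → ℤ)).summable_iff.2 hs
    refine this.congr fun k => ?_
    simp [absK_neg]
  have hF' : Summable fun k => absK (-k) * coef φ (-k) * hart (-k) x :=
    (Equiv.neg (Fin 3 → ℤ)).summable_iff.2 hF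
  have hc : Summable fun k => ((sqNorm k ^ (1 / 2 : ℝ) : ℝ) : ℂ) * fourierCoef φ k * expMode k x := by
    refine Summable.of_norm_bounded (hs.add hs') fun k => ?_
    rw [norm_mul, norm_mul, norm_expMode, mul_one, Complex.norm_real, rpow_half_eq, ← mul_add,
      Real.norm_eq_abs, abs_of_nonneg (Real.sqrt_nonneg _)]
    refine mul_le_mul_of_nonneg_left ?_ (Real.sqrt_nonneg _)
    refine le_of_sq_le_sq ?_ (by positivity)
    have h1 := norm_fourierCoef_sq hφ k
    have h2 : 1 ≤ (2 * π) ^ 3 := one_le_pow₀ (by linarith [Real.pi_gt_three])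
    have h3 : 1 * ‖fourierCoef φ k‖ ^ 2 ≤ (2 * π) ^ 3 * ‖fourierCoef φ k‖ ^ 2 :=
      mul_le_mul_of_nonneg_right h2 (sq_nonneg _)
    have h4 : 0 ≤ |coef φ k| * |coef φ (-k)| := by positivity
    nlinarith [sq_abs (coef φ k), sq_abs (coef φ (-k)), sq_nonneg (coef φ k), sq_nonneg (coef φ (-k))]
  rw [fracLaplacian, Complex.re_tsum hc]
  have e : ∀ k, (((sqNorm k ^ (1 / 2 : ℝ) : ℝ) : ℂ) * fourierCoef φ k * expMode k x).re =
      1 / 2 * (absK k * coef φ k * hart k x) + 1 / 2 * (absK (-k) * coef φ (-k) * hart (-k) x) := by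
    intro k
    rw [mul_assoc, Complex.re_ofReal_mul, fourierCoef_mul_expMode_re hφ, rpow_half_eq, absK_neg, absK]
    ring
  simp_rw [e]
  rw [(hF.mul_left _).tsum_add (hF'.mul_left _), tsum_mul_left, tsum_mul_left,
    show (∑' k, absK (-k) * coef φ (-k) * hart (-k) x) = ∑' k, absK k * coef φ k * hart k x from
      (Equiv.neg (Fin 3 → ℤ)).tsum_eq fun k => absK k * coef φ k * hart k x]
  ring

theorem fracLaplacian_const_mul_hart (c : ℝ) (k : Fin 3 → ℤ) (x : Torus3) :
    fracLaplacian (1 / 2) (fun x => c * hart k x) x = absK k * (c * hart k x) := by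
  have hc : ∀ l, coef (fun x => c * hart k x) l = if k = l then c else 0 := fun l => by
    rw [coef_const_mul, coef_hart]; split_ifs <;> simp
  rw [fracLaplacian_half_eq ((integrable_of_continuous (continuous_hart k)).const_mul c),
    tsum_eq_single k]
  · rw [hc, if_pos rfl]; ring
  · intro l hl
    rw [hc, if_neg (Ne.symm hl)]; ring
  · refine summable_of_ne_finset_zero (s := {k}) fun l hl => ?_
    rw [hc, if_neg (fun h => hl (by simp [h]))]; simp

/-! ### Weak derivatives in time -/

/-- The lemma of du Bois-Reymond. -/
theorem eqOn_const_of_integral_mul_deriv {w : ℝ → ℝ} (hw : Continuous w) {T : ℝ} (hT : 0 < T)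
    (h : ∀ χ : ℝ → ℝ, ContDiff ℝ ∞ χ → (∃ a b, 0 < a ∧ b < T ∧ ∀ t, t ∉ Icc a b → χ t = 0) →
      ∫ t in (0 : ℝ)..T, w t * deriv χ t = 0) : ∃ c, ∀ t ∈ Ioo 0 T, w t = c := by
  -- A fixed bump of integral 1 supported in `[T/4, 3T/4]`; the constant will be the mean of `w`
  -- against it.
  set θ : ContDiffBump (T / 2) := ⟨T / 8, T / 4, by linarith, by linarith⟩ with hθ
  have hθs : ∀ t, t ∉ Icc (T / 4) (3 * T / 4) → θ.normed volume t = 0 := by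
    intro t ht
    have : t ∉ Function.support (θ.normed volume) := by
      rw [θ.support_normed_eq, Metric.mem_ball, Real.dist_eq, abs_lt]
      rintro ⟨h1, h2⟩
      simp only [hθ] at h1 h2
      exact ht ⟨by linarith, by linarith⟩
    simpa using this
  set c := ∫ t in (0 : ℝ)..T, w t * θ.normed volume t with hc
  have cθ : Continuous (θ.normed volume) := (θ.contDiff_normed (n := 0)).continuous
  have key : ∀ ψ : ℝ → ℝ, ContDiff ℝ ∞ ψ → HasCompactSupport ψ → tsupport ψ ⊆ Ioo 0 T →
      ∫ t, ψ t • (w t - c) = 0 := by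
    intro ψ hψ hψc hψs
    obtain ⟨a, b, ha, hb, hab⟩ : ∃ a b, 0 < a ∧ b < T ∧ ∀ t, t ∉ Icc a b → ψ t = 0 := by
      rcases (tsupport ψ).eq_empty_or_nonempty with he | hne
      · exact ⟨1, T - 1, one_pos, by linarith, fun t _ => image_eq_zero_of_notMem_tsupport (by simp [he])⟩
      · obtain ⟨a, ha, ha'⟩ := IsCompact.exists_isLeast hψc hne
        obtain ⟨b, hb, hb'⟩ := IsCompact.exists_isGreatest hψc hne
        exact ⟨a, b, (hψs ha).1, (hψs hb).2, fun t ht =>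
          image_eq_zero_of_notMem_tsupport fun h => ht ⟨ha' h, hb' h⟩⟩
    set m := ∫ t in (0 : ℝ)..T, ψ t with hm
    -- Subtracting this multiple of the bump makes the mean vanish, so the primitive `χ` has compact
    -- support in `(0, T)` and is an admissible test function.
    set ρ := fun t => ψ t - m * θ.normed volume t with hρ
    have hρd : ContDiff ℝ ∞ ρ := hψ.sub (contDiff_const.mul θ.contDiff_normed)
    have hρ0 : ∀ t, t ∉ Icc (min a (T / 4)) (max b (3 * T / 4)) → ρ t = 0 := by
      intro t ht
      have h1 : t ∉ Icc a b := fun h => ht ⟨(min_le_left _ _).trans h.1, h.2.trans (le_max_left _ _)⟩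
      have h2 : t ∉ Icc (T / 4) (3 * T / 4) := fun h =>
        ht ⟨(min_le_right _ _).trans h.1, h.2.trans (le_max_right _ _)⟩
      simp [hρ, hab t h1, hθs t h2]
    have hθ1 : ∫ t in (0 : ℝ)..T, θ.normed volume t = 1 := by
      rw [intervalIntegral.integral_of_le hT.le, ← θ.integral_normed (μ := volume)]
      refine setIntegral_eq_integral_of_forall_compl_eq_zero fun t ht => hθs t fun h => ht ?_
      exact ⟨by linarith [h.1], by linarith [h.2]⟩
    have hρint : ∫ t in (0 : ℝ)..T, ρ t = 0 := by
      have I : IntervalIntegrable (fun t => m * θ.normed volume t) volume 0 T :=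
        (continuous_const.mul cθ).intervalIntegrable _ _
      simp only [hρ]
      rw [intervalIntegral.integral_sub (hψ.continuous.intervalIntegrable _ _) I,
        intervalIntegral.integral_const_mul, hθ1]
      ring
    set χ := fun t => ∫ s in (0 : ℝ)..t, ρ s with hχ
    have hχd : ∀ t, HasDerivAt χ (ρ t) t := fun t =>
      intervalIntegral.integral_hasDerivAt_right (hρd.continuous.intervalIntegrable _ _)
        hρd.continuous.aestronglyMeasurable.stronglyMeasurableAtFilter hρd.continuous.continuousAt
    have hχ' : deriv χ = ρ := funext fun t => (hχd t).deriv
    have hχs : ContDiff ℝ ∞ χ :=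
      contDiff_infty_iff_deriv.2 ⟨fun t => (hχd t).differentiableAt, hχ' ▸ hρd⟩
    have hχ0 : ∀ t, t ∉ Icc (min a (T / 4)) (max b (3 * T / 4)) → χ t = 0 := by
      intro t ht
      rcases lt_or_ge t (min a (T / 4)) with h1 | h1
      · refine intervalIntegral.integral_zero_ae (Eventually.of_forall fun s hs => hρ0 s fun h => ?_)
        rcases le_total 0 t with h2 | h2
        · rw [uIoc_of_le h2] at hs
          linarith [hs.2, h.1]
        · rw [uIoc_of_ge h2] at hs
          have : 0 < min a (T / 4) := lt_min ha (by linarith)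
          linarith [hs.2, h.1]
      · have h2 : max b (3 * T / 4) < t := by
          by_contra h3
          exact ht ⟨h1, not_lt.1 h3⟩
        have h3 : χ t = χ T + ∫ s in T..t, ρ s :=
          (intervalIntegral.integral_add_adjacent_intervals (hρd.continuous.intervalIntegrable _ _)
            (hρd.continuous.intervalIntegrable _ _)).symm
        rw [h3, show χ T = 0 from hρint, zero_add]
        refine intervalIntegral.integral_zero_ae (Eventually.of_forall fun s hs => hρ0 s fun h => ?_)
        have h4 : max b (3 * T / 4) < T := max_lt hb (by linarith)
        rcases le_total T t with h5 | h5
        · rw [uIoc_of_le h5] at hs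
          linarith [hs.1, h.2]
        · rw [uIoc_of_ge h5] at hs
          linarith [hs.1, h.2]
    have h1 := h χ hχs ⟨_, _, lt_min ha (by linarith), max_lt hb (by linarith), hχ0⟩
    rw [hχ'] at h1
    have h2 : ∫ t, ψ t • (w t - c) = ∫ t in (0 : ℝ)..T, ψ t * (w t - c) := by
      rw [intervalIntegral.integral_of_le hT.le]
      refine (setIntegral_eq_integral_of_forall_compl_eq_zero fun t ht => ?_).symm
      rw [hab t fun h => ht ⟨by linarith [h.1], by linarith [h.2]⟩, zero_smul]
    have cψ := hψ.continuous
    have I1 : IntervalIntegrable (fun t => ψ t * w t) volume 0 T :=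
      (cψ.mul hw).intervalIntegrable _ _
    have I2 : IntervalIntegrable (fun t => m * (w t * θ.normed volume t)) volume 0 T :=
      (continuous_const.mul (hw.mul cθ)).intervalIntegrable _ _
    have I3 : IntervalIntegrable (fun t => ψ t * c) volume 0 T :=
      (cψ.mul continuous_const).intervalIntegrable _ _
    have h3 : ∫ t in (0 : ℝ)..T, w t * ρ t = (∫ t in (0 : ℝ)..T, ψ t * w t) - m * c := by
      rw [hc, ← intervalIntegral.integral_const_mul, ← intervalIntegral.integral_sub I1 I2]
      refine intervalIntegral.integral_congr fun t _ => ?_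
      simp only [hρ]; ring
    have h4 : ∫ t in (0 : ℝ)..T, ψ t * (w t - c) = (∫ t in (0 : ℝ)..T, ψ t * w t) - m * c := by
      rw [hm, ← intervalIntegral.integral_mul_const, ← intervalIntegral.integral_sub I1 I3]
      refine intervalIntegral.integral_congr fun t _ => ?_
      ring
    rw [h2, h4, ← h3, h1]
  have hcw : Continuous fun t => w t - c := hw.sub continuous_const
  have hae := isOpen_Ioo.ae_eq_zero_of_integral_contDiff_smul_eq_zero (μ := volume)
    (hcw.locallyIntegrable.locallyIntegrableOn _) (U := Ioo 0 T) key
  refine ⟨c, fun t ht => sub_eq_zero.1 ?_⟩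
  have h5 : (fun t => w t - c) =ᵐ[volume.restrict (Ioo 0 T)] fun _ => 0 :=
    (ae_restrict_iff' measurableSet_Ioo).2 hae
  exact Measure.eqOn_open_of_ae_eq h5 isOpen_Ioo hcw.continuousOn continuousOn_const ht

/-- The difference of `p` and the primitive of `v` has zero weak derivative, hence is constant.
Continuity of `v` makes the derivative classical. -/
theorem hasDerivAt_of_integral_mul_deriv {p v : ℝ → ℝ} (hp : Continuous p) (hv : Continuous v)
    (h : ∀ T, 0 < T → ∀ χ : ℝ → ℝ, ContDiff ℝ ∞ χ →
      (∃ a b, 0 < a ∧ b < T ∧ ∀ t, t ∉ Icc a b → χ t = 0) →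
      ∫ t in (0 : ℝ)..T, p t * deriv χ t = -∫ t in (0 : ℝ)..T, v t * χ t) {t : ℝ} (ht : 0 < t) :
    HasDerivAt p (v t) t := by
  set V := fun t => ∫ s in (0 : ℝ)..t, v s with hV
  have hVd : ∀ t, HasDerivAt V (v t) t := fun t =>
    intervalIntegral.integral_hasDerivAt_right (hv.intervalIntegrable _ _)
      hv.aestronglyMeasurable.stronglyMeasurableAtFilter hv.continuousAt
  have hVc : Continuous V := continuous_iff_continuousAt.2 fun t => (hVd t).continuousAt
  obtain ⟨c, hc⟩ := eqOn_const_of_integral_mul_deriv (w := fun t => p t - V t) (hp.sub hVc)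
    (T := t + 1) (by linarith)
    (fun χ hχ hs => by
      have hχ' : Continuous (deriv χ) := hχ.continuous_deriv (by simp)
      have h1 := h (t + 1) (by linarith) χ hχ hs
      obtain ⟨a, b, ha, hb, h0⟩ := hs
      have h2 := intervalIntegral.integral_mul_deriv_eq_deriv_mul (a := 0) (b := t + 1) (u := V)
        (v := χ) (u' := v) (v' := deriv χ) (fun s _ => hVd s)
        (fun s _ => (hχ.differentiable (by simp) s).hasDerivAt) (hv.intervalIntegrable _ _)
        (hχ'.intervalIntegrable _ _)
      rw [h0 0 fun h => by linarith [h.1], h0 (t + 1) fun h => by linarith [h.2], mul_zero, mul_zero,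
        sub_zero, zero_sub] at h2
      have I1 : IntervalIntegrable (fun s => p s * deriv χ s) volume 0 (t + 1) :=
        (hp.mul hχ').intervalIntegrable _ _
      have I2 : IntervalIntegrable (fun s => V s * deriv χ s) volume 0 (t + 1) :=
        (hVc.mul hχ').intervalIntegrable _ _
      simp only [sub_mul]
      rw [intervalIntegral.integral_sub I1 I2, h1, h2, sub_self])
  have : p =ᶠ[𝓝 t] fun s => V s + c := by
    filter_upwards [isOpen_Ioo.mem_nhds (show t ∈ Ioo 0 (t + 1) from ⟨ht, by linarith⟩)] with s hs
    have := hc s hs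
    linarith
  exact ((hVd t).add_const c).congr_of_eventuallyEq this

/-! ### Weak solutions solve the equations for the coefficients -/

theorem integral_mul_const_hart (u : Torus3 → ℝ) (c : ℝ) (k : Fin 3 → ℤ) :
    ∫ x, u x * (c * hart k x) = c * coef u k := by
  rw [coef, ← integral_const_mul]
  exact integral_congr_ae (Eventually.of_forall fun x => by ring)

/-- The first component of an element of the energy space, as a continuous linear map. -/
def posL : EnergySpace →L[ℝ] L2 :=
  (ContinuousLinearMap.fst ℝ L2 (Fin 3 → L2)).comp
    (H1.subtypeL.comp (ContinuousLinearMap.fst ℝ H1 L2))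

theorem isTestFunction_mul_hart {T : ℝ} {χ : ℝ → ℝ} (hχ : ContDiff ℝ ∞ χ)
    (h : ∃ a b, 0 < a ∧ b < T ∧ ∀ t, t ∉ Icc a b → χ t = 0) (k : Fin 3 → ℤ) :
    IsTestFunction T fun t x => χ t * hart k x where
  smooth := (hχ.comp contDiff_fst).mul
    (ContDiff.comp (g := fun y => hart k (proj y)) (smoothTorus_hart k) contDiff_snd)
  support := by
    obtain ⟨a, b, ha, hb, h0⟩ := h
    exact ⟨a, b, ha, hb, fun t ht x => by rw [h0 t ht, zero_mul]⟩

theorem partialX_const_mul_hart (c : ℝ) (k : Fin 3 → ℤ) (i : Fin 3) (x : Torus3) :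
    partialX i (fun x => c * hart k x) x = c * k i * hart (-k) x := by
  rw [mul_assoc, ← partialX_hart, partialX, deriv_const_mul_field, partialX]

section

variable {γ : ℝ} {f : ℝ → ℝ} {g : L2} {ξ : ℝ → EnergySpace} {ξ₀ : EnergySpace} {C : ℝ}

/-- Testing with `χ(t) hart k(x)` gives each equation weakly in time. Weak continuity makes all
coefficients, including those of the nonlinearity, continuous, so the equations hold classically.
For negative times the trajectory is frozen at its initial value. -/
theorem IsWeakEnergySolution.modeSolution (h : IsWeakEnergySolution 0 γ f g ξ ξ₀)
    (hf : Growth f C) : ModeSolution γ f g fun t => ξ (max t 0) := by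
  have hmax : Continuous fun t : ℝ => max t 0 := continuous_id.max continuous_const
  have hcomp : ∀ l : EnergySpace →L[ℝ] ℝ, Continuous fun t => l (ξ (max t 0)) := fun l =>
    (h.weaklyContinuous l).comp_continuous hmax fun t => le_max_right t 0
  have cp : ∀ k, Continuous fun t => coef (ξ (max t 0)).pos k := fun k => by
    refine (hcomp ((innerSL ℝ (hartLp k)).comp posL)).congr fun t => ?_
    exact inner_hartLp k _
  have cv : ∀ k, Continuous fun t => coef (ξ (max t 0)).vel k := fun k => by
    refine (hcomp ((innerSL ℝ (hartLp k)).comp (ContinuousLinearMap.snd ℝ H1 L2))).congr fun t => ?_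
    exact inner_hartLp k _
  have hb : ∀ T, ∃ R, 0 ≤ R ∧ ∀ t ≤ T, ‖ξ (max t 0)‖ ≤ R := by
    intro T
    obtain ⟨R, hR⟩ := h.bounded (max T 1) (by positivity)
    refine ⟨max R 0, le_max_right _ _, fun t ht => (hR _ ⟨le_max_right _ _, ?_⟩).trans (le_max_left _ _)⟩
    exact max_le_max ht zero_le_one
  have cF : ∀ k, Continuous fun t => coef (fun x => f ((ξ (max t 0)).pos x)) k := fun k =>
    hf.continuous_coef cp (fun T => by
      obtain ⟨R, hR, hb⟩ := hb T
      refine ⟨3 * R + 1, by positivity, fun t ht => (hs_two_pos_le _).trans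
        (ENNReal.ofReal_le_ofReal ?_)⟩
      have := pow_le_pow_left₀ (norm_nonneg _) (hb t ht) 2
      nlinarith) k
  have hmaxT : ∀ {T t : ℝ}, 0 < T → t ∈ uIcc 0 T → max t 0 = t := fun hT ht => by
    rw [uIcc_of_le hT.le] at ht
    exact max_eq_left ht.1
  refine ⟨cp, cv, hb, fun T => ?_, fun k t ht => ?_, fun k t ht => ?_⟩
  · rcases le_or_gt T 0 with hT | hT
    · rw [Ioo_eq_empty (not_lt.2 hT)]; simp
    · refine lt_of_le_of_lt ((setLIntegral_mono' measurableSet_Ioo fun t ht => ?_).trans_eq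
        (lintegral_const_mul' 2 _ (by simp))) (ENNReal.mul_lt_top (by simp) (h.velocity T hT))
      rw [max_eq_left ht.1.le]
      exact hs_one_le_hsNormSq _
  · refine hasDerivAt_of_integral_mul_deriv (cp k) (cv k) (fun T hT χ hχ hs => ?_) ht
    have h1 := h.timeDeriv T hT _ (isTestFunction_mul_hart hχ hs k)
    refine (intervalIntegral.integral_congr fun t ht => ?_).trans (h1.trans (congrArg _
      (intervalIntegral.integral_congr fun t ht => ?_)))
    · simp only [hmaxT hT ht]
      rw [mul_comm, ← integral_mul_const_hart]
      refine integral_congr_ae (Eventually.of_forall fun x => ?_)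
      simp only
      rw [deriv_mul_const_field]
    · simp only [hmaxT hT ht]
      rw [integral_mul_const_hart, mul_comm]
  · set W := fun t => coef g k - γ * absK k * coef (ξ (max t 0)).vel k -
      sqNorm k * coef (ξ (max t 0)).pos k - coef (fun x => f ((ξ (max t 0)).pos x)) k with hW
    have hk1 := cp k
    have hk2 := cv k
    have hk3 := cF k
    have cW : Continuous W := by fun_prop
    refine hasDerivAt_of_integral_mul_deriv (v := W) (cv k) cW (fun T hT χ hχ hs => ?_) ht
    have hk4 : Continuous χ := hχ.continuous
    have h1 := h.equation T hT _ (isTestFunction_mul_hart hχ hs k)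
    have e1 : ∫ t in (0 : ℝ)..T, ∫ x, (ξ t).vel x * deriv (fun s => χ s * hart k x) t =
        ∫ t in (0 : ℝ)..T, coef (ξ (max t 0)).vel k * deriv χ t :=
      intervalIntegral.integral_congr fun t ht => by
        simp only [hmaxT hT ht]
        refine Eq.trans ?_ (mul_comm _ _)
        rw [← integral_mul_const_hart]
        refine integral_congr_ae (Eventually.of_forall fun x => ?_)
        simp only
        rw [deriv_mul_const_field]
    have e2 : ∫ t in (0 : ℝ)..T, ∑ i, ∫ x, (ξ t).grad i x * partialX i (fun x => χ t * hart k x) x =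
        ∫ t in (0 : ℝ)..T, sqNorm k * coef (ξ (max t 0)).pos k * χ t :=
      intervalIntegral.integral_congr fun t ht => by
        simp only [hmaxT hT ht, partialX_const_mul_hart, integral_mul_const_hart, coef_grad,
          Pi.neg_apply, neg_neg, Int.cast_neg, neg_mul]
        rw [sqNorm, Finset.sum_mul, Finset.sum_mul]
        exact Finset.sum_congr rfl fun i _ => by ring
    have e3 : ∫ t in (0 : ℝ)..T, ∫ x, (ξ t).vel x * fracLaplacian (1 / 2) (fun x => χ t * hart k x) x =
        ∫ t in (0 : ℝ)..T, absK k * coef (ξ (max t 0)).vel k * χ t :=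
      intervalIntegral.integral_congr fun t ht => by
        simp only [hmaxT hT ht, fracLaplacian_const_mul_hart, ← mul_assoc (absK k)]
        rw [integral_mul_const_hart]
        ring
    have e4 : ∫ t in (0 : ℝ)..T, ∫ x, f ((ξ t).pos x) * (χ t * hart k x) =
        ∫ t in (0 : ℝ)..T, coef (fun x => f ((ξ (max t 0)).pos x)) k * χ t :=
      intervalIntegral.integral_congr fun t ht => by
        simp only [hmaxT hT ht]
        rw [integral_mul_const_hart (fun x => f ((ξ t).pos x)), mul_comm]
    have e5 : ∫ t in (0 : ℝ)..T, ∫ x, g x * (χ t * hart k x) = ∫ t in (0 : ℝ)..T, coef g k * χ t :=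
      intervalIntegral.integral_congr fun t ht => by
        rw [integral_mul_const_hart, mul_comm]
    rw [e1, e2, e3, e4, e5, zero_mul, add_zero] at h1
    have I2 : IntervalIntegrable (fun t => sqNorm k * coef (ξ (max t 0)).pos k * χ t) volume 0 T :=
      Continuous.intervalIntegrable (by fun_prop) _ _
    have I3 : IntervalIntegrable (fun t => γ * (absK k * coef (ξ (max t 0)).vel k * χ t)) volume 0 T :=
      Continuous.intervalIntegrable (by fun_prop) _ _
    have I4 : IntervalIntegrable (fun t => coef (fun x => f ((ξ (max t 0)).pos x)) k * χ t) volume 0 T :=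
      Continuous.intervalIntegrable (by fun_prop) _ _
    have I5 : IntervalIntegrable (fun t => coef g k * χ t) volume 0 T :=
      Continuous.intervalIntegrable (by fun_prop) _ _
    have e6 : ∫ t in (0 : ℝ)..T, W t * χ t = (∫ t in (0 : ℝ)..T, coef g k * χ t) -
        (∫ t in (0 : ℝ)..T, γ * (absK k * coef (ξ (max t 0)).vel k * χ t)) -
        (∫ t in (0 : ℝ)..T, sqNorm k * coef (ξ (max t 0)).pos k * χ t) -
        ∫ t in (0 : ℝ)..T, coef (fun x => f ((ξ (max t 0)).pos x)) k * χ t := by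
      rw [← intervalIntegral.integral_sub I5 I3, ← intervalIntegral.integral_sub (I5.sub I3) I2,
        ← intervalIntegral.integral_sub ((I5.sub I3).sub I2) I4]
      refine intervalIntegral.integral_congr fun t _ => ?_
      simp only [hW]
      ring
    rw [intervalIntegral.integral_const_mul γ] at e6
    linarith

end

/-! ### Weak continuity -/

theorem tendsto_norm_sub_trigL (w : L2) :
    Tendsto (fun N => ‖w - trigL (box N) (coef w)‖) atTop (𝓝 0) := by
  have h := tendsto_hs_tail (n := 0) (a := coef w) (by rw [hs_zero_coef]; exact ENNReal.ofReal_lt_top)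
  have e : ∀ N, hs 0 (fun k => coef w k - coef (trigL (box N) (coef w)) k) =
      ENNReal.ofReal (‖w - trigL (box N) (coef w)‖ ^ 2) := fun N => by
    rw [← hs_zero_coef]
    congr 1
    ext k
    rw [coef_Lp_sub]
  simp_rw [e] at h
  have h2 := (Real.continuous_sqrt.tendsto _).comp ((ENNReal.tendsto_toReal ENNReal.zero_ne_top).comp h)
  refine (h2.congr fun N => ?_).trans (le_of_eq (by simp))
  simp only [Function.comp]
  rw [ENNReal.toReal_ofReal (sq_nonneg _), Real.sqrt_sq (norm_nonneg _)]

theorem inner_trigL (s : Finset (Fin 3 → ℤ)) (a : (Fin 3 → ℤ) → ℝ) (u : L2) :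
    inner ℝ (trigL s a) u = ∑ k ∈ s, coef u k * a k := by
  rw [← integral_mul_eq_inner, ← integral_mul_trigL (integrable_coe u)]
  exact integral_congr_ae (Eventually.of_forall fun x => mul_comm _ _)

/-- A locally bounded trajectory in `L²` with continuous coefficients is weakly continuous. -/
theorem continuous_clm_of_coef {U : ℝ → L2} (hc : ∀ k, Continuous fun t => coef (U t) k)
    (hb : ∀ T, ∃ R, ∀ t ≤ T, ‖U t‖ ≤ R) (m : L2 →L[ℝ] ℝ) : Continuous fun t => m (U t) := by
  set w := (InnerProductSpace.toDual ℝ L2).symm m with hw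
  have e : ∀ u, m u = inner ℝ w u := fun u => by
    rw [hw, InnerProductSpace.toDual_symm_apply]
  simp_rw [e]
  rw [continuous_iff_continuousAt]
  intro t
  obtain ⟨R, hR⟩ := hb (t + 1)
  have hR0 : 0 ≤ R := (norm_nonneg _).trans (hR t (by linarith))
  refine continuousAt_of_locally_uniform_approx_of_continuousAt fun V hV => ?_
  obtain ⟨ε, hε, hεV⟩ := Metric.mem_uniformity_dist.1 hV
  obtain ⟨N, hN⟩ := ((tendsto_norm_sub_trigL w).eventually_lt_const
    (show 0 < ε / (R + 1) by positivity)).exists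
  refine ⟨Iic (t + 1), Iic_mem_nhds (by linarith), fun s => inner ℝ (trigL (box N) (coef w)) (U s),
    ?_, fun s hs => hεV ?_⟩
  · simp_rw [inner_trigL]
    exact (continuous_finsetSum _ fun k _ => (hc k).mul continuous_const).continuousAt
  · rw [Real.dist_eq, ← inner_sub_left]
    refine (abs_real_inner_le_norm _ _).trans_lt ?_
    calc _ ≤ ‖w - trigL (box N) (coef w)‖ * R := mul_le_mul_of_nonneg_left (hR s hs) (norm_nonneg _)
      _ ≤ ‖w - trigL (box N) (coef w)‖ * (R + 1) :=
        mul_le_mul_of_nonneg_left (by linarith) (norm_nonneg _)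
      _ < ε := (lt_div_iff₀ (by positivity)).1 hN

/-- The functional is split into functionals on L², one for each component of `(u, ∇u, v)`, to which
the coefficient criterion applies. -/
theorem ModeSolution.continuous_clm {γ : ℝ} {f : ℝ → ℝ} {g : L2} {ξ : ℝ → EnergySpace}
    (h : ModeSolution γ f g ξ) (l : EnergySpace →L[ℝ] ℝ) : Continuous fun t => l (ξ t) := by
  -- Hahn–Banach extends the functional from the graph `H1` to the full product, where it splits
  -- into components.
  obtain ⟨L, hL, -⟩ := exists_extension_norm_eq H1 (l.comp (ContinuousLinearMap.inl ℝ H1 L2))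
  have e : ∀ ξ : EnergySpace, l ξ = L.comp (ContinuousLinearMap.inl ℝ L2 (Fin 3 → L2)) ξ.pos +
      ∑ i, (L.comp ((ContinuousLinearMap.inr ℝ L2 (Fin 3 → L2)).comp
        (ContinuousLinearMap.single ℝ (fun _ => L2) i))) (ξ.grad i) +
      l.comp (ContinuousLinearMap.inr ℝ H1 L2) ξ.vel := by
    intro ξ
    have e1 : l ξ = l (ξ.1, 0) + l (0, ξ.2) := by
      rw [← map_add]; simp
    have e2 : l (ξ.1, 0) = L (ξ.1 : L2 × (Fin 3 → L2)) := (hL ξ.1).symm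
    have e3 : (ξ.1 : L2 × (Fin 3 → L2)) = (ξ.pos, 0) + ∑ i, (0, Pi.single i (ξ.grad i)) := by
      refine Prod.ext ?_ ?_
      · simp [EnergySpace.pos, Prod.fst_sum]
      · rw [Prod.snd_add, Prod.snd_sum, zero_add]
        exact (Finset.univ_sum_single ξ.grad).symm
    rw [e1, e2, e3, map_add, map_sum]
    rfl
  simp_rw [e]
  have hb : ∀ T, ∃ R, ∀ t ≤ T, ‖ξ t‖ ≤ R := fun T => by
    obtain ⟨R, -, hR⟩ := h.bounded T
    exact ⟨R, hR⟩
  refine ((continuous_clm_of_coef h.cont_pos (fun T => ?_) _).add (continuous_finsetSum _ fun i _ =>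
    continuous_clm_of_coef (fun k => ?_) (fun T => ?_) _)).add
    (continuous_clm_of_coef h.cont_vel (fun T => ?_) _)
  · obtain ⟨R, hR⟩ := hb T
    exact ⟨R, fun t ht => (norm_pos_le _).trans (hR t ht)⟩
  · simp_rw [coef_grad]
    exact (continuous_const.mul (h.cont_pos (-k))).neg
  · obtain ⟨R, hR⟩ := hb T
    exact ⟨R, fun t ht => (norm_grad_le _ i).trans (hR t ht)⟩
  · obtain ⟨R, hR⟩ := hb T
    exact ⟨R, fun t ht => (norm_vel_le _).trans (hR t ht)⟩

/-! ### Coefficients of smooth functions -/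

theorem SmoothTorus.smoothTorus_partialX {φ : Torus3 → ℝ} (h : SmoothTorus φ) (i : Fin 3) :
    SmoothTorus (partialX i φ) := by
  unfold SmoothTorus
  simp_rw [h.partialX_proj i]
  exact (ContDiff.fderiv_right h (m := ∞) (by simp)).clm_apply contDiff_const

/-- Each derivative multiplies the coefficients by a component of `k`; applied to the largest
component, this gains one power of `nu`. -/
theorem SmoothTorus.exists_decay {φ : Torus3 → ℝ} (h : SmoothTorus φ) (n : ℕ) :
    ∃ M, ∀ k, nu k ^ n * |coef φ k| ≤ M := by
  induction n generalizing φ with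
  | zero =>
    refine ⟨∫ x, |φ x|, fun k => ?_⟩
    rw [pow_zero, one_mul, coef, ← Real.norm_eq_abs]
    refine norm_integral_le_of_norm_le (integrable_of_continuous h.continuous).abs
      (Eventually.of_forall fun x => ?_)
    rw [norm_mul, Real.norm_eq_abs, Real.norm_eq_abs]
    exact mul_le_of_le_one_right (abs_nonneg _) (abs_hart_le k x)
  | succ n ih =>
    obtain ⟨M, hM⟩ := ih h
    choose M' hM' using fun i => ih (h.smoothTorus_partialX i)
    refine ⟨M + ∑ i, M' i, fun k => ?_⟩
    obtain ⟨i, hi⟩ := exists_norm_eq k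
    have h0 : ∀ i, 0 ≤ M' i := fun i =>
      (mul_nonneg (pow_nonneg (nu_pos k).le n) (abs_nonneg _)).trans (hM' i k)
    have h1 : nu k ^ n * (‖k‖ * |coef φ k|) ≤ M' i := by
      have := hM' i (-k)
      rw [coef_partialX h, nu_neg, neg_neg, abs_neg, abs_mul] at this
      simpa [hi] using this
    have h2 := Finset.single_le_sum (f := M') (fun i _ => h0 i) (Finset.mem_univ i)
    have e : nu k ^ (n + 1) * |coef φ k| = nu k ^ n * |coef φ k| + nu k ^ n * (‖k‖ * |coef φ k|) := by
      rw [pow_succ, nu]; ring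
    rw [e]
    linarith [hM k]

/-- Decay of order 5 is used: one power for the symbol and four for summability over ℤ³. -/
theorem SmoothTorus.summable_absK {φ : Torus3 → ℝ} (h : SmoothTorus φ) :
    Summable fun k => absK k * |coef φ k| := by
  obtain ⟨M, hM⟩ := h.exists_decay 5
  refine Summable.of_nonneg_of_le (fun k => mul_nonneg (absK_nonneg k) (abs_nonneg _)) (fun k => ?_)
    (summable_nu_inv_four.mul_left (2 * M))
  have h0 := nu_pos k
  rw [le_mul_inv_iff₀ (by positivity)]
  calc absK k * |coef φ k| * nu k ^ 4 ≤ (2 * nu k) * |coef φ k| * nu k ^ 4 := by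
        gcongr; exact absK_le_nu k
    _ = 2 * (nu k ^ 5 * |coef φ k|) := by ring
    _ ≤ 2 * M := by linarith [hM k]

theorem SmoothTorus.fracLaplacian_eq {φ : Torus3 → ℝ} (h : SmoothTorus φ) (x : Torus3) :
    fracLaplacian (1 / 2) φ x = ∑' k, absK k * coef φ k * hart k x :=
  fracLaplacian_half_eq (integrable_of_continuous h.continuous) h.summable_absK x

theorem SmoothTorus.norm_term_le (φ : Torus3 → ℝ) (k : Fin 3 → ℤ) (x : Torus3) :
    ‖absK k * coef φ k * hart k x‖ ≤ absK k * |coef φ k| := by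
  rw [norm_mul, norm_mul, Real.norm_eq_abs, Real.norm_eq_abs, Real.norm_eq_abs,
    abs_of_nonneg (absK_nonneg k)]
  exact mul_le_of_le_one_right (mul_nonneg (absK_nonneg k) (abs_nonneg _)) (abs_hart_le k x)

theorem SmoothTorus.continuous_fracLaplacian {φ : Torus3 → ℝ} (h : SmoothTorus φ) :
    Continuous (fracLaplacian (1 / 2) φ) := by
  rw [show fracLaplacian (1 / 2) φ = fun x => ∑' k, absK k * coef φ k * hart k x from
    funext h.fracLaplacian_eq]
  exact continuous_tsum (fun k => continuous_const.mul (continuous_hart k)) h.summable_absK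
    fun k x => SmoothTorus.norm_term_le φ k x

theorem SmoothTorus.coef_fracLaplacian {φ : Torus3 → ℝ} (h : SmoothTorus φ) (l : Fin 3 → ℤ) :
    coef (fracLaplacian (1 / 2) φ) l = absK l * coef φ l := by
  have e : ∀ x, fracLaplacian (1 / 2) φ x * hart l x =
      ∑' k, absK k * coef φ k * hart k x * hart l x := fun x => by
    rw [h.fracLaplacian_eq, tsum_mul_right]
  have hle : ∀ k x, ‖absK k * coef φ k * hart k x * hart l x‖ ≤ absK k * |coef φ k| := fun k x => by
    rw [norm_mul, Real.norm_eq_abs (hart l x)]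
    exact (mul_le_of_le_one_right (norm_nonneg _) (abs_hart_le l x)).trans
      (SmoothTorus.norm_term_le φ k x)
  have hc : ∀ k, Integrable (fun x => absK k * coef φ k * hart k x * hart l x) := fun k =>
    integrable_of_continuous ((continuous_const.mul (continuous_hart k)).mul (continuous_hart l))
  have hint : ∀ k, ∫ x, absK k * coef φ k * hart k x * hart l x = if k = l then absK l * coef φ l else 0 := by
    intro k
    simp_rw [mul_assoc (absK k * coef φ k)]
    rw [integral_const_mul, integral_hart_mul_hart]
    split_ifs with hk
    · rw [hk, mul_one]
    · rw [mul_zero]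
  rw [coef]
  simp_rw [e]
  rw [← integral_tsum_of_summable_integral_norm hc, tsum_eq_single l]
  · rw [hint, if_pos rfl]
  · intro k hk
    rw [hint, if_neg hk]
  · refine Summable.of_nonneg_of_le (fun k => integral_nonneg fun x => norm_nonneg _) (fun k => ?_)
      (h.summable_absK.mul_left ((2 * π) ^ 3))
    refine (integral_mono (hc k).norm (integrable_const _) (hle k)).trans_eq ?_
    rw [integral_const, volume_real_torus, smul_eq_mul]

theorem sum_coef_sq_le {h : Torus3 → ℝ} (hh : Continuous h) {M : ℝ} (hM : ∀ x, |h x| ≤ M)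
    (s : Finset (Fin 3 → ℤ)) : ∑ k ∈ s, coef h k ^ 2 ≤ M ^ 2 * (2 * π) ^ 3 := by
  have h1 := hasSum_coef_mul_continuous (toL2 hh) hh
  simp_rw [coef_toL2, ← sq] at h1
  refine (sum_le_hasSum s (fun k _ => sq_nonneg _) h1).trans ?_
  have e : ∫ x, toL2 hh x * h x = ∫ x, h x * h x := by
    refine integral_congr_ae ?_
    filter_upwards [coeFn_toL2 hh] with x hx
    rw [hx]
  rw [e]
  refine (integral_mono (integrable_of_continuous (hh.mul hh)) (integrable_const (M ^ 2))
    fun x => ?_).trans_eq ?_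
  · have := pow_le_pow_left₀ (abs_nonneg _) (hM x) 2
    rw [sq_abs, sq] at this
    exact this
  · rw [integral_const, volume_real_torus, smul_eq_mul, mul_comm]

theorem SmoothTorus.sum_sqNorm_mul_le {φ : Torus3 → ℝ} (h : SmoothTorus φ) {M : ℝ}
    (hM : ∀ i x, |partialX i φ x| ≤ M) (s : Finset (Fin 3 → ℤ)) :
    ∑ k ∈ s, sqNorm k * coef φ k ^ 2 ≤ 3 * (M ^ 2 * (2 * π) ^ 3) := by
  have h1 : ∀ i, ∑ k ∈ s, (k i : ℝ) ^ 2 * coef φ k ^ 2 ≤ M ^ 2 * (2 * π) ^ 3 := by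
    intro i
    have := sum_coef_sq_le (h.continuous_partialX i) (hM i) (s.map (Equiv.neg _).toEmbedding)
    rw [Finset.sum_map] at this
    refine le_of_eq_of_le (Finset.sum_congr rfl fun k _ => ?_) this
    simp only [Equiv.coe_toEmbedding, Equiv.neg_apply, coef_partialX h, neg_neg, Pi.neg_apply, Int.cast_neg]
    ring
  simp_rw [sqNorm, Finset.sum_mul]
  rw [Finset.sum_comm]
  exact (Finset.sum_le_sum fun i _ => h1 i).trans_eq (by simp)

theorem SmoothTorus.hs_two_le {φ : Torus3 → ℝ} (h : SmoothTorus φ) {M : ℝ} (hM0 : ∀ x, |φ x| ≤ M)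
    (hM : ∀ i x, |partialX i φ x| ≤ M) :
    hs 2 (coef φ) ≤ ENNReal.ofReal (8 * (M ^ 2 * (2 * π) ^ 3)) := by
  refine (hs_le_ofReal_iff (by positivity)).2 fun s => ?_
  have h1 := sum_coef_sq_le h.continuous hM0 s
  have h2 := h.sum_sqNorm_mul_le hM s
  have h3 : ∑ k ∈ s, nu k ^ 2 * coef φ k ^ 2 ≤
      ∑ k ∈ s, (2 * coef φ k ^ 2 + 2 * (sqNorm k * coef φ k ^ 2)) := by
    refine Finset.sum_le_sum fun k _ => ?_
    have : nu k ^ 2 ≤ 2 + 2 * sqNorm k := by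
      have := norm_sq_le_sqNorm k
      unfold nu
      nlinarith [sq_nonneg (1 - ‖k‖)]
    nlinarith [mul_le_mul_of_nonneg_right this (sq_nonneg (coef φ k))]
  rw [Finset.sum_add_distrib, ← Finset.mul_sum, ← Finset.mul_sum] at h3
  linarith

/-! ### Test functions -/

theorem continuous_uncurry_of_proj {h : ℝ → Torus3 → ℝ}
    (hh : Continuous fun p : ℝ × (Fin 3 → ℝ) => h p.1 (proj p.2)) : Continuous (Function.uncurry h) :=
  (IsOpenQuotientMap.id.prodMap isOpenQuotientMap_proj).isQuotientMap.continuous_iff.2 hh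

section

variable {T : ℝ} {φ : ℝ → Torus3 → ℝ}

theorem IsTestFunction.smoothTorus (h : IsTestFunction T φ) (t : ℝ) : SmoothTorus (φ t) :=
  h.smooth.comp (contDiff_const.prodMk contDiff_id)

theorem IsTestFunction.continuous (h : IsTestFunction T φ) : Continuous (Function.uncurry φ) :=
  continuous_uncurry_of_proj h.smooth.continuous

theorem IsTestFunction.hasDerivAt_proj (h : IsTestFunction T φ) (t : ℝ) (y : Fin 3 → ℝ) :
    HasDerivAt (fun s => φ s (proj y))
      (fderiv ℝ (fun p : ℝ × (Fin 3 → ℝ) => φ p.1 (proj p.2)) (t, y) (1, 0)) t := by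
  have h1 := ((h.smooth.differentiable (by simp)) (t, y)).hasFDerivAt
  exact h1.comp_hasDerivAt t ((hasDerivAt_id t).prodMk (hasDerivAt_const t y))

theorem IsTestFunction.hasDerivAt (h : IsTestFunction T φ) (t : ℝ) (x : Torus3) :
    HasDerivAt (fun s => φ s x) (deriv (fun s => φ s x) t) t := by
  obtain ⟨y, rfl⟩ := proj_surjective x
  exact (h.hasDerivAt_proj t y).differentiableAt.hasDerivAt

theorem IsTestFunction.continuous_deriv (h : IsTestFunction T φ) :
    Continuous (Function.uncurry fun t x => deriv (fun s => φ s x) t) := by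
  refine continuous_uncurry_of_proj ?_
  simp_rw [fun t y => (h.hasDerivAt_proj t y).deriv]
  exact (h.smooth.continuous_fderiv (by simp)).clm_apply continuous_const

theorem IsTestFunction.continuous_partialX (h : IsTestFunction T φ) (i : Fin 3) :
    Continuous (Function.uncurry fun t => partialX i (φ t)) := by
  refine continuous_uncurry_of_proj ?_
  have e : ∀ p : ℝ × (Fin 3 → ℝ), partialX i (φ p.1) (proj p.2) =
      fderiv ℝ (fun p : ℝ × (Fin 3 → ℝ) => φ p.1 (proj p.2)) p (0, Pi.single i 1) := by
    intro p
    rw [(h.smoothTorus p.1).partialX_proj]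
    have h1 := ((h.smooth.differentiable (by simp)) p).hasFDerivAt
    have h2 : HasFDerivAt (fun y : Fin 3 → ℝ => (p.1, y)) (ContinuousLinearMap.inr ℝ ℝ (Fin 3 → ℝ)) p.2 :=
      hasFDerivAt_prodMk_right p.1 p.2
    have h3 : HasFDerivAt (fun y => φ p.1 (proj y)) _ p.2 :=
      HasFDerivAt.comp (g := fun p : ℝ × (Fin 3 → ℝ) => φ p.1 (proj p.2)) p.2 h1 h2
    rw [h3.fderiv]
    rfl
  simp_rw [e]
  exact (h.smooth.continuous_fderiv (by simp)).clm_apply continuous_const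

theorem exists_bound_Icc {h : ℝ → Torus3 → ℝ} (hh : Continuous (Function.uncurry h)) (T : ℝ) :
    ∃ M, ∀ t ∈ Icc 0 T, ∀ x, |h t x| ≤ M := by
  obtain ⟨M, hM⟩ := ((isCompact_Icc (a := 0) (b := T)).prod
    (isCompact_univ (X := Torus3))).exists_bound_of_continuousOn hh.continuousOn
  exact ⟨M, fun t ht x => hM (t, x) ⟨ht, mem_univ x⟩⟩

theorem IsTestFunction.exists_bound (h : IsTestFunction T φ) : ∃ M, ∀ t ∈ Icc 0 T,
    (∀ x, |φ t x| ≤ M) ∧ (∀ x, |deriv (fun s => φ s x) t| ≤ M) ∧ ∀ i x, |partialX i (φ t) x| ≤ M := by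
  obtain ⟨M1, h1⟩ := exists_bound_Icc h.continuous T
  obtain ⟨M2, h2⟩ := exists_bound_Icc h.continuous_deriv T
  choose M3 h3 using fun i => exists_bound_Icc (h.continuous_partialX i) T
  refine ⟨max (max M1 M2) (∑ i, |M3 i|), fun t ht => ⟨fun x => ?_, fun x => ?_, fun i x => ?_⟩⟩
  · exact (h1 t ht x).trans ((le_max_left _ _).trans (le_max_left _ _))
  · exact (h2 t ht x).trans ((le_max_right _ _).trans (le_max_left _ _))
  · refine ((h3 i t ht x).trans (le_abs_self _)).trans (le_trans ?_ (le_max_right _ _))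
    exact Finset.single_le_sum (f := fun i => |M3 i|) (fun i _ => abs_nonneg _) (Finset.mem_univ i)

theorem continuous_coef_uncurry {h : ℝ → Torus3 → ℝ} (hh : Continuous (Function.uncurry h))
    (k : Fin 3 → ℤ) : Continuous fun t => coef (h t) k :=
  continuous_integral_torus (h := fun t x => h t x * hart k x)
    (hh.mul ((continuous_hart k).comp continuous_snd))

theorem IsTestFunction.hasDerivAt_coef (h : IsTestFunction T φ) (k : Fin 3 → ℤ) (t : ℝ) :
    HasDerivAt (fun t => coef (φ t) k) (coef (fun x => deriv (fun s => φ s x) t) k) t :=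
  hasDerivAt_integral_torus (h := fun t x => φ t x * hart k x)
    (h' := fun t x => deriv (fun s => φ s x) t * hart k x)
    (h.continuous.mul ((continuous_hart k).comp continuous_snd))
    (h.continuous_deriv.mul ((continuous_hart k).comp continuous_snd)) one_pos
    fun s _ x => (h.hasDerivAt s x).mul_const _

theorem IsTestFunction.coef_zero (h : IsTestFunction T φ) (k : Fin 3 → ℤ) :
    coef (φ 0) k = 0 ∧ coef (φ T) k = 0 := by
  obtain ⟨a, b, ha, hb, h0⟩ := h.support
  refine ⟨?_, ?_⟩
  · simp [coef, h0 0 fun h => by linarith [h.1]]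
  · simp [coef, h0 T fun h => by linarith [h.2]]

end

/-! ### Solutions of the equations for the coefficients are weak solutions -/

/-- Exchange of the mode sum with the time integral by dominated convergence, with a constant
majorant for all box sums. -/
theorem tendsto_integral_sum_box {a : (Fin 3 → ℤ) → ℝ → ℝ} {G : ℝ → ℝ} {T M : ℝ} (hT : 0 ≤ T)
    (ha : ∀ k, Continuous (a k)) (hM : ∀ N, ∀ t ∈ Ioc 0 T, |∑ k ∈ box N, a k t| ≤ M)
    (hG : ∀ t ∈ Ioc 0 T, Tendsto (fun N => ∑ k ∈ box N, a k t) atTop (𝓝 (G t))) :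
    Tendsto (fun N => ∑ k ∈ box N, ∫ t in (0 : ℝ)..T, a k t) atTop (𝓝 (∫ t in (0 : ℝ)..T, G t)) := by
  have h := intervalIntegral.tendsto_integral_filter_of_dominated_convergence (a := 0) (b := T)
    (μ := volume) (F := fun N t => ∑ k ∈ box N, a k t) (f := G) (l := atTop) (fun _ => M)
    (Eventually.of_forall fun N => (continuous_finsetSum _ fun k _ => ha k).aestronglyMeasurable)
    (Eventually.of_forall fun N => Eventually.of_forall fun t ht => by
      rw [uIoc_of_le hT] at ht
      exact hM N t ht) intervalIntegrable_const
    (Eventually.of_forall fun t ht => by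
      rw [uIoc_of_le hT] at ht
      exact hG t ht)
  refine h.congr fun N => ?_
  rw [intervalIntegral.integral_finsetSum fun k _ => (ha k).intervalIntegrable _ _]

theorem abs_sum_mul_le {ι : Type*} {s : Finset ι} {x y : ι → ℝ} {A B : ℝ} (hx : ∑ k ∈ s, x k ^ 2 ≤ A)
    (hy : ∑ k ∈ s, y k ^ 2 ≤ B) : |∑ k ∈ s, x k * y k| ≤ A + B := by
  refine (Finset.abs_sum_le_sum_abs _ _).trans ?_
  have h : ∑ k ∈ s, |x k * y k| ≤ ∑ k ∈ s, (x k ^ 2 + y k ^ 2) := by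
    refine Finset.sum_le_sum fun k _ => ?_
    rw [abs_mul]
    nlinarith [sq_nonneg (|x k| - |y k|), sq_abs (x k), sq_abs (y k), abs_nonneg (x k), abs_nonneg (y k)]
  rw [Finset.sum_add_distrib] at h
  linarith

theorem hasSum_grad_mul (ξ : EnergySpace) {φ : Torus3 → ℝ} (h : SmoothTorus φ) :
    HasSum (fun k => sqNorm k * coef ξ.pos k * coef φ k) (∑ i, ∫ x, ξ.grad i x * partialX i φ x) := by
  have h1 : HasSum (fun k => ∑ i, coef (ξ.grad i) k * coef (partialX i φ) k)
      (∑ i, ∫ x, ξ.grad i x * partialX i φ x) :=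
    hasSum_sum fun i _ => hasSum_coef_mul_continuous (ξ.grad i) (h.continuous_partialX i)
  have h2 := (Equiv.neg (Fin 3 → ℤ)).hasSum_iff.2 h1
  refine h2.congr_fun fun k => ?_
  simp only [Function.comp, Equiv.neg_apply, coef_grad, coef_partialX h, neg_neg, Pi.neg_apply,
    Int.cast_neg]
  rw [sqNorm, Finset.sum_mul, Finset.sum_mul]
  exact Finset.sum_congr rfl fun i _ => by ring

section

variable {γ : ℝ} {f : ℝ → ℝ} {g : L2} {ξ : ℝ → EnergySpace} {C : ℝ}

/-- Every pairing with a test function is a limit of box sums of time integrals, and in each mode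
the equation is an integration by parts in time, without boundary terms because the test function
vanishes near 0 and T. -/
theorem ModeSolution.isWeakEnergySolution (h : ModeSolution γ f g ξ) (hf : Growth f C) :
    IsWeakEnergySolution 0 γ f g ξ (ξ 0) := by
  refine ⟨fun l => (h.continuous_clm l).continuousOn, fun T _ => ?_, fun T hT φ hφ => ?_,
    fun T hT => ?_, rfl, fun T hT φ hφ => ?_⟩
  · obtain ⟨R, -, hR⟩ := h.bounded T
    exact ⟨R, fun t ht => hR t ht.2⟩
  · obtain ⟨R, hR0, hR⟩ := h.bounded T
    obtain ⟨M, hM⟩ := hφ.exists_bound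
    set V := M ^ 2 * (2 * π) ^ 3
    have cp := h.cont_pos
    have cv := h.cont_vel
    have cφ := fun k => continuous_coef_uncurry hφ.continuous k
    have cφ' := fun k => continuous_coef_uncurry hφ.continuous_deriv k
    have hp : ∀ t ≤ T, ∀ s : Finset (Fin 3 → ℤ), ∑ k ∈ s, coef (ξ t).pos k ^ 2 ≤ R ^ 2 := fun t ht s =>
      (sum_le_hasSum s (fun k _ => sq_nonneg _) (hasSum_coef_sq (ξ t).pos)).trans
        (pow_le_pow_left₀ (norm_nonneg _) ((norm_pos_le _).trans (hR t ht)) 2)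
    have hv : ∀ t ≤ T, ∀ s : Finset (Fin 3 → ℤ), ∑ k ∈ s, coef (ξ t).vel k ^ 2 ≤ R ^ 2 := fun t ht s =>
      (sum_le_hasSum s (fun k _ => sq_nonneg _) (hasSum_coef_sq (ξ t).vel)).trans
        (pow_le_pow_left₀ (norm_nonneg _) ((norm_vel_le _).trans (hR t ht)) 2)
    have l1 := tendsto_integral_sum_box (M := R ^ 2 + V) hT.le
      (fun k => (cp k).mul (cφ' k)) (fun N t ht => abs_sum_mul_le (hp t ht.2 _)
        (sum_coef_sq_le (hφ.continuous_deriv.comp (Continuous.prodMk_right t))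
          (hM t (Ioc_subset_Icc_self ht)).2.1 _))
      (fun t ht => (hasSum_coef_mul_continuous (ξ t).pos
        (hφ.continuous_deriv.comp (Continuous.prodMk_right t))).comp tendsto_box)
    have l2 := tendsto_integral_sum_box (M := R ^ 2 + V) hT.le
      (fun k => (cv k).mul (cφ k)) (fun N t ht => abs_sum_mul_le (hv t ht.2 _)
        (sum_coef_sq_le (hφ.smoothTorus t).continuous (hM t (Ioc_subset_Icc_self ht)).1 _))
      (fun t ht => (hasSum_coef_mul_continuous (ξ t).vel (hφ.smoothTorus t).continuous).comp tendsto_box)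
    refine tendsto_nhds_unique l1 (l2.neg.congr fun N => ?_)
    rw [← Finset.sum_neg_distrib]
    refine Finset.sum_congr rfl fun k _ => ?_
    have hFTC := intervalIntegral.integral_eq_sub_of_hasDerivAt_of_le hT.le
      (f := fun t => coef (ξ t).pos k * coef (φ t) k) ((cp k).mul (cφ k)).continuousOn
      (fun t ht => (h.hasDerivAt_pos k t ht.1).mul (hφ.hasDerivAt_coef k t))
      ((((cv k).mul (cφ k)).add ((cp k).mul (cφ' k))).intervalIntegrable _ _)
    rw [(hφ.coef_zero k).1, (hφ.coef_zero k).2] at hFTC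
    have I1 : IntervalIntegrable (fun t => coef (ξ t).vel k * coef (φ t) k) volume 0 T :=
      ((cv k).mul (cφ k)).intervalIntegrable _ _
    have I2 : IntervalIntegrable (fun t => coef (ξ t).pos k * coef (fun x => deriv (fun s => φ s x) t) k)
      volume 0 T := ((cp k).mul (cφ' k)).intervalIntegrable _ _
    rw [intervalIntegral.integral_add I1 I2] at hFTC
    simp only [Pi.mul_apply]
    linarith
  · refine lt_of_le_of_lt ((setLIntegral_mono' measurableSet_Ioo fun t ht =>
      hsNormSq_half_le _).trans_eq (lintegral_const_mul' 2 _ (by simp)))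
      (ENNReal.mul_lt_top (by simp) (h.dissip T))
  · obtain ⟨R, hR0, hR⟩ := h.bounded T
    obtain ⟨M, hM⟩ := hφ.exists_bound
    have hM0 : 0 ≤ M := (abs_nonneg _).trans ((hM T ⟨hT.le, le_rfl⟩).1 0)
    set V := M ^ 2 * (2 * π) ^ 3 with hV
    have hV0 : 0 ≤ V := by positivity
    have cp := h.cont_pos
    have cv := h.cont_vel
    have cF := fun k => h.continuous_coef hf k
    have cφ := fun k => continuous_coef_uncurry hφ.continuous k
    have cφ' := fun k => continuous_coef_uncurry hφ.continuous_deriv k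
    have hv : ∀ t ≤ T, ∀ s : Finset (Fin 3 → ℤ), ∑ k ∈ s, coef (ξ t).vel k ^ 2 ≤ R ^ 2 := fun t ht s =>
      (sum_le_hasSum s (fun k _ => sq_nonneg _) (hasSum_coef_sq (ξ t).vel)).trans
        (pow_le_pow_left₀ (norm_nonneg _) ((norm_vel_le _).trans (hR t ht)) 2)
    have hgr : ∀ t ≤ T, ∀ s : Finset (Fin 3 → ℤ), ∑ k ∈ s, sqNorm k * coef (ξ t).pos k ^ 2 ≤ 3 * R ^ 2 :=
      fun t ht s => (sum_le_hasSum s (fun k _ => mul_nonneg (sqNorm_nonneg k) (sq_nonneg _))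
        (hasSum_grad (ξ t))).trans ((Finset.sum_le_sum fun i _ => pow_le_pow_left₀ (norm_nonneg _)
          ((norm_grad_le _ i).trans (hR t ht)) 2).trans_eq (by simp))
    have hφ2 : ∀ t ∈ Ioc 0 T, ∀ s : Finset (Fin 3 → ℤ), ∑ k ∈ s, coef (φ t) k ^ 2 ≤ V := fun t ht s =>
      sum_coef_sq_le (hφ.smoothTorus t).continuous (hM t (Ioc_subset_Icc_self ht)).1 s
    have hφ3 : ∀ t ∈ Ioc 0 T, ∀ s : Finset (Fin 3 → ℤ), ∑ k ∈ s, (absK k * coef (φ t) k) ^ 2 ≤ 3 * V :=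
      fun t ht s => by
        simp_rw [mul_pow, absK_sq]
        exact (hφ.smoothTorus t).sum_sqNorm_mul_le (hM t (Ioc_subset_Icc_self ht)).2.2 s
    have l1 := tendsto_integral_sum_box (M := R ^ 2 + V) hT.le
      (fun k => (cv k).mul (cφ' k)) (fun N t ht => abs_sum_mul_le (hv t ht.2 _)
        (sum_coef_sq_le (hφ.continuous_deriv.comp (Continuous.prodMk_right t))
          (hM t (Ioc_subset_Icc_self ht)).2.1 _))
      (fun t ht => (hasSum_coef_mul_continuous (ξ t).vel
        (hφ.continuous_deriv.comp (Continuous.prodMk_right t))).comp tendsto_box)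
    have l2 := tendsto_integral_sum_box (M := 3 * R ^ 2 + 3 * V) hT.le
      (a := fun k t => sqNorm k * coef (ξ t).pos k * coef (φ t) k)
      (fun k => ((cp k).const_mul _).mul (cφ k)) (fun N t ht => by
        -- The weight |k|² is split evenly between `u` and `φ`, so both square sums are bounded by
        -- gradients.
        have := abs_sum_mul_le (s := box N) (x := fun k => absK k * coef (ξ t).pos k)
          (y := fun k => absK k * coef (φ t) k) (A := 3 * R ^ 2) (by
            simp_rw [mul_pow, absK_sq]
            exact hgr t ht.2 _) (hφ3 t ht _)
        refine le_of_eq_of_le (congrArg _ (Finset.sum_congr rfl fun k _ => ?_)) this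
        rw [← absK_sq]; ring)
      (fun t ht => (hasSum_grad_mul (ξ t) (hφ.smoothTorus t)).comp tendsto_box)
    have l3 := tendsto_integral_sum_box (M := R ^ 2 + 3 * V) hT.le
      (a := fun k t => coef (ξ t).vel k * (absK k * coef (φ t) k))
      (fun k => (cv k).mul ((cφ k).const_mul _)) (fun N t ht => abs_sum_mul_le (hv t ht.2 _) (hφ3 t ht _))
      (G := fun t => ∫ x, (ξ t).vel x * fracLaplacian (1 / 2) (φ t) x)
      (fun t ht => by
        have := (hasSum_coef_mul_continuous (ξ t).vel (hφ.smoothTorus t).continuous_fracLaplacian).comp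
          tendsto_box
        simpa only [(hφ.smoothTorus t).coef_fracLaplacian, Function.comp_def] using this)
    have l4 := tendsto_integral_sum_box hT.le
      (a := fun k t => coef (fun x => f ((ξ t).pos x)) k * coef (φ t) k)
      (M := C * (sobC * (1 + 2 * (3 * R) ^ 5) * Real.sqrt (8 * V)))
      (fun k => (cF k).mul (cφ k)) (G := fun t => ∫ x, f ((ξ t).pos x) * φ t x)
      (fun N t ht => by
        have := hf.abs_sum_coef_mul_le (u := (ξ t).pos) (w := toL2 (hφ.smoothTorus t).continuous)
          (R := 3 * R) (A := Real.sqrt (8 * V)) (by positivity) (Real.sqrt_nonneg _)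
          ((hs_two_pos_le _).trans (ENNReal.ofReal_le_ofReal (by
            have := pow_le_pow_left₀ (norm_nonneg _) (hR t ht.2) 2
            nlinarith))) (by
            rw [Real.sq_sqrt (by positivity), funext (coef_toL2 (hφ.smoothTorus t).continuous)]
            exact (hφ.smoothTorus t).hs_two_le (hM t (Ioc_subset_Icc_self ht)).1
              (hM t (Ioc_subset_Icc_self ht)).2.2) (box N)
        simpa only [coef_toL2] using this)
      (fun t ht => by
        have h1 := hf.tendsto_sum_coef_mul (u := (ξ t).pos) (w := toL2 (hφ.smoothTorus t).continuous)
          (hs_lt_top_pos _) (by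
            rw [funext (coef_toL2 (hφ.smoothTorus t).continuous)]
            exact ((hφ.smoothTorus t).hs_two_le (hM t (Ioc_subset_Icc_self ht)).1
              (hM t (Ioc_subset_Icc_self ht)).2.2).trans_lt ENNReal.ofReal_lt_top)
        have e : ∫ x, f ((ξ t).pos x) * toL2 (hφ.smoothTorus t).continuous x =
            ∫ x, f ((ξ t).pos x) * φ t x := by
          refine integral_congr_ae ?_
          filter_upwards [coeFn_toL2 (hφ.smoothTorus t).continuous] with x hx
          rw [hx]
        rw [e] at h1
        simpa only [coef_toL2] using h1)
    have l5 := tendsto_integral_sum_box (M := ‖g‖ ^ 2 + V) hT.le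
      (a := fun k t => coef g k * coef (φ t) k)
      (fun k => (cφ k).const_mul _) (fun N t ht => abs_sum_mul_le
        (sum_le_hasSum _ (fun k _ => sq_nonneg _) (hasSum_coef_sq g)) (hφ2 t ht _))
      (fun t ht => (hasSum_coef_mul_continuous g (hφ.smoothTorus t).continuous).comp tendsto_box)
    refine tendsto_nhds_unique ((((l1.neg.add l2).add (tendsto_const_nhds (x := 0 * ∫ t in (0 : ℝ)..T,
      ∫ x, (ξ t).vel x * φ t x))).add (l3.const_mul γ)).add l4) (l5.congr fun N => ?_)
    rw [zero_mul, add_zero, ← Finset.sum_neg_distrib, Finset.mul_sum, ← Finset.sum_add_distrib,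
      ← Finset.sum_add_distrib, ← Finset.sum_add_distrib]
    refine Finset.sum_congr rfl fun k _ => ?_
    have hFTC := intervalIntegral.integral_eq_sub_of_hasDerivAt_of_le hT.le
      (f := fun t => coef (ξ t).vel k * coef (φ t) k)
      (f' := fun t => coef g k * coef (φ t) k - γ * (coef (ξ t).vel k * (absK k * coef (φ t) k)) -
        sqNorm k * coef (ξ t).pos k * coef (φ t) k - coef (fun x => f ((ξ t).pos x)) k * coef (φ t) k +
        coef (ξ t).vel k * coef (fun x => deriv (fun s => φ s x) t) k) ((cv k).mul (cφ k)).continuousOn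
      (fun t ht => ((h.hasDerivAt_vel k t ht.1).mul (hφ.hasDerivAt_coef k t)).congr_deriv (by ring))
      (Continuous.intervalIntegrable (by
        have := cp k; have := cv k; have := cF k; have := cφ k; have := cφ' k
        fun_prop) _ _)
    rw [(hφ.coef_zero k).1, (hφ.coef_zero k).2] at hFTC
    have I1 : IntervalIntegrable (fun t => coef (ξ t).vel k * coef (fun x => deriv (fun s => φ s x) t) k)
      volume 0 T := ((cv k).mul (cφ' k)).intervalIntegrable _ _
    have I2 : IntervalIntegrable (fun t => sqNorm k * coef (ξ t).pos k * coef (φ t) k) volume 0 T :=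
      (((cp k).const_mul _).mul (cφ k)).intervalIntegrable _ _
    have I3 : IntervalIntegrable (fun t => γ * (coef (ξ t).vel k * (absK k * coef (φ t) k))) volume 0 T :=
      (((cv k).mul ((cφ k).const_mul _)).const_mul _).intervalIntegrable _ _
    have I4 : IntervalIntegrable (fun t => coef (fun x => f ((ξ t).pos x)) k * coef (φ t) k) volume 0 T :=
      ((cF k).mul (cφ k)).intervalIntegrable _ _
    have I5 : IntervalIntegrable (fun t => coef g k * coef (φ t) k) volume 0 T :=
      ((cφ k).const_mul _).intervalIntegrable _ _
    rw [intervalIntegral.integral_add (((I5.sub I3).sub I2).sub I4) I1,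
      intervalIntegral.integral_sub ((I5.sub I3).sub I2) I4, intervalIntegral.integral_sub (I5.sub I3) I2,
      intervalIntegral.integral_sub I5 I3, intervalIntegral.integral_const_mul γ] at hFTC
    simp only [Pi.mul_apply]
    linarith

end

/-! ### Truncation of the nonlinearity -/

/-- The point of `[-M, M]` closest to `u`. -/
def clamp (M u : ℝ) : ℝ := max (-M) (min u M)

theorem clamp_of_abs_le {M u : ℝ} (h : |u| ≤ M) : clamp M u = u := by
  rw [abs_le] at h
  rw [clamp, min_eq_left h.2, max_eq_right h.1]

theorem continuous_clamp (M : ℝ) : Continuous (clamp M) :=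
  continuous_const.max (continuous_id.min continuous_const)

theorem abs_clamp_le {M : ℝ} (hM : 0 ≤ M) (u : ℝ) : |clamp M u| ≤ M := by
  rw [abs_le]
  exact ⟨le_max_left _ _, max_le (by linarith) (min_le_right _ _)⟩

theorem clamp_zero {M : ℝ} (hM : 0 ≤ M) : clamp M 0 = 0 := clamp_of_abs_le (by simpa using hM)

theorem clamp_sub_le {M u v : ℝ} (h : v ≤ u) :
    0 ≤ clamp M u - clamp M v ∧ clamp M u - clamp M v ≤ u - v := by
  unfold clamp
  constructor
  · exact sub_nonneg.2 (max_le_max le_rfl (min_le_min h le_rfl))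
  · rw [sub_le_iff_le_add]
    refine max_le ?_ ?_
    · linarith [le_max_left (-M) (min v M)]
    · rcases le_total v M with h1 | h1
      · rw [min_eq_left h1]
        linarith [le_max_right (-M) v, min_le_left u M]
      · rw [min_eq_right h1]
        linarith [le_max_right (-M) M, min_le_right u M]

theorem abs_clamp_sub_le (M u v : ℝ) : |clamp M u - clamp M v| ≤ |u - v| ∧
    |(u - clamp M u) - (v - clamp M v)| ≤ |u - v| := by
  rcases le_total v u with h | h
  · obtain ⟨h1, h2⟩ := clamp_sub_le (M := M) h
    rw [abs_of_nonneg h1, abs_of_nonneg (sub_nonneg.2 h), abs_of_nonneg (by linarith)]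
    constructor <;> linarith
  · obtain ⟨h1, h2⟩ := clamp_sub_le (M := M) h
    rw [abs_of_nonpos (by linarith), abs_of_nonpos (sub_nonpos.2 h), abs_of_nonpos (by linarith)]
    constructor <;> linarith

theorem abs_clamp_le_abs {M : ℝ} (hM : 0 ≤ M) (u : ℝ) : |clamp M u| ≤ |u| ∧ |u - clamp M u| ≤ |u| := by
  have h := abs_clamp_sub_le M u 0
  rw [clamp_zero hM] at h
  simpa using h

/-- The function which agrees with `f` on `[-M, M]` and is affine with slope `κ` outside. -/
def trunc (f : ℝ → ℝ) (κ M u : ℝ) : ℝ := f (clamp M u) + κ * (u - clamp M u)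

/-- A lower bound by a linear function with slope `κ`. -/
structure Coercive (f : ℝ → ℝ) (κ D : ℝ) : Prop where
  pos : 0 < κ
  nonneg : 0 ≤ D
  ge : ∀ u, 0 ≤ u → κ * u - D ≤ f u
  le : ∀ u, u ≤ 0 → f u ≤ κ * u + D

/-- Integrating the linear bounds gives `κ/2 u² - D|u|`; completing the square absorbs the linear
term. -/
theorem Coercive.primitive_ge {f : ℝ → ℝ} {κ D : ℝ} (h : Coercive f κ D) (hf : Continuous f) (u : ℝ) :
    κ / 4 * u ^ 2 - D ^ 2 / κ ≤ ∫ s in (0 : ℝ)..u, f s := by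
  have key : κ / 2 * u ^ 2 - D * |u| ≤ ∫ s in (0 : ℝ)..u, f s := by
    rcases le_total 0 u with hu | hu
    · have h1 := intervalIntegral.integral_mono_on hu
        (Continuous.intervalIntegrable (μ := volume) (u := fun s => κ * s - D) (by fun_prop) _ _)
        (hf.intervalIntegrable (μ := volume) 0 u) fun s hs => h.ge s hs.1
      rw [intervalIntegral.integral_sub (Continuous.intervalIntegrable (by fun_prop) _ _)
        intervalIntegrable_const, intervalIntegral.integral_const_mul, integral_id,
        intervalIntegral.integral_const, smul_eq_mul] at h1
      rw [abs_of_nonneg hu]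
      linarith
    · have h1 := intervalIntegral.integral_mono_on hu (hf.intervalIntegrable (μ := volume) u 0)
        (Continuous.intervalIntegrable (μ := volume) (u := fun s => κ * s + D) (by fun_prop) _ _)
        fun s hs => h.le s hs.2
      rw [intervalIntegral.integral_add (Continuous.intervalIntegrable (by fun_prop) _ _)
        intervalIntegrable_const, intervalIntegral.integral_const_mul, integral_id,
        intervalIntegral.integral_const, smul_eq_mul] at h1
      rw [abs_of_nonpos hu, intervalIntegral.integral_symm]
      linarith
  have hκ := h.pos
  have h2 : κ / 4 * u ^ 2 - D * |u| + D ^ 2 / κ = (κ / 2 * |u| - D) ^ 2 / κ := by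
    rw [← sq_abs u]; field_simp; ring
  have h3 : 0 ≤ (κ / 2 * |u| - D) ^ 2 / κ := by positivity
  linarith

section

variable {f : ℝ → ℝ} {C κ D M : ℝ}

theorem trunc_of_abs_le {u : ℝ} (h : |u| ≤ M) : trunc f κ M u = f u := by
  rw [trunc, clamp_of_abs_le h, sub_self, mul_zero, add_zero]

/-- The affine continuation has the coercivity slope itself, so the constants `κ` and `D` survive
for every `M`. This makes the Galerkin energy bounds uniform. -/
theorem Coercive.trunc (h : Coercive f κ D) (hM : 0 ≤ M) : Coercive (trunc f κ M) κ D := by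
  refine ⟨h.pos, h.nonneg, fun u hu => ?_, fun u hu => ?_⟩
  · have := (clamp_sub_le (M := M) hu).1
    rw [clamp_zero hM, sub_zero] at this
    have := h.ge _ this
    rw [DampedWave.trunc]; linarith
  · have := (clamp_sub_le (M := M) hu).1
    rw [clamp_zero hM] at this
    have := h.le (clamp M u) (by linarith)
    rw [DampedWave.trunc]; linarith

theorem Growth.trunc (h : Growth f C) (hκ : 0 ≤ κ) (hM : 0 ≤ M) : Growth (trunc f κ M) (C + κ) := by
  have h0 := h.pos
  have hb1 : ∀ u : ℝ, |u| ≤ 1 + |u| ^ 5 := fun u => by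
    rcases le_total |u| 1 with h | h
    · have : 0 ≤ |u| ^ 5 := by positivity
      linarith
    · have := le_self_pow₀ h (by norm_num : 5 ≠ 0)
      linarith
  refine ⟨by linarith, (h.cont.comp (continuous_clamp M)).add
    (continuous_const.mul (continuous_id.sub (continuous_clamp M))), fun u => ?_, fun u v => ?_⟩
  · obtain ⟨h1, h2⟩ := abs_clamp_le_abs hM u
    refine (abs_add_le _ _).trans ?_
    rw [abs_mul, abs_of_nonneg hκ, add_mul]
    refine add_le_add ((h.bound _).trans (mul_le_mul_of_nonneg_left ?_ h0.le))
      (mul_le_mul_of_nonneg_left (h2.trans (hb1 u)) hκ)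
    have := pow_le_pow_left₀ (abs_nonneg _) h1 5
    linarith
  · obtain ⟨h1, h2⟩ := abs_clamp_sub_le M u v
    have hu := pow_le_pow_left₀ (abs_nonneg _) (abs_clamp_le_abs hM u).1 4
    have hv := pow_le_pow_left₀ (abs_nonneg _) (abs_clamp_le_abs hM v).1 4
    have e : DampedWave.trunc f κ M u - DampedWave.trunc f κ M v =
        (f (clamp M u) - f (clamp M v)) + κ * ((u - clamp M u) - (v - clamp M v)) := by
      simp only [DampedWave.trunc]; ring
    rw [e]
    refine (abs_add_le _ _).trans ?_
    rw [abs_mul, abs_of_nonneg hκ, add_mul, add_mul]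
    have p1 : 0 ≤ |u| ^ 4 := by positivity
    have p2 : 0 ≤ |v| ^ 4 := by positivity
    refine add_le_add ((h.lip _ _).trans (mul_le_mul (mul_le_mul_of_nonneg_left (by linarith) h0.le) h1
      (abs_nonneg _) (by positivity))) ?_
    rw [mul_assoc]
    refine mul_le_mul_of_nonneg_left (h2.trans ?_) hκ
    exact le_mul_of_one_le_left (abs_nonneg _) (by linarith)

theorem Growth.exists_lipschitz_trunc (h : Growth f C) (hκ : 0 ≤ κ) (hM : 0 ≤ M) :
    ∃ L, 0 ≤ L ∧ ∀ u v, |DampedWave.trunc f κ M u - DampedWave.trunc f κ M v| ≤ L * |u - v| := by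
  have h0 := h.pos
  refine ⟨C * (1 + M ^ 4 + M ^ 4) + κ, by positivity, fun u v => ?_⟩
  obtain ⟨h1, h2⟩ := abs_clamp_sub_le M u v
  have hu := pow_le_pow_left₀ (abs_nonneg _) (abs_clamp_le hM u) 4
  have hv := pow_le_pow_left₀ (abs_nonneg _) (abs_clamp_le hM v) 4
  have e : DampedWave.trunc f κ M u - DampedWave.trunc f κ M v =
      (f (clamp M u) - f (clamp M v)) + κ * ((u - clamp M u) - (v - clamp M v)) := by
    simp only [DampedWave.trunc]; ring
  rw [e]
  refine (abs_add_le _ _).trans ?_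
  rw [abs_mul, abs_of_nonneg hκ, add_mul]
  exact add_le_add ((h.lip _ _).trans (mul_le_mul (mul_le_mul_of_nonneg_left (by linarith) h0.le) h1
    (abs_nonneg _) (by positivity))) (mul_le_mul_of_nonneg_left h2 hκ)

/-- The truncation is felt only where |u| > M, and there one factor |u|/M may be inserted for free.
The resulting sixth power is integrable for H¹ functions, so the error is O(1/M). -/
theorem Growth.abs_trunc_sub_le (h : Growth f C) (hκ : 0 ≤ κ) (hM : 1 ≤ M) (u : ℝ) :
    |DampedWave.trunc f κ M u - f u| ≤ 4 * (C + κ) / M * |u| ^ 6 := by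
  have h0 := h.pos
  rcases le_or_gt |u| M with hu | hu
  · rw [trunc_of_abs_le hu, sub_self, abs_zero]; positivity
  · have h1 := (h.trunc hκ (by linarith : 0 ≤ M)).bound u
    have h2 := h.bound u
    have h3 : |DampedWave.trunc f κ M u - f u| ≤ 2 * (C + κ) * (1 + |u| ^ 5) := by
      refine (abs_sub _ _).trans ?_
      have : 0 ≤ κ * (1 + |u| ^ 5) := by positivity
      nlinarith
    have h4 : 1 ≤ |u| ^ 5 := one_le_pow₀ (by linarith)
    have h5 : |u| ^ 5 * M ≤ |u| ^ 6 := by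
      rw [pow_succ |u| 5]
      exact mul_le_mul_of_nonneg_left hu.le (by positivity)
    refine h3.trans ?_
    rw [div_mul_eq_mul_div, le_div_iff₀ (by linarith)]
    have h6 : (1 + |u| ^ 5) * M ≤ 2 * |u| ^ 6 := by nlinarith
    have h7 : 0 ≤ C + κ := by linarith
    nlinarith

end

/-! ### Global solutions of ordinary differential equations -/

theorem norm_integral_le_exp {E : Type*} [NormedAddCommGroup E] [NormedSpace ℝ E] {h : ℝ → E}
    {A l m : ℝ} (hl : 0 < l) (hm : 0 ≤ m) (hA : 0 ≤ A) (hh : ∀ s ∈ Ioc 0 m, ‖h s‖ ≤ A * Real.exp (l * s)) :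
    ‖∫ s in (0 : ℝ)..m, h s‖ ≤ A / l * Real.exp (l * m) := by
  have h1 := intervalIntegral.norm_integral_le_of_norm_le (μ := volume) hm (f := h)
    (g := fun s => A * Real.exp (l * s)) (Eventually.of_forall hh)
    (Continuous.intervalIntegrable (by fun_prop) _ _)
  refine h1.trans ?_
  rw [intervalIntegral.integral_const_mul, intervalIntegral.integral_comp_mul_left (fun x => Real.exp x) hl.ne',
    integral_exp, mul_zero, Real.exp_zero, smul_eq_mul, div_mul_eq_mul_div, ← mul_div_assoc',
    div_eq_inv_mul]
  refine mul_le_mul_of_nonneg_left ?_ hA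
  exact mul_le_mul_of_nonneg_left (by linarith) (by positivity)

/-- A global Picard iteration in an exponentially weighted sup norm: the fixed point `y` is bounded,
and `e^(l t) y` is the solution. -/
theorem exists_forall_hasDerivAt_of_lipschitz {E : Type*} [NormedAddCommGroup E] [NormedSpace ℝ E]
    [CompleteSpace E] {F : E → E} {L : ℝ} (hL : 0 ≤ L) (hF : ∀ x y, ‖F x - F y‖ ≤ L * ‖x - y‖) (x₀ : E) :
    ∃ α : ℝ → E, Continuous α ∧ α 0 = x₀ ∧ ∀ t, 0 ≤ t → HasDerivAt α (F (α t)) t := by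
  have cF : Continuous F := by
    have : LipschitzWith ⟨L, hL⟩ F := LipschitzWith.of_dist_le_mul fun x y => by
      rw [dist_eq_norm, dist_eq_norm]; exact hF x y
    exact this.continuous
  -- With this rate the integral operator contracts by `L / l`, which is at most 1/2.
  set l := 2 * L + 1 with hl
  have hl0 : 0 < l := by positivity
  set z : BoundedContinuousFunction ℝ E → ℝ → E := fun y s => Real.exp (l * s) • y s with hz
  have cz : ∀ y, Continuous (z y) := fun y =>
    (Real.continuous_exp.comp (continuous_const.mul continuous_id)).smul y.continuous
  set G : BoundedContinuousFunction ℝ E → ℝ → E := fun y t => x₀ + ∫ s in (0 : ℝ)..t, F (z y s) with hG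
  have dG : ∀ y t, HasDerivAt (G y) (F (z y t)) t := fun y t =>
    (intervalIntegral.integral_hasDerivAt_right ((cF.comp (cz y)).intervalIntegrable _ _)
      (cF.comp (cz y)).aestronglyMeasurable.stronglyMeasurableAtFilter
      (cF.comp (cz y)).continuousAt).const_add x₀
  have cG : ∀ y, Continuous (G y) := fun y => continuous_iff_continuousAt.2 fun t => (dG y t).continuousAt
  have hzn : ∀ y s, ‖z y s‖ ≤ ‖y‖ * Real.exp (l * s) := fun y s => by
    rw [hz, norm_smul, Real.norm_eq_abs, Real.abs_exp, mul_comm]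
    exact mul_le_mul_of_nonneg_right (y.norm_coe_le_norm s) (Real.exp_pos _).le
  have hbound : ∀ y t, ‖Real.exp (-(l * max t 0)) • G y (max t 0)‖ ≤ ‖x₀‖ + (‖F 0‖ + L * ‖y‖) / l := by
    intro y t
    set m := max t 0
    have hm : 0 ≤ m := le_max_right _ _
    have h1 := norm_integral_le_exp (h := fun s => F (z y s)) (A := ‖F 0‖ + L * ‖y‖) hl0 hm
      (by positivity) (fun s hs => by
        have h2 := hF (z y s) 0
        rw [sub_zero] at h2
        have h3 := norm_le_norm_sub_add (F (z y s)) (F 0)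
        have h4 : 1 ≤ Real.exp (l * s) := Real.one_le_exp (mul_nonneg hl0.le hs.1.le)
        have h5 := mul_le_mul_of_nonneg_left (hzn y s) hL
        have h6 := mul_le_mul_of_nonneg_left h4 (norm_nonneg (F 0))
        nlinarith)
    have e1 : Real.exp (-(l * m)) ≤ 1 := Real.exp_le_one_iff.2 (by nlinarith)
    have e2 : Real.exp (-(l * m)) * Real.exp (l * m) = 1 := by rw [← Real.exp_add]; simp
    rw [norm_smul, Real.norm_eq_abs, Real.abs_exp]
    calc Real.exp (-(l * m)) * ‖G y m‖ ≤ Real.exp (-(l * m)) *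
          (‖x₀‖ + (‖F 0‖ + L * ‖y‖) / l * Real.exp (l * m)) :=
          mul_le_mul_of_nonneg_left ((norm_add_le _ _).trans (by linarith)) (Real.exp_pos _).le
      _ = Real.exp (-(l * m)) * ‖x₀‖ + (‖F 0‖ + L * ‖y‖) / l := by
          linear_combination (‖F 0‖ + L * ‖y‖) / l * e2
      _ ≤ _ := by
          have := mul_le_mul_of_nonneg_right e1 (norm_nonneg x₀)
          linarith
  set P : BoundedContinuousFunction ℝ E → BoundedContinuousFunction ℝ E := fun y =>
    BoundedContinuousFunction.ofNormedAddCommGroup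
      (fun t => Real.exp (-(l * max t 0)) • G y (max t 0))
      (by
        have := cG y
        have h1 : Continuous fun t : ℝ => max t 0 := continuous_id.max continuous_const
        exact (Real.continuous_exp.comp (continuous_const.mul h1).neg).smul (this.comp h1)) _ (hbound y)
    with hP
  have hPc : ContractingWith (1 / 2) P := by
    refine ⟨by norm_num, LipschitzWith.of_dist_le_mul fun y y' => ?_⟩
    refine (BoundedContinuousFunction.dist_le (by positivity)).2 fun t => ?_
    rw [dist_eq_norm, dist_eq_norm]
    change ‖Real.exp (-(l * max t 0)) • G y (max t 0) - Real.exp (-(l * max t 0)) • G y' (max t 0)‖ ≤ _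
    set m := max t 0
    have hm : 0 ≤ m := le_max_right _ _
    have e2 : Real.exp (-(l * m)) * Real.exp (l * m) = 1 := by rw [← Real.exp_add]; simp
    have e3 : G y m - G y' m = ∫ s in (0 : ℝ)..m, (F (z y s) - F (z y' s)) := by
      have I1 : IntervalIntegrable (fun s => F (z y s)) volume 0 m :=
        (cF.comp (cz y)).intervalIntegrable _ _
      have I2 : IntervalIntegrable (fun s => F (z y' s)) volume 0 m :=
        (cF.comp (cz y')).intervalIntegrable _ _
      rw [intervalIntegral.integral_sub I1 I2]
      simp only [hG]; abel
    have h1 := norm_integral_le_exp (h := fun s => F (z y s) - F (z y' s)) (A := L * ‖y - y'‖) hl0 hm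
      (by positivity) (fun s hs => by
        refine (hF _ _).trans ?_
        rw [mul_assoc]
        refine mul_le_mul_of_nonneg_left ?_ hL
        simp only [hz]
        rw [← smul_sub, norm_smul, Real.norm_eq_abs, Real.abs_exp, mul_comm]
        exact mul_le_mul_of_nonneg_right ((y - y').norm_coe_le_norm s) (Real.exp_pos _).le)
    rw [← smul_sub, norm_smul, Real.norm_eq_abs, Real.abs_exp, e3]
    calc _ ≤ Real.exp (-(l * m)) * (L * ‖y - y'‖ / l * Real.exp (l * m)) :=
          mul_le_mul_of_nonneg_left h1 (Real.exp_pos _).le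
      _ = L * ‖y - y'‖ / l := by linear_combination L * ‖y - y'‖ / l * e2
      _ ≤ 1 / 2 * ‖y - y'‖ := by
          rw [div_le_iff₀ hl0, hl]
          nlinarith [norm_nonneg (y - y')]
      _ = _ := by simp
  set y := hPc.fixedPoint P with hy
  have hfix : P y = y := hPc.fixedPoint_isFixedPt
  have hα : ∀ t, 0 ≤ t → z y t = G y t := by
    intro t ht
    have h1 : y t = Real.exp (-(l * t)) • G y t := by
      conv_lhs => rw [← hfix]
      change Real.exp (-(l * max t 0)) • G y (max t 0) = _
      rw [max_eq_left ht]
    simp only [hz]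
    rw [h1, smul_smul, ← Real.exp_add]
    simp
  refine ⟨G y, cG y, by simp [hG], fun t ht => ?_⟩
  rw [← hα t ht]
  exact dG y t

/-! ### Galerkin approximations -/

/-- The Galerkin approximation of the damped wave equation with modes in `s`, in terms of the
Fourier coefficients `a` of the solution and `b` of its time derivative. -/
structure GalerkinSolution (γ : ℝ) (f : ℝ → ℝ) (g : L2) (s : Finset (Fin 3 → ℤ))
    (a b : ℝ → (Fin 3 → ℤ) → ℝ) : Prop where
  cont_pos : ∀ k, Continuous fun t => a t k
  cont_vel : ∀ k, Continuous fun t => b t k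
  zero_pos : ∀ t k, k ∉ s → a t k = 0
  zero_vel : ∀ t k, k ∉ s → b t k = 0
  const_pos : ∀ t, a t = a (max t 0)
  const_vel : ∀ t, b t = b (max t 0)
  hasDerivAt_pos : ∀ k ∈ s, ∀ t, 0 < t → HasDerivAt (fun t => a t k) (b t k) t
  hasDerivAt_vel : ∀ k ∈ s, ∀ t, 0 < t → HasDerivAt (fun t => b t k)
    (coef g k - γ * absK k * b t k - sqNorm k * a t k - coef (fun x => f (trig s (a t) x)) k) t

/-- Extension of a finite family of coefficients by zero. -/
def extendCoef (s : Finset (Fin 3 → ℤ)) (c : s → ℝ) (k : Fin 3 → ℤ) : ℝ :=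
  if h : k ∈ s then c ⟨k, h⟩ else 0

theorem extendCoef_mem {s : Finset (Fin 3 → ℤ)} (c : s → ℝ) {k : Fin 3 → ℤ} (h : k ∈ s) :
    extendCoef s c k = c ⟨k, h⟩ := dif_pos h

theorem abs_coef_le_of_bound {h : Torus3 → ℝ} {c : ℝ} (hc : 0 ≤ c) (hb : ∀ x, |h x| ≤ c) (k : Fin 3 → ℤ) :
    |coef h k| ≤ c * (2 * π) ^ 3 := by
  have h1 := norm_integral_le_of_norm_le_const (μ := (volume : Measure Torus3))
    (f := fun x => h x * hart k x) (C := c) (Eventually.of_forall fun x => by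
      rw [norm_mul, Real.norm_eq_abs, Real.norm_eq_abs]
      exact (mul_le_mul (hb x) (abs_hart_le k x) (abs_nonneg _) hc).trans (mul_one c).le)
  rwa [volume_real_torus] at h1

theorem abs_coef_comp_trig_sub_le {f : ℝ → ℝ} {L : ℝ} (hL : 0 ≤ L) (hf : ∀ u v, |f u - f v| ≤ L * |u - v|)
    (s : Finset (Fin 3 → ℤ)) {a a' : (Fin 3 → ℤ) → ℝ} {d : ℝ} (hd : 0 ≤ d) (h : ∀ k ∈ s, |a k - a' k| ≤ d)
    (k : Fin 3 → ℤ) :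
    |coef (fun x => f (trig s a x)) k - coef (fun x => f (trig s a' x)) k| ≤
      L * (s.card * d) * (2 * π) ^ 3 := by
  have cf : Continuous f := by
    have : LipschitzWith ⟨L, hL⟩ f := LipschitzWith.of_dist_le_mul fun x y => by
      rw [Real.dist_eq, Real.dist_eq]; exact hf x y
    exact this.continuous
  have i1 : Integrable fun x => f (trig s a x) := integrable_of_continuous (cf.comp (continuous_trig s a))
  have i2 : Integrable fun x => f (trig s a' x) := integrable_of_continuous (cf.comp (continuous_trig s a'))
  rw [← coef_sub i1 i2]
  refine abs_coef_le_of_bound (by positivity) (fun x => (hf _ _).trans ?_) k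
  refine mul_le_mul_of_nonneg_left ?_ hL
  have e : trig s a x - trig s a' x = ∑ k ∈ s, (a k - a' k) * hart k x := by
    simp only [trig, ← Finset.sum_sub_distrib, sub_mul]
  rw [e, ← nsmul_eq_mul]
  refine (Finset.abs_sum_le_sum_abs _ _).trans (Finset.sum_le_card_nsmul _ _ _ fun k hk => ?_)
  rw [abs_mul]
  exact (mul_le_mul (h k hk) (abs_hart_le k x) (abs_nonneg _) hd).trans (mul_one d).le

theorem exists_galerkinSolution {γ : ℝ} (hγ : 0 ≤ γ) {f : ℝ → ℝ} {L : ℝ} (hL : 0 ≤ L)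
    (hf : ∀ u v, |f u - f v| ≤ L * |u - v|) (g : L2) (s : Finset (Fin 3 → ℤ)) (a₀ b₀ : (Fin 3 → ℤ) → ℝ) :
    ∃ a b, GalerkinSolution γ f g s a b ∧ ∀ k ∈ s, a 0 k = a₀ k ∧ b 0 k = b₀ k := by
  set F : (s → ℝ) × (s → ℝ) → (s → ℝ) × (s → ℝ) := fun p => (p.2, fun k =>
    coef g k - γ * absK k * p.2 k - sqNorm k * p.1 k -
      coef (fun x => f (trig s (extendCoef s p.1) x)) k) with hF
  set M : ℝ := ∑ k ∈ s, (γ * absK k + sqNorm k) + L * s.card * (2 * π) ^ 3 + 1 with hM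
  have hterm : ∀ k, 0 ≤ γ * absK k + sqNorm k := fun k =>
    add_nonneg (mul_nonneg hγ (absK_nonneg k)) (sqNorm_nonneg k)
  have hsum : 0 ≤ ∑ k ∈ s, (γ * absK k + sqNorm k) := Finset.sum_nonneg fun k _ => hterm k
  have hP : 0 ≤ L * s.card * (2 * π) ^ 3 := by positivity
  have hM0 : 0 ≤ M := by positivity
  have hLip : ∀ p q, ‖F p - F q‖ ≤ M * ‖p - q‖ := by
    intro p q
    have h1 : ∀ k, |p.1 k - q.1 k| ≤ ‖p - q‖ := fun k =>
      (norm_le_pi_norm (p.1 - q.1) k).trans (norm_fst_le (p - q))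
    have h2 : ∀ k, |p.2 k - q.2 k| ≤ ‖p - q‖ := fun k =>
      (norm_le_pi_norm (p.2 - q.2) k).trans (norm_snd_le (p - q))
    have hn := norm_nonneg (p - q)
    refine max_le ?_ ?_
    · refine (norm_snd_le (p - q)).trans (le_mul_of_one_le_left hn ?_)
      linarith
    · refine (pi_norm_le_iff_of_nonneg (by positivity)).2 fun k => ?_
      have h3 := abs_coef_comp_trig_sub_le hL hf s (a := extendCoef s p.1) (a' := extendCoef s q.1) hn
        (fun k hk => by rw [extendCoef_mem _ hk, extendCoef_mem _ hk]; exact h1 _) k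
      have e : (F p - F q).2 k = -(γ * absK k * (p.2 k - q.2 k)) + -(sqNorm k * (p.1 k - q.1 k)) +
          -(coef (fun x => f (trig s (extendCoef s p.1) x)) k -
            coef (fun x => f (trig s (extendCoef s q.1) x)) k) := by
        simp only [hF, Prod.snd_sub, Pi.sub_apply]
        ring
      rw [e, Real.norm_eq_abs]
      refine (abs_add_three _ _ _).trans ?_
      rw [abs_neg, abs_neg, abs_neg, abs_mul _ (p.2 k - q.2 k), abs_mul _ (p.1 k - q.1 k),
        abs_of_nonneg (sqNorm_nonneg _), abs_of_nonneg (mul_nonneg hγ (absK_nonneg _))]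
      have h4 := mul_le_mul_of_nonneg_left (h2 k) (mul_nonneg hγ (absK_nonneg (k : Fin 3 → ℤ)))
      have h5 := mul_le_mul_of_nonneg_left (h1 k) (sqNorm_nonneg (k : Fin 3 → ℤ))
      have h6 := mul_le_mul_of_nonneg_right
        (Finset.single_le_sum (f := fun k => γ * absK k + sqNorm k) (fun k _ => hterm k) k.2) hn
      rw [hM]
      linarith
  obtain ⟨α, hα, hα0, hαd⟩ := exists_forall_hasDerivAt_of_lipschitz hM0 hLip
    ((fun k => a₀ k, fun k => b₀ k) : (s → ℝ) × (s → ℝ))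
  have cm : Continuous fun t : ℝ => max t 0 := continuous_id.max continuous_const
  have hev : ∀ t : ℝ, 0 < t → (fun t => max t 0) =ᶠ[𝓝 t] fun t => t := fun t ht => by
    filter_upwards [eventually_gt_nhds ht] with r hr
    exact max_eq_left hr.le
  have hmm : ∀ t : ℝ, max (max t 0) 0 = max t 0 := fun t => max_eq_left (le_max_right _ _)
  refine ⟨fun t => extendCoef s (α (max t 0)).1, fun t => extendCoef s (α (max t 0)).2,
    ⟨fun k => ?_, fun k => ?_, fun t k hk => dif_neg hk, fun t k hk => dif_neg hk, fun t => ?_, fun t => ?_,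
      fun k hk t ht => ?_, fun k hk t ht => ?_⟩, fun k hk => ?_⟩
  · by_cases hk : k ∈ s
    · simp only [extendCoef_mem _ hk]
      exact (continuous_apply _).comp (continuous_fst.comp (hα.comp cm))
    · simp only [extendCoef, dif_neg hk]
      exact continuous_const
  · by_cases hk : k ∈ s
    · simp only [extendCoef_mem _ hk]
      exact (continuous_apply _).comp (continuous_snd.comp (hα.comp cm))
    · simp only [extendCoef, dif_neg hk]
      exact continuous_const
  · simp only [hmm]
  · simp only [hmm]
  · simp only [extendCoef_mem _ hk]
    have h1 := hasDerivAt_pi.1 (hαd t ht.le).fst ⟨k, hk⟩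
    rw [max_eq_left ht.le]
    refine h1.congr_of_eventuallyEq ?_
    filter_upwards [hev t ht] with r hr
    rw [hr]
  · have h1 := hasDerivAt_pi.1 (hαd t ht.le).snd ⟨k, hk⟩
    simp only [extendCoef_mem _ hk]
    rw [max_eq_left ht.le]
    refine h1.congr_of_eventuallyEq ?_
    filter_upwards [hev t ht] with r hr
    rw [hr]
  · simp only [extendCoef_mem _ hk, max_self, hα0, and_self]

section

variable {γ : ℝ} {f : ℝ → ℝ} {g : L2} {s : Finset (Fin 3 → ℤ)} {a b : ℝ → (Fin 3 → ℤ) → ℝ} {C κ D : ℝ}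

/-- Exact energy balance: the Galerkin equations are the Hamiltonian system of the modal energy plus
the damping, so no commutator appears. -/
theorem GalerkinSolution.energy_eq (h : GalerkinSolution γ f g s a b) (hf : Continuous f) {T : ℝ}
    (hT : 0 ≤ T) : modalEnergy f s (coef g) (a T) (b T) + γ * ∑ k ∈ s, absK k * ∫ t in (0 : ℝ)..T, b t k ^ 2 =
      modalEnergy f s (coef g) (a 0) (b 0) := by
  have cv : ∀ k, Continuous fun t => b t k ^ 2 := fun k => (h.cont_vel k).pow 2
  have cD : Continuous fun t => -(γ * ∑ k ∈ s, absK k * b t k ^ 2) :=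
    (continuous_const.mul (continuous_finsetSum _ fun k _ => (cv k).const_mul _)).neg
  have hFTC := intervalIntegral.integral_eq_sub_of_hasDerivAt_of_le hT
    (f := fun t => modalEnergy f s (coef g) (a t) (b t)) (f' := fun t => -(γ * ∑ k ∈ s, absK k * b t k ^ 2))
    (continuous_modalEnergy hf (fun k _ => h.cont_pos k) (fun k _ => h.cont_vel k)
      _).continuousOn (fun t ht => by
        refine (hasDerivAt_modalEnergy hf (fun k _ => h.cont_pos k) (fun k _ => h.cont_vel k)
          (coef g) ht.1 (fun k hk t ht => h.hasDerivAt_pos k hk t ht)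
          (fun k hk => h.hasDerivAt_vel k hk t ht.1)).congr_deriv ?_
        rw [Finset.mul_sum, ← Finset.sum_neg_distrib]
        refine Finset.sum_congr rfl fun k _ => ?_
        ring) (cD.intervalIntegrable _ _)
  rw [intervalIntegral.integral_neg, intervalIntegral.integral_const_mul,
    intervalIntegral.integral_finsetSum (f := fun k t => absK k * b t k ^ 2)
        (fun k _ => ((cv k).const_mul _).intervalIntegrable _ _)] at hFTC
  simp_rw [intervalIntegral.integral_const_mul] at hFTC
  linarith

theorem integral_trig_sq (s : Finset (Fin 3 → ℤ)) (a : (Fin 3 → ℤ) → ℝ) :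
    ∫ x, trig s a x ^ 2 = ∑ k ∈ s, a k ^ 2 := by
  have h := integral_mul_trig (integrable_of_continuous (continuous_trig s a)) s a
  simp only [sq]
  rw [h]
  refine Finset.sum_congr rfl fun k hk => ?_
  rw [coef_trig, if_pos hk]

theorem sum_coef_sq_le_norm (g : L2) (s : Finset (Fin 3 → ℤ)) : ∑ k ∈ s, coef g k ^ 2 ≤ ‖g‖ ^ 2 :=
  sum_le_hasSum s (fun _ _ => sq_nonneg _) (hasSum_coef_sq g)

/-- The potential yields `κ/4` of the L² norm; half of it absorbs the linear term with `g`. -/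
theorem Coercive.modalEnergy_ge (hc : Coercive f κ D) (hf : Continuous f) (g : L2) (s : Finset (Fin 3 → ℤ))
    (a b : (Fin 3 → ℤ) → ℝ) :
    1 / 2 * ∑ k ∈ s, b k ^ 2 + 1 / 2 * ∑ k ∈ s, sqNorm k * a k ^ 2 + κ / 8 * ∑ k ∈ s, a k ^ 2 -
      (D ^ 2 / κ * (2 * π) ^ 3 + 2 / κ * ‖g‖ ^ 2) ≤ modalEnergy f s (coef g) a b := by
  have hκ := hc.pos
  have h1 : κ / 4 * ∑ k ∈ s, a k ^ 2 - D ^ 2 / κ * (2 * π) ^ 3 ≤ ∫ x, ∫ r in (0 : ℝ)..(trig s a x), f r := by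
    have I1 : Integrable (fun x => κ / 4 * trig s a x ^ 2) :=
      integrable_of_continuous (continuous_const.mul ((continuous_trig s a).pow 2))
    have I2 : Integrable (fun _ : Torus3 => D ^ 2 / κ) := integrable_const _
    have I3 : Integrable (fun x => ∫ r in (0 : ℝ)..(trig s a x), f r) :=
      integrable_of_continuous ((continuous_primitive hf).comp (continuous_trig s a))
    have h2 := integral_mono (I1.sub I2) I3 fun x => hc.primitive_ge hf (trig s a x)
    have e := integral_sub I1 I2
    simp only [Pi.sub_apply] at h2
    rw [e, integral_const_mul, integral_trig_sq, integral_const, volume_real_torus, smul_eq_mul,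
      mul_comm _ (D ^ 2 / κ)] at h2
    exact h2
  have h3 : ∑ k ∈ s, coef g k * a k ≤ κ / 8 * ∑ k ∈ s, a k ^ 2 + 2 / κ * ‖g‖ ^ 2 := by
    refine le_trans ?_ (add_le_add_right (mul_le_mul_of_nonneg_left (sum_coef_sq_le_norm g s)
      (by positivity : 0 ≤ 2 / κ)) _)
    rw [Finset.mul_sum, Finset.mul_sum, ← Finset.sum_add_distrib]
    refine Finset.sum_le_sum fun k _ => ?_
    have : κ / 8 * a k ^ 2 + 2 / κ * coef g k ^ 2 - coef g k * a k = 2 / κ * (κ / 4 * a k - coef g k) ^ 2 := by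
      field_simp; ring
    have h4 : 0 ≤ 2 / κ * (κ / 4 * a k - coef g k) ^ 2 := by positivity
    linarith
  rw [modalEnergy, Finset.sum_sub_distrib, Finset.sum_add_distrib]
  simp_rw [mul_assoc (1 / 2 : ℝ)]
  rw [← Finset.mul_sum, ← Finset.mul_sum]
  linarith

theorem Growth.modalEnergy_le (hf : Growth f C) (g : L2) {s : Finset (Fin 3 → ℤ)} {a b : (Fin 3 → ℤ) → ℝ}
    {R : ℝ} (hR : 0 ≤ R) (ha : hs 2 a ≤ ENNReal.ofReal (R ^ 2)) (hb : hs 0 b ≤ ENNReal.ofReal (R ^ 2)) :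
    modalEnergy f s (coef g) a b ≤ 5 / 2 * R ^ 2 + 1 / 2 * ‖g‖ ^ 2 + C * (sobC * (1 + 2 * R ^ 5) * R) := by
  have hRR : 0 ≤ R ^ 2 := sq_nonneg R
  have ha' := (hs_le_ofReal_iff hRR).1 ha s
  have hb' := (hs_le_ofReal_iff hRR).1 hb s
  simp only [pow_zero, one_mul] at hb'
  have h1 : (∫ x, ∫ r in (0 : ℝ)..(trig s a x), f r) ≤ C * (sobC * (1 + 2 * R ^ 5) * R) := by
    have h2 := hf.abs_integral_primitive_sub_le hR hR ((hs_trigL_le 2 s a).trans ha)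
      (v := 0) (hs_zero_le.trans (by simp))
      (by simp only [coef_Lp_zero, sub_zero]; exact (hs_trigL_le 2 s a).trans ha)
    have e1 : ∫ x, ∫ r in (0 : ℝ)..(trigL s a x), f r = ∫ x, ∫ r in (0 : ℝ)..(trig s a x), f r := by
      refine integral_congr_ae ?_
      filter_upwards [coeFn_trigL s a] with x hx
      rw [hx]
    have e2 : ∫ x, ∫ r in (0 : ℝ)..((0 : L2) x), f r = 0 := by
      rw [← integral_zero Torus3 ℝ]
      refine integral_congr_ae ?_
      filter_upwards [Lp.coeFn_zero ℝ 2 (volume : Measure Torus3)] with x hx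
      rw [hx]; simp
    rw [e1, e2, sub_zero] at h2
    exact (le_abs_self _).trans h2
  have h3 : ∑ k ∈ s, (1 / 2 * b k ^ 2 + 1 / 2 * sqNorm k * a k ^ 2 - coef g k * a k) ≤
      1 / 2 * ∑ k ∈ s, b k ^ 2 + 2 * ∑ k ∈ s, nu k ^ 2 * a k ^ 2 + 1 / 2 * ∑ k ∈ s, coef g k ^ 2 := by
    rw [Finset.mul_sum, Finset.mul_sum, Finset.mul_sum, ← Finset.sum_add_distrib, ← Finset.sum_add_distrib]
    refine Finset.sum_le_sum fun k _ => ?_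
    have h4 := sqNorm_le k
    have h5 : sqNorm k + 1 ≤ 3 * nu k ^ 2 := by
      rw [nu]; nlinarith [norm_nonneg k]
    have h6 := mul_le_mul_of_nonneg_right h5 (sq_nonneg (a k))
    have h7 : 0 ≤ nu k ^ 2 * a k ^ 2 := by positivity
    nlinarith [sq_nonneg (coef g k + a k)]
  have h4 := sum_coef_sq_le_norm g s
  rw [modalEnergy]
  linarith

theorem sum_le_sum_of_eq_zero {ι : Type*} {s s' : Finset ι} {w : ι → ℝ} (h0 : ∀ k, 0 ≤ w k)
    (hz : ∀ k, k ∉ s → w k = 0) : ∑ k ∈ s', w k ≤ ∑ k ∈ s, w k :=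
  sum_le_hasSum s' (fun k _ => h0 k) (hasSum_sum_of_ne_finset_zero (L := .unconditional ι) hz)

/-- The bound is chosen before `f` and `s`, hence is uniform over all truncations and all boxes; it
depends on the nonlinearity only through the constants of growth and coercivity. -/
theorem GalerkinSolution.exists_bound {γ : ℝ} (hγ : 0 < γ) (C κ D : ℝ) (hκ : 0 < κ) (g : L2) {R : ℝ}
    (hR : 0 ≤ R) : ∃ M, 0 < M ∧ ∀ f s a b, Growth f C → Coercive f κ D → GalerkinSolution γ f g s a b →
      hs 2 (a 0) ≤ ENNReal.ofReal (R ^ 2) → hs 0 (b 0) ≤ ENNReal.ofReal (R ^ 2) →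
      (∀ t, hs 2 (a t) ≤ ENNReal.ofReal (M ^ 2) ∧ hs 0 (b t) ≤ ENNReal.ofReal (M ^ 2)) ∧
      ∀ T, 0 ≤ T → ∫⁻ t in Ioo 0 T, hs 1 (b t) ≤ ENNReal.ofReal (T * M ^ 2 + M ^ 2) := by
  set E := |5 / 2 * R ^ 2 + 1 / 2 * ‖g‖ ^ 2 + C * (sobC * (1 + 2 * R ^ 5) * R)| +
    |D ^ 2 / κ * (2 * π) ^ 3 + 2 / κ * ‖g‖ ^ 2| with hE
  have hE0 : 0 ≤ E := by positivity
  -- `16/κ` and `4` come from the L² and gradient parts of the H¹ norm, `1/γ` from the dissipation;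
  -- the added 1 only ensures positivity.
  have hM0 : 0 < 1 + (16 / κ + 4 + 1 / γ) * E := by positivity
  refine ⟨Real.sqrt (1 + (16 / κ + 4 + 1 / γ) * E), Real.sqrt_pos.2 hM0, fun f s a b hf hc h ha hb => ?_⟩
  rw [Real.sq_sqrt hM0.le]
  have key : ∀ t, 0 ≤ t → 1 / 2 * ∑ k ∈ s, b t k ^ 2 + 1 / 2 * ∑ k ∈ s, sqNorm k * a t k ^ 2 +
      κ / 8 * ∑ k ∈ s, a t k ^ 2 + γ * ∑ k ∈ s, absK k * ∫ r in (0 : ℝ)..t, b r k ^ 2 ≤ E := by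
    intro t ht
    have h1 := h.energy_eq hf.cont ht
    have h2 := hc.modalEnergy_ge hf.cont g s (a t) (b t)
    have h3 := hf.modalEnergy_le g (s := s) hR ha hb
    have h4 := le_abs_self (5 / 2 * R ^ 2 + 1 / 2 * ‖g‖ ^ 2 + C * (sobC * (1 + 2 * R ^ 5) * R))
    have h5 := le_abs_self (D ^ 2 / κ * (2 * π) ^ 3 + 2 / κ * ‖g‖ ^ 2)
    linarith
  have pa : ∀ t, 0 ≤ ∑ k ∈ s, a t k ^ 2 := fun t => Finset.sum_nonneg fun k _ => sq_nonneg _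
  have pb : ∀ t, 0 ≤ ∑ k ∈ s, b t k ^ 2 := fun t => Finset.sum_nonneg fun k _ => sq_nonneg _
  have pg : ∀ t, 0 ≤ ∑ k ∈ s, sqNorm k * a t k ^ 2 := fun t =>
    Finset.sum_nonneg fun k _ => mul_nonneg (sqNorm_nonneg k) (sq_nonneg _)
  have pd : ∀ t, 0 ≤ t → 0 ≤ ∑ k ∈ s, absK k * ∫ r in (0 : ℝ)..t, b r k ^ 2 := fun t ht =>
    Finset.sum_nonneg fun k _ => mul_nonneg (absK_nonneg k)
      (intervalIntegral.integral_nonneg ht fun r _ => sq_nonneg _)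
  have e1 : 0 ≤ 1 / γ * E := by positivity
  have e2 : 0 ≤ 16 / κ * E := by positivity
  have hb2 : ∀ t, 0 ≤ t → ∑ k ∈ s, b t k ^ 2 ≤ 2 * E := fun t ht => by
    have := mul_nonneg (by positivity : 0 ≤ κ / 8) (pa t)
    have := mul_nonneg hγ.le (pd t ht)
    linarith [key t ht, pg t]
  refine ⟨fun t => ?_, fun T hT => ?_⟩
  · rw [h.const_pos t, h.const_vel t]
    have ht : 0 ≤ max t 0 := le_max_right _ _
    set m := max t 0
    have h1 := key m ht
    have h2 := mul_nonneg (by positivity : 0 ≤ κ / 8) (pa m)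
    have h3 := mul_nonneg hγ.le (pd m ht)
    constructor
    · refine (hs_le_ofReal_iff hM0.le).2 fun s' => ?_
      have h4 : ∑ k ∈ s', nu k ^ 2 * a m k ^ 2 ≤ ∑ k ∈ s, nu k ^ 2 * a m k ^ 2 := 
        sum_le_sum_of_eq_zero (fun k => by have := nu_pos k; positivity) fun k hk => by
          rw [h.zero_pos m k hk]; simp
      have h5 : ∑ k ∈ s, nu k ^ 2 * a m k ^ 2 ≤ 2 * ∑ k ∈ s, a m k ^ 2 + 2 * ∑ k ∈ s, sqNorm k * a m k ^ 2 := by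
        rw [Finset.mul_sum, Finset.mul_sum, ← Finset.sum_add_distrib]
        refine Finset.sum_le_sum fun k _ => ?_
        have : nu k ^ 2 ≤ 2 + 2 * sqNorm k := by
          have := norm_sq_le_sqNorm k
          rw [nu]; nlinarith [sq_nonneg (1 - ‖k‖)]
        nlinarith [mul_le_mul_of_nonneg_right this (sq_nonneg (a m k))]
      have h6 : ∑ k ∈ s, a m k ^ 2 ≤ 8 / κ * E := by
        have : κ / 8 * ∑ k ∈ s, a m k ^ 2 ≤ E := by linarith [pb m, pg m]
        calc _ = 8 / κ * (κ / 8 * ∑ k ∈ s, a m k ^ 2) := by field_simp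
          _ ≤ _ := mul_le_mul_of_nonneg_left this (by positivity)
      have h7 : ∑ k ∈ s, sqNorm k * a m k ^ 2 ≤ 2 * E := by linarith [pb m]
      have e3 : 2 * (8 / κ * E) = 16 / κ * E := by ring
      linarith
    · refine (hs_le_ofReal_iff hM0.le).2 fun s' => ?_
      have h4 : ∑ k ∈ s', nu k ^ 0 * b m k ^ 2 ≤ ∑ k ∈ s, nu k ^ 0 * b m k ^ 2 := 
        sum_le_sum_of_eq_zero (fun k => by have := nu_pos k; positivity) fun k hk => by
          rw [h.zero_vel m k hk]; simp
      simp only [pow_zero, one_mul] at h4 ⊢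
      linarith [hb2 m ht]
  · rw [lintegral_hs_le_iff h.cont_vel 1 hT (by positivity)]
    intro s'
    have cv : ∀ k, Continuous fun t => b t k ^ 2 := fun k => (h.cont_vel k).pow 2
    have p : ∀ k, 0 ≤ ∫ r in (0 : ℝ)..T, b r k ^ 2 := fun k =>
      intervalIntegral.integral_nonneg hT fun r _ => sq_nonneg _
    have h4 : ∑ k ∈ s', ∫ t in (0 : ℝ)..T, nu k ^ 1 * b t k ^ 2 ≤
        ∑ k ∈ s, ∫ t in (0 : ℝ)..T, nu k ^ 1 * b t k ^ 2 := by
      simp_rw [intervalIntegral.integral_const_mul]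
      exact sum_le_sum_of_eq_zero (fun k => mul_nonneg (pow_pos (nu_pos k) 1).le (p k)) fun k hk => by
        simp [h.zero_vel _ k hk]
    have h5 : ∑ k ∈ s, ∫ t in (0 : ℝ)..T, nu k ^ 1 * b t k ^ 2 ≤
        (∫ t in (0 : ℝ)..T, ∑ k ∈ s, b t k ^ 2) + ∑ k ∈ s, absK k * ∫ t in (0 : ℝ)..T, b t k ^ 2 := by
      rw [intervalIntegral.integral_finsetSum (f := fun k t => b t k ^ 2)
        (fun k _ => (cv k).intervalIntegrable _ _), ← Finset.sum_add_distrib]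
      refine Finset.sum_le_sum fun k _ => ?_
      rw [intervalIntegral.integral_const_mul, pow_one, nu]
      nlinarith [mul_le_mul_of_nonneg_right (norm_le_absK k) (p k)]
    have h6 := integral_le_const_mul (continuous_finsetSum s fun k _ => cv k) hT
      (c := 2 * E) fun t ht => hb2 t ht.1
    have h7 : ∑ k ∈ s, absK k * ∫ t in (0 : ℝ)..T, b t k ^ 2 ≤ 1 / γ * E := by
      have h8 : γ * ∑ k ∈ s, absK k * ∫ t in (0 : ℝ)..T, b t k ^ 2 ≤ E := by
        linarith [key T hT, pb T, pg T, mul_nonneg (by positivity : 0 ≤ κ / 8) (pa T)]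
      calc _ = 1 / γ * (γ * ∑ k ∈ s, absK k * ∫ t in (0 : ℝ)..T, b t k ^ 2) := by field_simp
        _ ≤ _ := mul_le_mul_of_nonneg_left h8 (by positivity)
    have h9 : T * (2 * E) ≤ T * (1 + (16 / κ + 4 + 1 / γ) * E) :=
      mul_le_mul_of_nonneg_left (by linarith) hT
    linarith

/-! ### Equicontinuity in time of the Galerkin coefficients -/

theorem abs_sub_le_of_hasDerivAt {φ φ' : ℝ → ℝ} (hc : Continuous φ) (h0 : ∀ t, φ t = φ (max t 0))
    (hd : ∀ t, 0 < t → HasDerivAt φ (φ' t) t) {L : ℝ} (hL : 0 ≤ L) (hb : ∀ t, |φ' t| ≤ L) (t r : ℝ) :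
    |φ t - φ r| ≤ L * |t - r| := by
  have key : ∀ t r : ℝ, 0 ≤ r → r < t → |φ t - φ r| ≤ L * (t - r) := by
    intro t r hr hrt
    obtain ⟨c, hc, he⟩ := exists_hasDerivAt_eq_slope φ φ' hrt hc.continuousOn
      fun x hx => hd x (hr.trans_lt hx.1)
    have h1 : φ t - φ r = φ' c * (t - r) := by
      rw [he, div_mul_cancel₀ _ (sub_pos.2 hrt).ne']
    rw [h1, abs_mul, abs_of_pos (sub_pos.2 hrt)]
    exact mul_le_mul_of_nonneg_right (hb c) (sub_pos.2 hrt).le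
  have key2 : |φ t - φ r| ≤ L * |max t 0 - max r 0| := by
    rw [h0 t, h0 r]
    rcases lt_trichotomy (max t 0) (max r 0) with h | h | h
    · rw [abs_sub_comm, abs_sub_comm (max t 0), abs_of_pos (sub_pos.2 h)]
      exact key _ _ (le_max_right _ _) h
    · rw [h]; simp
    · rw [abs_of_pos (sub_pos.2 h)]
      exact key _ _ (le_max_right _ _) h
  exact key2.trans (mul_le_mul_of_nonneg_left (abs_max_sub_max_le_abs _ _ _) hL)

theorem abs_coef_le_of_hs {n : ℕ} {a : (Fin 3 → ℤ) → ℝ} {M : ℝ} (hM : 0 ≤ M)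
    (h : hs n a ≤ ENNReal.ofReal (M ^ 2)) (k : Fin 3 → ℤ) : |a k| ≤ M := by
  have h1 := (hs_le_ofReal_iff (sq_nonneg M)).1 h {k}
  rw [Finset.sum_singleton] at h1
  refine abs_le_of_sq_le_sq ?_ hM
  refine le_trans ?_ h1
  exact le_mul_of_one_le_left (sq_nonneg _) (one_le_pow₀ (one_le_nu k))

theorem Growth.abs_coef_le (hf : Growth f C) {u : L2} {M : ℝ} (hM : 0 ≤ M)
    (hu : hs 2 (coef u) ≤ ENNReal.ofReal (M ^ 2)) (k : Fin 3 → ℤ) :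
    |coef (fun x => f (u x)) k| ≤ C * (sobC * (1 + 2 * M ^ 5) * nu k) := by
  have h1 := (hf.mul_le hM (nu_pos k).le hu (w := hartLp k) (hs_coef_hart 2 k).le).2
  have e : ∫ x, f (u x) * hartLp k x = coef (fun x => f (u x)) k := by
    refine integral_congr_ae ?_
    filter_upwards [coeFn_hartLp k] with x hx
    rw [hx]
  rwa [e] at h1

theorem coef_comp_trigL (f : ℝ → ℝ) (s : Finset (Fin 3 → ℤ)) (a : (Fin 3 → ℤ) → ℝ) (k : Fin 3 → ℤ) :
    coef (fun x => f (trigL s a x)) k = coef (fun x => f (trig s a x)) k := by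
  refine coef_congr ?_ k
  filter_upwards [coeFn_trigL s a] with x hx
  rw [hx]

/-- The equations bound the time derivative of each coefficient by a constant that depends on the
mode but not on the set `s` of Galerkin modes. -/
theorem GalerkinSolution.abs_sub_le (h : GalerkinSolution γ f g s a b) (hγ : 0 ≤ γ) (hf : Growth f C) {M : ℝ}
    (hM : 0 ≤ M) (ha : ∀ t, hs 2 (a t) ≤ ENNReal.ofReal (M ^ 2))
    (hb : ∀ t, hs 0 (b t) ≤ ENNReal.ofReal (M ^ 2)) (k : Fin 3 → ℤ) (t r : ℝ) :
    |a t k - a r k| ≤ M * |t - r| ∧ |b t k - b r k| ≤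
      (|coef g k| + γ * absK k * M + sqNorm k * M + C * (sobC * (1 + 2 * M ^ 5) * nu k)) * |t - r| := by
  have hC := hf.pos
  have h1 := absK_nonneg k
  have h2 := sqNorm_nonneg k
  have h3 := nu_pos k
  have h4 := sobC_pos
  have hL : 0 ≤ |coef g k| + γ * absK k * M + sqNorm k * M + C * (sobC * (1 + 2 * M ^ 5) * nu k) := by
    positivity
  by_cases hk : k ∈ s
  · refine ⟨abs_sub_le_of_hasDerivAt (h.cont_pos k) (fun t => by rw [h.const_pos t])
      (fun t ht => h.hasDerivAt_pos k hk t ht) hM (fun t => abs_coef_le_of_hs hM (hb t) k) t r,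
      abs_sub_le_of_hasDerivAt (h.cont_vel k) (fun t => by rw [h.const_vel t])
      (fun t ht => h.hasDerivAt_vel k hk t ht) hL (fun t => ?_) t r⟩
    have e1 := hf.abs_coef_le hM ((hs_trigL_le 2 s (a t)).trans (ha t)) k
    rw [coef_comp_trigL] at e1
    have e2 := mul_le_mul_of_nonneg_left (abs_coef_le_of_hs hM (hb t) k) (mul_nonneg hγ h1)
    have e3 := mul_le_mul_of_nonneg_left (abs_coef_le_of_hs hM (ha t) k) h2
    rw [← abs_of_nonneg (mul_nonneg hγ h1), ← abs_mul, abs_of_nonneg (mul_nonneg hγ h1)] at e2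
    rw [← abs_of_nonneg h2, ← abs_mul, abs_of_nonneg h2] at e3
    refine (abs_sub _ _).trans (add_le_add ((abs_sub _ _).trans (add_le_add ((abs_sub _ _).trans
      (add_le_add le_rfl e2)) e3)) e1)
  · simp only [h.zero_pos _ k hk, h.zero_vel _ k hk, sub_self, abs_zero]
    exact ⟨by positivity, by positivity⟩

end

/-! ### Passage to the limit -/

/-- An Arzelà–Ascoli argument with pointwise conclusion: compactness gives convergence at all
rational times for all indices at once, and the Lipschitz bounds carry it to every real time. -/
theorem exists_subseq_tendsto_of_lipschitz {ι : Type*} [Countable ι] {φ : ℕ → ι → ℝ → ℝ} {M : ℝ}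
    (hM : ∀ n i t, |φ n i t| ≤ M) {L : ι → ℝ} (hL0 : ∀ i, 0 ≤ L i)
    (hL : ∀ n i t r, |φ n i t - φ n i r| ≤ L i * |t - r|) :
    ∃ θ : ℕ → ℕ, StrictMono θ ∧ ∃ ψ : ι → ℝ → ℝ, ∀ i t, Tendsto (fun n => φ (θ n) i t) atTop (𝓝 (ψ i t)) := by
  -- The index set is countable, so the compact product is metrizable and has convergent
  -- subsequences; no explicit diagonal argument is needed.
  have hK : IsCompact (Set.pi univ fun _ : ι × ℚ => Icc (-M) M) := isCompact_univ_pi fun _ => isCompact_Icc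
  obtain ⟨Ψ, -, θ, hθ, hΨ⟩ := hK.tendsto_subseq (x := fun n (p : ι × ℚ) => φ n p.1 p.2)
    fun n p _ => abs_le.1 (hM n p.1 p.2)
  rw [tendsto_pi_nhds] at hΨ
  have hC : ∀ i t, ∃ y, Tendsto (fun n => φ (θ n) i t) atTop (𝓝 y) := by
    intro i t
    refine cauchySeq_tendsto_of_complete (Metric.cauchySeq_iff.2 fun ε hε => ?_)
    obtain ⟨q, hq1, hq2⟩ := exists_rat_btwn (show t < t + ε / (4 * (L i + 1)) by
      have := hL0 i
      have : 0 < ε / (4 * (L i + 1)) := by positivity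
      linarith)
    have hL' := hL0 i
    have h1 : L i * |t - q| ≤ ε / 4 := by
      rw [abs_sub_comm, abs_of_pos (by linarith)]
      have h2 : (q - t) ≤ ε / (4 * (L i + 1)) := by linarith
      calc L i * (q - t) ≤ (L i + 1) * (ε / (4 * (L i + 1))) :=
            mul_le_mul (by linarith) h2 (by linarith) (by linarith)
        _ = ε / 4 := by field_simp
    obtain ⟨N, hN⟩ := Metric.cauchySeq_iff.1 ((hΨ (i, q)).cauchySeq) (ε / 4) (by positivity)
    refine ⟨N, fun m hm n hn => ?_⟩
    have h2 := hN m hm n hn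
    simp only [Function.comp, Real.dist_eq] at h2
    rw [Real.dist_eq]
    have h3 := abs_lt.1 h2
    have h4 := abs_le.1 ((hL (θ m) i t q).trans h1)
    have h5 := abs_le.1 ((hL (θ n) i t q).trans h1)
    rw [abs_lt]
    constructor <;> linarith [h3.1, h3.2, h4.1, h4.2, h5.1, h5.2]
  choose ψ hψ using hC
  exact ⟨θ, hθ, ψ, hψ⟩

theorem continuous_of_lipschitz {φ : ℝ → ℝ} {L : ℝ} (hL0 : 0 ≤ L) (hL : ∀ t r, |φ t - φ r| ≤ L * |t - r|) :
    Continuous φ := by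
  have : LipschitzWith ⟨L, hL0⟩ φ := LipschitzWith.of_dist_le_mul fun x y => by
    rw [Real.dist_eq, Real.dist_eq]; exact hL x y
  exact this.continuous

theorem tendsto_intervalIntegral_of_bounded {ψ : ℕ → ℝ → ℝ} {ψ₀ : ℝ → ℝ} (hc : ∀ n, Continuous (ψ n)) {c : ℝ}
    (hb : ∀ n t, |ψ n t| ≤ c) (h : ∀ t, Tendsto (fun n => ψ n t) atTop (𝓝 (ψ₀ t))) (a b : ℝ) :
    Tendsto (fun n => ∫ t in a..b, ψ n t) atTop (𝓝 (∫ t in a..b, ψ₀ t)) :=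
  intervalIntegral.tendsto_integral_filter_of_dominated_convergence (fun _ => c)
    (Eventually.of_forall fun n => (hc n).aestronglyMeasurable)
    (Eventually.of_forall fun n => Eventually.of_forall fun t _ => hb n t)
    intervalIntegrable_const (Eventually.of_forall fun t _ => h t)

/-- The limit is taken in the integrated equations by dominated convergence; continuity of the
limiting right side restores differentiability. -/
theorem hasDerivAt_of_tendsto {φ ψ : ℕ → ℝ → ℝ} {φ₀ ψ₀ : ℝ → ℝ} (cφ : ∀ n, Continuous (φ n))
    (cψ : ∀ n, Continuous (ψ n)) (hd : ∀ᶠ n in atTop, ∀ t, 0 < t → HasDerivAt (φ n) (ψ n t) t) {c : ℝ}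
    (hb : ∀ n t, |ψ n t| ≤ c) (hφ : ∀ t, Tendsto (fun n => φ n t) atTop (𝓝 (φ₀ t)))
    (hψ : ∀ t, Tendsto (fun n => ψ n t) atTop (𝓝 (ψ₀ t))) (cψ₀ : Continuous ψ₀) {t : ℝ} (ht : 0 < t) :
    HasDerivAt φ₀ (ψ₀ t) t := by
  have key : ∀ r, 0 ≤ r → φ₀ r = φ₀ 0 + ∫ x in (0 : ℝ)..r, ψ₀ x := by
    intro r hr
    have h1 := tendsto_intervalIntegral_of_bounded cψ hb hψ 0 r
    have h2 := (hφ r).sub (hφ 0)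
    have h3 : φ₀ r - φ₀ 0 = ∫ x in (0 : ℝ)..r, ψ₀ x := by
      refine tendsto_nhds_unique (h2.congr' ?_) h1
      filter_upwards [hd] with n hn
      exact (intervalIntegral.integral_eq_sub_of_hasDerivAt_of_le hr (cφ n).continuousOn
        (fun x hx => hn x hx.1) ((cψ n).intervalIntegrable _ _)).symm
    linarith
  have h1 : HasDerivAt (fun r => φ₀ 0 + ∫ x in (0 : ℝ)..r, ψ₀ x) (ψ₀ t) t :=
    (intervalIntegral.integral_hasDerivAt_right (cψ₀.intervalIntegrable _ _)
      cψ₀.aestronglyMeasurable.stronglyMeasurableAtFilter cψ₀.continuousAt).const_add _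
  refine h1.congr_of_eventuallyEq ?_
  filter_upwards [eventually_gt_nhds ht] with r hr
  exact key r hr.le

section

variable {γ : ℝ} {f : ℝ → ℝ} {C κ D : ℝ}

theorem Growth.abs_coef_trunc_sub_le (hf : Growth f C) (hκ : 0 ≤ κ) {m : ℝ} (hm : 1 ≤ m) {u : L2} {M : ℝ}
    (hM : 0 ≤ M) (hu : hs 2 (coef u) ≤ ENNReal.ofReal (M ^ 2)) (k : Fin 3 → ℤ) :
    |coef (fun x => DampedWave.trunc f κ m (u x)) k - coef (fun x => f (u x)) k| ≤
      4 * (C + κ) / m * (sobC * M ^ 6) := by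
  have hC := hf.pos
  have hsob := sobC_pos
  have htop : hs 2 (coef u) < ⊤ := hu.trans_lt ENNReal.ofReal_lt_top
  have i1 := (hf.trunc hκ (by linarith : 0 ≤ m)).integrable htop
  have i2 := hf.integrable htop
  obtain ⟨i3, h3⟩ := integral_le_of_lintegral_le (aesm_abs_pow u 6) (fun x => by positivity)
    (by positivity) (lintegral_pow_six_le hM hu)
  rw [← coef_sub i1 i2]
  have h1 : |coef (fun x => DampedWave.trunc f κ m (u x) - f (u x)) k| ≤
      ∫ x, 4 * (C + κ) / m * |u x| ^ 6 := by
    refine norm_integral_le_of_norm_le (μ := (volume : Measure Torus3))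
      (f := fun x => (DampedWave.trunc f κ m (u x) - f (u x)) * hart k x) (i3.const_mul _)
      (Eventually.of_forall fun x => ?_)
    rw [norm_mul, Real.norm_eq_abs, Real.norm_eq_abs]
    exact (mul_le_mul (hf.abs_trunc_sub_le hκ hm (u x)) (abs_hart_le k x) (abs_nonneg _)
      (by positivity)).trans (mul_one _).le
  refine h1.trans ?_
  rw [integral_const_mul]
  exact mul_le_mul_of_nonneg_left h3 (by positivity)

/-- Galerkin systems with modes in `box N` and the nonlinearity truncated at height `N + 1`. Energy
bounds and mode-wise Lipschitz bounds give a subsequence along which all coefficients converge at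
all times; bounds pass to the limit by lower semicontinuity. -/
theorem exists_modeSolution (hγ : 0 < γ) (hf : Growth f C) (hc : Coercive f κ D) (g : L2) (ξ₀ : EnergySpace) :
    ∃ ξ, ModeSolution γ f g ξ ∧ ξ 0 = ξ₀ := by
  have hκ := hc.pos
  have hC := hf.pos
  have hm : ∀ N : ℕ, (1 : ℝ) ≤ N + 1 := fun N => by linarith [Nat.cast_nonneg (α := ℝ) N]
  have hm0 : ∀ N : ℕ, (0 : ℝ) ≤ N + 1 := fun N => by linarith [hm N]
  have hfN : ∀ N : ℕ, Growth (trunc f κ (N + 1)) (C + κ) := fun N => hf.trunc hκ.le (hm0 N)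
  have hex : ∀ N : ℕ, ∃ a b, GalerkinSolution γ (trunc f κ (N + 1)) g (box N) a b ∧
      ∀ k ∈ box N, a 0 k = coef ξ₀.pos k ∧ b 0 k = coef ξ₀.vel k := fun N => by
    obtain ⟨L, hL, hLip⟩ := hf.exists_lipschitz_trunc hκ.le (hm0 N)
    exact exists_galerkinSolution hγ.le hL hLip g (box N) _ _
  choose a b hG hinit using hex
  obtain ⟨M, hM, hbound⟩ := GalerkinSolution.exists_bound hγ (C + κ) κ D hκ g
    (R := 3 * ‖ξ₀‖) (by positivity)
  have hbd := fun N => hbound _ (box N) (a N) (b N) (hfN N) (hc.trunc (hm0 N)) (hG N)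
    ((hs_le_of_abs_le fun k => by
      by_cases hk : k ∈ box N
      · rw [(hinit N k hk).1]
      · rw [(hG N).zero_pos 0 k hk, abs_zero]; exact abs_nonneg _).trans
      ((hs_two_pos_le ξ₀).trans (ENNReal.ofReal_le_ofReal (by nlinarith [sq_nonneg ‖ξ₀‖]))))
    ((hs_le_of_abs_le fun k => by
      by_cases hk : k ∈ box N
      · rw [(hinit N k hk).2]
      · rw [(hG N).zero_vel 0 k hk, abs_zero]; exact abs_nonneg _).trans
      ((hs_zero_vel_le ξ₀).trans (ENNReal.ofReal_le_ofReal (by nlinarith [sq_nonneg ‖ξ₀‖]))))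
  set L : (Fin 3 → ℤ) → ℝ := fun k =>
    |coef g k| + γ * absK k * M + sqNorm k * M + (C + κ) * (sobC * (1 + 2 * M ^ 5) * nu k) with hLdef
  have hL0 : ∀ k, 0 ≤ L k := fun k => by
    have h1 := absK_nonneg k
    have h2 := sqNorm_nonneg k
    have h3 := nu_pos k
    have h4 := sobC_pos
    positivity
  have hlip := fun N k t r => (hG N).abs_sub_le hγ.le (hfN N) hM.le (fun t => ((hbd N).1 t).1)
    (fun t => ((hbd N).1 t).2) k t r
  have hcoefa : ∀ N t k, |a N t k| ≤ M := fun N t k => abs_coef_le_of_hs hM.le ((hbd N).1 t).1 k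
  have hcoefb : ∀ N t k, |b N t k| ≤ M := fun N t k => abs_coef_le_of_hs hM.le ((hbd N).1 t).2 k
  obtain ⟨θ, hθ, ψ, hψ⟩ := exists_subseq_tendsto_of_lipschitz
    (φ := fun N (p : (Fin 3 → ℤ) × Bool) t => if p.2 then a N t p.1 else b N t p.1) (M := M)
    (L := fun p => if p.2 then M else L p.1) (fun N p t => by
      rcases p with ⟨k, _ | _⟩
      · simpa using hcoefb N t k
      · simpa using hcoefa N t k) (fun p => by
      rcases p with ⟨k, _ | _⟩
      · simpa using hL0 k
      · simpa using hM.le) (fun N p t r => by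
      rcases p with ⟨k, _ | _⟩
      · simpa using (hlip N k t r).2
      · simpa using (hlip N k t r).1)
  have hA : ∀ k t, Tendsto (fun n => a (θ n) t k) atTop (𝓝 (ψ (k, true) t)) := fun k t => by
    simpa using hψ (k, true) t
  have hB : ∀ k t, Tendsto (fun n => b (θ n) t k) atTop (𝓝 (ψ (k, false) t)) := fun k t => by
    simpa using hψ (k, false) t
  have hA2 : ∀ t, hs 2 (fun k => ψ (k, true) t) ≤ ENNReal.ofReal (M ^ 2) := fun t =>
    hs_le_of_tendsto (sq_nonneg M) (Eventually.of_forall fun n => ((hbd (θ n)).1 t).1) fun k => hA k t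
  have hB2 : ∀ t, hs 0 (fun k => ψ (k, false) t) ≤ ENNReal.ofReal (M ^ 2) := fun t =>
    hs_le_of_tendsto (sq_nonneg M) (Eventually.of_forall fun n => ((hbd (θ n)).1 t).2) fun k => hB k t
  have hexξ : ∀ t, ∃ ξ : EnergySpace, (∀ k, coef ξ.pos k = ψ (k, true) t) ∧
      ∀ k, coef ξ.vel k = ψ (k, false) t := fun t =>
    exists_energySpace ((hA2 t).trans_lt ENNReal.ofReal_lt_top) ((hB2 t).trans_lt ENNReal.ofReal_lt_top)
  choose ξ hξ1 hξ2 using hexξ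
  have cA : ∀ k, Continuous (ψ (k, true)) := fun k => continuous_of_lipschitz hM.le fun t r =>
    le_of_tendsto ((hA k t).sub (hA k r)).abs (Eventually.of_forall fun n => (hlip (θ n) k t r).1)
  have cB : ∀ k, Continuous (ψ (k, false)) := fun k => continuous_of_lipschitz (hL0 k) fun t r =>
    le_of_tendsto ((hB k t).sub (hB k r)).abs (Eventually.of_forall fun n => (hlip (θ n) k t r).2)
  have hpos2 : ∀ t, hs 2 (coef (ξ t).pos) ≤ ENNReal.ofReal (M ^ 2) := fun t => by
    have : coef (ξ t).pos = fun k => ψ (k, true) t := funext (hξ1 t)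
    rw [this]; exact hA2 t
  have hvel0 : ∀ t, hs 0 (coef (ξ t).vel) ≤ ENNReal.ofReal (M ^ 2) := fun t => by
    have : coef (ξ t).vel = fun k => ψ (k, false) t := funext (hξ2 t)
    rw [this]; exact hB2 t
  have cpos : ∀ k, Continuous fun t => coef (ξ t).pos k := fun k => by simp_rw [hξ1]; exact cA k
  have cvel : ∀ k, Continuous fun t => coef (ξ t).vel k := fun k => by simp_rw [hξ2]; exact cB k
  have hbox : ∀ k, ∀ᶠ n in atTop, k ∈ box (θ n) := fun k => by
    obtain ⟨N, hN⟩ := exists_subset_box {k}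
    filter_upwards [eventually_ge_atTop N] with n hn
    exact box_mono (hn.trans hθ.le_apply) (hN (Finset.mem_singleton_self k))
  have hU : ∀ N t, hs 2 (coef (trigL (box N) (a N t))) ≤ ENNReal.ofReal (M ^ 2) := fun N t =>
    (hs_trigL_le 2 _ _).trans ((hbd N).1 t).1
  -- Two errors vanish: the truncation error by the sixth-power bound, and the Galerkin error by
  -- weak continuity of the nonlinearity.
  have hlimf : ∀ k t, Tendsto (fun n => coef (fun x => trunc f κ ((θ n : ℕ) + 1) (trig (box (θ n)) (a (θ n) t) x)) k)
      atTop (𝓝 (coef (fun x => f ((ξ t).pos x)) k)) := by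
    intro k t
    have h1 : Tendsto (fun n => coef (fun x => f (trigL (box (θ n)) (a (θ n) t) x)) k) atTop
        (𝓝 (coef (fun x => f ((ξ t).pos x)) k)) := by
      refine hf.tendsto_coef hM.le (Eventually.of_forall fun n => hU (θ n) t) (hpos2 t) (fun k => ?_) k
      rw [hξ1]
      refine (hA k t).congr' ?_
      filter_upwards [hbox k] with n hn
      rw [coef_trigL, if_pos hn]
    have h2 : Tendsto (fun n : ℕ => 4 * (C + κ) / ((θ n : ℕ) + 1 : ℝ) * (sobC * M ^ 6)) atTop (𝓝 0) := by
      have h3 : Tendsto (fun n : ℕ => ((θ n : ℕ) + 1 : ℝ)) atTop atTop :=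
        tendsto_atTop_add_const_right _ _ (tendsto_natCast_atTop_atTop.comp hθ.tendsto_atTop)
      simpa using (h3.const_div_atTop (4 * (C + κ))).mul_const (sobC * M ^ 6)
    have h3 : Tendsto (fun n => coef (fun x => trunc f κ ((θ n : ℕ) + 1) (trig (box (θ n)) (a (θ n) t) x)) k -
        coef (fun x => f (trigL (box (θ n)) (a (θ n) t) x)) k) atTop (𝓝 0) := by
      refine squeeze_zero_norm (fun n => ?_) h2
      rw [← coef_comp_trigL]
      exact hf.abs_coef_trunc_sub_le hκ.le (hm (θ n)) hM.le (hU (θ n) t) k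
    simpa using h3.add h1
  refine ⟨ξ, ⟨cpos, cvel, fun T => ⟨M, hM.le, fun t _ => norm_le_of_hs hM.le (hpos2 t) (hvel0 t)⟩,
    fun T => ?_, fun k t ht => ?_, fun k t ht => ?_⟩, ext_energySpace (fun k => ?_) fun k => ?_⟩
  · rcases lt_or_ge T 0 with hT | hT
    · rw [Ioo_eq_empty (by linarith)]; simp
    refine lt_of_le_of_lt ?_ (ENNReal.ofReal_lt_top (r := T * M ^ 2 + M ^ 2))
    rw [lintegral_hs_le_iff cvel 1 hT (by positivity)]
    intro s
    have h1 : Tendsto (fun n => ∑ k ∈ s, ∫ t in (0 : ℝ)..T, nu k ^ 1 * b (θ n) t k ^ 2) atTop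
        (𝓝 (∑ k ∈ s, ∫ t in (0 : ℝ)..T, nu k ^ 1 * coef (ξ t).vel k ^ 2)) := by
      refine tendsto_finsetSum _ fun k _ => ?_
      refine tendsto_intervalIntegral_of_bounded (ψ := fun n t => nu k ^ 1 * b (θ n) t k ^ 2) (c := nu k ^ 1 * M ^ 2)
        (fun n => (((hG (θ n)).cont_vel k).pow 2).const_mul _) (fun n t => ?_) (fun t => ?_) 0 T
      · rw [abs_mul, abs_of_pos (pow_pos (nu_pos k) 1), abs_pow]
        exact mul_le_mul_of_nonneg_left (pow_le_pow_left₀ (abs_nonneg _) (hcoefb _ t k) 2)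
          (pow_pos (nu_pos k) 1).le
      · rw [hξ2]
        exact ((hB k t).pow 2).const_mul _
    refine le_of_tendsto h1 (Eventually.of_forall fun n => ?_)
    exact (lintegral_hs_le_iff (hG (θ n)).cont_vel 1 hT (by positivity)).1 ((hbd (θ n)).2 T hT) s
  · have h1 := hasDerivAt_of_tendsto (φ := fun n t => a (θ n) t k) (ψ := fun n t => b (θ n) t k)
      (fun n => (hG (θ n)).cont_pos k) (fun n => (hG (θ n)).cont_vel k)
      (by
        filter_upwards [hbox k] with n hn t ht
        exact (hG (θ n)).hasDerivAt_pos k hn t ht)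
      (fun n t => hcoefb _ t k) (fun t => hA k t) (fun t => hB k t) (cB k) ht
    simp_rw [hξ1, hξ2]
    exact h1
  · have hcf : Continuous fun t => coef (fun x => f ((ξ t).pos x)) k :=
      hf.continuous_coef cpos (fun T => ⟨M, hM, fun t _ => hpos2 t⟩) k
    have h1 := hasDerivAt_of_tendsto (φ := fun n t => b (θ n) t k)
      (ψ := fun n t => coef g k - γ * absK k * b (θ n) t k - sqNorm k * a (θ n) t k -
        coef (fun x => trunc f κ ((θ n : ℕ) + 1) (trig (box (θ n)) (a (θ n) t) x)) k)
      (φ₀ := fun t => coef (ξ t).vel k)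
      (ψ₀ := fun t => coef g k - γ * absK k * coef (ξ t).vel k - sqNorm k * coef (ξ t).pos k -
        coef (fun x => f ((ξ t).pos x)) k) (c := L k)
      (fun n => (hG (θ n)).cont_vel k)
      (fun n => ((continuous_const.sub (continuous_const.mul ((hG (θ n)).cont_vel k))).sub
        (continuous_const.mul ((hG (θ n)).cont_pos k))).sub
        (continuous_coef_comp_trig (hfN (θ n)).cont (fun k _ => (hG (θ n)).cont_pos k) k))
      (by
        filter_upwards [hbox k] with n hn t ht
        exact (hG (θ n)).hasDerivAt_vel k hn t ht)
      (fun n t => ?_) (fun t => by rw [hξ2]; exact hB k t)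
      (fun t => by
        rw [hξ1, hξ2]
        exact (((tendsto_const_nhds.sub ((hB k t).const_mul _))).sub ((hA k t).const_mul _)).sub (hlimf k t))
      (((continuous_const.sub (continuous_const.mul (cvel k))).sub (continuous_const.mul (cpos k))).sub hcf) ht
    · exact h1
    · have e1 := (hfN (θ n)).abs_coef_le hM.le (hU (θ n) t) k
      rw [coef_comp_trigL] at e1
      have p1 := mul_nonneg hγ.le (absK_nonneg k)
      have p2 := sqNorm_nonneg k
      have e2 := mul_le_mul_of_nonneg_left (hcoefb (θ n) t k) p1
      have e3 := mul_le_mul_of_nonneg_left (hcoefa (θ n) t k) p2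
      rw [← abs_of_nonneg p1, ← abs_mul, abs_of_nonneg p1] at e2
      rw [← abs_of_nonneg p2, ← abs_mul, abs_of_nonneg p2] at e3
      exact (abs_sub _ _).trans (add_le_add ((abs_sub _ _).trans (add_le_add ((abs_sub _ _).trans
        (add_le_add le_rfl e2)) e3)) e1)
  · rw [hξ1]
    refine tendsto_nhds_unique (hA k 0) (tendsto_const_nhds.congr' ?_)
    filter_upwards [hbox k] with n hn
    exact ((hinit (θ n) k hn).1).symm
  · rw [hξ2]
    refine tendsto_nhds_unique (hB k 0) (tendsto_const_nhds.congr' ?_)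
    filter_upwards [hbox k] with n hn
    exact ((hinit (θ n) k hn).2).symm

end

/-! ### Functions with values in a nowhere dense set -/

theorem coef_const_of_ne_zero (m : ℝ) {k : Fin 3 → ℤ} (hk : k ≠ 0) : coef (fun _ => m) k = 0 := by
  have e : (fun _ : Torus3 => m) = fun x => (m * Real.sqrt ((2 * π) ^ 3)) * hart 0 x := funext fun x => by
    rw [mul_assoc, ← one_eq_hart, mul_one]
  rw [e, coef_const_mul, coef_hart, if_neg hk.symm, mul_zero]

theorem exists_ae_eq_const_of_coef {h : Torus3 → ℝ} (hh : Integrable h) (h0 : ∀ k, k ≠ 0 → coef h k = 0) :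
    ∃ m, ∀ᵐ x, h x = m := by
  have hp := sqrt_pos_aux.ne'
  have i1 : Integrable fun x => coef h 0 * hart 0 x :=
    (integrable_of_continuous (continuous_hart 0)).const_mul _
  have h1 := ae_eq_zero_of_coef_eq_zero (hh.sub i1) fun k => by
    refine (coef_sub hh i1 k).trans ?_
    rw [coef_const_mul, coef_hart]
    by_cases hk : k = 0
    · subst hk; simp
    · rw [h0 k hk, if_neg (Ne.symm hk)]; simp
  refine ⟨coef h 0 * (Real.sqrt ((2 * π) ^ 3))⁻¹, ?_⟩
  filter_upwards [h1] with x hx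
  have h2 : hart 0 x = (Real.sqrt ((2 * π) ^ 3))⁻¹ := by
    rw [eq_inv_of_mul_eq_one_right (one_eq_hart x).symm]
  rw [← h2]
  exact sub_eq_zero.1 hx

theorem integral_sq_translate_sub_le {w : L2} {R : ℝ} (hw : hs 2 (coef w) ≤ ENNReal.ofReal (R ^ 2))
    (i : Fin 3) (s : ℝ) : Integrable (fun x => (w (x + shift i s) - w x) ^ 2) ∧
      ∫ x, (w (x + shift i s) - w x) ^ 2 ≤ R ^ 2 * s ^ 2 := by
  have htop : hs 2 (coef w) < ⊤ := hw.trans_lt ENNReal.ofReal_lt_top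
  obtain ⟨h1, h2⟩ := growth_id.integral_mul_secondDiff htop i s
  simp only [← sq] at h1 h2
  refine ⟨h1, ?_⟩
  rw [← h2]
  have h3 := hasSum_coef_mul w (secondDiff i s w)
  have h4 := summable_of_hs_lt_top htop
  rw [hs_eq_ofReal h4, ENNReal.ofReal_le_ofReal_iff (sq_nonneg R)] at hw
  have h5 := hasSum_le (fun k => ?_) h3 (h4.hasSum.mul_left (s ^ 2))
  · nlinarith [mul_le_mul_of_nonneg_left hw (sq_nonneg s)]
  · rw [coef_secondDiff]
    have h6 : 2 - 2 * Real.cos (k i * s) ≤ s ^ 2 * nu k ^ 2 := by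
      refine (diff_symbol_le_sq _).trans ?_
      rw [mul_pow, mul_comm, ← sq_abs (k i : ℝ)]
      exact mul_le_mul_of_nonneg_left (pow_le_pow_left₀ (abs_nonneg _) (abs_apply_le_nu k i) 2) (sq_nonneg s)
    nlinarith [mul_le_mul_of_nonneg_right h6 (sq_nonneg (coef w k))]

/-- The derivative at `s = 0` is `-q B`, and a quadratic bound forces it to vanish. -/
theorem eq_zero_of_abs_le_sq {A B q c : ℝ}
    (h : ∀ s : ℝ, |Real.cos (q * s) * A - Real.sin (q * s) * B - A| ≤ c * s ^ 2) : q * B = 0 := by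
  have h1 : HasDerivAt (fun s : ℝ => Real.cos (q * s) * A - Real.sin (q * s) * B) (-(q * B)) 0 := by
    have h2 : HasDerivAt (fun s : ℝ => q * s) q 0 := by simpa using (hasDerivAt_id (0 : ℝ)).const_mul q
    have h3 := (h2.cos.mul_const A).sub (h2.sin.mul_const B)
    refine h3.congr_deriv ?_
    simp
  have h2 : HasDerivAt (fun s : ℝ => Real.cos (q * s) * A - Real.sin (q * s) * B) 0 0 := by
    rw [hasDerivAt_iff_isLittleO]
    have h3 : (fun s : ℝ => s ^ 2) =o[𝓝 0] fun s : ℝ => s := by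
      simpa using Asymptotics.isLittleO_pow_id (𝕜 := ℝ) (n := 2) (by norm_num)
    refine (Asymptotics.IsBigO.of_bound c (Eventually.of_forall fun s => ?_)).trans_isLittleO
      (by simpa using h3)
    simpa [abs_of_nonneg (sq_nonneg s)] using h s
  have := h1.unique h2
  linarith

/-- An H¹ function cannot jump. The indicator `χ` of `{q ≤ w}` changes under a shift only where `w`
changes by at least `q - p`, so its increment is at most the squared increment of `w` over `(q -
p)²`. The integral of that is O(s²), so the coefficients of `χ` have zero derivative under
translations, all nonzero modes vanish and `χ` is constant. -/
theorem ae_const_or_of_gap {w : L2} (hw : hs 2 (coef w) < ⊤) {p q : ℝ} (hpq : p < q)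
    (hgap : ∀ᵐ x, w x ≤ p ∨ q ≤ w x) : (∀ᵐ x, w x ≤ p) ∨ ∀ᵐ x, q ≤ w x := by
  obtain ⟨R, hR, hw⟩ := exists_sq_bound hw
  set A := {x | q ≤ w x} with hA
  have hAm : MeasurableSet A := measurableSet_le measurable_const (Lp.stronglyMeasurable w).measurable
  set χ : L2 := indicatorConstLp 2 hAm (measure_ne_top _ _) (1 : ℝ) with hχ
  have hχe : ∀ᵐ x, χ x = A.indicator (fun _ => 1) x := indicatorConstLp_coeFn
  have hdiff : ∀ (i : Fin 3) (s : ℝ), ∀ᵐ x, |translate (shift i s) χ x - χ x| ≤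
      ((q - p) ^ 2)⁻¹ * (w (x + shift i s) - w x) ^ 2 := by
    intro i s
    have hsh := (measurePreserving_add_right (volume : Measure Torus3) (shift i s)).quasiMeasurePreserving
    filter_upwards [coeFn_translate (shift i s) χ, hχe, hsh.ae hχe, hgap, hsh.ae hgap] with x h1 h2 h3 h4 h5
    rw [h1, h2, h3]
    have hqp : 0 < q - p := sub_pos.2 hpq
    have hrhs : 0 ≤ ((q - p) ^ 2)⁻¹ * (w (x + shift i s) - w x) ^ 2 := by positivity
    by_cases hx : q ≤ w x <;> by_cases hy : q ≤ w (x + shift i s)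
    · rw [indicator_of_mem (show x ∈ A from hx), indicator_of_mem (show _ ∈ A from hy)]
      simpa using hrhs
    · rw [indicator_of_mem (show x ∈ A from hx), indicator_of_notMem (show _ ∉ A from hy)]
      have := h5.resolve_right hy
      rw [zero_sub, abs_neg, abs_one, inv_mul_eq_div, one_le_div (by positivity)]
      nlinarith
    · rw [indicator_of_notMem (show x ∉ A from hx), indicator_of_mem (show _ ∈ A from hy)]
      have := h4.resolve_right hx
      rw [sub_zero, abs_one, inv_mul_eq_div, one_le_div (by positivity)]
      nlinarith
    · rw [indicator_of_notMem (show x ∉ A from hx), indicator_of_notMem (show _ ∉ A from hy)]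
      simpa using hrhs
  have hcoef : ∀ k, k ≠ 0 → coef χ k = 0 := by
    intro k hk
    obtain ⟨i, hi⟩ := Function.ne_iff.1 hk
    -- Translating the mode `-k` brings in the coefficient at `k` through the sine, so its
    -- derivative isolates the coefficient sought.
    have h1 : (((-k) i : ℤ) : ℝ) * coef χ (-(-k)) = 0 := by
      refine eq_zero_of_abs_le_sq (A := coef χ (-k)) (c := ((q - p) ^ 2)⁻¹ * R ^ 2) fun s => ?_
      rw [← coef_translate, ← coef_Lp_sub]
      obtain ⟨h2, h3⟩ := integral_sq_translate_sub_le hw i s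
      have h4 : |coef (translate (shift i s) χ - χ : L2) (-k)| ≤
          ∫ x, ((q - p) ^ 2)⁻¹ * (w (x + shift i s) - w x) ^ 2 := by
        refine norm_integral_le_of_norm_le (μ := (volume : Measure Torus3))
          (f := fun x => (translate (shift i s) χ - χ : L2) x * hart (-k) x) (h2.const_mul _) ?_
        filter_upwards [hdiff i s, Lp.coeFn_sub (translate (shift i s) χ) χ] with x hx hx2
        rw [hx2, norm_mul, Real.norm_eq_abs, Real.norm_eq_abs]
        refine (mul_le_mul hx (abs_hart_le _ x) (abs_nonneg _) ?_).trans (mul_one _).le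
        positivity
      refine h4.trans ?_
      rw [integral_const_mul, mul_assoc]
      exact mul_le_mul_of_nonneg_left h3 (by positivity)
    rw [neg_neg] at h1
    refine (mul_eq_zero.1 h1).resolve_left ?_
    simpa using hi
  obtain ⟨m, hm⟩ := exists_ae_eq_const_of_coef (integrable_coe χ) hcoef
  by_cases hm1 : m = 1
  · right
    filter_upwards [hm, hχe] with x h1 h2
    by_contra hx
    rw [h1, hm1, indicator_of_notMem (show x ∉ A from hx)] at h2
    norm_num at h2
  · left
    filter_upwards [hm, hχe, hgap] with x h1 h2 h3
    refine h3.resolve_right fun hx => hm1 ?_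
    rw [h1, indicator_of_mem (show x ∈ A from hx)] at h2
    exact h2

theorem exists_gap_of_isNowhereDense {Z : Set ℝ} (hZ : IsNowhereDense Z) {a b : ℝ} (hab : a < b) :
    ∃ p q, a ≤ p ∧ p < q ∧ q ≤ b ∧ ∀ z ∈ Z, z ≤ p ∨ q ≤ z := by
  have h1 : ¬ Ioo a b ⊆ closure Z := fun h => by
    have h2 := interior_maximal h isOpen_Ioo
    rw [hZ] at h2
    obtain ⟨c, hc⟩ := exists_between hab
    exact h2 hc
  obtain ⟨y, hy, hyZ⟩ := not_subset.1 h1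
  obtain ⟨ε, hε, hball⟩ := Metric.isOpen_iff.1 (isOpen_Ioo.inter isClosed_closure.isOpen_compl) y ⟨hy, hyZ⟩
  have hsub : ∀ z, y - ε < z → z < y + ε → z ∈ Ioo a b ∩ (closure Z)ᶜ := fun z h1 h2 => hball (by
    rw [Metric.mem_ball, Real.dist_eq, abs_lt]; constructor <;> linarith)
  refine ⟨y - ε / 2, y + ε / 2, (hsub _ (by linarith) (by linarith)).1.1.le, by linarith,
    (hsub _ (by linarith) (by linarith)).1.2.le, fun z hz => ?_⟩
  by_contra! hcon
  exact (hsub z (by linarith [hcon.1]) (by linarith [hcon.2])).2 (subset_closure hz)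

/-- Gaps of the nowhere dense set lie arbitrarily close below the mean `c`. Since `w` stays on one
side of each gap and cannot stay below its own mean, it lies above; hence `w ≥ c`, and equality of
means gives `w = c`. -/
theorem ae_eq_const_of_mem_isNowhereDense {w : L2} (hw : hs 2 (coef w) < ⊤) {Z : Set ℝ}
    (hZ : IsNowhereDense Z) (h : ∀ᵐ x, w x ∈ Z) : ∃ c, ∀ᵐ x, w x = c := by
  have hvol : (volume : Measure Torus3).real univ ≠ 0 := by
    rw [volume_real_torus]; positivity
  have hvp : 0 < (volume : Measure Torus3).real univ := by
    rw [volume_real_torus]; positivity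
  set c := (∫ x, w x) / (volume : Measure Torus3).real univ with hc
  have hI : ∀ r : ℝ, ∫ _ : Torus3, r = (volume : Measure Torus3).real univ * r := fun r => by
    rw [integral_const, smul_eq_mul]
  have hcI : ∫ x, w x = (volume : Measure Torus3).real univ * c := by
    rw [hc]; field_simp
  have key : ∀ n : ℕ, ∀ᵐ x, c - 2 * (1 / ((n : ℝ) + 1)) ≤ w x := by
    intro n
    have hn : 0 < 1 / ((n : ℝ) + 1) := by positivity
    -- A gap strictly below the mean, at distance at most `2 / (n + 1)`.
    obtain ⟨p, q, h1, h2, h3, h4⟩ := exists_gap_of_isNowhereDense hZ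
      (show c - 2 * (1 / ((n : ℝ) + 1)) < c - 1 / ((n : ℝ) + 1) by linarith)
    rcases ae_const_or_of_gap hw h2 (h.mono fun x hx => h4 _ hx) with h5 | h5
    · exfalso
      have h6 := integral_mono_ae (integrable_coe w) (integrable_const p) h5
      rw [hI, hcI] at h6
      have := le_of_mul_le_mul_left h6 hvp
      linarith
    · filter_upwards [h5] with x hx
      linarith
  have h1 : ∀ᵐ x, c ≤ w x := by
    filter_upwards [ae_all_iff.2 key] with x hx
    have h2 : Tendsto (fun n : ℕ => c - 2 * (1 / ((n : ℝ) + 1))) atTop (𝓝 (c - 2 * 0)) :=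
      tendsto_const_nhds.sub (tendsto_one_div_add_atTop_nhds_zero_nat.const_mul 2)
    rw [mul_zero, sub_zero] at h2
    exact le_of_tendsto h2 (Eventually.of_forall hx)
  refine ⟨c, ?_⟩
  have i1 : Integrable fun x => w x - c := (integrable_coe w).sub (integrable_const c)
  have h2 : ∫ x, (w x - c) = 0 := by
    rw [integral_sub (integrable_coe w) (integrable_const c), hI, hcI, sub_self]
  have h3 := (integral_eq_zero_iff_of_nonneg_ae (h1.mono fun x hx => sub_nonneg.2 hx) i1).1 h2
  filter_upwards [h3] with x hx
  exact sub_eq_zero.1 hx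

/-! ### Spatially constant increments -/

theorem integrable_abs_pow_six {u : L2} (hu : hs 2 (coef u) < ⊤) : Integrable fun x => |u x| ^ 6 := by
  obtain ⟨R, hR, hu⟩ := exists_sq_bound hu
  have := sobC_pos
  exact (integral_le_of_lintegral_le (aesm_abs_pow u 6) (fun x => by positivity)
    (by positivity) (lintegral_pow_six_le hR hu)).1

/-- The difference quotients of `f` along the constant shifts have vanishing nonzero modes;
dominated convergence passes this to `f'(w)`. -/
theorem Growth.exists_deriv_eq_const {f : ℝ → ℝ} {C : ℝ} (hf : Growth f C) (hd : Differentiable ℝ f)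
    {w : L2} (hw : hs 2 (coef w) < ⊤) {ε : ℕ → ℝ} (hε : Tendsto ε atTop (𝓝 0)) (hε0 : ∀ n, ε n ≠ 0)
    (hi : ∀ n, Integrable fun x => f (w x + ε n))
    (h : ∀ n k, k ≠ 0 → coef (fun x => f (w x + ε n)) k = coef (fun x => f (w x)) k) :
    ∃ m, ∀ᵐ x, deriv f (w x) = m := by
  have hC := hf.pos
  have i0 := hf.integrable hw
  have i6 := integrable_abs_pow_six hw
  have hquot : ∀ n, Integrable fun x => (ε n)⁻¹ * (f (w x + ε n) - f (w x)) := fun n =>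
    ((hi n).sub i0).const_mul _
  have hlim : ∀ x, Tendsto (fun n => (ε n)⁻¹ * (f (w x + ε n) - f (w x))) atTop (𝓝 (deriv f (w x))) := by
    intro x
    have h1 := (hd (w x)).hasDerivAt.tendsto_slope_zero
    have h2 : Tendsto ε atTop (𝓝[≠] 0) :=
      tendsto_nhdsWithin_iff.2 ⟨hε, Eventually.of_forall fun n => hε0 n⟩
    simpa [Function.comp_def] using h1.comp h2
  -- For |ε| ≤ 1 the Lipschitz factor is at most `C (9 + 9|w|⁴)`; the fourth power is then traded
  -- for `1 + |w|⁶`, whose integrability is known.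
  have hbnd : ∀ᶠ n in atTop, ∀ x, |(ε n)⁻¹ * (f (w x + ε n) - f (w x))| ≤ C * (18 + 9 * |w x| ^ 6) := by
    filter_upwards [hε.eventually (Metric.closedBall_mem_nhds (0 : ℝ) one_pos)] with n hn x
    rw [Real.dist_eq, sub_zero] at hn
    have h1 := hf.lip (w x + ε n) (w x)
    rw [add_sub_cancel_left] at h1
    rw [abs_mul, abs_inv, inv_mul_le_iff₀ (abs_pos.2 (hε0 n))]
    refine Eq.trans_ge (mul_comm _ _) ?_
    refine h1.trans (mul_le_mul_of_nonneg_right (mul_le_mul_of_nonneg_left ?_ hC.le) (abs_nonneg _))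
    have h2 : |w x + ε n| ≤ |w x| + 1 := (abs_add_le _ _).trans (by linarith)
    have h3 := pow_le_pow_left₀ (abs_nonneg _) h2 4
    have h4 : (|w x| + 1) ^ 4 ≤ 8 * (|w x| ^ 4 + 1) := by
      nlinarith [sq_nonneg (|w x| - 1), sq_nonneg (|w x| ^ 2 - 1), abs_nonneg (w x),
        sq_nonneg (|w x| + 1), mul_nonneg (abs_nonneg (w x)) (sq_nonneg (|w x| - 1)),
        sq_nonneg (|w x| ^ 2 - |w x|)]
    have h5 : |w x| ^ 4 ≤ 1 + |w x| ^ 6 := by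
      rcases le_total |w x| 1 with h | h
      · have := pow_le_one₀ (abs_nonneg (w x)) h (n := 4)
        have : 0 ≤ |w x| ^ 6 := by positivity
        linarith
      · have := pow_le_pow_right₀ h (show 4 ≤ 6 by norm_num)
        linarith
    linarith
  have hbi : Integrable fun x => C * (18 + 9 * |w x| ^ 6) :=
    ((integrable_const 18).add (i6.const_mul 9)).const_mul C
  have hdm : AEStronglyMeasurable (fun x => deriv f (w x)) :=
    ((measurable_deriv f).comp (Lp.stronglyMeasurable w).measurable).aestronglyMeasurable
  have hdi : Integrable fun x => deriv f (w x) := by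
    refine hbi.mono' hdm (Eventually.of_forall fun x => ?_)
    exact le_of_tendsto (hlim x).norm (hbnd.mono fun n hn => hn x)
  refine exists_ae_eq_const_of_coef hdi fun k hk => ?_
  have h1 : Tendsto (fun n => coef (fun x => (ε n)⁻¹ * (f (w x + ε n) - f (w x))) k) atTop
      (𝓝 (coef (fun x => deriv f (w x)) k)) := by
    refine tendsto_integral_filter_of_dominated_convergence (fun x => C * (18 + 9 * |w x| ^ 6))
      (Eventually.of_forall fun n => (integrable_mul_hart (hquot n) k).aestronglyMeasurable)
      (hbnd.mono fun n hn => Eventually.of_forall fun x => ?_) hbi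
      (Eventually.of_forall fun x => (hlim x).mul_const _)
    rw [norm_mul, Real.norm_eq_abs, Real.norm_eq_abs]
    exact (mul_le_mul (hn x) (abs_hart_le k x) (abs_nonneg _) ((abs_nonneg _).trans (hn x))).trans
      (mul_one _).le
  refine tendsto_nhds_unique h1 (tendsto_const_nhds.congr fun n => ?_)
  rw [coef_const_mul, coef_sub (hi n) i0, h n k hk, sub_self, mul_zero]

/-! ### Shifts in time, equilibria and strict decay of the energy -/

section

variable {γ : ℝ} {f : ℝ → ℝ} {g : L2} {ξ : ℝ → EnergySpace} {C K : ℝ}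

theorem ModeSolution.shift (h : ModeSolution γ f g ξ) {s : ℝ} (hs : 0 ≤ s) :
    ModeSolution γ f g (fun t => ξ (max t 0 + s)) := by
  have cm : Continuous fun t : ℝ => max t 0 + s := (continuous_id.max continuous_const).add continuous_const
  have hev : ∀ t : ℝ, 0 < t → (fun t => max t 0 + s) =ᶠ[𝓝 t] fun t => t + s := fun t ht => by
    filter_upwards [eventually_gt_nhds ht] with r hr
    rw [max_eq_left hr.le]
  refine ⟨fun k => (h.cont_pos k).comp cm, fun k => (h.cont_vel k).comp cm, fun T => ?_, fun T => ?_,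
    fun k t ht => ?_, fun k t ht => ?_⟩
  · obtain ⟨R, hR, hb⟩ := h.bounded (max T 0 + s)
    exact ⟨R, hR, fun t ht => hb _ (add_le_add_left (max_le_max ht le_rfl) s)⟩
  · refine lt_of_le_of_lt ?_ (h.dissip (T + s))
    rw [← lintegral_indicator measurableSet_Ioo, ← lintegral_indicator measurableSet_Ioo,
      ← lintegral_add_right_eq_self ((Ioo 0 (T + s)).indicator _) s]
    refine lintegral_mono fun t => ?_
    by_cases ht : t ∈ Ioo 0 T
    · rw [indicator_of_mem ht, indicator_of_mem (show t + s ∈ Ioo 0 (T + s) from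
        ⟨by linarith [ht.1], by linarith [ht.2]⟩), max_eq_left ht.1.le]
    · rw [indicator_of_notMem ht]
      exact zero_le
  · have h1 := (h.hasDerivAt_pos k (t + s) (by linarith)).comp_add_const t s
    simp only [max_eq_left ht.le]
    refine h1.congr_of_eventuallyEq ?_
    filter_upwards [hev t ht] with r hr
    rw [hr]
  · have h1 := (h.hasDerivAt_vel k (t + s) (by linarith)).comp_add_const t s
    simp only [max_eq_left ht.le]
    refine h1.congr_of_eventuallyEq ?_
    filter_upwards [hev t ht] with r hr
    rw [hr]

/-- At an interior time of the constant stretch both derivatives vanish, so the state is stationary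
for the coefficient equations and solves them for all times. -/
theorem ModeSolution.const_of_eqOn (h : ModeSolution γ f g ξ) {T : ℝ} (hT : 0 < T)
    (he : ∀ t ∈ Icc 0 T, ξ t = ξ 0) : ModeSolution γ f g (fun _ => ξ 0) := by
  have hev : ∀ᶠ t in 𝓝 (T / 2), ξ t = ξ 0 := by
    filter_upwards [Icc_mem_nhds (show 0 < T / 2 by linarith) (show T / 2 < T by linarith)] with t ht
    exact he t ht
  have h2 : ξ (T / 2) = ξ 0 := hev.self_of_nhds
  have h3 : ∀ k, coef (ξ 0).vel k = 0 := fun k => by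
    have h4 := h.hasDerivAt_pos k (T / 2) (by linarith)
    rw [h2] at h4
    refine h4.unique ((hasDerivAt_const (T / 2) (coef (ξ 0).pos k)).congr_of_eventuallyEq ?_)
    filter_upwards [hev] with t ht
    rw [ht]
  refine ⟨fun k => continuous_const, fun k => continuous_const,
    fun T => ⟨‖ξ 0‖, norm_nonneg _, fun t _ => le_rfl⟩, fun T => ?_, fun k t _ => ?_, fun k t _ => ?_⟩
  · simp [hs, h3]
  · rw [h3]
    exact hasDerivAt_const t _
  · have h4 := h.hasDerivAt_vel k (T / 2) (by linarith)
    rw [h2] at h4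
    have h5 := h4.unique ((hasDerivAt_const (T / 2) (coef (ξ 0).vel k)).congr_of_eventuallyEq (by
      filter_upwards [hev] with t ht
      rw [ht]))
    rw [h5]
    exact hasDerivAt_const t _

theorem eq_zero_of_integral_sq_le {φ : ℝ → ℝ} (hφ : Continuous φ) {T : ℝ} (hT : 0 < T)
    (h : ∫ t in (0 : ℝ)..T, φ t ^ 2 ≤ 0) : ∀ t ∈ Icc 0 T, φ t = 0 := by
  intro t ht
  by_contra hne
  have := intervalIntegral.integral_pos hT (hφ.pow 2).continuousOn (fun x _ => sq_nonneg (φ x))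
    ⟨t, ht, (sq_pos_of_ne_zero hne)⟩
  exact absurd h (not_le.2 this)

theorem ModeSolution.pos_eq (h : ModeSolution γ f g ξ) {T : ℝ} {k : Fin 3 → ℤ}
    (hv : ∀ t ∈ Icc 0 T, coef (ξ t).vel k = 0) : ∀ t ∈ Icc 0 T, coef (ξ t).pos k = coef (ξ 0).pos k := by
  intro t ht
  have h1 := intervalIntegral.integral_eq_sub_of_hasDerivAt_of_le ht.1 (h.cont_pos k).continuousOn
    (fun x hx => h.hasDerivAt_pos k x hx.1) ((h.cont_vel k).intervalIntegrable _ _)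
  have h2 : ∫ r in (0 : ℝ)..t, coef (ξ r).vel k = 0 := by
    rw [intervalIntegral.integral_congr (g := fun _ => (0 : ℝ)) fun r hr => ?_]
    · simp
    · rw [uIcc_of_le ht.1] at hr
      exact hv r ⟨hr.1, hr.2.trans ht.2⟩
  linarith

/-- Equal energies kill the velocity in all modes except the mean, so `u` moves only by spatial
constants. Nondegeneracy of `f'` and nonconstancy of `g` exclude a moving mean. -/
theorem ModeSolution.eq_of_energy_eq (h : ModeSolution γ f g ξ) (hf : Growth f C) (hγ : 0 < γ)
    (hK0 : 0 ≤ K) (hK : ∀ u v, -K * (u - v) ^ 2 ≤ (f u - f v) * (u - v)) (hd : Differentiable ℝ f)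
    (hflat : ∀ a, IsNowhereDense (deriv f ⁻¹' {a})) (hg : ¬ ∃ c : ℝ, ∀ᵐ x, g x = c) {T : ℝ} (hT : 0 < T)
    (hE : energy f g (ξ T) = energy f g (ξ 0)) : ∀ t ∈ Icc 0 T, ξ t = ξ 0 := by
  have hv : ∀ k, k ≠ 0 → ∀ t ∈ Icc 0 T, coef (ξ t).vel k = 0 := by
    intro k hk
    refine eq_zero_of_integral_sq_le (h.cont_vel k) hT ?_
    have h1 := h.dissipation_le hf hγ hK0 hK hT.le k
    rw [hE, sub_self] at h1
    have h2 : 0 < γ * absK k :=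
      mul_pos hγ (lt_of_lt_of_le one_pos ((one_le_norm_of_ne_zero hk).trans (norm_le_absK k)))
    by_contra! h3
    exact absurd h1 (not_le.2 (mul_pos h2 h3))
  have hp : ∀ k, k ≠ 0 → ∀ t ∈ Icc 0 T, coef (ξ t).pos k = coef (ξ 0).pos k := fun k hk =>
    h.pos_eq (hv k hk)
  have hfc : ∀ k, k ≠ 0 → ∀ t ∈ Ioo 0 T, coef (fun x => f ((ξ t).pos x)) k =
      coef g k - sqNorm k * coef (ξ 0).pos k := by
    intro k hk t ht
    have h1 := (h.hasDerivAt_vel k t ht.1).unique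
      ((hasDerivAt_const t (0 : ℝ)).congr_of_eventuallyEq (by
        filter_upwards [Icc_mem_nhds ht.1 ht.2] with r hr
        exact hv k hk r hr))
    rw [hv k hk t ⟨ht.1.le, ht.2.le⟩, hp k hk t ⟨ht.1.le, ht.2.le⟩] at h1
    linarith
  have hv0 : ∀ t ∈ Ioo 0 T, coef (ξ t).vel 0 = 0 := by
    intro t ht
    by_contra hne
    -- A nonzero derivative of the mean gives times `r n → t` with means different from that at `t`,
    -- hence nonzero constant shifts of the same profile.
    have h1 := (h.hasDerivAt_pos 0 t ht.1).eventually_ne (c := coef (ξ t).pos 0) hne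
    have h2 : ∀ᶠ r in 𝓝[≠] t, r ∈ Ioo 0 T ∧ coef (ξ r).pos 0 ≠ coef (ξ t).pos 0 :=
      (eventually_nhdsWithin_of_eventually_nhds (Ioo_mem_nhds ht.1 ht.2)).and h1
    obtain ⟨r, hr1, hr2⟩ := exists_seq_forall_of_frequently h2.frequently
    have hr1' : Tendsto r atTop (𝓝 t) := hr1.mono_right nhdsWithin_le_nhds
    set c := (Real.sqrt ((2 * π) ^ 3))⁻¹ with hc
    have hc0 : c ≠ 0 := inv_ne_zero sqrt_pos_aux.ne'
    have hhart : ∀ x, hart 0 x = c := fun x => by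
      rw [hc, eq_inv_of_mul_eq_one_right (one_eq_hart x).symm]
    set δ : ℕ → ℝ := fun n => coef (ξ (r n)).pos 0 - coef (ξ t).pos 0 with hδ
    have hpos : ∀ n, (ξ (r n)).pos = (ξ t).pos + δ n • hartLp 0 := fun n => by
      refine ext_coef fun k => ?_
      rw [coef_Lp_add, coef_Lp_smul, coef_hartLp]
      by_cases hk : k = 0
      · subst hk; simp [hδ]
      · rw [if_neg (Ne.symm hk), hp k hk _ ⟨(hr2 n).1.1.le, (hr2 n).1.2.le⟩,
          hp k hk _ ⟨ht.1.le, ht.2.le⟩]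
        simp
    have hposae : ∀ n, ∀ᵐ x, (ξ (r n)).pos x = (ξ t).pos x + δ n * c := fun n => by
      filter_upwards [Lp.coeFn_add (ξ t).pos (δ n • hartLp 0), Lp.coeFn_smul (δ n) (hartLp 0),
        coeFn_hartLp 0] with x h3 h4 h5
      rw [hpos n, h3, Pi.add_apply, h4, Pi.smul_apply, h5, hhart, smul_eq_mul]
    have hcongr : ∀ n, (fun x => f ((ξ (r n)).pos x)) =ᵐ[volume] fun x => f ((ξ t).pos x + δ n * c) :=
      fun n => (hposae n).mono fun x hx => by simp only [hx]
    obtain ⟨m, hm⟩ := hf.exists_deriv_eq_const hd (hs_lt_top_pos (ξ t)) (ε := fun n => δ n * c)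
      (by
        have h3 := (((h.cont_pos 0).tendsto t).comp hr1').sub_const (coef (ξ t).pos 0)
        rw [sub_self] at h3
        simpa using h3.mul_const c)
      (fun n => mul_ne_zero (sub_ne_zero.2 (hr2 n).2) hc0)
      (fun n => (hf.integrable (hs_lt_top_pos (ξ (r n)))).congr (hcongr n))
      (fun n k hk => by
        rw [← coef_congr (hcongr n), hfc k hk _ (hr2 n).1, hfc k hk _ ht])
    obtain ⟨w, hw⟩ := ae_eq_const_of_mem_isNowhereDense (hs_lt_top_pos (ξ t)) (hflat m) hm
    -- With `u(t)` and therefore `f(u(t))` constant in space, the stationary equations for the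
    -- nonzero modes reduce to vanishing coefficients of `g`.
    refine hg (exists_ae_eq_const_of_coef (integrable_coe g) fun k hk => ?_)
    have h3 := hfc k hk t ht
    rw [coef_congr (show (fun x => f ((ξ t).pos x)) =ᵐ[volume] fun _ => f w from
      hw.mono fun x hx => by simp only [hx]), coef_const_of_ne_zero _ hk, ← hp k hk t ⟨ht.1.le, ht.2.le⟩,
      coef_congr (show ((ξ t).pos : Torus3 → ℝ) =ᵐ[volume] fun _ => w from hw),
      coef_const_of_ne_zero _ hk, mul_zero, sub_zero] at h3
    exact h3.symm
  -- The endpoints are reached by continuity, because the coefficient equations hold only for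
  -- positive times.
  have hv0' : ∀ t ∈ Icc 0 T, coef (ξ t).vel 0 = 0 := by
    have h1 : closure (Ioo 0 T) ⊆ {t | coef (ξ t).vel 0 = 0} :=
      closure_minimal hv0 (isClosed_eq (h.cont_vel 0) continuous_const)
    rwa [closure_Ioo hT.ne] at h1
  have hvall : ∀ k, ∀ t ∈ Icc 0 T, coef (ξ t).vel k = 0 := fun k => by
    by_cases hk : k = 0
    · subst hk; exact hv0'
    · exact hv k hk
  intro t ht
  refine ext_energySpace (fun k => h.pos_eq (hvall k) t ht) fun k => ?_
  rw [hvall k t ht, hvall k 0 ⟨le_rfl, hT.le⟩]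

end

end DampedWave

end

/-! ### The semigroup and its Lyapunov function -/

theorem proposition4p2 (γ : ℝ) (hγ : 0 < γ) (f : ℝ → ℝ) (hf : DampedWave.IsAdmissible f)
    (g : DampedWave.L2)
    (hg : ¬ ∃ c : ℝ, ∀ᵐ x : DampedWave.Torus3, g x = c)
    (hflat : ∀ a : ℝ, IsNowhereDense (deriv f ⁻¹' {a})) :
    ∃ S : ℝ → DampedWave.EnergySpace → DampedWave.EnergySpace,
      DampedWave.IsSolutionSemigroup 0 γ f g S ∧
        DampedWave.IsGlobalLyapunov S (DampedWave.energy f g) := by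
  obtain ⟨C, hC⟩ := hf.exists_growth
  obtain ⟨K, hK0, hK⟩ := hf.exists_monotone
  obtain ⟨κ, D, hκ, hD, h1, h2⟩ := hf.exists_coercive
  choose ξ hξ hξ0 using DampedWave.exists_modeSolution hγ hC ⟨hκ, hD, h1, h2⟩ g
  have huniq : ∀ ξ₀ η, DampedWave.ModeSolution γ f g η → η 0 = ξ₀ → ∀ t, 0 ≤ t → η t = ξ ξ₀ t :=
    fun ξ₀ η hη h0 t ht => hη.eqOn (hξ ξ₀) hC hγ hK0.le hK (by rw [h0, hξ0]) ht
  have hadd : ∀ s t, 0 ≤ s → 0 ≤ t → ∀ ξ₀, ξ ξ₀ (t + s) = ξ (ξ ξ₀ s) t := fun s t hs ht ξ₀ => by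
    have h3 := huniq (ξ ξ₀ s) _ ((hξ ξ₀).shift hs) (by simp) t ht
    simpa only [max_eq_left ht] using h3
  have hdecr : ∀ ξ₀ t, 0 ≤ t → DampedWave.energy f g (ξ ξ₀ t) ≤ DampedWave.energy f g ξ₀ := fun ξ₀ t ht => by
    -- The mode `k = 0` carries no damping, so the inequality reduces to monotonicity of the energy.
    have h3 := (hξ ξ₀).dissipation_le hC hγ hK0.le hK ht 0
    rw [DampedWave.absK, DampedWave.sqNorm_zero, Real.sqrt_zero, mul_zero, zero_mul, hξ0] at h3
    linarith
  refine ⟨fun t ξ₀ => ξ ξ₀ t, ⟨fun ξ₀ => ?_, fun ξ₀ η hη t ht => ?_, hξ0, hadd⟩,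
    ⟨hC.continuous_energy g, fun ξ₀ s hs t ht hst => ?_, fun ξ₀ T hT hE t ht => ?_⟩⟩
  · have h3 := (hξ ξ₀).isWeakEnergySolution hC
    rwa [hξ0] at h3
  · have h3 := huniq ξ₀ _ (hη.modeSolution hC) (by simp [hη.initial]) t ht
    simpa only [max_eq_left ht] using h3
  · have h3 := hdecr (ξ ξ₀ s) (t - s) (sub_nonneg.2 hst)
    rwa [← hadd s (t - s) hs (sub_nonneg.2 hst), sub_add_cancel] at h3
  · have h3 := (hξ ξ₀).eq_of_energy_eq hC hγ hK0.le hK (hf.contDiff.differentiable (by simp)) hflat hg hT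
      (by rw [hξ0]; exact hE)
    -- Constancy on `[0, T]` makes the constant trajectory a solution on the whole half-line;
    -- uniqueness identifies it with the given one.
    have h4 := huniq ξ₀ _ ((hξ ξ₀).const_of_eqOn hT h3) (hξ0 ξ₀) t ht
    rw [← h4, hξ0]
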